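/- **Theorem (Free-action principle).** Let $(M,g)$ be a smooth finite-dimensional Riemannian manifold with distance $\mathrm{dist}$. "Smooth $\epsilon$-dependent" means smooth jointly in $(\epsilon,m)\in\mathbb R\times M$; formal power series in $\epsilon$ are treated order by order, and a smooth $\epsilon$-dependent object is identified with its Taylor series at $\epsilon=0$ where it is combined with formal series. *Setting.* Let $\Omega_\epsilon=-\mathbf d\vartheta_\epsilon$ ($\vartheta_\epsilon$ a smooth $\epsilon$-dependent $1$-form) be an exact barely-symplectic form, i.e. non-degenerate for every $\epsilon\neq0$. Assume it is regular with degeneracy index $d$: $d\ge 0$ is the smallest integer such that the Poisson bivector of $\Omega_\epsilon$ ($\epsilon\ne 0$) equals $\epsilon^{-d}j_\epsilon$ with $j_\epsilon$ a smooth $\epsilon$-dependent bivector (smooth also at $\epsilon=0$). Let $X_\epsilon$ be a smooth $\epsilon$-dependent vector field with $\iota_{X_\epsilon}\Omega_\epsilon=\mathbf dH_\epsilon$ for a smooth $\epsilon$-dependent function $H_\epsilon$, and nearly periodic: $X_0=\omega_0R_0$, where $R_0$ generates a smooth circle action, $\omega_0>0$ is smooth and $\mathcal L_{R_0}\omega_0=0$.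 Let $S_0=\{R_0=0\}$. Let $R_\epsilon=R_0+\epsilon R_1+\cdots$ be the roto-rate (formal series of vector fields with leading term $R_0$, $\exp(2\pi\mathcal L_{R_\epsilon})=1$ and $[X_\epsilon,R_\epsilon]=0$), let $\overline\vartheta_\epsilon$ be a formal series of $1$-forms with $\Omega_\epsilon=-\mathbf d\overline\vartheta_\epsilon$ and $\mathcal L_{R_\epsilon}\overline\vartheta_\epsilon=0$, and let $\mu_\epsilon=\iota_{R_\epsilon}\overline\vartheta_\epsilon$ be the adiabatic invariant. Assume $\mu_\epsilon$ has vanishing index $\nu$ (the largest integer with $\mu_\epsilon=O(\epsilon^\nu)$), and write $\mu_\epsilon=\epsilon^\nu\mu^*_\epsilon$. Let $N\ge0$ be an integer with $N+1>3(d-\nu)$. *Slow manifold.* Let $C_0\subset M$ be compact (for instance a compact codimension-$0$ submanifold with or without boundary), and let $C_0',C_0''$ be compact with $C_0\subset\mathrm{int}\,C_0'$, $C_0'\subset\mathrm{int}\,C_0''$. For small $|\epsilon|$ let $\mu^{*(N)}_\epsilon:\mathrm{int}\,C_0''\to\mathbb R$ be a smooth $\epsilon$-dependent function and $\mathcal S_\epsilon:S_0\cap\mathrm{int}\,C_0''\to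 M$ a smooth $\epsilon$-dependent embedding such that: $\mathcal S_0$ is the inclusion; $\mu^{*(N)}_\epsilon-\mu^*_\epsilon=O(\epsilon^{N+1})$ on $\mathrm{int}\,C_0'$; for $\epsilon\neq0$ the image of $\mathcal S_\epsilon$ is the set of critical points of $\mu^{*(N)}_\epsilon$ in $\mathrm{int}\,C_0''$; and $\mathcal S_\epsilon|_{S_0\cap\mathrm{int}\,C_0}$ is an $N$-th order parameterized slow manifold of $X_\epsilon$ (at $\mathcal S_\epsilon(s_0)$, for each $s_0$, the component of $X_\epsilon$ normal to the image is $O(\epsilon^{N+1})$ and the tangential one is $O(\epsilon)$) whose image $S^{(N)}_\epsilon:=\mathcal S_\epsilon(S_0\cap\mathrm{int}\,C_0)$ lies in $\mathrm{int}\,C_0'$ for small $\epsilon$. *Hypothesis.* For all sufficiently small $\epsilon\ne0$ and every $s\in\overline{S^{(N)}_\epsilon}$, the Hessian form $\boldsymbol H_s(\mu^{*(N)}_\epsilon)$ is positive or negative semi-definite. *Conclusion.* For every integer $k\geq 0$ there is an $\epsilon_0>0$ such that for all non-zero $\epsilon\in[-\epsilon_0,\epsilon_0]$ and every integral curve $z:\mathbb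 R\to M$ of $X_\epsilon$ that is contained in $C_0$ and satisfies $\mathrm{dist}(z(0),S^{(N)}_\epsilon)\le|\epsilon|^{N+1}$, one of the following holds: (a) $\mathrm{dist}(z(t),S^{(N)}_\epsilon)\le|\epsilon|^{(N+1-d+\nu)/2}$ for all $|t|\le|\epsilon|^{-k}$; (b) $z$ runs off the edge $\overline{S^{(N)}_\epsilon}\setminus S^{(N)}_\epsilon$: there is a time $t$ with $|t|\le|\epsilon|^{-k}$ such that $\mathrm{dist}(z(\tau),S^{(N)}_\epsilon)\le|\epsilon|^{(N+1-d+\nu)/2}$ for all $\tau$ between $0$ and $t$, and the points of $\overline{S^{(N)}_\epsilon}$ nearest to $z(t)$ all lie on the edge (and at least one exists). -/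

import Mathlib

open Set Filter Topology Manifold Bundle
open scoped ContDiff

noncomputable section

namespace NearlyPeriodic

/-! ## Vector fields, forms and their calculus on a manifold -/

section Calculus

variable {E : Type*} [NormedAddCommGroup E] [NormedSpace ℝ E]
  {M : Type*} [TopologicalSpace M] [ChartedSpace E M] [IsManifold 𝓘(ℝ, E) ∞ M]

/-- The `n`-th Taylor coefficient at `ε = 0` of a curve `ε ↦ f ε` in a normed space. -/
def taylorCoeff {F : Type*} [NormedAddCommGroup F] [NormedSpace ℝ F] (f : ℝ → F) (n : ℕ) : F :=
  ((n.factorial : ℝ)⁻¹) • iteratedDeriv n f 0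

/-- The `n`-th coefficient `X_n` in the expansion `X_ε = X_0 + ε X_1 + ⋯` of an `ε`-dependent
vector field, taken in each (fixed) tangent space. -/
def vectorCoeff (X : ℝ → (m : M) → TangentSpace 𝓘(ℝ, E) m) (n : ℕ) :
    (m : M) → TangentSpace 𝓘(ℝ, E) m :=
  fun m => taylorCoeff (F := E) (fun ε => (X ε m : E)) n

/-- A smooth vector field. -/
def SmoothVectorField (V : (m : M) → TangentSpace 𝓘(ℝ, E) m) : Prop :=
  ContMDiff 𝓘(ℝ, E) 𝓘(ℝ, E).tangent ∞
    (fun m => (⟨m, V m⟩ : TangentBundle 𝓘(ℝ, E) M))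

/-- A smooth `ε`-dependent vector field: smooth in `(ε, m)` jointly. -/
def SmoothVectorFamily (X : ℝ → (m : M) → TangentSpace 𝓘(ℝ, E) m) : Prop :=
  ContMDiff (𝓘(ℝ, ℝ).prod 𝓘(ℝ, E)) 𝓘(ℝ, E).tangent ∞
    (fun p : ℝ × M => (⟨p.2, X p.1 p.2⟩ : TangentBundle 𝓘(ℝ, E) M))

/-- A smooth `1`-form. -/
def SmoothOneForm (α : (m : M) → TangentSpace 𝓘(ℝ, E) m →L[ℝ] ℝ) : Prop :=
  ContMDiff 𝓘(ℝ, E) (𝓘(ℝ, E).prod 𝓘(ℝ, E →L[ℝ] ℝ)) ∞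
    (fun m => TotalSpace.mk' (E →L[ℝ] ℝ)
      (E := fun m : M => TangentSpace 𝓘(ℝ, E) m →L[ℝ] Trivial M ℝ m) m (α m))

/-- A smooth `ε`-dependent `1`-form. -/
def SmoothOneFormFamily (α : ℝ → (m : M) → TangentSpace 𝓘(ℝ, E) m →L[ℝ] ℝ) : Prop :=
  ContMDiff (𝓘(ℝ, ℝ).prod 𝓘(ℝ, E)) (𝓘(ℝ, E).prod 𝓘(ℝ, E →L[ℝ] ℝ)) ∞
    (fun p : ℝ × M => TotalSpace.mk' (E →L[ℝ] ℝ)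
      (E := fun m : M => TangentSpace 𝓘(ℝ, E) m →L[ℝ] Trivial M ℝ m) p.2 (α p.1 p.2))

/-- A smooth `ε`-dependent covariant `2`-tensor field. -/
def SmoothTwoTensorFamily
    (Ω : ℝ → (m : M) → TangentSpace 𝓘(ℝ, E) m →L[ℝ] TangentSpace 𝓘(ℝ, E) m →L[ℝ] ℝ) : Prop :=
  ContMDiff (𝓘(ℝ, ℝ).prod 𝓘(ℝ, E)) (𝓘(ℝ, E).prod 𝓘(ℝ, E →L[ℝ] E →L[ℝ] ℝ)) ∞
    (fun p : ℝ × M => TotalSpace.mk' (E →L[ℝ] E →L[ℝ] ℝ)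
      (E := fun m : M =>
        TangentSpace 𝓘(ℝ, E) m →L[ℝ] TangentSpace 𝓘(ℝ, E) m →L[ℝ] Trivial M ℝ m)
      p.2 (Ω p.1 p.2))

/-- A smooth `ε`-dependent bundle map `T*M → TM`. -/
def SmoothSharpFamily
    (j : ℝ → (m : M) → (TangentSpace 𝓘(ℝ, E) m →L[ℝ] ℝ) →L[ℝ] TangentSpace 𝓘(ℝ, E) m) : Prop :=
  ContMDiff (𝓘(ℝ, ℝ).prod 𝓘(ℝ, E)) (𝓘(ℝ, E).prod 𝓘(ℝ, (E →L[ℝ] ℝ) →L[ℝ] E)) ∞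
    (fun p : ℝ × M => TotalSpace.mk' ((E →L[ℝ] ℝ) →L[ℝ] E)
      (E := fun m : M =>
        (TangentSpace 𝓘(ℝ, E) m →L[ℝ] Trivial M ℝ m) →L[ℝ] TangentSpace 𝓘(ℝ, E) m)
      p.2 (j p.1 p.2))

/-- A smooth `ε`-dependent real function. -/
def SmoothFunctionFamily (H : ℝ → M → ℝ) : Prop :=
  ContMDiff (𝓘(ℝ, ℝ).prod 𝓘(ℝ, E)) 𝓘(ℝ, ℝ) ∞ (fun p : ℝ × M => H p.1 p.2)

/-- The differential of a function, applied to a tangent vector. -/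
def dFun (f : M → ℝ) (m : M) (v : TangentSpace 𝓘(ℝ, E) m) : ℝ :=
  (mfderiv 𝓘(ℝ, E) 𝓘(ℝ, ℝ) f m : E →L[ℝ] ℝ) v

/-- The coordinate expression of a `1`-form in the preferred chart at `m`. -/
def oneFormInChart (α : (m : M) → TangentSpace 𝓘(ℝ, E) m →L[ℝ] ℝ) (m : M) :
    E → (E →L[ℝ] ℝ) :=
  fun y => (α ((extChartAt 𝓘(ℝ, E) m).symm y) : E →L[ℝ] ℝ).comp
    (mfderiv 𝓘(ℝ, E) 𝓘(ℝ, E) (extChartAt 𝓘(ℝ, E) m).symm y : E →L[ℝ] E)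

/-- The exterior derivative of a `1`-form: in the preferred chart at `m` (whose differential at `m`
is the identification of `T_m M` with `E`), `dα(u, w) = ∂_u α(w) - ∂_w α(u)`. -/
def dOne (α : (m : M) → TangentSpace 𝓘(ℝ, E) m →L[ℝ] ℝ) (m : M)
    (u w : TangentSpace 𝓘(ℝ, E) m) : ℝ :=
  (fderiv ℝ (oneFormInChart α m) (extChartAt 𝓘(ℝ, E) m m) (u : E)) (w : E)
    - (fderiv ℝ (oneFormInChart α m) (extChartAt 𝓘(ℝ, E) m m) (w : E)) (u : E)

/-- The Lie derivative of a `1`-form, `L_V α = ι_V dα + d(ι_V α)`. -/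
def lieOne (V : (m : M) → TangentSpace 𝓘(ℝ, E) m)
    (α : (m : M) → TangentSpace 𝓘(ℝ, E) m →L[ℝ] ℝ) (m : M) (w : TangentSpace 𝓘(ℝ, E) m) : ℝ :=
  dOne α m (V m) w + dFun (fun x => α x (V x)) m w

/-- The Hessian form of a function, computed in the preferred chart at `s`. At a critical point
of a smooth function it does not depend on the chart. -/
def hessian (f : M → ℝ) (s : M) (u w : TangentSpace 𝓘(ℝ, E) s) : ℝ :=
  (fderiv ℝ (fderiv ℝ (f ∘ (extChartAt 𝓘(ℝ, E) s).symm)) (extChartAt 𝓘(ℝ, E) s s) (u : E)) (w : E)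

/-- Vectors tangent at `a` to a subset `A`: velocities of smooth curves that lie in `A`.
For an embedded submanifold this is its tangent space. -/
def tangentSet (A : Set M) (a : M) : Set (TangentSpace 𝓘(ℝ, E) a) :=
  {v | ∃ γ : ℝ → M, ContMDiff 𝓘(ℝ, ℝ) 𝓘(ℝ, E) ∞ γ ∧ γ 0 = a ∧ (∀ t, γ t ∈ A) ∧
    (mfderiv 𝓘(ℝ, ℝ) 𝓘(ℝ, E) γ 0 : ℝ →L[ℝ] E) 1 = (v : E)}

end Calculus

/-! ## Nearly-periodic Hamiltonian systems on barely-symplectic manifolds -/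

section Systems

variable {E : Type*} [NormedAddCommGroup E] [NormedSpace ℝ E]
  {M : Type*} [TopologicalSpace M] [ChartedSpace E M] [IsManifold 𝓘(ℝ, E) ∞ M]

/-- `R₀` is the infinitesimal generator of a smooth action of the circle `ℝ / 2πℤ` on `M`. -/
def GeneratesCircleAction (R₀ : (m : M) → TangentSpace 𝓘(ℝ, E) m) : Prop :=
  ∃ Φ : ℝ → M → M,
    ContMDiff (𝓘(ℝ, ℝ).prod 𝓘(ℝ, E)) 𝓘(ℝ, E) ∞ (fun p : ℝ × M => Φ p.1 p.2) ∧
    (∀ m, Φ 0 m = m) ∧ (∀ a b m, Φ (a + b) m = Φ a (Φ b m)) ∧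
    (∀ m, Φ (2 * Real.pi) m = m) ∧
    ∀ m, IsMIntegralCurve (I := 𝓘(ℝ, E)) (fun θ => Φ θ m) R₀

/-- A nearly-periodic system with limiting roto-rate `R₀`. -/
structure IsNearlyPeriodic (X : ℝ → (m : M) → TangentSpace 𝓘(ℝ, E) m)
    (R₀ : (m : M) → TangentSpace 𝓘(ℝ, E) m) : Prop where
  smooth : SmoothVectorFamily X
  circle : GeneratesCircleAction R₀
  limit : ∃ ω₀ : M → ℝ, ContMDiff 𝓘(ℝ, E) 𝓘(ℝ, ℝ) ∞ ω₀ ∧ (∀ m, 0 < ω₀ m) ∧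
    (∀ m, dFun ω₀ m (R₀ m) = 0) ∧ ∀ m, X 0 m = ω₀ m • R₀ m

/-- An exact barely-symplectic form: a smooth `ε`-dependent `2`-form `Ω_ε = -dϑ_ε` (hence closed
and alternating) that is non-degenerate for every `ε ≠ 0`. -/
structure IsExactBarelySymplectic
    (Ω : ℝ → (m : M) → TangentSpace 𝓘(ℝ, E) m →L[ℝ] TangentSpace 𝓘(ℝ, E) m →L[ℝ] ℝ) : Prop where
  smooth : SmoothTwoTensorFamily Ω
  exact : ∃ ϑ : ℝ → (m : M) → TangentSpace 𝓘(ℝ, E) m →L[ℝ] ℝ, SmoothOneFormFamily ϑ ∧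
    ∀ ε m u w, Ω ε m u w = -dOne (ϑ ε) m u w
  nondegenerate : ∀ ε, ε ≠ 0 → ∀ m u, (∀ w, Ω ε m u w = 0) → u = 0

/-- The Poisson bivector of `Ω_ε` is `ε^{-d} j_ε` with `j_ε` smooth in `(ε, m)`, also at `ε = 0`.
Written for the bundle maps `v ↦ ι_v Ω_ε` and `α ↦ ι_α j_ε`, the inverse of the first is
`-ε^{-d}` times the second. (Such a `j_ε` is automatically antisymmetric.) -/
def HasRegularPoisson
    (Ω : ℝ → (m : M) → TangentSpace 𝓘(ℝ, E) m →L[ℝ] TangentSpace 𝓘(ℝ, E) m →L[ℝ] ℝ)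
    (d : ℕ) : Prop :=
  ∃ j : ℝ → (m : M) → (TangentSpace 𝓘(ℝ, E) m →L[ℝ] ℝ) →L[ℝ] TangentSpace 𝓘(ℝ, E) m,
    SmoothSharpFamily j ∧ ∀ ε, ε ≠ 0 → ∀ m v, j ε m (Ω ε m v) = -(ε ^ d • v)

/-- `Ω_ε` is regular with degeneracy index `d`. -/
def HasDegeneracyIndex
    (Ω : ℝ → (m : M) → TangentSpace 𝓘(ℝ, E) m →L[ℝ] TangentSpace 𝓘(ℝ, E) m →L[ℝ] ℝ)
    (d : ℕ) : Prop :=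
  IsLeast {d' : ℕ | HasRegularPoisson Ω d'} d

/-- `X_ε` is Hamiltonian: `ι_{X_ε} Ω_ε = dH_ε` for a smooth `ε`-dependent function `H_ε`. -/
def IsHamiltonian
    (Ω : ℝ → (m : M) → TangentSpace 𝓘(ℝ, E) m →L[ℝ] TangentSpace 𝓘(ℝ, E) m →L[ℝ] ℝ)
    (X : ℝ → (m : M) → TangentSpace 𝓘(ℝ, E) m) : Prop :=
  ∃ H : ℝ → M → ℝ, SmoothFunctionFamily (E := E) H ∧
    ∀ ε m v, Ω ε m (X ε m) v = dFun (H ε) m v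

/-- `exp(2π L_R) = 1` for a formal power series `R = ∑ εⁿ Rₙ` of vector fields. For a formal series
of functions `f`, `F_θ = exp(θ L_R) f` is the solution of `∂_θ F_θ = L_R F_θ`, `F_0 = f`,
order by order in `ε`; the condition says that every solution returns to `f` at `θ = 2π`. -/
def FormalExpTwoPiIsOne (R : ℕ → (m : M) → TangentSpace 𝓘(ℝ, E) m) : Prop :=
  ∀ F : ℝ → ℕ → M → ℝ,
    (∀ n, ContMDiff (𝓘(ℝ, ℝ).prod 𝓘(ℝ, E)) 𝓘(ℝ, ℝ) ∞ (fun p : ℝ × M => F p.1 n p.2)) →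
    (∀ θ n m, HasDerivAt (fun τ => F τ n m)
      (∑ p ∈ Finset.HasAntidiagonal.antidiagonal n, dFun (F θ p.2) m (R p.1 m)) θ) →
    ∀ n m, F (2 * Real.pi) n m = F 0 n m

/-- A roto-rate of `X_ε`: a formal power series of smooth vector fields with leading term the
limiting roto-rate `R₀`, with `exp(2π L_R) = 1` and `[X_ε, R_ε] = 0` order by order. -/
structure IsRotoRate (X : ℝ → (m : M) → TangentSpace 𝓘(ℝ, E) m)
    (R₀ : (m : M) → TangentSpace 𝓘(ℝ, E) m) (R : ℕ → (m : M) → TangentSpace 𝓘(ℝ, E) m) :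
    Prop where
  smooth : ∀ n, SmoothVectorField (R n)
  leading : R 0 = R₀
  periodic : FormalExpTwoPiIsOne R
  commute : ∀ n m, ∑ p ∈ Finset.HasAntidiagonal.antidiagonal n,
    VectorField.mlieBracket 𝓘(ℝ, E) (vectorCoeff X p.1) (R p.2) m = 0

/-- `μ = ∑ εⁿ μₙ` is the adiabatic invariant `ι_R ϑ̄`, where `R` is the roto-rate and `ϑ̄` is a formal
power series of smooth `1`-forms with `Ω_ε = -dϑ̄` and `L_R ϑ̄ = 0` order by order. -/
def IsAdiabaticInvariant
    (Ω : ℝ → (m : M) → TangentSpace 𝓘(ℝ, E) m →L[ℝ] TangentSpace 𝓘(ℝ, E) m →L[ℝ] ℝ)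
    (X : ℝ → (m : M) → TangentSpace 𝓘(ℝ, E) m)
    (R₀ : (m : M) → TangentSpace 𝓘(ℝ, E) m) (μ : ℕ → M → ℝ) : Prop :=
  ∃ (R : ℕ → (m : M) → TangentSpace 𝓘(ℝ, E) m)
    (θ : ℕ → (m : M) → TangentSpace 𝓘(ℝ, E) m →L[ℝ] ℝ),
    IsRotoRate X R₀ R ∧ (∀ n, SmoothOneForm (θ n)) ∧
    (∀ n m u w, taylorCoeff (fun ε => Ω ε m u w) n = -dOne (θ n) m u w) ∧
    (∀ n m w, ∑ p ∈ Finset.HasAntidiagonal.antidiagonal n, lieOne (R p.1) (θ p.2) m w = 0) ∧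
    ∀ n m, μ n m = ∑ p ∈ Finset.HasAntidiagonal.antidiagonal n, θ p.2 m (R p.1 m)

/-- The vanishing index of `μ = ∑ εⁿ μₙ` is `ν`: the largest `ν` with `μ = O(ε^ν)`.
The reduced adiabatic invariant is then `μ* = ∑ εⁿ μ_{ν+n}`. -/
def HasVanishingIndex (μ : ℕ → M → ℝ) (ν : ℕ) : Prop :=
  IsGreatest {ν' : ℕ | ∀ n < ν', ∀ m, μ n m = 0} ν

/-- The limiting slow manifold, the zero set of the limiting roto-rate. -/
def limitingSlowManifold (R₀ : (m : M) → TangentSpace 𝓘(ℝ, E) m) : Set M :=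
  {s | R₀ s = 0}

end Systems

/-! ## Slow manifolds -/

section SlowManifolds

variable {E : Type*} [NormedAddCommGroup E] [NormedSpace ℝ E]
  {M : Type*} [TopologicalSpace M] [ChartedSpace E M] [IsManifold 𝓘(ℝ, E) ∞ M]

/-- `S_ε`, `|ε| < e`, is a smooth `ε`-dependent embedding into `M` of the embedded submanifold
`A ⊆ M`: it is smooth in `(ε, a)` (locally the restriction of a smooth map), and each `S_ε` is a
homeomorphism onto its image and an immersion. -/
structure IsSmoothEmbeddingFamily (e : ℝ) (A : Set M) (S : ℝ → M → M) : Prop where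
  smooth : ∀ ε, |ε| < e → ∀ a ∈ A, ∃ U ∈ 𝓝 ((ε, a) : ℝ × M), ∃ F : ℝ × M → M,
    ContMDiffOn (𝓘(ℝ, ℝ).prod 𝓘(ℝ, E)) 𝓘(ℝ, E) ∞ F U ∧ ∀ p ∈ U, p.2 ∈ A → S p.1 p.2 = F p
  embedding : ∀ ε, |ε| < e → IsEmbedding (A.domRestrict (S ε))
  immersion : ∀ ε, |ε| < e → ∀ γ : ℝ → M, ContMDiff 𝓘(ℝ, ℝ) 𝓘(ℝ, E) ∞ γ → (∀ t, γ t ∈ A) →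
    (mfderiv 𝓘(ℝ, ℝ) 𝓘(ℝ, E) (S ε ∘ γ) 0 : ℝ →L[ℝ] E) 1 = 0 →
    (mfderiv 𝓘(ℝ, ℝ) 𝓘(ℝ, E) γ 0 : ℝ →L[ℝ] E) 1 = 0

/-- Along the submanifolds `S_ε(A)`, the normal component of `X_ε` is `O(ε^{N+1})` and the
tangential component (here `v`) is `O(ε)`: the condition for the smooth `ε`-dependent embedding
`S_ε` of `A` to be an `N`-th order parameterized slow manifold. -/
def IsSlowOfOrder [RiemannianBundle (fun m : M => TangentSpace 𝓘(ℝ, E) m)]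
    (X : ℝ → (m : M) → TangentSpace 𝓘(ℝ, E) m) (N : ℕ) (A : Set M) (S : ℝ → M → M) : Prop :=
  ∀ a ∈ A, ∃ C : ℝ, ∀ᶠ ε in 𝓝 (0 : ℝ), ∃ v ∈ tangentSet (E := E) (S ε '' A) (S ε a),
    (∀ u ∈ tangentSet (E := E) (S ε '' A) (S ε a), inner ℝ (X ε (S ε a) - v) u = 0) ∧
    ‖X ε (S ε a) - v‖ ≤ C * |ε| ^ (N + 1) ∧ ‖v‖ ≤ C * |ε|

/-- The `N`-th order slow manifold over the compact region `C₀` and the `N`-th order approximation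
`μN` of the reduced adiabatic invariant whose critical manifold it is. Here `C₀ ⊆ int C₁`,
`C₁ ⊆ int C₂`, `S₀` is the limiting slow manifold, and everything is defined for `|ε| < e`. -/
structure IsCriticalSlowManifold [RiemannianBundle (fun m : M => TangentSpace 𝓘(ℝ, E) m)]
    (X : ℝ → (m : M) → TangentSpace 𝓘(ℝ, E) m) (S₀ : Set M) (μ : ℕ → M → ℝ) (ν N : ℕ)
    (C₀ C₁ C₂ : Set M) (e : ℝ) (μN : ℝ → M → ℝ) (S : ℝ → M → M) : Prop where
  e_pos : 0 < e
  compact₁ : IsCompact C₁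
  compact₂ : IsCompact C₂
  subset₁ : C₀ ⊆ interior C₁
  subset₂ : C₁ ⊆ interior C₂
  /-- `μN` is a smooth `ε`-dependent function on `int C₂`. -/
  smooth_μN : ContMDiffOn (𝓘(ℝ, ℝ).prod 𝓘(ℝ, E)) 𝓘(ℝ, ℝ) ∞ (fun p : ℝ × M => μN p.1 p.2)
    (Ioo (-e) e ×ˢ interior C₂)
  /-- `μN - μ* = O(ε^{N+1})` on `int C₁`, where `μ* = ∑ εⁿ μ_{ν+n}`. -/
  approx : ∀ m ∈ interior C₁, ∀ n ≤ N, taylorCoeff (fun ε => μN ε m) n = μ (ν + n) m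
  embedding : IsSmoothEmbeddingFamily (E := E) e (S₀ ∩ interior C₂) S
  /-- At `ε = 0` the embedding is the inclusion of the limiting slow manifold. -/
  at_zero : ∀ s ∈ S₀ ∩ interior C₂, S 0 s = s
  /-- For `ε ≠ 0` the image of the embedding is the set of critical points of `μN`. -/
  critical : ∀ ε, ε ≠ 0 → |ε| < e →
    S ε '' (S₀ ∩ interior C₂) = {m ∈ interior C₂ | ∀ v, dFun (E := E) (μN ε) m v = 0}
  /-- Over `int C₀` the embedding is an `N`-th order parameterized slow manifold of `X_ε`. -/
  slow : IsSlowOfOrder X N (S₀ ∩ interior C₀) S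
  inside : ∀ᶠ ε in 𝓝 (0 : ℝ), S ε '' (S₀ ∩ interior C₀) ⊆ interior C₁

end SlowManifolds

/-! ## Running off the edge -/

/-- The curve `z` runs off the edge `closure S \ S` of `S` at a time of absolute value at most `T`,
without being further than `r` away from `S` before: at that time the points of `closure S` that
are nearest to `z` all lie on the edge (and there is one). -/
def RunsOffEdge {M : Type*} [PseudoEMetricSpace M] (z : ℝ → M) (S : Set M) (r T : ℝ) : Prop :=
  ∃ t : ℝ, |t| ≤ T ∧ (∀ τ ∈ uIcc 0 t, Metric.infEDist (z τ) S ≤ ENNReal.ofReal r) ∧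
    (∃ s ∈ closure S \ S, edist (z t) s = Metric.infEDist (z t) S) ∧
    ∀ s ∈ S, Metric.infEDist (z t) S < edist (z t) s

end NearlyPeriodic

end

set_option linter.unusedSectionVars false

noncomputable section

namespace NearlyPeriodic

/-! ### Smoothness of parametric integrals -/

section ParametricIntegral

variable {P F : Type*} [NormedAddCommGroup P] [NormedSpace ℝ P]
  [NormedAddCommGroup F] [NormedSpace ℝ F]

/-! Write δ = d - ν, r = |ε|^((N+1-δ)/2), and let ρ = ∑_{n<L} εⁿ μ_{ν+n} with L = N+2+k be a
truncation of the reduced adiabatic invariant. The proof is a Lyapunov argument: ρ is almost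
conserved, it is almost zero on the slow manifold, and a trajectory on which ρ stays small cannot
sit at distance r with its nearest point away from the edge.

Conservation. Since [X, R] = 0, the formal function L_R H has zero differential at each order. Then
H + τ L_R H solves the transport equation of R, and exp(2π L_R) = 1 forces L_R H = 0
(`RotoSystem.energyRate_eq_zero`). Together with ι_R Ω = dμ this gives dρ(X) = O(ε^L) on compact
sets, so ρ varies by O(ε^(N+2)) while |t| ≤ |ε|^(-k) (`RotoSystem.exists_reduced_drift`).

Smallness on the slow manifold. The invariant is R paired with a 1-form, so it is small where R is
small. At a critical point of the approximate invariant, dρ = O(ε^(N+1)), and the relation ε^δ R =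
-j dρ + O(ε^L) makes the truncated roto-rate O(ε^(N+1-δ)). Averaging the coordinates over the formal
circle action yields a nearby point at which the roto-rate vanishes up to the order of truncation
(`exists_near_zero`), and Taylor's formula carries the bound back: ρ = O(ε^(N+2)) at the critical
point (`SlowModel.exists_critical_value_bound`).

No interior contact. Let z be at distance r from the slow manifold with nearest point s off the
edge, and v = z - s in a chart. Taylor's formula bounds the Hessian on (v, v) by a multiple of
|ε|^(N+2) + |ε|^(N+1) r + r³; the condition N ≥ 3δ is what makes r³ negligible. A semi-definite form
that is small on (v, v) almost annihilates a vector w close to v (`exists_resolvent_bound`).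
Differentiating the relation between R and dρ shows that the linearized roto-rate almost annihilates
w, so w is almost tangent to the zero set of R₀, and moving s along w brings it closer to z
(`SlowModel.exists_descent`, `exists_chart_comparison`, `RotoSystem.eventually_exists_closer`). At
the exit time the nearest points of the closure therefore lie on the edge
(`runsOffEdge_of_exists_closer`).

The analysis takes place in charts, with formal identities turned into identities at finite ε by
smooth remainders (`HasExpansion`), and compactness makes the estimates uniform. -/

theorem hasFDerivAt_slice {f : ℝ × P → F} {σ : ℝ} {p : P} (hf : DifferentiableAt ℝ f (σ, p)) :
    HasFDerivAt (fun q => f (σ, q)) ((fderiv ℝ f (σ, p)).comp (ContinuousLinearMap.inr ℝ ℝ P)) p :=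
  hf.hasFDerivAt.comp p (hasFDerivAt_prodMk_right σ p)

variable [FiniteDimensional ℝ P] [CompleteSpace F]

theorem hasFDerivAt_parametric_integral {f : ℝ × P → F} {W : Set (ℝ × P)} {O : Set P}
    (hW : IsOpen W) (hO : IsOpen O) (hsub : ∀ σ ∈ Icc (0 : ℝ) 1, ∀ p ∈ O, (σ, p) ∈ W)
    (hf : ContDiffOn ℝ ∞ f W) {p : P} (hp : p ∈ O) :
    HasFDerivAt (fun q => ∫ σ in (0 : ℝ)..1, f (σ, q))
      (∫ σ in (0 : ℝ)..1, (fderiv ℝ f (σ, p)).comp (ContinuousLinearMap.inr ℝ ℝ P)) p := by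
  obtain ⟨r, hr, hball⟩ := Metric.nhds_basis_closedBall.mem_iff.1 (hO.mem_nhds hp)
  have hfd : ContinuousOn (fderiv ℝ f) W :=
    (hf.continuousOn_fderiv_of_isOpen hW (by simp))
  have hK : IsCompact (Icc (0 : ℝ) 1 ×ˢ Metric.closedBall p r) :=
    isCompact_Icc.prod (isCompact_closedBall p r)
  have hKW : Icc (0 : ℝ) 1 ×ˢ Metric.closedBall p r ⊆ W := by
    rintro ⟨σ, q⟩ ⟨h1, h2⟩
    exact hsub σ h1 q (hball h2)
  have hcomp : ContinuousOn (fun w : ℝ × P =>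
      (fderiv ℝ f w).comp (ContinuousLinearMap.inr ℝ ℝ P)) W :=
    hfd.clm_comp continuousOn_const
  obtain ⟨B, hB⟩ := (hK.image_of_continuousOn (hcomp.mono hKW)).isBounded.exists_norm_le
  have hslice : ∀ q ∈ Metric.closedBall p r, ContinuousOn (fun σ : ℝ => f (σ, q)) (Icc 0 1) :=
    fun q hq => hf.continuousOn.comp (by fun_prop) fun σ hσ => hKW ⟨hσ, hq⟩
  have hu : uIcc (0 : ℝ) 1 = Icc 0 1 := uIcc_of_le zero_le_one
  have hU : Set.uIoc (0 : ℝ) 1 ⊆ Icc 0 1 := by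
    rw [uIoc_of_le zero_le_one]; exact Ioc_subset_Icc_self
  refine hasFDerivAt_integral_of_dominated_of_fderiv_le'' (bound := fun _ => B)
    (F' := fun q σ => (fderiv ℝ f (σ, q)).comp (ContinuousLinearMap.inr ℝ ℝ P))
    (Metric.closedBall_mem_nhds p hr) ?_ ?_ ?_ ?_ ?_ ?_
  · filter_upwards [Metric.closedBall_mem_nhds p hr] with q hq
    exact ((hslice q hq).mono hU).aestronglyMeasurable measurableSet_uIoc
  · exact (hu ▸ hslice p (Metric.mem_closedBall_self hr.le)).intervalIntegrable
  · refine (ContinuousOn.mono (s := Icc (0:ℝ) 1) ?_ hU).aestronglyMeasurable measurableSet_uIoc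
    exact hcomp.comp (f := fun σ : ℝ => (σ, p)) (by fun_prop)
      fun σ hσ => hKW ⟨hσ, Metric.mem_closedBall_self hr.le⟩
  · refine (MeasureTheory.ae_restrict_mem measurableSet_uIoc).mono fun σ hσ q hq => ?_
    exact hB _ ⟨(σ, q), ⟨hU hσ, hq⟩, rfl⟩
  · exact intervalIntegrable_const
  · refine (MeasureTheory.ae_restrict_mem measurableSet_uIoc).mono fun σ hσ q hq => ?_
    exact hasFDerivAt_slice
      ((hf.contDiffAt (hW.mem_nhds (hKW ⟨hU hσ, hq⟩))).differentiableAt (by simp))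

/-- The derivative, tested on a fixed vector, is an integral of the same kind with the same target
space. Induction on the order of differentiability therefore closes once it is carried out for all
integrands at once. -/
theorem contDiffOn_parametric_integral {f : ℝ × P → F} {W : Set (ℝ × P)} {O : Set P}
    (hW : IsOpen W) (hO : IsOpen O) (hsub : ∀ σ ∈ Icc (0 : ℝ) 1, ∀ p ∈ O, (σ, p) ∈ W)
    (hf : ContDiffOn ℝ ∞ f W) :
    ContDiffOn ℝ ∞ (fun q => ∫ σ in (0 : ℝ)..1, f (σ, q)) O := by
  suffices h : ∀ n : ℕ, ∀ f : ℝ × P → F, ContDiffOn ℝ ∞ f W →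
      ContDiffOn ℝ n (fun q => ∫ σ in (0 : ℝ)..1, f (σ, q)) O from
    contDiffOn_infty.2 fun n => h n f hf
  intro n
  induction n with
  | zero =>
    intro f hf
    exact contDiffOn_zero.2 fun p hp =>
      (hasFDerivAt_parametric_integral hW hO hsub hf hp).continuousAt.continuousWithinAt
  | succ n ih =>
    intro f hf
    push_cast
    refine (contDiffOn_succ_iff_fderiv_of_isOpen hO).2 ⟨fun p hp =>
      (hasFDerivAt_parametric_integral hW hO hsub hf hp).differentiableAt.differentiableWithinAt,
      by simp, contDiffOn_clm_apply.2 fun y => ?_⟩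
    have hfd : ContDiffOn ℝ ∞ (fderiv ℝ f) W := hf.fderiv_of_isOpen hW (by simp)
    refine (ih (fun w => fderiv ℝ f w (0, y)) (hfd.clm_apply contDiffOn_const)).congr
      fun p hp => ?_
    rw [(hasFDerivAt_parametric_integral hW hO hsub hf hp).fderiv,
      ContinuousLinearMap.intervalIntegral_apply]
    · simp
    · refine ContinuousOn.intervalIntegrable ?_
      rw [uIcc_of_le zero_le_one]
      exact (hfd.continuousOn.clm_comp continuousOn_const).comp (f := fun σ : ℝ => (σ, p))
        (by fun_prop) fun σ hσ => hsub σ hσ p hp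

end ParametricIntegral

/-! ### Taylor expansion in a parameter, with smooth remainder -/

section Taylor

variable {P F : Type*} [NormedAddCommGroup P] [NormedSpace ℝ P]
  [NormedAddCommGroup F] [NormedSpace ℝ F]

/-- This is the Leibniz rule for a factor whose second derivative vanishes. At t = 0 only the second
term survives, which is the index shift in `taylorCoeff_const_add_smul`. -/
theorem iteratedDeriv_id_smul {b : ℝ → F} {s : Set ℝ} (hs : IsOpen s) (hb : ContDiffOn ℝ ∞ b s)
    (n : ℕ) : ∀ t ∈ s, iteratedDeriv (n + 1) (fun t => t • b t) t =
      t • iteratedDeriv (n + 1) b t + ((n : ℝ) + 1) • iteratedDeriv n b t := by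
  have hd : ∀ n : ℕ, ∀ t ∈ s, HasDerivAt (iteratedDeriv n b) (iteratedDeriv (n + 1) b t) t := by
    intro n t ht
    rw [iteratedDeriv_succ]
    have : ContDiffAt ℝ ∞ b t := hb.contDiffAt (hs.mem_nhds ht)
    have h2 : DifferentiableAt ℝ (iteratedDeriv n b) t := by
      have := this.differentiableAt_iteratedFDeriv (m := n) (by exact_mod_cast ENat.natCast_lt_top n)
      rw [iteratedDeriv_eq_equiv_comp]
      exact (LinearIsometryEquiv.differentiableAt _).comp t this
    exact h2.hasDerivAt
  induction n with
  | zero =>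
    intro t ht
    have h0 := (hasDerivAt_id t).smul (hd 0 t ht)
    simp only [iteratedDeriv_zero] at h0
    have h1 : deriv (fun t => t • b t) t = _ := h0.deriv
    simpa [iteratedDeriv_one] using h1
  | succ n ih =>
    intro t ht
    rw [iteratedDeriv_succ]
    have heq : iteratedDeriv (n + 1) (fun t => t • b t) =ᶠ[𝓝 t] fun t =>
        t • iteratedDeriv (n + 1) b t + ((n : ℝ) + 1) • iteratedDeriv n b t := by
      filter_upwards [hs.mem_nhds ht] with t ht using ih t ht
    rw [heq.deriv_eq]
    have h1 := ((hasDerivAt_id t).smul (hd (n + 1) t ht)).add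
      ((hd n t ht).const_smul ((n : ℝ) + 1))
    refine (HasDerivAt.deriv h1).trans ?_
    simp only [id, one_smul, Nat.cast_add, Nat.cast_one]
    module

theorem taylorCoeff_const_add_smul {b : ℝ → F} {s : Set ℝ} (hs : IsOpen s) (h0 : (0 : ℝ) ∈ s)
    (hb : ContDiffOn ℝ ∞ b s) {f : ℝ → F} {a : F} (hf : ∀ t ∈ s, f t = a + t • b t) (n : ℕ) :
    taylorCoeff f (n + 1) = taylorCoeff b n := by
  have heq : f =ᶠ[𝓝 0] fun t => a + t • b t := by
    filter_upwards [hs.mem_nhds h0] with t ht using hf t ht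
  have h1 : iteratedDeriv (n + 1) f 0 = ((n : ℝ) + 1) • iteratedDeriv n b 0 := by
    rw [heq.iteratedDeriv_eq, iteratedDeriv_const_add (Nat.succ_pos n),
      iteratedDeriv_id_smul hs hb n 0 h0]
    simp
  rw [taylorCoeff, taylorCoeff, h1, smul_smul, Nat.factorial_succ]
  congr 1
  push_cast
  field_simp

theorem taylorCoeff_zero (f : ℝ → F) : taylorCoeff f 0 = f 0 := by simp [taylorCoeff]

variable [FiniteDimensional ℝ P] [CompleteSpace F]

/-- Hadamard's lemma: b(ε, x) = ∫₀¹ ∂_ε f(σε, x) dσ. This integral is smooth jointly in (ε, x),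
including at ε = 0, where the quotient itself is not defined. -/
theorem exists_smooth_divided_difference {e : ℝ} {U : Set P} (hU : IsOpen U)
    {f : ℝ × P → F} (hf : ContDiffOn ℝ ∞ f (Ioo (-e) e ×ˢ U)) :
    ∃ b : ℝ × P → F, ContDiffOn ℝ ∞ b (Ioo (-e) e ×ˢ U) ∧
      ∀ ε ∈ Ioo (-e) e, ∀ x ∈ U, f (ε, x) = f (0, x) + ε • b (ε, x) := by
  have hD : IsOpen (Ioo (-e) e ×ˢ U) := isOpen_Ioo.prod hU
  have hfd : ContDiffOn ℝ ∞ (fun w => fderiv ℝ f w (1, 0)) (Ioo (-e) e ×ˢ U) :=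
    (hf.fderiv_of_isOpen hD (by simp)).clm_apply contDiffOn_const
  have hmem : ∀ σ ∈ Icc (0 : ℝ) 1, ∀ ε ∈ Ioo (-e) e, σ * ε ∈ Ioo (-e) e := by
    intro σ hσ ε hε
    rw [mem_Ioo, ← abs_lt] at hε ⊢
    rw [abs_mul, abs_of_nonneg hσ.1]
    exact (mul_le_of_le_one_left (abs_nonneg ε) hσ.2).trans_lt hε
  let g : ℝ × (ℝ × P) → ℝ × P := fun w => (w.1 * w.2.1, w.2.2)
  have hg : ContDiff ℝ ∞ g := by fun_prop
  refine ⟨fun p => ∫ σ in (0 : ℝ)..1, fderiv ℝ f (σ * p.1, p.2) (1, 0), ?_, ?_⟩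
  · refine contDiffOn_parametric_integral (f := fun w => fderiv ℝ f (g w) (1, 0))
      (hD.preimage hg.continuous) hD ?_ (hfd.comp hg.contDiffOn fun w hw => hw)
    rintro σ hσ ⟨ε, x⟩ ⟨hε, hx⟩
    exact ⟨hmem σ hσ ε hε, hx⟩
  · intro ε hε x hx
    have hder : ∀ σ ∈ uIcc (0 : ℝ) 1, HasDerivAt (fun σ : ℝ => f (σ * ε, x))
        (ε • fderiv ℝ f (σ * ε, x) (1, 0)) σ := by
      intro σ hσ
      rw [uIcc_of_le zero_le_one] at hσ
      have hdf := ((hf.contDiffAt (hD.mem_nhds (show (σ * ε, x) ∈ _ from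
        ⟨hmem σ hσ ε hε, hx⟩))).differentiableAt (by simp)).hasFDerivAt
      have hl : HasDerivAt (fun σ : ℝ => (σ * ε, x)) (ε, (0 : P)) σ := by
        simpa using ((hasDerivAt_id σ).mul_const ε).prodMk (hasDerivAt_const σ x)
      have := hdf.comp_hasDerivAt σ hl
      have h2 : ((ε, 0) : ℝ × P) = ε • (1, 0) := by simp
      rw [h2, map_smul] at this
      exact this
    have hint : IntervalIntegrable (fun σ : ℝ => ε • fderiv ℝ f (σ * ε, x) (1, 0))
        MeasureTheory.volume 0 1 := by
      refine ContinuousOn.intervalIntegrable ?_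
      rw [uIcc_of_le zero_le_one]
      exact continuousOn_const.smul (hfd.continuousOn.comp (f := fun σ : ℝ => (σ * ε, x))
        (by fun_prop) fun σ hσ => ⟨hmem σ hσ ε hε, hx⟩)
    have := intervalIntegral.integral_eq_sub_of_hasDerivAt hder hint
    rw [intervalIntegral.integral_smul] at this
    simp only [one_mul, zero_mul] at this
    simp only
    rw [this]
    abel

/-- Hadamard's lemma iterated K times. The clause on shifted coefficients identifies the value of
the remainder at ε = 0 with the next Taylor coefficient; this drives the induction and also shows
that the coefficients are smooth in x. -/
theorem exists_taylor_expansion {e : ℝ} (he : 0 < e) {U : Set P} (hU : IsOpen U)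
    {f : ℝ × P → F} (hf : ContDiffOn ℝ ∞ f (Ioo (-e) e ×ˢ U)) (K : ℕ) :
    ∃ b : ℝ × P → F, ContDiffOn ℝ ∞ b (Ioo (-e) e ×ˢ U) ∧
      (∀ x ∈ U, ∀ m, taylorCoeff (fun ε => f (ε, x)) (K + m) =
        taylorCoeff (fun ε => b (ε, x)) m) ∧
      ∀ ε ∈ Ioo (-e) e, ∀ x ∈ U, f (ε, x) =
        ∑ n ∈ Finset.range K, ε ^ n • taylorCoeff (fun ε => f (ε, x)) n + ε ^ K • b (ε, x) := by
  induction K with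
  | zero => exact ⟨f, hf, by simp, by simp⟩
  | succ K ih =>
    obtain ⟨b, hb, hcoef, hexp⟩ := ih
    obtain ⟨c, hc, hbc⟩ := exists_smooth_divided_difference hU hb
    have h0 : (0 : ℝ) ∈ Ioo (-e) e := by simp [he]
    have hslice : ∀ x ∈ U, ContDiffOn ℝ ∞ (fun ε => c (ε, x)) (Ioo (-e) e) := fun x hx =>
      hc.comp (by fun_prop) fun ε hε => ⟨hε, hx⟩
    refine ⟨c, hc, fun x hx m => ?_, fun ε hε x hx => ?_⟩
    · rw [show K + 1 + m = K + (m + 1) by ring, hcoef x hx,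
        taylorCoeff_const_add_smul isOpen_Ioo h0 (hslice x hx) fun t ht => hbc t ht x hx]
    · have := hcoef x hx 0
      rw [taylorCoeff_zero, add_zero] at this
      rw [hexp ε hε x hx, hbc ε hε x hx, Finset.sum_range_succ, this, smul_add, smul_smul,
        pow_succ, add_assoc]

theorem contDiffOn_taylorCoeff {e : ℝ} (he : 0 < e) {U : Set P} (hU : IsOpen U)
    {f : ℝ × P → F} (hf : ContDiffOn ℝ ∞ f (Ioo (-e) e ×ˢ U)) (n : ℕ) :
    ContDiffOn ℝ ∞ (fun x => taylorCoeff (fun ε => f (ε, x)) n) U := by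
  obtain ⟨b, hb, hcoef, -⟩ := exists_taylor_expansion he hU hf n
  refine (hb.comp (g := b) (f := fun x : P => ((0 : ℝ), x)) (by fun_prop)
    fun x hx => ⟨by simp [he], hx⟩).congr fun x hx => ?_
  simpa [taylorCoeff_zero] using hcoef x hx 0

end Taylor

/-! ### Uniqueness of asymptotic coefficients and truncated Cauchy products -/

section Coefficients

variable {F : Type*} [NormedAddCommGroup F] [NormedSpace ℝ F]

/-- The limit ε → 0 kills the constant coefficient; dividing by ε lowers the order by one. Only
continuity of `b` at 0 is needed, and the identity is used only off zero, which matters because the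
Poisson tensor controls nothing at ε = 0. -/
theorem coeff_eq_zero_of_pow_bound {K : ℕ} {a : ℕ → F} {b : ℝ → F}
    (hb : ContinuousAt b 0)
    (h : ∀ᶠ ε in 𝓝[≠] (0 : ℝ), ∑ n ∈ Finset.range K, ε ^ n • a n = ε ^ K • b ε) :
    ∀ n < K, a n = 0 := by
  induction K generalizing a with
  | zero => simp
  | succ K ih =>
    have h0 : a 0 = 0 := by
      have h1 : Tendsto (fun ε : ℝ => ∑ n ∈ Finset.range (K + 1), ε ^ n • a n) (𝓝[≠] 0)
          (𝓝 (∑ n ∈ Finset.range (K + 1), (0 : ℝ) ^ n • a n)) :=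
        (Continuous.tendsto (by fun_prop) 0).mono_left nhdsWithin_le_nhds
      have h2 : Tendsto (fun ε : ℝ => ε ^ (K + 1) • b ε) (𝓝[≠] 0)
          (𝓝 ((0 : ℝ) ^ (K + 1) • b 0)) :=
        ((ContinuousAt.pow continuousAt_id _).smul hb).tendsto.mono_left nhdsWithin_le_nhds
      have := tendsto_nhds_unique (h1.congr' h) h2
      rw [Finset.sum_range_succ'] at this
      simpa using this
    have h3 : ∀ n < K, a (n + 1) = 0 := by
      refine ih (a := fun n => a (n + 1)) ?_
      filter_upwards [h, self_mem_nhdsWithin] with ε hε hne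
      have hne : ε ≠ 0 := hne
      rw [Finset.sum_range_succ', h0, smul_zero, add_zero] at hε
      have : ε • ∑ n ∈ Finset.range K, ε ^ n • a (n + 1) = ε • (ε ^ K • b ε) := by
        rw [smul_smul, ← pow_succ', ← hε, Finset.smul_sum]
        refine Finset.sum_congr rfl fun n _ => ?_
        rw [smul_smul, ← pow_succ']
      exact smul_right_injective F hne this
    intro n hn
    cases n with
    | zero => exact h0
    | succ n => exact h3 n (by omega)

variable {A B : Type*} [NormedAddCommGroup A] [NormedSpace ℝ A]
  [NormedAddCommGroup B] [NormedSpace ℝ B]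

/-- The truncated sum `∑_{n < K} εⁿ aₙ` of a formal series. -/
def truncSum {A : Type*} [AddCommGroup A] [Module ℝ A] (K : ℕ) (a : ℕ → A) (ε : ℝ) : A :=
  ∑ n ∈ Finset.range K, ε ^ n • a n

/-- The remainder in the product of two truncated series. -/
def cauchyRemainder (L : A →L[ℝ] B →L[ℝ] F) (K : ℕ) (a : ℕ → A) (b : ℕ → B) (ε : ℝ) : F :=
  ∑ p ∈ (Finset.range K ×ˢ Finset.range K).filter (fun p => K ≤ p.1 + p.2),
    ε ^ (p.1 + p.2 - K) • L (a p.1) (b p.2)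

/-- The index pairs with sum below K regroup into the Cauchy product, and all remaining pairs carry
a factor ε^K. This is how order-by-order identities become exact identities at finite ε. -/
theorem truncSum_mul (L : A →L[ℝ] B →L[ℝ] F) (K : ℕ) (a : ℕ → A) (b : ℕ → B) (ε : ℝ) :
    L (truncSum K a ε) (truncSum K b ε) =
      truncSum K (fun n => ∑ p ∈ Finset.HasAntidiagonal.antidiagonal n, L (a p.1) (b p.2)) ε +
        ε ^ K • cauchyRemainder L K a b ε := by
  have h1 : L (truncSum K a ε) (truncSum K b ε) =
      ∑ p ∈ Finset.range K ×ˢ Finset.range K, ε ^ (p.1 + p.2) • L (a p.1) (b p.2) := by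
    simp only [truncSum, map_sum, sum_apply, map_smul,
      smul_apply, Finset.sum_product, pow_add, Finset.smul_sum]
    rw [Finset.sum_comm]
    refine Finset.sum_congr rfl fun p _ => Finset.sum_congr rfl fun q _ => ?_
    rw [smul_smul, mul_comm]
  rw [h1, ← Finset.sum_filter_add_sum_filter_not _ (fun p : ℕ × ℕ => K ≤ p.1 + p.2), add_comm]
  congr 1
  · simp only [truncSum, Finset.smul_sum]
    rw [Finset.sum_sigma']
    refine Finset.sum_bij' (fun p _ => ⟨p.1 + p.2, p⟩) (fun p _ => p.2) ?_ ?_ ?_ ?_ ?_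
    · rintro ⟨p, q⟩ h
      simp at h ⊢
      omega
    · rintro ⟨n, p, q⟩ h
      simp at h ⊢
      omega
    · simp
    · rintro ⟨n, p, q⟩ h
      simp at h ⊢
      omega
    · simp
  · simp only [cauchyRemainder, Finset.smul_sum]
    refine Finset.sum_congr rfl fun p hp => ?_
    rw [Finset.mem_filter] at hp
    rw [smul_smul, ← pow_add, Nat.add_sub_cancel' hp.2]

end Coefficients

/-! ### Tensor fields in a chart -/

section Charts

variable {E : Type*} [NormedAddCommGroup E] [NormedSpace ℝ E]
  {M : Type*} [TopologicalSpace M] [ChartedSpace E M]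

/-- The differential of the preferred chart at `c`. -/
def chartD (c m : M) : E →L[ℝ] E := mfderiv 𝓘(ℝ, E) 𝓘(ℝ, E) (extChartAt 𝓘(ℝ, E) c) m

/-- The differential of the inverse of the preferred chart at `c`. -/
def chartSymmD (c : M) (x : E) : E →L[ℝ] E :=
  mfderiv 𝓘(ℝ, E) 𝓘(ℝ, E) (extChartAt 𝓘(ℝ, E) c).symm x

variable [IsManifold 𝓘(ℝ, E) ∞ M]

theorem chartD_chartSymmD {c : M} {x : E} (hx : x ∈ (extChartAt 𝓘(ℝ, E) c).target) (v : E) :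
    chartD c ((extChartAt 𝓘(ℝ, E) c).symm x) (chartSymmD c x v) = v := by
  have : IsManifold 𝓘(ℝ, E) 1 M := .of_le (n := ∞) (by simp)
  have := mfderiv_extChartAt_comp_mfderivWithin_extChartAt_symm (I := 𝓘(ℝ, E)) hx
  simp only [modelWithCornersSelf_coe, range_id, mfderivWithin_univ] at this
  exact congrArg (fun L : E →L[ℝ] E => L v) this

theorem chartSymmD_chartD {c : M} {x : E} (hx : x ∈ (extChartAt 𝓘(ℝ, E) c).target) (v : E) :
    chartSymmD c x (chartD c ((extChartAt 𝓘(ℝ, E) c).symm x) v) = v := by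
  have : IsManifold 𝓘(ℝ, E) 1 M := .of_le (n := ∞) (by simp)
  have := mfderivWithin_extChartAt_symm_comp_mfderiv_extChartAt (I := 𝓘(ℝ, E)) hx
  simp only [modelWithCornersSelf_coe, range_id, mfderivWithin_univ] at this
  exact congrArg (fun L : E →L[ℝ] E => L v) this

theorem chartSymmD_self (c : M) : chartSymmD c (extChartAt 𝓘(ℝ, E) c c) = .id ℝ E := by
  have : IsManifold 𝓘(ℝ, E) 1 M := .of_le (n := ∞) (by simp)
  have := mfderivWithin_range_extChartAt_symm (I := 𝓘(ℝ, E)) (x := c)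
  simp only [modelWithCornersSelf_coe, range_id, mfderivWithin_univ] at this
  exact this

theorem chartD_self (c : M) : chartD c c = .id ℝ E := by
  have : IsManifold 𝓘(ℝ, E) 1 M := .of_le (n := ∞) (by simp)
  exact mfderiv_extChartAt_self (I := 𝓘(ℝ, E)) (x := c)

theorem isOpen_chart_target (c : M) : IsOpen (extChartAt 𝓘(ℝ, E) c).target :=
  isOpen_extChartAt_target c

theorem mdifferentiableAt_chart_symm {c : M} {x : E} (hx : x ∈ (extChartAt 𝓘(ℝ, E) c).target) :
    MDifferentiableAt 𝓘(ℝ, E) 𝓘(ℝ, E) (extChartAt 𝓘(ℝ, E) c).symm x :=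
  ((contMDiffOn_extChartAt_symm (I := 𝓘(ℝ, E)) (n := ∞) c).contMDiffAt
    ((isOpen_chart_target c).mem_nhds hx)).mdifferentiableAt (by simp)

/-- The differential of a function in a chart. -/
theorem dFun_chartSymmD {f : M → ℝ} {c : M} {x : E} (hx : x ∈ (extChartAt 𝓘(ℝ, E) c).target)
    (hf : MDifferentiableAt 𝓘(ℝ, E) 𝓘(ℝ, ℝ) f ((extChartAt 𝓘(ℝ, E) c).symm x)) (v : E) :
    dFun (E := E) f ((extChartAt 𝓘(ℝ, E) c).symm x) (chartSymmD c x v) =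
      fderiv ℝ (f ∘ (extChartAt 𝓘(ℝ, E) c).symm) x v := by
  have := mfderiv_comp x hf (mdifferentiableAt_chart_symm hx)
  rw [mfderiv_eq_fderiv] at this
  rw [this]
  rfl

theorem contMDiffOn_prod_chart_symm (c : M) :
    ContMDiffOn 𝓘(ℝ, ℝ × E) (𝓘(ℝ, ℝ).prod 𝓘(ℝ, E)) ∞
      (fun p : ℝ × E => (p.1, (extChartAt 𝓘(ℝ, E) c).symm p.2))
      (univ ×ˢ (extChartAt 𝓘(ℝ, E) c).target) :=
  (contDiff_fst.contMDiff.contMDiffOn).prodMk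
    ((contMDiffOn_extChartAt_symm (I := 𝓘(ℝ, E)) (n := ∞) c).comp
      contDiff_snd.contMDiff.contMDiffOn fun _ hp => hp.2)

/-- A function family in a chart. -/
theorem contDiffOn_function_chart {f : ℝ × M → ℝ} {s : Set ℝ} {U : Set M} (c : M)
    (hf : ContMDiffOn (𝓘(ℝ, ℝ).prod 𝓘(ℝ, E)) 𝓘(ℝ, ℝ) ∞ f (s ×ˢ U)) :
    ContDiffOn ℝ ∞ (fun p : ℝ × E => f (p.1, (extChartAt 𝓘(ℝ, E) c).symm p.2))
      (s ×ˢ ((extChartAt 𝓘(ℝ, E) c).target ∩ (extChartAt 𝓘(ℝ, E) c).symm ⁻¹' U)) :=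
  (hf.comp ((contMDiffOn_prod_chart_symm c).mono (by
    rintro ⟨a, b⟩ ⟨-, h, -⟩; exact ⟨mem_univ _, h⟩)) (by
    rintro ⟨a, b⟩ ⟨h1, -, h2⟩; exact ⟨h1, h2⟩)).contDiffOn

/-- The coordinate expression of a vector field. -/
def vectorInChart (V : (m : M) → TangentSpace 𝓘(ℝ, E) m) (c : M) (x : E) : E :=
  chartD c ((extChartAt 𝓘(ℝ, E) c).symm x) (V ((extChartAt 𝓘(ℝ, E) c).symm x))

/-- This matches the fibre coordinate in which smoothness of sections is defined with the derivative
of the chart, in which all later computations take place. -/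
theorem trivializationAt_tangent_snd {c m : M} (hm : m ∈ (chartAt E c).source)
    (v : TangentSpace 𝓘(ℝ, E) m) :
    (trivializationAt E (TangentSpace 𝓘(ℝ, E) : M → Type _) c ⟨m, v⟩).2 = chartD (E := E) c m v := by
  have : IsManifold 𝓘(ℝ, E) 1 M := .of_le (n := ∞) (by simp)
  have h := TangentBundle.continuousLinearMapAt_trivializationAt (𝕜 := ℝ) (I := 𝓘(ℝ, E)) hm
  have h2 := congrArg (fun L : E →L[ℝ] E => L v) h
  refine Eq.trans ?_ h2
  exact (Trivialization.continuousLinearMapAt_apply_of_mem ℝ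
    (trivializationAt E (TangentSpace 𝓘(ℝ, E) : M → Type _) c)
    (b := m) (by simpa using hm) v).symm

theorem chart_symm_mem_source {c : M} {x : E} (hx : x ∈ (extChartAt 𝓘(ℝ, E) c).target) :
    (extChartAt 𝓘(ℝ, E) c).symm x ∈ (chartAt E c).source := by
  have := (extChartAt 𝓘(ℝ, E) c).map_target hx
  rwa [extChartAt_source] at this

theorem contDiffOn_vectorInChart {N : Type*} [NormedAddCommGroup N] [NormedSpace ℝ N] {s : Set N}
    {c : M} {b : N → M} {v : (p : N) → TangentSpace 𝓘(ℝ, E) (b p)}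
    (hb : ∀ p ∈ s, b p ∈ (chartAt E c).source)
    (hv : ContMDiffOn 𝓘(ℝ, N) 𝓘(ℝ, E).tangent ∞
      (fun p => (⟨b p, v p⟩ : TangentBundle 𝓘(ℝ, E) M)) s) :
    ContDiffOn ℝ ∞ (fun p => chartD c (b p) (v p)) s := by
  have := ((trivializationAt E (TangentSpace 𝓘(ℝ, E) : M → Type _) c).contMDiffOn_iff
    (IM := 𝓘(ℝ, N)) (IB := 𝓘(ℝ, E)) (n := ∞) (fun p hp => by
      simpa [Trivialization.mem_source] using hb p hp)).1 hv
  refine this.2.contDiffOn.congr fun p hp => ?_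
  exact (trivializationAt_tangent_snd (hb p hp) (v p)).symm

/-- Coordinate frames are constant in the bundle trivialization. Evaluating tensor fields on them
reduces smoothness of a tensor to smoothness of its components. -/
theorem contMDiffOn_frame {N : Type*} [NormedAddCommGroup N] [NormedSpace ℝ N] {s : Set N}
    {c : M} {x : N → E} (hx : ContDiffOn ℝ ∞ x s)
    (hxs : ∀ p ∈ s, x p ∈ (extChartAt 𝓘(ℝ, E) c).target) (e : E) :
    ContMDiffOn 𝓘(ℝ, N) 𝓘(ℝ, E).tangent ∞
      (fun p => (⟨(extChartAt 𝓘(ℝ, E) c).symm (x p), chartSymmD c (x p) e⟩ :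
        TangentBundle 𝓘(ℝ, E) M)) s := by
  refine ((trivializationAt E (TangentSpace 𝓘(ℝ, E) : M → Type _) c).contMDiffOn_iff
    (IM := 𝓘(ℝ, N)) (IB := 𝓘(ℝ, E)) (n := ∞) (fun p hp => by
      simpa [Trivialization.mem_source] using chart_symm_mem_source (hxs p hp))).2 ⟨?_, ?_⟩
  · exact (contMDiffOn_extChartAt_symm (I := 𝓘(ℝ, E)) (n := ∞) c).comp hx.contMDiffOn hxs
  · refine (contMDiffOn_const (c := e)).congr fun p hp => ?_
    exact (trivializationAt_tangent_snd (chart_symm_mem_source (hxs p hp)) _).trans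
      (chartD_chartSymmD (hxs p hp) e)

theorem contDiffOn_vectorFamily_chart {X : ℝ → (m : M) → TangentSpace 𝓘(ℝ, E) m}
    (hX : SmoothVectorFamily X) (c : M) :
    ContDiffOn ℝ ∞ (fun p : ℝ × E => vectorInChart (X p.1) c p.2)
      (univ ×ˢ (extChartAt 𝓘(ℝ, E) c).target) :=
  contDiffOn_vectorInChart (fun _ hp => chart_symm_mem_source hp.2)
    (hX.comp_contMDiffOn (contMDiffOn_prod_chart_symm c))

theorem contDiffOn_vectorField_chart {V : (m : M) → TangentSpace 𝓘(ℝ, E) m}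
    (hV : SmoothVectorField V) (c : M) :
    ContDiffOn ℝ ∞ (vectorInChart V c) (extChartAt 𝓘(ℝ, E) c).target :=
  contDiffOn_vectorInChart (fun _ hp => chart_symm_mem_source hp)
    (hV.comp_contMDiffOn (contMDiffOn_extChartAt_symm (I := 𝓘(ℝ, E)) (n := ∞) c))

/-- The coordinate expression of a covariant `2`-tensor field. -/
def twoTensorInChart
    (Ω : (m : M) → TangentSpace 𝓘(ℝ, E) m →L[ℝ] TangentSpace 𝓘(ℝ, E) m →L[ℝ] ℝ) (c : M) (x : E) :
    E →L[ℝ] E →L[ℝ] ℝ :=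
  ContinuousLinearMap.bilinearComp
    (show E →L[ℝ] E →L[ℝ] ℝ from Ω ((extChartAt 𝓘(ℝ, E) c).symm x))
    (chartSymmD c x) (chartSymmD c x)

/-- The coordinate expression of a bundle map `T*M → TM`. -/
def sharpInChart
    (j : (m : M) → (TangentSpace 𝓘(ℝ, E) m →L[ℝ] ℝ) →L[ℝ] TangentSpace 𝓘(ℝ, E) m)
    (c : M) (x : E) : (E →L[ℝ] ℝ) →L[ℝ] E :=
  (chartD c ((extChartAt 𝓘(ℝ, E) c).symm x)).comp
    ((show (E →L[ℝ] ℝ) →L[ℝ] E from j ((extChartAt 𝓘(ℝ, E) c).symm x)).comp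
      (ContinuousLinearMap.precomp ℝ (chartD c ((extChartAt 𝓘(ℝ, E) c).symm x))))

end Charts

/-! ### Smoothness of coordinate expressions of tensor fields and of the metric -/

section SmoothCharts

variable {E : Type*} [NormedAddCommGroup E] [NormedSpace ℝ E] [FiniteDimensional ℝ E]
  {M : Type*} [TopologicalSpace M] [ChartedSpace E M] [IsManifold 𝓘(ℝ, E) ∞ M]

theorem contDiffOn_of_trivial_section {N : Type*} [NormedAddCommGroup N] [NormedSpace ℝ N]
    {s : Set N} {b : N → M} {f : N → ℝ}
    (h : ContMDiffOn 𝓘(ℝ, N) (𝓘(ℝ, E).prod 𝓘(ℝ, ℝ)) ∞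
      (fun p => TotalSpace.mk' ℝ (E := fun m : M => Trivial M ℝ m) (b p) (f p)) s) :
    ContDiffOn ℝ ∞ f s := fun p hp =>
  ((Bundle.contMDiffWithinAt_totalSpace.1 (h p hp)).2).contDiffWithinAt

theorem contDiffOn_oneForm_section {N : Type*} [NormedAddCommGroup N] [NormedSpace ℝ N]
    {s : Set N} {c : M} {x : N → E} (hx : ContDiffOn ℝ ∞ x s)
    (hxs : ∀ p ∈ s, x p ∈ (extChartAt 𝓘(ℝ, E) c).target)
    {α : (p : N) → TangentSpace 𝓘(ℝ, E) ((extChartAt 𝓘(ℝ, E) c).symm (x p)) →L[ℝ] ℝ}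
    (hα : ContMDiffOn 𝓘(ℝ, N) (𝓘(ℝ, E).prod 𝓘(ℝ, E →L[ℝ] ℝ)) ∞
      (fun p => TotalSpace.mk' (E →L[ℝ] ℝ)
        (E := fun m : M => TangentSpace 𝓘(ℝ, E) m →L[ℝ] Trivial M ℝ m)
        ((extChartAt 𝓘(ℝ, E) c).symm (x p)) (α p)) s) :
    ContDiffOn ℝ ∞ (fun p => (show E →L[ℝ] ℝ from α p).comp (chartSymmD c (x p))) s :=
  contDiffOn_clm_apply.2 fun e =>
    contDiffOn_of_trivial_section (hα.clm_bundle_apply (contMDiffOn_frame hx hxs e))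

theorem contDiffOn_oneForm_chart {α : (m : M) → TangentSpace 𝓘(ℝ, E) m →L[ℝ] ℝ}
    (hα : SmoothOneForm α) (c : M) :
    ContDiffOn ℝ ∞ (oneFormInChart α c) (extChartAt 𝓘(ℝ, E) c).target :=
  contDiffOn_oneForm_section (x := id) contDiffOn_id (fun _ h => h)
    (hα.comp_contMDiffOn (contMDiffOn_extChartAt_symm (I := 𝓘(ℝ, E)) (n := ∞) c))

theorem contDiffOn_oneFormFamily_chart {α : ℝ → (m : M) → TangentSpace 𝓘(ℝ, E) m →L[ℝ] ℝ}
    (hα : SmoothOneFormFamily α) (c : M) :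
    ContDiffOn ℝ ∞ (fun p : ℝ × E => oneFormInChart (α p.1) c p.2)
      (univ ×ˢ (extChartAt 𝓘(ℝ, E) c).target) :=
  contDiffOn_oneForm_section (x := Prod.snd) contDiffOn_snd (fun _ h => h.2)
    (hα.comp_contMDiffOn (contMDiffOn_prod_chart_symm c))

theorem contDiffOn_twoTensor_section {N : Type*} [NormedAddCommGroup N] [NormedSpace ℝ N]
    {s : Set N} {c : M} {x : N → E} (hx : ContDiffOn ℝ ∞ x s)
    (hxs : ∀ p ∈ s, x p ∈ (extChartAt 𝓘(ℝ, E) c).target)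
    {Ω : (p : N) → TangentSpace 𝓘(ℝ, E) ((extChartAt 𝓘(ℝ, E) c).symm (x p)) →L[ℝ]
      TangentSpace 𝓘(ℝ, E) ((extChartAt 𝓘(ℝ, E) c).symm (x p)) →L[ℝ] ℝ}
    (hΩ : ContMDiffOn 𝓘(ℝ, N) (𝓘(ℝ, E).prod 𝓘(ℝ, E →L[ℝ] E →L[ℝ] ℝ)) ∞
      (fun p => TotalSpace.mk' (E →L[ℝ] E →L[ℝ] ℝ)
        (E := fun m : M =>
          TangentSpace 𝓘(ℝ, E) m →L[ℝ] TangentSpace 𝓘(ℝ, E) m →L[ℝ] Trivial M ℝ m)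
        ((extChartAt 𝓘(ℝ, E) c).symm (x p)) (Ω p)) s) :
    ContDiffOn ℝ ∞ (fun p => ContinuousLinearMap.bilinearComp (show E →L[ℝ] E →L[ℝ] ℝ from Ω p)
      (chartSymmD c (x p)) (chartSymmD c (x p))) s :=
  contDiffOn_clm_apply.2 fun e => contDiffOn_clm_apply.2 fun e' =>
    contDiffOn_of_trivial_section ((hΩ.clm_bundle_apply (contMDiffOn_frame hx hxs e)).clm_bundle_apply
      (contMDiffOn_frame hx hxs e'))

theorem contDiffOn_twoTensorFamily_chart
    {Ω : ℝ → (m : M) → TangentSpace 𝓘(ℝ, E) m →L[ℝ] TangentSpace 𝓘(ℝ, E) m →L[ℝ] ℝ}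
    (hΩ : SmoothTwoTensorFamily Ω) (c : M) :
    ContDiffOn ℝ ∞ (fun p : ℝ × E => twoTensorInChart (Ω p.1) c p.2)
      (univ ×ˢ (extChartAt 𝓘(ℝ, E) c).target) :=
  contDiffOn_twoTensor_section (x := Prod.snd) contDiffOn_snd (fun _ h => h.2)
    (hΩ.comp_contMDiffOn (contMDiffOn_prod_chart_symm c))

/-- The dual of `contMDiffOn_frame`: constant covectors of the chart are smooth sections. They are
the test objects for bundle maps defined on T*M. -/
theorem contMDiffOn_coframe {N : Type*} [NormedAddCommGroup N] [NormedSpace ℝ N] {s : Set N}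
    {c : M} {x : N → E} (hx : ContDiffOn ℝ ∞ x s)
    (hxs : ∀ p ∈ s, x p ∈ (extChartAt 𝓘(ℝ, E) c).target) (ξ : E →L[ℝ] ℝ) :
    ContMDiffOn 𝓘(ℝ, N) (𝓘(ℝ, E).prod 𝓘(ℝ, E →L[ℝ] ℝ)) ∞
      (fun p => TotalSpace.mk' (E →L[ℝ] ℝ)
        (E := fun m : M => TangentSpace 𝓘(ℝ, E) m →L[ℝ] Trivial M ℝ m)
        ((extChartAt 𝓘(ℝ, E) c).symm (x p))
        (show E →L[ℝ] ℝ from ξ.comp (chartD c ((extChartAt 𝓘(ℝ, E) c).symm (x p))))) s := by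
  have h1 : IsManifold 𝓘(ℝ, E) 1 M := .of_le (n := ∞) (by simp)
  refine ((trivializationAt (E →L[ℝ] ℝ)
    (fun m : M => TangentSpace 𝓘(ℝ, E) m →L[ℝ] Trivial M ℝ m) c).contMDiffOn_iff
    (IM := 𝓘(ℝ, N)) (IB := 𝓘(ℝ, E)) (n := ∞) (fun p hp => by
      simpa [Trivialization.mem_source] using chart_symm_mem_source (hxs p hp))).2 ⟨?_, ?_⟩
  · exact (contMDiffOn_extChartAt_symm (I := 𝓘(ℝ, E)) (n := ∞) c).comp hx.contMDiffOn hxs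
  · refine (contMDiffOn_const (c := ξ)).congr fun p hp => ?_
    have hm := chart_symm_mem_source (hxs p hp)
    rw [hom_trivializationAt_apply]
    ext e
    have h2 := TangentBundle.symmL_trivializationAt (𝕜 := ℝ) (I := 𝓘(ℝ, E)) hm
    simp only [modelWithCornersSelf_coe, range_id, mfderivWithin_univ] at h2
    rw [(extChartAt 𝓘(ℝ, E) c).right_inv (hxs p hp)] at h2
    have h3 : (trivializationAt E (TangentSpace 𝓘(ℝ, E) : M → Type _) c).symmL ℝ
        ((extChartAt 𝓘(ℝ, E) c).symm (x p)) e = (chartSymmD c (x p) e : E) :=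
      congrArg (fun L : E →L[ℝ] E => L e) h2
    have h4 : ((trivializationAt ℝ (Trivial M ℝ) c).continuousLinearMapAt ℝ
        ((extChartAt 𝓘(ℝ, E) c).symm (x p))) = ContinuousLinearMap.id ℝ ℝ :=
      Bundle.Trivial.continuousLinearMapAt_trivialization ℝ M ℝ _
    refine Eq.trans (b := (ContinuousLinearMap.id ℝ ℝ) (ξ (chartD c
      ((extChartAt 𝓘(ℝ, E) c).symm (x p)) (chartSymmD c (x p) e)))) ?_ ?_
    · rw [← h3]
      exact congrArg (fun L : ℝ →L[ℝ] ℝ => L _) h4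
    · rw [chartD_chartSymmD (hxs p hp)]; rfl

theorem contDiffOn_sharpFamily_chart
    {j : ℝ → (m : M) → (TangentSpace 𝓘(ℝ, E) m →L[ℝ] ℝ) →L[ℝ] TangentSpace 𝓘(ℝ, E) m}
    (hj : SmoothSharpFamily j) (c : M) :
    ContDiffOn ℝ ∞ (fun p : ℝ × E => sharpInChart (j p.1) c p.2)
      (univ ×ˢ (extChartAt 𝓘(ℝ, E) c).target) :=
  contDiffOn_clm_apply.2 fun ξ =>
    contDiffOn_vectorInChart (fun _ hp => chart_symm_mem_source hp.2)
      ((hj.comp_contMDiffOn (contMDiffOn_prod_chart_symm c)).clm_bundle_apply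
        (contMDiffOn_coframe (x := Prod.snd) contDiffOn_snd (fun _ h => h.2) ξ))

/-- The Riemannian metric in a chart. -/
theorem exists_metric_chart [RiemannianBundle (fun m : M => TangentSpace 𝓘(ℝ, E) m)]
    [IsContMDiffRiemannianBundle 𝓘(ℝ, E) ∞ E (fun m : M => TangentSpace 𝓘(ℝ, E) m)] (c : M) :
    ∃ g : E → E →L[ℝ] E →L[ℝ] ℝ, ContDiffOn ℝ ∞ g (extChartAt 𝓘(ℝ, E) c).target ∧
      ∀ x ∈ (extChartAt 𝓘(ℝ, E) c).target, ∀ v : E,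
        g x v v = ‖(show TangentSpace 𝓘(ℝ, E) ((extChartAt 𝓘(ℝ, E) c).symm x) from
          chartSymmD c x v)‖ ^ 2 := by
  obtain ⟨g, hg, hinner⟩ := IsContMDiffRiemannianBundle.exists_contMDiff (IB := 𝓘(ℝ, E)) (n := ∞)
    (F := E) (E := fun m : M => TangentSpace 𝓘(ℝ, E) m)
  have := contDiffOn_twoTensor_section (c := c) (x := id)
    (s := (extChartAt 𝓘(ℝ, E) c).target) contDiffOn_id (fun _ h => h)
    (Ω := fun x => g ((extChartAt 𝓘(ℝ, E) c).symm x))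
    (hg.comp_contMDiffOn (contMDiffOn_extChartAt_symm (I := 𝓘(ℝ, E)) (n := ∞) c))
  refine ⟨_, this, ?_⟩
  intro x hx v
  have h1 := hinner ((extChartAt 𝓘(ℝ, E) c).symm x) (chartSymmD c x v) (chartSymmD c x v)
  rw [← real_inner_self_eq_norm_sq, h1]
  rfl

end SmoothCharts

section ChartCalculus

variable {E : Type*} [NormedAddCommGroup E] [NormedSpace ℝ E] [FiniteDimensional ℝ E]
  {M : Type*} [TopologicalSpace M] [ChartedSpace E M] [IsManifold 𝓘(ℝ, E) ∞ M]

/-! ### Exterior derivative in a chart, and the Hessian at a critical point -/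

theorem contDiffOn_transition (c c' : M) :
    ContDiffOn ℝ ∞ ((extChartAt 𝓘(ℝ, E) c) ∘ (extChartAt 𝓘(ℝ, E) c').symm)
      ((extChartAt 𝓘(ℝ, E) c').target ∩
        (extChartAt 𝓘(ℝ, E) c').symm ⁻¹' (chartAt E c).source) :=
  ((contMDiffOn_extChartAt (I := 𝓘(ℝ, E)) (n := ∞) (x := c)).comp
    ((contMDiffOn_extChartAt_symm (I := 𝓘(ℝ, E)) (n := ∞) c').mono inter_subset_left)
    fun _ h => h.2).contDiffOn

theorem isOpen_transition_domain (c c' : M) :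
    IsOpen ((extChartAt 𝓘(ℝ, E) c').target ∩
        (extChartAt 𝓘(ℝ, E) c').symm ⁻¹' (chartAt E c).source) :=
  (continuousOn_extChartAt_symm c').isOpen_inter_preimage (isOpen_chart_target c')
    (chartAt E c).open_source

theorem chartD_comp_chartSymmD {c c' : M} {y : E} (hy : y ∈ (extChartAt 𝓘(ℝ, E) c').target ∩
    (extChartAt 𝓘(ℝ, E) c').symm ⁻¹' (chartAt E c).source) :
    fderiv ℝ ((extChartAt 𝓘(ℝ, E) c) ∘ (extChartAt 𝓘(ℝ, E) c').symm) y =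
      (chartD c ((extChartAt 𝓘(ℝ, E) c').symm y)).comp (chartSymmD c' y) := by
  have : MDifferentiableAt 𝓘(ℝ, E) 𝓘(ℝ, E) (extChartAt 𝓘(ℝ, E) c)
      ((extChartAt 𝓘(ℝ, E) c').symm y) :=
    ((contMDiffOn_extChartAt (I := 𝓘(ℝ, E)) (n := ∞) (x := c)).contMDiffAt
      ((chartAt E c).open_source.mem_nhds hy.2)).mdifferentiableAt (by simp)
  have := mfderiv_comp y this (mdifferentiableAt_chart_symm hy.1)
  rw [mfderiv_eq_fderiv] at this
  exact this

/-- The exterior derivative of a `1`-form may be computed in any chart. -/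
theorem dOne_chartSymmD {α : (m : M) → TangentSpace 𝓘(ℝ, E) m →L[ℝ] ℝ} (hα : SmoothOneForm α)
    {c : M} {x : E} (hx : x ∈ (extChartAt 𝓘(ℝ, E) c).target) (u w : E) :
    dOne α ((extChartAt 𝓘(ℝ, E) c).symm x) (chartSymmD c x u) (chartSymmD c x w) =
      fderiv ℝ (oneFormInChart α c) x u w - fderiv ℝ (oneFormInChart α c) x w u := by
  set m := (extChartAt 𝓘(ℝ, E) c).symm x with hm
  set T : E → E := (extChartAt 𝓘(ℝ, E) c) ∘ (extChartAt 𝓘(ℝ, E) m).symm with hT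
  set y₀ := extChartAt 𝓘(ℝ, E) m m with hy₀
  set D := (extChartAt 𝓘(ℝ, E) m).target ∩
    (extChartAt 𝓘(ℝ, E) m).symm ⁻¹' (chartAt E c).source with hD
  have hDo : IsOpen D := isOpen_transition_domain c m
  have hmc : m ∈ (chartAt E c).source := chart_symm_mem_source hx
  have hy₀D : y₀ ∈ D := by
    refine ⟨mem_extChartAt_target m, ?_⟩
    simp only [hy₀, mem_preimage, extChartAt_to_inv]
    exact hmc
  have hTy₀ : T y₀ = x := by
    simp only [hT, hy₀, Function.comp_apply, extChartAt_to_inv]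
    exact (extChartAt 𝓘(ℝ, E) c).right_inv hx
  have hTs : ContDiffOn ℝ ∞ T D := contDiffOn_transition c m
  have hTmem : ∀ y ∈ D, T y ∈ (extChartAt 𝓘(ℝ, E) c).target := fun y hy =>
    (extChartAt 𝓘(ℝ, E) c).map_source (by rw [extChartAt_source]; exact hy.2)
  have hinv : ∀ y ∈ D, (extChartAt 𝓘(ℝ, E) c).symm (T y) = (extChartAt 𝓘(ℝ, E) m).symm y :=
    fun y hy => (extChartAt 𝓘(ℝ, E) c).left_inv (by rw [extChartAt_source]; exact hy.2)
  have hform : ∀ y ∈ D, oneFormInChart α m y = (oneFormInChart α c (T y)).comp (fderiv ℝ T y) := by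
    intro y hy
    rw [hT, chartD_comp_chartSymmD hy, ← hT]
    ext v
    have h1 := chartSymmD_chartD (hTmem y hy) (chartSymmD m y v)
    simp only [oneFormInChart]
    have h2 := hinv y hy
    change _ = (α ((extChartAt 𝓘(ℝ, E) c).symm (T y)) : E →L[ℝ] ℝ)
      (chartSymmD c (T y) (chartD c ((extChartAt 𝓘(ℝ, E) m).symm y) (chartSymmD m y v)))
    rw [← h2, h1]
    rw [h2]
    rfl
  have hαc := contDiffOn_oneForm_chart hα c
  have hd1 : HasFDerivAt (oneFormInChart α c) (fderiv ℝ (oneFormInChart α c) x) (T y₀) := by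
    rw [hTy₀]
    exact ((hαc.contDiffAt ((isOpen_chart_target c).mem_nhds hx)).differentiableAt
      (by simp)).hasFDerivAt
  have hTy : ContDiffAt ℝ ∞ T y₀ := hTs.contDiffAt (hDo.mem_nhds hy₀D)
  have hd2 : HasFDerivAt T (fderiv ℝ T y₀) y₀ := (hTy.differentiableAt (by simp)).hasFDerivAt
  have hd3 : HasFDerivAt (fderiv ℝ T) (fderiv ℝ (fderiv ℝ T) y₀) y₀ :=
    ((hTy.fderiv_right (m := ∞) (by simp)).differentiableAt (by simp)).hasFDerivAt
  have hd4 := (hd1.comp y₀ hd2).clm_comp hd3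
  have hfd := (hd4.congr_of_eventuallyEq (f₁ := oneFormInChart α m)
    (by filter_upwards [hDo.mem_nhds hy₀D] with y hy using hform y hy)).fderiv
  -- The change of chart T contributes its second derivative to the derivative of the pulled-back
  -- form; by symmetry this contribution drops out after antisymmetrization.
  have hsymm : ∀ a b : E, fderiv ℝ (fderiv ℝ T) y₀ a b = fderiv ℝ (fderiv ℝ T) y₀ b a := by
    intro a b
    exact (hTy.isSymmSndFDerivAt (by rw [minSmoothness_of_isRCLikeNormedField]; exact WithTop.coe_le_coe.2 le_top)).eq a b
  have hTD : ∀ v : E, fderiv ℝ T y₀ (chartSymmD c x v) = v := by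
    intro v
    rw [hT, chartD_comp_chartSymmD hy₀D]
    simp only [ContinuousLinearMap.comp_apply, hy₀, chartSymmD_self, extChartAt_to_inv]
    exact chartD_chartSymmD hx v
  unfold dOne
  rw [← hy₀, hfd]
  simp only [ContinuousLinearMap.comp_apply, add_apply, ContinuousLinearMap.compL_apply,
    ContinuousLinearMap.flip_apply, Function.comp_apply]
  rw [hTD, hTD, hsymm (chartSymmD c x u)]
  ring

/-- At a critical point the second derivative in any chart is the Hessian form, transported by the
chart. -/
theorem fderiv_fderiv_chart_of_critical {f : M → ℝ} {c m : M} (hm : m ∈ (chartAt E c).source)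
    {U : Set M} (hU : U ∈ 𝓝 m) (hf : ContMDiffOn 𝓘(ℝ, E) 𝓘(ℝ, ℝ) ∞ f U)
    (hcrit : fderiv ℝ (f ∘ (extChartAt 𝓘(ℝ, E) c).symm) (extChartAt 𝓘(ℝ, E) c m) = 0)
    (u w : E) :
    fderiv ℝ (fderiv ℝ (f ∘ (extChartAt 𝓘(ℝ, E) c).symm)) (extChartAt 𝓘(ℝ, E) c m) u w =
      hessian (E := E) f m (chartSymmD c (extChartAt 𝓘(ℝ, E) c m) u)
        (chartSymmD c (extChartAt 𝓘(ℝ, E) c m) w) := by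
  set x := extChartAt 𝓘(ℝ, E) c m with hxdef
  set T : E → E := (extChartAt 𝓘(ℝ, E) c) ∘ (extChartAt 𝓘(ℝ, E) m).symm with hT
  set y₀ := extChartAt 𝓘(ℝ, E) m m with hy₀
  set D := (extChartAt 𝓘(ℝ, E) m).target ∩
    (extChartAt 𝓘(ℝ, E) m).symm ⁻¹' (chartAt E c).source with hD
  set f' : E → ℝ := f ∘ (extChartAt 𝓘(ℝ, E) c).symm with hf'
  have hx : x ∈ (extChartAt 𝓘(ℝ, E) c).target :=
    (extChartAt 𝓘(ℝ, E) c).map_source (by rw [extChartAt_source]; exact hm)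
  have hxm : (extChartAt 𝓘(ℝ, E) c).symm x = m :=
    (extChartAt 𝓘(ℝ, E) c).left_inv (by rw [extChartAt_source]; exact hm)
  have hDo : IsOpen D := isOpen_transition_domain c m
  have hy₀D : y₀ ∈ D := by
    refine ⟨mem_extChartAt_target m, ?_⟩
    simp only [hy₀, mem_preimage, extChartAt_to_inv]
    exact hm
  have hTy₀ : T y₀ = x := by
    simp only [hT, hy₀, Function.comp_apply, extChartAt_to_inv, hxdef]
  have hTy : ContDiffAt ℝ ∞ T y₀ := (contDiffOn_transition c m).contDiffAt (hDo.mem_nhds hy₀D)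
  have hf'x : ContDiffAt ℝ ∞ f' x := by
    have h1 : ContMDiffAt 𝓘(ℝ, E) 𝓘(ℝ, ℝ) ∞ f ((extChartAt 𝓘(ℝ, E) c).symm x) := by
      rw [hxm]; exact hf.contMDiffAt hU
    exact (h1.comp x ((contMDiffOn_extChartAt_symm (I := 𝓘(ℝ, E)) (n := ∞) c).contMDiffAt
      ((isOpen_chart_target c).mem_nhds hx))).contDiffAt
  have hcomp : f ∘ (extChartAt 𝓘(ℝ, E) m).symm =ᶠ[𝓝 y₀] f' ∘ T := by
    filter_upwards [hDo.mem_nhds hy₀D] with y hy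
    simp only [hf', hT, Function.comp_apply]
    rw [(extChartAt 𝓘(ℝ, E) c).left_inv (by rw [extChartAt_source]; exact hy.2)]
  have hev1 : ∀ᶠ y in 𝓝 y₀, ContDiffAt ℝ ∞ T y := by
    filter_upwards [hDo.mem_nhds hy₀D] with y hy
    exact (contDiffOn_transition c m).contDiffAt (hDo.mem_nhds hy)
  have hev2 : ∀ᶠ y in 𝓝 y₀, DifferentiableAt ℝ f' (T y) := by
    have h1 : ∀ᶠ z in 𝓝 x, ContDiffAt ℝ 1 f' z := (hf'x.of_le (by simp)).eventually (by simp)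
    rw [← hTy₀] at h1
    exact (hTy.continuousAt.eventually h1).mono fun y hy => hy.differentiableAt (by simp)
  have hfd : fderiv ℝ (f ∘ (extChartAt 𝓘(ℝ, E) m).symm) =ᶠ[𝓝 y₀]
      fun y => (fderiv ℝ f' (T y)).comp (fderiv ℝ T y) := by
    filter_upwards [hcomp.eventuallyEq_nhds, hev1, hev2] with y h1 h2 h3
    rw [h1.fderiv_eq, fderiv_comp y h3 (h2.differentiableAt (by simp))]
  have hd1 : HasFDerivAt (fderiv ℝ f') (fderiv ℝ (fderiv ℝ f') x) (T y₀) := by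
    rw [hTy₀]
    exact ((hf'x.fderiv_right (m := ∞) (by simp)).differentiableAt (by simp)).hasFDerivAt
  have hd2 : HasFDerivAt T (fderiv ℝ T y₀) y₀ := (hTy.differentiableAt (by simp)).hasFDerivAt
  have hd3 : HasFDerivAt (fderiv ℝ T) (fderiv ℝ (fderiv ℝ T) y₀) y₀ :=
    ((hTy.fderiv_right (m := ∞) (by simp)).differentiableAt (by simp)).hasFDerivAt
  have hd4 := (hd1.comp y₀ hd2).clm_comp hd3
  have hfd2 := (hd4.congr_of_eventuallyEq hfd).fderiv
  have hTD : ∀ v : E, fderiv ℝ T y₀ (chartSymmD c x v) = v := by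
    intro v
    rw [hT, chartD_comp_chartSymmD hy₀D]
    simp only [ContinuousLinearMap.comp_apply, hy₀, chartSymmD_self, extChartAt_to_inv]
    have := chartD_chartSymmD hx v
    rw [hxm] at this
    exact this
  unfold hessian
  rw [← hy₀, hfd2]
  -- The second derivative of T enters composed with the first derivative of f' at x, which is zero
  -- by `hcrit`; only the transported Hessian is left.
  simp only [ContinuousLinearMap.comp_apply, add_apply, ContinuousLinearMap.compL_apply,
    ContinuousLinearMap.flip_apply, Function.comp_apply, hTy₀, hcrit]
  rw [hTD, hTD]
  simp

end ChartCalculus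

/-! ### Formal solutions of the transport equation -/

section Transport

variable {E : Type*} [NormedAddCommGroup E] [NormedSpace ℝ E] [FiniteDimensional ℝ E]
  {M : Type*} [TopologicalSpace M] [ChartedSpace E M] [IsManifold 𝓘(ℝ, E) ∞ M]

theorem contMDiff_of_chart {f : ℝ × M → ℝ}
    (hf : ∀ c : M, ContDiffOn ℝ ∞ (fun p : ℝ × E => f (p.1, (extChartAt 𝓘(ℝ, E) c).symm p.2))
      (univ ×ˢ (extChartAt 𝓘(ℝ, E) c).target)) :
    ContMDiff (𝓘(ℝ, ℝ).prod 𝓘(ℝ, E)) 𝓘(ℝ, ℝ) ∞ f := by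
  rintro ⟨θ, c⟩
  have h1 : ContMDiffAt (𝓘(ℝ, ℝ).prod 𝓘(ℝ, E)) 𝓘(ℝ, ℝ × E) ∞
      (fun p : ℝ × M => (p.1, extChartAt 𝓘(ℝ, E) c p.2)) (θ, c) := by
    have h2 : ContMDiffAt 𝓘(ℝ, E) 𝓘(ℝ, E) ∞ (extChartAt 𝓘(ℝ, E) c) c := contMDiffAt_extChartAt
    exact contMDiffAt_fst.prodMk_space (h2.comp (θ, c) contMDiffAt_snd)
  have h3 : ContMDiffAt 𝓘(ℝ, ℝ × E) 𝓘(ℝ, ℝ) ∞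
      (fun p : ℝ × E => f (p.1, (extChartAt 𝓘(ℝ, E) c).symm p.2))
      (θ, extChartAt 𝓘(ℝ, E) c c) :=
    ((hf c).contDiffAt ((isOpen_univ.prod (isOpen_chart_target c)).mem_nhds
      ⟨mem_univ _, mem_extChartAt_target c⟩)).contMDiffAt
  refine (h3.comp (θ, c) h1).congr_of_eventuallyEq ?_
  have : {p : ℝ × M | p.2 ∈ (extChartAt 𝓘(ℝ, E) c).source} ∈ 𝓝 (θ, c) :=
    continuous_snd.continuousAt.preimage_mem_nhds (extChartAt_source_mem_nhds c)
  filter_upwards [this] with p hp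
  simp only [Function.comp_apply]
  rw [(extChartAt 𝓘(ℝ, E) c).left_inv hp]

theorem contDiffOn_chart_of_contMDiff {f : ℝ × M → ℝ}
    (hf : ContMDiff (𝓘(ℝ, ℝ).prod 𝓘(ℝ, E)) 𝓘(ℝ, ℝ) ∞ f) (c : M) :
    ContDiffOn ℝ ∞ (fun p : ℝ × E => f (p.1, (extChartAt 𝓘(ℝ, E) c).symm p.2))
      (univ ×ˢ (extChartAt 𝓘(ℝ, E) c).target) := by
  simpa using contDiffOn_function_chart (s := univ) (U := univ) c hf.contMDiffOn

theorem contMDiff_slice {f : ℝ × M → ℝ}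
    (hf : ContMDiff (𝓘(ℝ, ℝ).prod 𝓘(ℝ, E)) 𝓘(ℝ, ℝ) ∞ f) (θ : ℝ) :
    ContMDiff 𝓘(ℝ, E) 𝓘(ℝ, ℝ) ∞ (fun m => f (θ, m)) :=
  hf.comp (contMDiff_const.prodMk contMDiff_id)

theorem dFun_eq_fderiv_chart {f : M → ℝ} (hf : ContMDiff 𝓘(ℝ, E) 𝓘(ℝ, ℝ) ∞ f)
    (V : (m : M) → TangentSpace 𝓘(ℝ, E) m) {c : M} {x : E}
    (hx : x ∈ (extChartAt 𝓘(ℝ, E) c).target) :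
    dFun f ((extChartAt 𝓘(ℝ, E) c).symm x) (V ((extChartAt 𝓘(ℝ, E) c).symm x)) =
      fderiv ℝ (f ∘ (extChartAt 𝓘(ℝ, E) c).symm) x (vectorInChart V c x) := by
  rw [← dFun_chartSymmD hx (hf.mdifferentiableAt (by simp))]
  exact congrArg (fun v : E => dFun f ((extChartAt 𝓘(ℝ, E) c).symm x) v)
    (chartSymmD_chartD hx (V ((extChartAt 𝓘(ℝ, E) c).symm x))).symm

theorem contMDiff_dFun_vectorField {f : ℝ × M → ℝ}
    (hf : ContMDiff (𝓘(ℝ, ℝ).prod 𝓘(ℝ, E)) 𝓘(ℝ, ℝ) ∞ f)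
    {V : (m : M) → TangentSpace 𝓘(ℝ, E) m} (hV : SmoothVectorField V) :
    ContMDiff (𝓘(ℝ, ℝ).prod 𝓘(ℝ, E)) 𝓘(ℝ, ℝ) ∞
      (fun p : ℝ × M => dFun (fun m => f (p.1, m)) p.2 (V p.2)) := by
  refine contMDiff_of_chart fun c => ?_
  have h1 := contDiffOn_chart_of_contMDiff hf c
  have hopen : IsOpen (univ ×ˢ (extChartAt 𝓘(ℝ, E) c).target : Set (ℝ × E)) :=
    isOpen_univ.prod (isOpen_chart_target c)
  have h2 := (h1.fderiv_of_isOpen (m := ∞) hopen (by simp)).clm_apply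
    (contDiffOn_const (c := (0 : ℝ)).prodMk ((contDiffOn_vectorField_chart hV c).comp
      (contDiffOn_snd (s := univ ×ˢ (extChartAt 𝓘(ℝ, E) c).target)) fun p hp => hp.2))
  refine h2.congr fun p hp => ?_
  rw [dFun_eq_fderiv_chart (contMDiff_slice hf p.1) V hp.2]
  have h3 := hasFDerivAt_slice (σ := p.1) (p := p.2)
    ((h1.contDiffAt (hopen.mem_nhds hp)).differentiableAt (by simp))
  have h4 : fderiv ℝ ((fun m => f (p.1, m)) ∘ (extChartAt 𝓘(ℝ, E) c).symm) p.2 = _ := h3.fderiv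
  rw [h4]
  simp

theorem contMDiff_integral {h : ℝ × (ℝ × M) → ℝ}
    (hh : ContMDiff (𝓘(ℝ, ℝ).prod (𝓘(ℝ, ℝ).prod 𝓘(ℝ, E))) 𝓘(ℝ, ℝ) ∞ h) :
    ContMDiff (𝓘(ℝ, ℝ).prod 𝓘(ℝ, E)) 𝓘(ℝ, ℝ) ∞
      (fun p : ℝ × M => ∫ σ in (0 : ℝ)..1, h (σ, p)) := by
  refine contMDiff_of_chart fun c => ?_
  have hopen : IsOpen (univ ×ˢ (extChartAt 𝓘(ℝ, E) c).target : Set (ℝ × E)) :=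
    isOpen_univ.prod (isOpen_chart_target c)
  refine contDiffOn_parametric_integral
    (f := fun w : ℝ × (ℝ × E) => h (w.1, (w.2.1, (extChartAt 𝓘(ℝ, E) c).symm w.2.2)))
    (W := univ ×ˢ (univ ×ˢ (extChartAt 𝓘(ℝ, E) c).target)) (isOpen_univ.prod hopen) hopen
    (fun σ _ p hp => ⟨mem_univ _, hp⟩) ?_
  have h1 : ContMDiffOn 𝓘(ℝ, ℝ × (ℝ × E)) (𝓘(ℝ, ℝ).prod (𝓘(ℝ, ℝ).prod 𝓘(ℝ, E))) ∞
      (fun w : ℝ × (ℝ × E) => (w.1, (w.2.1, (extChartAt 𝓘(ℝ, E) c).symm w.2.2)))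
      (univ ×ˢ (univ ×ˢ (extChartAt 𝓘(ℝ, E) c).target)) :=
    (contDiff_fst.contMDiff.contMDiffOn).prodMk
      ((contMDiffOn_prod_chart_symm c).comp contDiff_snd.contMDiff.contMDiffOn fun _ hp => hp.2)
  exact (hh.comp_contMDiffOn h1).contDiffOn

variable {R₀ : (m : M) → TangentSpace 𝓘(ℝ, E) m} {Φ : ℝ → M → M}

/-- `Φ` is a smooth flow with generator `R₀`. -/
structure IsSmoothFlow (R₀ : (m : M) → TangentSpace 𝓘(ℝ, E) m) (Φ : ℝ → M → M) : Prop where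
  smooth : ContMDiff (𝓘(ℝ, ℝ).prod 𝓘(ℝ, E)) 𝓘(ℝ, E) ∞ (fun p : ℝ × M => Φ p.1 p.2)
  zero : ∀ m, Φ 0 m = m
  add : ∀ a b m, Φ (a + b) m = Φ a (Φ b m)
  integral : ∀ m, IsMIntegralCurve (I := 𝓘(ℝ, E)) (fun θ => Φ θ m) R₀

theorem IsSmoothFlow.contMDiff_comp {N : Type*} {H : Type*} {E' : Type*}
    [NormedAddCommGroup E'] [NormedSpace ℝ E'] [TopologicalSpace H]
    {I : ModelWithCorners ℝ E' H} [TopologicalSpace N] [ChartedSpace H N]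
    (hΦ : IsSmoothFlow R₀ Φ) {a : N → ℝ} {b : N → M}
    (ha : ContMDiff I 𝓘(ℝ, ℝ) ∞ a) (hb : ContMDiff I 𝓘(ℝ, E) ∞ b) :
    ContMDiff I 𝓘(ℝ, E) ∞ (fun p => Φ (a p) (b p)) :=
  hΦ.smooth.comp (ha.prodMk hb)

theorem hasDerivAt_comp_integralCurve {w : M → ℝ} {z : ℝ → M}
    {V : (m : M) → TangentSpace 𝓘(ℝ, E) m} (hz : IsMIntegralCurve (I := 𝓘(ℝ, E)) z V) {τ : ℝ}
    (hw : MDifferentiableAt 𝓘(ℝ, E) 𝓘(ℝ, ℝ) w (z τ)) :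
    HasDerivAt (fun τ => w (z τ)) (dFun w (z τ) (V (z τ))) τ := by
  have key : ∀ (L : E →L[ℝ] ℝ) (v : E),
      HasFDerivAt (fun τ => w (z τ)) (L.comp ((1 : ℝ →L[ℝ] ℝ).smulRight v)) τ →
      HasDerivAt (fun τ => w (z τ)) (L v) τ := by
    intro L v h
    exact h.hasDerivAt.congr_deriv (by simp)
  exact key _ _ (hw.hasMFDerivAt.comp τ (hz τ)).hasFDerivAt

/-- Along a flow, the derivative of a pulled back function. -/
theorem IsSmoothFlow.hasDerivAt_pullback (hΦ : IsSmoothFlow R₀ Φ) {w : M → ℝ}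
    (hw : ContMDiff 𝓘(ℝ, E) 𝓘(ℝ, ℝ) ∞ w) (θ : ℝ) (m : M) :
    HasDerivAt (fun τ => w (Φ τ m)) (dFun (fun x => w (Φ θ x)) m (R₀ m)) θ := by
  have hwθ : ContMDiff 𝓘(ℝ, E) 𝓘(ℝ, ℝ) ∞ (fun x => w (Φ θ x)) :=
    hw.comp (hΦ.contMDiff_comp contMDiff_const contMDiff_id)
  -- Splitting Φ_{θ+τ} as Φ_θ ∘ Φ_τ puts the derivative on w ∘ Φ_θ at m itself. This is the form in
  -- which the transport equation is stated, as opposed to dw at Φ_θ m.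
  have h1 : HasDerivAt (fun τ => w (Φ θ (Φ τ m)))
      (dFun (fun x => w (Φ θ x)) (Φ 0 m) (R₀ (Φ 0 m))) 0 :=
    hasDerivAt_comp_integralCurve (hΦ.integral m) (τ := 0) (hwθ.mdifferentiableAt (by simp))
  rw [hΦ.zero] at h1
  have h2 : (fun τ => w (Φ θ (Φ τ m))) = fun τ => w (Φ (θ + τ) m) := by
    funext τ; rw [hΦ.add]
  rw [h2] at h1
  have h3 := h1.scomp_of_eq θ ((hasDerivAt_id θ).sub_const θ) (by simp)
  simpa [Function.comp_def] using h3

/-- Duhamel's formula for the inhomogeneous transport equation. -/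
theorem IsSmoothFlow.duhamel (hΦ : IsSmoothFlow R₀ Φ) {g : ℝ × M → ℝ}
    (hg : ContMDiff (𝓘(ℝ, ℝ).prod 𝓘(ℝ, E)) 𝓘(ℝ, ℝ) ∞ g) :
    ContMDiff (𝓘(ℝ, ℝ).prod 𝓘(ℝ, E)) 𝓘(ℝ, ℝ) ∞
        (fun p : ℝ × M => ∫ s in (0 : ℝ)..p.1, g (s, Φ (p.1 - s) p.2)) ∧
      ∀ θ m, HasDerivAt (fun τ => ∫ s in (0 : ℝ)..τ, g (s, Φ (τ - s) m))
        (g (θ, m) + dFun (fun x => ∫ s in (0 : ℝ)..θ, g (s, Φ (θ - s) x)) m (R₀ m)) θ := by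
  -- By the group law the Duhamel integral equals G(θ, Φ_θ m), with an integrand that no longer
  -- contains θ. Differentiating along the diagonal then separates the source term from the
  -- transport term.
  set G : ℝ × M → ℝ := fun p => ∫ s in (0 : ℝ)..p.1, g (s, Φ (-s) p.2) with hG
  have hGs : ContMDiff (𝓘(ℝ, ℝ).prod 𝓘(ℝ, E)) 𝓘(ℝ, ℝ) ∞ G := by
    -- The substitution s = θσ moves the variable endpoint into the integrand, so that the
    -- smoothness of integrals over the fixed interval [0, 1] applies.
    have h1 : G = fun p : ℝ × M => p.1 * ∫ σ in (0 : ℝ)..1, g (p.1 * σ, Φ (-(p.1 * σ)) p.2) := by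
      funext p
      have := intervalIntegral.smul_integral_comp_mul_left (a := 0) (b := 1)
        (fun s => g (s, Φ (-s) p.2)) p.1
      simp only [mul_zero, mul_one, smul_eq_mul] at this
      rw [hG, this]
    rw [h1]
    have hmul : ContMDiff (𝓘(ℝ, ℝ).prod (𝓘(ℝ, ℝ).prod 𝓘(ℝ, E))) 𝓘(ℝ, ℝ) ∞
        (fun w : ℝ × (ℝ × M) => w.2.1 * w.1) :=
      (contMDiff_fst.comp contMDiff_snd).mul contMDiff_fst
    exact contMDiff_fst.mul (contMDiff_integral
      (h := fun w => g (w.2.1 * w.1, Φ (-(w.2.1 * w.1)) w.2.2))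
      (hg.comp (hmul.prodMk (hΦ.contMDiff_comp hmul.neg (contMDiff_snd.comp contMDiff_snd)))))
  have hrep : ∀ θ m, (∫ s in (0 : ℝ)..θ, g (s, Φ (θ - s) m)) = G (θ, Φ θ m) := by
    intro θ m
    simp only [hG]
    refine intervalIntegral.integral_congr fun s _ => ?_
    rw [← hΦ.add]
    ring_nf
  have hGflow : ContMDiff (𝓘(ℝ, ℝ).prod 𝓘(ℝ, E)) 𝓘(ℝ, ℝ) ∞
      (fun p : ℝ × M => G (p.1, Φ p.1 p.2)) := hGs.comp (contMDiff_fst.prodMk hΦ.smooth)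
  refine ⟨hGflow.congr fun p => hrep p.1 p.2, fun θ m => ?_⟩
  simp only [hrep]
  have hK : ContDiff ℝ ∞ (fun q : ℝ × ℝ => G (q.1, Φ q.2 m)) := by
    have h1 : ContMDiff 𝓘(ℝ, ℝ × ℝ) (𝓘(ℝ, ℝ).prod 𝓘(ℝ, E)) ∞
        (fun q : ℝ × ℝ => (q.1, Φ q.2 m)) :=
      (contDiff_fst.contMDiff).prodMk
        (hΦ.contMDiff_comp contDiff_snd.contMDiff contMDiff_const)
    exact (hGs.comp h1).contDiff
  have hKd := (hK.differentiable (by simp) (θ, θ)).hasFDerivAt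
  have hdiag := HasFDerivAt.comp_hasDerivAt (f := fun τ : ℝ => (τ, τ)) θ hKd
    ((hasDerivAt_id θ).prodMk (hasDerivAt_id θ))
  have hleft := HasFDerivAt.comp_hasDerivAt (f := fun τ : ℝ => (τ, θ)) θ hKd
    ((hasDerivAt_id θ).prodMk (hasDerivAt_const θ θ))
  have hright := HasFDerivAt.comp_hasDerivAt (f := fun τ : ℝ => (θ, τ)) θ hKd
    ((hasDerivAt_const θ θ).prodMk (hasDerivAt_id θ))
  have hleft' : HasDerivAt (fun τ => G (τ, Φ θ m)) (g (θ, m)) θ := by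
    have hc : Continuous fun s : ℝ => g (s, Φ (-s) (Φ θ m)) :=
      hg.continuous.comp (continuous_id.prodMk
        (hΦ.smooth.continuous.comp (continuous_neg.prodMk continuous_const)))
    have := intervalIntegral.integral_hasDerivAt_right (hc.intervalIntegrable 0 θ)
      (hc.stronglyMeasurableAtFilter _ _) hc.continuousAt
    refine this.congr_deriv ?_
    rw [← hΦ.add, neg_add_cancel, hΦ.zero]
  have hright' : HasDerivAt (fun τ => G (θ, Φ τ m))
      (dFun (fun x => G (θ, Φ θ x)) m (R₀ m)) θ :=
    hΦ.hasDerivAt_pullback (contMDiff_slice hGs θ) θ m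
  have e1 := hleft.unique hleft'
  have e2 := hright.unique hright'
  refine hdiag.congr_deriv ?_
  rw [← e1, ← e2, ← map_add]
  simp

/-- The coefficients of the formal solution of the transport equation with initial value `f`. -/
def transportCoeff (Φ : ℝ → M → M) (R : ℕ → (m : M) → TangentSpace 𝓘(ℝ, E) m) (f : M → ℝ) :
    ℕ → ℝ → M → ℝ
  | n => fun θ m => (if n = 0 then f (Φ θ m) else 0) +
      ∫ s in (0 : ℝ)..θ, ∑ q : Fin n, dFun (transportCoeff Φ R f q.1 s) (Φ (θ - s) m)
        (R (n - q.1) (Φ (θ - s) m))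
  termination_by n => n
  decreasing_by exact q.2

/-- The condition `FormalExpTwoPiIsOne` only speaks about given solutions, so solutions have to be
produced before it yields anything. At order n the equation is transport along R₀ with a source
built from lower orders, which Duhamel's formula solves along the flow of R₀. -/
theorem exists_formal_transport (hΦ : IsSmoothFlow R₀ Φ)
    {R : ℕ → (m : M) → TangentSpace 𝓘(ℝ, E) m} (hR : ∀ n, SmoothVectorField (R n))
    (hR0 : R 0 = R₀) {f : M → ℝ} (hf : ContMDiff 𝓘(ℝ, E) 𝓘(ℝ, ℝ) ∞ f) :
    ∃ F : ℝ → ℕ → M → ℝ,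
      (∀ n, ContMDiff (𝓘(ℝ, ℝ).prod 𝓘(ℝ, E)) 𝓘(ℝ, ℝ) ∞ (fun p : ℝ × M => F p.1 n p.2)) ∧
      (∀ θ n m, HasDerivAt (fun τ => F τ n m)
        (∑ p ∈ Finset.HasAntidiagonal.antidiagonal n, dFun (F θ p.2) m (R p.1 m)) θ) ∧
      (∀ m, F 0 0 m = f m) ∧ ∀ n, n ≠ 0 → ∀ m, F 0 n m = 0 := by
  have hfΦ : ContMDiff (𝓘(ℝ, ℝ).prod 𝓘(ℝ, E)) 𝓘(ℝ, ℝ) ∞ (fun p : ℝ × M => f (Φ p.1 p.2)) :=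
    hf.comp hΦ.smooth
  have hrec : ∀ n θ m, transportCoeff Φ R f n θ m = (if n = 0 then f (Φ θ m) else 0) +
      ∫ s in (0 : ℝ)..θ, ∑ q : Fin n, dFun (transportCoeff Φ R f q.1 s) (Φ (θ - s) m)
        (R (n - q.1) (Φ (θ - s) m)) := by
    intro n θ m
    rw [transportCoeff]
  have hsrc : ∀ n, (∀ q < n, ContMDiff (𝓘(ℝ, ℝ).prod 𝓘(ℝ, E)) 𝓘(ℝ, ℝ) ∞
      (fun p : ℝ × M => transportCoeff Φ R f q p.1 p.2)) →
      ContMDiff (𝓘(ℝ, ℝ).prod 𝓘(ℝ, E)) 𝓘(ℝ, ℝ) ∞ (fun p : ℝ × M =>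
        ∑ q : Fin n, dFun (transportCoeff Φ R f q.1 p.1) p.2 (R (n - q.1) p.2)) := by
    intro n ih
    exact contMDiff_finsetSum fun q _ => contMDiff_dFun_vectorField (ih q.1 q.2) (hR _)
  have hhom : ∀ n : ℕ, ContMDiff (𝓘(ℝ, ℝ).prod 𝓘(ℝ, E)) 𝓘(ℝ, ℝ) ∞
      (fun p : ℝ × M => if n = 0 then f (Φ p.1 p.2) else 0) := by
    intro n
    by_cases hn : n = 0
    · simpa [hn] using hfΦ
    · simpa [hn] using contMDiff_const
  have hsm : ∀ n, ContMDiff (𝓘(ℝ, ℝ).prod 𝓘(ℝ, E)) 𝓘(ℝ, ℝ) ∞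
      (fun p : ℝ × M => transportCoeff Φ R f n p.1 p.2) := by
    intro n
    induction n using Nat.strong_induction_on with
    | _ n ih =>
      simp only [hrec n]
      exact (hhom n).add (hΦ.duhamel (hsrc n ih)).1
  refine ⟨fun θ n m => transportCoeff Φ R f n θ m, hsm, ?_, ?_, ?_⟩
  · intro θ n m
    have hd := (hΦ.duhamel (hsrc n fun q _ => hsm q)).2 θ m
    have hs := (hΦ.duhamel (hsrc n fun q _ => hsm q)).1
    have hh : HasDerivAt (fun τ => if n = 0 then f (Φ τ m) else 0)
        (dFun (fun x => if n = 0 then f (Φ θ x) else 0) m (R₀ m)) θ := by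
      by_cases hn : n = 0
      · simpa [hn] using hΦ.hasDerivAt_pullback hf θ m
      · simp only [hn, if_false]
        refine (hasDerivAt_const θ (0 : ℝ)).congr_deriv ?_
        simp only [dFun, mfderiv_const]
        rfl
    have htot := hh.add hd
    have hfun : (fun τ => transportCoeff Φ R f n τ m) =
        (fun τ => if n = 0 then f (Φ τ m) else 0) + fun τ => ∫ s in (0 : ℝ)..τ,
          ∑ q : Fin n, dFun (transportCoeff Φ R f q.1 s) (Φ (τ - s) m)
            (R (n - q.1) (Φ (τ - s) m)) := by
      funext τ; exact hrec n τ m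
    simp only
    rw [hfun]
    refine htot.congr_deriv ?_
    -- The summand with index 0 for R is the transport term L_{R₀}; the other summands only involve
    -- coefficients of order below n and form the source.
    rw [Finset.Nat.sum_antidiagonal_eq_sum_range_succ_mk, Finset.sum_range_succ', hR0]
    simp only [Nat.sub_zero]
    have hadd : dFun (fun m => transportCoeff Φ R f n θ m) m (R₀ m) =
        dFun (fun x => if n = 0 then f (Φ θ x) else 0) m (R₀ m) +
        dFun (fun x => ∫ s in (0 : ℝ)..θ, ∑ q : Fin n,
          dFun (transportCoeff Φ R f q.1 s) (Φ (θ - s) x) (R (n - q.1) (Φ (θ - s) x))) m (R₀ m) := by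
      have h1 := ((contMDiff_slice (hhom n) θ).mdifferentiableAt (x := m) (by simp)).hasMFDerivAt
      have h2 := ((contMDiff_slice hs θ).mdifferentiableAt (x := m) (by simp)).hasMFDerivAt
      have h3 := (h1.add h2).mfderiv
      have hfun2 : (fun m => transportCoeff Φ R f n θ m) =
          (fun m => if n = 0 then f (Φ θ m) else 0) + fun x => ∫ s in (0 : ℝ)..θ,
          ∑ q : Fin n, dFun (transportCoeff Φ R f q.1 s) (Φ (θ - s) x)
            (R (n - q.1) (Φ (θ - s) x)) := by
        funext x; exact hrec n θ x
      unfold dFun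
      rw [hfun2]
      exact congrArg (fun L : E →L[ℝ] ℝ => L (R₀ m)) h3
    have hsum : ∑ q : Fin n, dFun (transportCoeff Φ R f q.1 θ) m (R (n - q.1) m) =
        ∑ k ∈ Finset.range n, dFun (fun m => transportCoeff Φ R f (n - (k + 1)) θ m) m
          (R (k + 1) m) := by
      rw [← Finset.sum_range_reflect, Finset.sum_range]
      refine Finset.sum_congr rfl fun q _ => ?_
      have h1 : n - (n - 1 - q.1 + 1) = q.1 := by have := q.2; omega
      have h2 : n - 1 - q.1 + 1 = n - q.1 := by have := q.2; omega
      rw [h1, h2]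
    rw [hadd, hsum]
    ring
  · intro m
    simp only
    rw [hrec]
    simp [hΦ.zero]
  · intro n hn m
    simp only
    rw [hrec]
    simp [hn]

end Transport

/-! ### Approximate zeros of a vector field with an averaging map -/

section NearZero

variable {E : Type*} [NormedAddCommGroup E] [NormedSpace ℝ E]

theorem hasFDerivAt_clm_apply_of_eq_zero {F : Type*} [NormedAddCommGroup F] [NormedSpace ℝ F]
    {L : E → F →L[ℝ] F} {v : E → F} {v' : E →L[ℝ] F} {c : E} (hL : DifferentiableAt ℝ L c)
    (hv : HasFDerivAt v v' c) (h0 : v c = 0) :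
    HasFDerivAt (fun x => L x (v x)) ((L c).comp v') c := by
  refine (hL.hasFDerivAt.clm_apply hv).congr_fderiv ?_
  ext w
  simp [h0]

variable [FiniteDimensional ℝ E]

/-- If `P = 1 - β ∘ A` annihilates the range of `A`, then `P` is a projection and `A + P` is
invertible. -/
theorem projection_of_comp_eq_zero {A P β : E →L[ℝ] E} (hP : ∀ v, P v = v - β (A v))
    (hPA : ∀ v, P (A v) = 0) :
    (∀ v, P (P v) = P v) ∧ Function.Injective (A + P) := by
  have hker : ∀ v, A v = 0 → P v = v := fun v hv => by rw [hP, hv]; simp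
  -- A vector A v in the kernel of A is fixed by P because it lies in the kernel, and killed by P
  -- because it lies in the range, hence it is zero. So E is the direct sum of range and kernel, and
  -- P projects onto the kernel.
  have hdis : Disjoint (LinearMap.range (A : E →ₗ[ℝ] E)) (LinearMap.ker (A : E →ₗ[ℝ] E)) := by
    rw [Submodule.disjoint_def]
    rintro _ ⟨v, rfl⟩ h
    have h1 := hker _ h
    have h2 := hPA v
    rw [← h1]
    exact h2
  have htop := Submodule.eq_top_of_disjoint _ _
    (LinearMap.finrank_range_add_finrank_ker (A : E →ₗ[ℝ] E)).ge hdis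
  have hdec : ∀ v, ∃ a b, A a = 0 ∧ v = A b + a := by
    intro v
    have hv : v ∈ LinearMap.range (A : E →ₗ[ℝ] E) ⊔ LinearMap.ker (A : E →ₗ[ℝ] E) := by
      rw [htop]; trivial
    obtain ⟨_, ⟨b, rfl⟩, a, ha, rfl⟩ := Submodule.mem_sup.1 hv
    exact ⟨a, b, ha, rfl⟩
  constructor
  · intro v
    obtain ⟨a, b, ha, rfl⟩ := hdec v
    simp [hPA, hker a ha]
  · rw [injective_iff_map_eq_zero]
    intro v hv
    obtain ⟨a, b, ha, rfl⟩ := hdec v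
    simp only [add_apply, map_add, ha, hPA, hker a ha, zero_add, add_zero] at hv
    have ha0 : a = 0 := by
      have := congrArg P hv
      simpa [hPA, hker a ha] using this
    rw [ha0, add_zero] at hv ⊢
    rw [← hker _ hv, hPA]

/-- Here A plays the role of the averaging map: it is nearly constant along V and is the identity
modulo V at ε = 0. Its derivative P at (0, c) is the projection onto the kernel of the linearization
A₀ of V along the range of A₀, so V + P is locally invertible and V(x) + P x = P m can be solved
near m. Then V(x) lies in the range of P, while the derivative of A, which is close to P, almost
kills V(x). Both can hold only if V(x) = O(ε^K). -/
theorem exists_near_zero {O : Set E} (hO : IsOpen O) {c : E} (hc : c ∈ O) {K : ℕ} (hK : 1 ≤ K)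
    {V A B : ℝ × E → E} {β : E → E →L[ℝ] E}
    (hV : ContDiffOn ℝ ∞ V (univ ×ˢ O)) (hA : ContDiffOn ℝ ∞ A (univ ×ˢ O))
    (hB : ContinuousOn B (univ ×ˢ O)) (hβ : DifferentiableAt ℝ β c)
    (hAV : ∀ ε, ∀ x ∈ O, fderiv ℝ (fun y => A (ε, y)) x (V (ε, x)) = ε ^ K • B (ε, x))
    (hAβ : ∀ᶠ x in 𝓝 c, A (0, x) = x - β x (V (0, x))) (hV0 : V (0, c) = 0) :
    ∃ ρ > 0, ∃ C > 0, ∀ ε : ℝ, |ε| ≤ ρ → ∀ m ∈ Metric.closedBall c ρ,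
      ∃ m' ∈ O, ‖m' - m‖ ≤ C * ‖V (ε, m)‖ ∧ ‖V (ε, m')‖ ≤ C * |ε| ^ K := by
  have hopen : IsOpen (univ ×ˢ O : Set (ℝ × E)) := isOpen_univ.prod hO
  have h0c : ((0 : ℝ), c) ∈ (univ ×ˢ O : Set (ℝ × E)) := ⟨mem_univ _, hc⟩
  have hVat : ContDiffAt ℝ ∞ V (0, c) := hV.contDiffAt (hopen.mem_nhds h0c)
  have hstrict : HasStrictFDerivAt V (fderiv ℝ V (0, c)) (0, c) :=
    hVat.hasStrictFDerivAt (by simp)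
  set DA : ℝ × E → E →L[ℝ] E := fun p => (fderiv ℝ A p).comp (ContinuousLinearMap.inr ℝ ℝ E)
    with hDA
  have hDAs : ContDiffOn ℝ ∞ DA (univ ×ˢ O) :=
    (hA.fderiv_of_isOpen (m := ∞) hopen (by simp)).clm_comp contDiffOn_const
  have hDAeq : ∀ p ∈ (univ ×ˢ O : Set (ℝ × E)), HasFDerivAt (fun y => A (p.1, y)) (DA p) p.2 :=
    fun p hp => hasFDerivAt_slice (σ := p.1) (p := p.2)
      ((hA.contDiffAt (hopen.mem_nhds hp)).differentiableAt (by simp))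
  set A₀ : E →L[ℝ] E := (fderiv ℝ V (0, c)).comp (ContinuousLinearMap.inr ℝ ℝ E) with hA₀
  have hA₀d : HasFDerivAt (fun y => V (0, y)) A₀ c :=
    hasFDerivAt_slice (hVat.differentiableAt (by simp))
  set P := DA (0, c) with hPdef
  have hP : ∀ v, P v = v - β c (A₀ v) := by
    have h1 : HasFDerivAt (fun x => x - β x (V (0, x)))
        (ContinuousLinearMap.id ℝ E - (β c).comp A₀) c :=
      (hasFDerivAt_id c).sub (hasFDerivAt_clm_apply_of_eq_zero hβ hA₀d hV0)
    have h2 := (hDAeq _ h0c).unique (h1.congr_of_eventuallyEq hAβ)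
    intro v
    rw [hPdef, h2]
    simp
  -- This differentiates DA(0, x) V(0, x) = 0 at c. The term with the second derivative of A drops
  -- out because V(0, c) = 0, and K ≥ 1 is what makes the right-hand side vanish at ε = 0.
  have hPA : ∀ v, P (A₀ v) = 0 := by
    have hd : DifferentiableAt ℝ (fun x => DA (0, x)) c :=
      ((hDAs.contDiffAt (hopen.mem_nhds h0c)).differentiableAt (by simp)).comp c
        (f := fun x => ((0 : ℝ), x)) (by fun_prop)
    have h1 := hasFDerivAt_clm_apply_of_eq_zero hd hA₀d hV0
    have h2 : (fun x => DA (0, x) (V (0, x))) =ᶠ[𝓝 c] fun _ => 0 := by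
      filter_upwards [hO.mem_nhds hc] with x hx
      rw [← (hDAeq (0, x) ⟨mem_univ _, hx⟩).fderiv]
      simp only
      rw [hAV 0 x hx, zero_pow (by omega), zero_smul]
    have h3 := (h1.congr_of_eventuallyEq h2.symm).unique (hasFDerivAt_const (0 : E) c)
    intro v
    exact congrArg (fun L : E →L[ℝ] E => L v) h3
  obtain ⟨hPP, hinj⟩ := projection_of_comp_eq_zero hP hPA
  set e : E ≃L[ℝ] E := (LinearEquiv.ofInjectiveEndo ((A₀ + P : E →L[ℝ] E) : E →ₗ[ℝ] E)
    hinj).toContinuousLinearEquiv with he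
  have heq : ∀ v, e v = A₀ v + P v := fun v => rfl
  -- The added 1 keeps n positive even when E is trivial, so that n⁻¹ is meaningful below.
  set n : NNReal := ‖(e.symm : E →L[ℝ] E)‖₊ + 1 with hn
  have hnpos : 0 < (n : ℝ) := by rw [hn]; positivity
  let finv : (e : E →L[ℝ] E).NonlinearRightInverse :=
    { toFun := e.symm
      nnnorm := n
      bound' := fun y => by
        refine ((e.symm : E →L[ℝ] E).le_opNorm y).trans ?_
        gcongr
        rw [hn]; simp
      right_inv' := fun y => e.apply_symm_apply y }
  obtain ⟨CB, hCB0, hCB⟩ : ∃ CB > 0, ∀ᶠ p in 𝓝 ((0 : ℝ), c), ‖B p‖ ≤ CB := by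
    refine ⟨‖B (0, c)‖ + 1, by positivity, ?_⟩
    exact (hB.continuousAt (hopen.mem_nhds h0c)).norm.eventually_le_const (by simp)
  have hDAc : ∀ᶠ p in 𝓝 ((0 : ℝ), c), ‖P - DA p‖ ≤ 1 / 2 := by
    have h1 : Tendsto (fun p => ‖P - DA p‖) (𝓝 ((0 : ℝ), c)) (𝓝 ‖P - DA (0, c)‖) :=
      (tendsto_const_nhds.sub (hDAs.continuousOn.continuousAt (hopen.mem_nhds h0c))).norm
    exact h1.eventually_le_const (by simp [hPdef])
  -- With κ = 1/(2n), the ball of radius 2n‖V(ε, m)‖ about m is mapped onto a set containing the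
  -- ball of radius (n⁻¹ - κ) · 2n‖V(ε, m)‖ = ‖V(ε, m)‖ about V(ε, m) + P m, hence containing P m.
  set κ : NNReal := n⁻¹ / 2 with hκ
  have hκpos : 0 < (κ : ℝ) := by rw [hκ]; push_cast; positivity
  have happ := hstrict.isLittleO.def hκpos
  rw [nhds_prod_eq] at happ
  obtain ⟨r, hr, hball⟩ : ∃ r > 0, ∀ ε : ℝ, |ε| < r → ∀ x ∈ Metric.ball c r, x ∈ O ∧
      ‖B (ε, x)‖ ≤ CB ∧ ‖P - DA (ε, x)‖ ≤ 1 / 2 ∧ ∀ y ∈ Metric.ball c r,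
        ‖V (ε, x) - V (ε, y) - A₀ (x - y)‖ ≤ κ * ‖x - y‖ := by
    obtain ⟨s, hs, t, ht, hst⟩ := Filter.mem_prod_iff.1 happ
    obtain ⟨r, hr, hb⟩ := Metric.mem_nhds_iff.1
      (Filter.inter_mem (Filter.inter_mem hs ht)
        (Filter.inter_mem (Filter.inter_mem hCB hDAc) (hopen.mem_nhds h0c)))
    refine ⟨r, hr, fun ε hε x hx => ?_⟩
    have hmem : ∀ x ∈ Metric.ball c r, (ε, x) ∈ Metric.ball ((0 : ℝ), c) r := by
      intro x hx
      rw [← ball_prod_same]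
      exact ⟨by simpa [Real.norm_eq_abs] using hε, hx⟩
    obtain ⟨⟨h1, h2⟩, ⟨h3, h4⟩, h5⟩ := hb (hmem x hx)
    refine ⟨h5.2, h3, h4, fun y hy => ?_⟩
    obtain ⟨⟨h6, h7⟩, -⟩ := hb (hmem y hy)
    have h8 := hst (mk_mem_prod h1 h7)
    simp only [mem_ofPred_eq, Prod.mk_sub_mk, sub_self] at h8
    simpa [hA₀, Prod.norm_mk] using h8
  have hVsmall : ∀ᶠ p in 𝓝 ((0 : ℝ), c), 2 * n * ‖V p‖ < r / 2 := by
    have h1 : Tendsto (fun p => 2 * (n : ℝ) * ‖V p‖) (𝓝 ((0 : ℝ), c)) (𝓝 (2 * n * ‖V (0, c)‖)) :=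
      hVat.continuousAt.norm.const_mul _
    exact h1.eventually_lt_const (by simp [hV0, hr])
  obtain ⟨r₁, hr₁, hb₁⟩ := Metric.mem_nhds_iff.1 hVsmall
  set ρ := min (r / 3) (r₁ / 2) with hρ
  have hρpos : 0 < ρ := by positivity
  refine ⟨ρ, hρpos, 2 * n + 2 * CB, by positivity, fun ε hε m hm => ?_⟩
  have hρr : ρ ≤ r / 3 := min_le_left _ _
  have hρr₁ : ρ ≤ r₁ / 2 := min_le_right _ _
  have hεr : |ε| < r := by linarith
  have hVm : 2 * n * ‖V (ε, m)‖ < r / 2 := by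
    refine hb₁ ?_
    rw [← ball_prod_same]
    refine ⟨by simpa [Real.norm_eq_abs] using by linarith, ?_⟩
    rw [Metric.mem_ball]
    have := Metric.mem_closedBall.1 hm
    linarith
  have happrox : ApproximatesLinearOn (fun x => V (ε, x) + P x) (e : E →L[ℝ] E)
      (Metric.ball c r) κ := by
    rw [ApproximatesLinearOn]
    intro x hx y hy
    have h1 := (hball ε hεr x hx).2.2.2 y hy
    refine le_trans (le_of_eq ?_) h1
    congr 1
    simp only [ContinuousLinearEquiv.coe_coe, heq, map_sub]
    abel
  have hsub : Metric.closedBall m (2 * n * ‖V (ε, m)‖) ⊆ Metric.ball c r := by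
    refine Metric.closedBall_subset_ball' ?_
    have := Metric.mem_closedBall.1 hm
    linarith
  have hsurj := happrox.surjOn_closedBall_of_nonlinearRightInverse finv
    (b := m) (by positivity) hsub
  have hnn : (finv.nnnorm : ℝ) = n := rfl
  have hrad : ((finv.nnnorm : ℝ)⁻¹ - κ) * (2 * n * ‖V (ε, m)‖) = ‖V (ε, m)‖ := by
    rw [hnn, hκ]
    push_cast
    field_simp
    ring
  rw [hrad] at hsurj
  obtain ⟨x, hx, hxe⟩ := hsurj (show P m ∈ _ by
    rw [Metric.mem_closedBall, dist_eq_norm]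
    simp)
  have hxb := hball ε hεr x (hsub hx)
  have hVx : V (ε, x) = P (m - x) := by
    simp only at hxe
    rw [map_sub, ← hxe]; abel
  -- Since P V(x) = V(x), the vector V(x) equals (P - DA)V(x) plus ε^K B. The first operator has
  -- norm at most 1/2, so its term is absorbed on the left.
  have hVx2 : ‖V (ε, x)‖ ≤ 2 * CB * |ε| ^ K := by
    have h1 : V (ε, x) = (P - DA (ε, x)) (V (ε, x)) + ε ^ K • B (ε, x) := by
      rw [← hAV ε x hxb.1, (hDAeq (ε, x) ⟨mem_univ _, hxb.1⟩).fderiv]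
      simp only [sub_apply, sub_add_cancel]
      rw [hVx, hPP]
    have h2 : ‖V (ε, x)‖ ≤ 1 / 2 * ‖V (ε, x)‖ + |ε| ^ K * CB := by
      calc ‖V (ε, x)‖ = ‖(P - DA (ε, x)) (V (ε, x)) + ε ^ K • B (ε, x)‖ := by rw [← h1]
        _ ≤ ‖(P - DA (ε, x)) (V (ε, x))‖ + ‖ε ^ K • B (ε, x)‖ := norm_add_le _ _
        _ ≤ 1 / 2 * ‖V (ε, x)‖ + |ε| ^ K * CB := by
          gcongr
          · exact ((P - DA (ε, x)).le_opNorm _).trans (by gcongr; exact hxb.2.2.1)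
          · rw [norm_smul, norm_pow, Real.norm_eq_abs]
            gcongr
            exact hxb.2.1
    linarith
  refine ⟨x, hxb.1, ?_, ?_⟩
  · have h1 := Metric.mem_closedBall.1 hx
    rw [dist_eq_norm] at h1
    refine h1.trans ?_
    gcongr
    linarith
  · refine hVx2.trans ?_
    gcongr
    linarith

/-- Averaging a periodic formal solution of the transport equation. -/
theorem exists_near_zero_of_transport {O : Set E} (hO : IsOpen O) {c : E} (hc : c ∈ O)
    {V : ℕ → E → E} (hV : ∀ n, ContDiffOn ℝ ∞ (V n) O) (hV0 : V 0 c = 0)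
    {F : ℕ → ℝ × E → E} (hF : ∀ n, ContDiffOn ℝ ∞ (F n) (univ ×ˢ O))
    (hder : ∀ n θ, ∀ x ∈ O, HasDerivAt (fun τ => F n (τ, x))
      (∑ p ∈ Finset.HasAntidiagonal.antidiagonal n,
        fderiv ℝ (fun y => F p.2 (θ, y)) x (V p.1 x)) θ)
    (hper : ∀ n, ∀ x ∈ O, F n (2 * Real.pi, x) = F n (0, x))
    (hinit : ∀ᶠ x in 𝓝 c, F 0 (0, x) = x) {K : ℕ} (hK : 1 ≤ K) :
    ∃ ρ > 0, ∃ C > 0, ∀ ε : ℝ, |ε| ≤ ρ → ∀ m ∈ Metric.closedBall c ρ,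
      ∃ m' ∈ O, ‖m' - m‖ ≤ C * ‖truncSum K (fun n => V n m) ε‖ ∧
        ‖truncSum K (fun n => V n m') ε‖ ≤ C * |ε| ^ K := by
  have hopen : IsOpen (univ ×ˢ O : Set (ℝ × E)) := isOpen_univ.prod hO
  set G : ℕ → ℝ × E → E := fun n p => F n (2 * Real.pi * p.1, p.2) with hG
  have hGs : ∀ n, ContDiffOn ℝ ∞ (G n) (univ ×ˢ O) := fun n =>
    (hF n).comp (f := fun p : ℝ × E => (2 * Real.pi * p.1, p.2)) (by fun_prop)
      fun p hp => ⟨mem_univ _, hp.2⟩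
  set DG : ℕ → ℝ × E → E →L[ℝ] E := fun n p =>
    (fderiv ℝ (G n) p).comp (ContinuousLinearMap.inr ℝ ℝ E) with hDG
  have hDGs : ∀ n, ContDiffOn ℝ ∞ (DG n) (univ ×ˢ O) := fun n =>
    ((hGs n).fderiv_of_isOpen (m := ∞) hopen (by simp)).clm_comp contDiffOn_const
  have hDGeq : ∀ n σ, ∀ x ∈ O, fderiv ℝ (fun y => F n (2 * Real.pi * σ, y)) x = DG n (σ, x) :=
    fun n σ x hx => (hasFDerivAt_slice (f := G n) (((hGs n).contDiffAt (hopen.mem_nhds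
      ⟨mem_univ _, hx⟩)).differentiableAt (by simp))).fderiv
  have hGder : ∀ n σ, ∀ x ∈ O, HasDerivAt (fun τ => G n (τ, x))
      ((2 * Real.pi) • ∑ p ∈ Finset.HasAntidiagonal.antidiagonal n, DG p.2 (σ, x) (V p.1 x)) σ := by
    intro n σ x hx
    have h1 := (hder n (2 * Real.pi * σ) x hx).scomp σ
      ((hasDerivAt_id σ).const_mul (2 * Real.pi))
    simp only [hDGeq _ _ x hx, mul_one] at h1
    exact h1
  have hcontσ : ∀ n, ∀ x ∈ O, Continuous fun σ => DG n (σ, x) := fun n x hx =>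
    (hDGs n).continuousOn.comp_continuous (f := fun σ : ℝ => (σ, x)) (by fun_prop)
      fun σ => ⟨mem_univ _, hx⟩
  have hcontG : ∀ n, ∀ x ∈ O, Continuous fun σ => G n (σ, x) := fun n x hx =>
    (hGs n).continuousOn.comp_continuous (f := fun σ : ℝ => (σ, x)) (by fun_prop)
      fun σ => ⟨mem_univ _, hx⟩
  set A : ℕ → E → E := fun n x => ∫ σ in (0 : ℝ)..1, G n (σ, x) with hA
  have hsub : ∀ σ ∈ Icc (0 : ℝ) 1, ∀ p ∈ O, (σ, p) ∈ (univ ×ˢ O : Set (ℝ × E)) :=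
    fun σ _ p hp => ⟨mem_univ _, hp⟩
  have hAs : ∀ n, ContDiffOn ℝ ∞ (A n) O := fun n =>
    contDiffOn_parametric_integral hopen hO hsub (hGs n)
  have hAd : ∀ n, ∀ x ∈ O, HasFDerivAt (A n) (∫ σ in (0 : ℝ)..1, DG n (σ, x)) x := fun n x hx =>
    hasFDerivAt_parametric_integral hopen hO hsub (hGs n) hx
  -- Integrating the transport equation over a full period gives the difference of the end values,
  -- which is zero. Hence the average is formally invariant under V.
  have hzero : ∀ n, ∀ x ∈ O, ∑ p ∈ Finset.HasAntidiagonal.antidiagonal n,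
      fderiv ℝ (A p.2) x (V p.1 x) = 0 := by
    intro n x hx
    have h1 : ∀ p ∈ Finset.HasAntidiagonal.antidiagonal n, fderiv ℝ (A p.2) x (V p.1 x) =
        ∫ σ in (0 : ℝ)..1, DG p.2 (σ, x) (V p.1 x) := by
      intro p _
      rw [(hAd p.2 x hx).fderiv]
      exact ContinuousLinearMap.intervalIntegral_apply
        ((hcontσ p.2 x hx).intervalIntegrable 0 1) _
    rw [Finset.sum_congr rfl h1, ← intervalIntegral.integral_finsetSum (fun p _ =>
      ((hcontσ p.2 x hx).clm_apply continuous_const).intervalIntegrable 0 1)]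
    have h2 : ∫ σ in (0 : ℝ)..1, (2 * Real.pi) • ∑ p ∈ Finset.HasAntidiagonal.antidiagonal n,
        DG p.2 (σ, x) (V p.1 x) = G n (1, x) - G n (0, x) := by
      refine intervalIntegral.integral_eq_sub_of_hasDerivAt (fun σ _ => hGder n σ x hx) ?_
      refine Continuous.intervalIntegrable ?_ 0 1
      exact (continuous_finsetSum _ fun p _ => (hcontσ p.2 x hx).clm_apply
        continuous_const).const_smul _
    have h3 : G n (1, x) - G n (0, x) = 0 := by
      simp only [hG, mul_one, mul_zero]
      rw [hper n x hx, sub_self]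
    rw [h3, intervalIntegral.integral_smul] at h2
    exact (smul_eq_zero.1 h2).resolve_left (by positivity)
  -- Integration by parts of σ ∂_σ G over [0, 1] produces this operator: the leading average differs
  -- from the value G(1, x) = F₀(0, x) by β(x) V₀(x).
  set β : E → E →L[ℝ] E := fun x => ∫ σ in (0 : ℝ)..1, (2 * Real.pi * σ) • DG 0 (σ, x) with hβ
  have hβs : ContDiffOn ℝ ∞ β O := contDiffOn_parametric_integral
    (f := fun p : ℝ × E => (2 * Real.pi * p.1) • DG 0 p) hopen hO hsub
    (ContDiffOn.smul (f := fun p : ℝ × E => 2 * Real.pi * p.1) (by fun_prop) (hDGs 0))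
  have hAβ : ∀ x ∈ O, A 0 x = F 0 (0, x) - β x (V 0 x) := by
    intro x hx
    have h1 : ∀ σ : ℝ, HasDerivAt (fun τ => τ • G 0 (τ, x))
        (σ • ((2 * Real.pi) • DG 0 (σ, x) (V 0 x)) + (1 : ℝ) • G 0 (σ, x)) σ := by
      intro σ
      have := (hasDerivAt_id σ).fun_smul (hGder 0 σ x hx)
      simpa using this
    have hc1 : Continuous fun σ : ℝ => σ • ((2 * Real.pi) • DG 0 (σ, x) (V 0 x)) :=
      continuous_id.smul (((hcontσ 0 x hx).clm_apply continuous_const).const_smul _)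
    have hc2 : Continuous fun σ : ℝ => (1 : ℝ) • G 0 (σ, x) := (hcontG 0 x hx).const_smul _
    have h2 := intervalIntegral.integral_eq_sub_of_hasDerivAt (a := 0) (b := 1)
      (fun σ _ => h1 σ) ((hc1.add hc2).intervalIntegrable 0 1)
    rw [intervalIntegral.integral_add (hc1.intervalIntegrable 0 1)
      (hc2.intervalIntegrable 0 1)] at h2
    have h3 : β x (V 0 x) = ∫ σ in (0 : ℝ)..1, σ • ((2 * Real.pi) • DG 0 (σ, x) (V 0 x)) := by
      rw [hβ]
      have hci : Continuous fun σ : ℝ => (2 * Real.pi * σ) • DG 0 (σ, x) :=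
        (continuous_const.mul continuous_id).smul (hcontσ 0 x hx)
      rw [ContinuousLinearMap.intervalIntegral_apply (hci.intervalIntegrable 0 1)]
      refine intervalIntegral.integral_congr fun σ _ => ?_
      simp only [smul_apply, smul_smul]
      ring_nf
    rw [h3, hA]
    simp only [one_smul, zero_smul, sub_zero] at h2
    have h4 : G 0 (1, x) = F 0 (0, x) := by
      simp only [hG, mul_one]; exact hper 0 x hx
    rw [← h4, ← h2]
    abel
  set L : E →L[ℝ] (E →L[ℝ] E) →L[ℝ] E := (ContinuousLinearMap.id ℝ (E →L[ℝ] E)).flip with hL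
  refine exists_near_zero hO hc hK (V := fun p => truncSum K (fun n => V n p.2) p.1)
    (A := fun p => truncSum K (fun n => A n p.2) p.1)
    (B := fun p => cauchyRemainder L K (fun n => V n p.2) (fun n => fderiv ℝ (A n) p.2) p.1)
    (β := β) ?_ ?_ ?_ ?_ ?_ ?_ ?_
  · exact ContDiffOn.sum fun n _ => ContDiffOn.smul (by fun_prop)
      ((hV n).comp contDiffOn_snd fun p hp => hp.2)
  · exact ContDiffOn.sum fun n _ => ContDiffOn.smul (by fun_prop)
      ((hAs n).comp contDiffOn_snd fun p hp => hp.2)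
  · refine continuousOn_finsetSum _ fun p _ => ContinuousOn.smul (by fun_prop) ?_
    simp only [hL, ContinuousLinearMap.flip_apply, ContinuousLinearMap.coe_id', id]
    exact ContinuousOn.clm_apply
      (((hAs p.2).fderiv_of_isOpen (m := ∞) hO (by simp)).continuousOn.comp continuousOn_snd
        fun q hq => hq.2)
      ((hV p.1).continuousOn.comp continuousOn_snd fun q hq => hq.2)
  · exact (hβs.contDiffAt (hO.mem_nhds hc)).differentiableAt (by simp)
  · intro ε x hx
    have h1 : fderiv ℝ (fun y => truncSum K (fun n => A n y) ε) x =
        truncSum K (fun n => fderiv ℝ (A n) x) ε := by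
      refine HasFDerivAt.fderiv ?_
      exact HasFDerivAt.fun_sum fun n _ => ((hAd n x hx).differentiableAt.hasFDerivAt).const_smul _
    rw [h1]
    have h2 := truncSum_mul L K (fun n => V n x) (fun n => fderiv ℝ (A n) x) ε
    have h3 : truncSum K (fun n => ∑ p ∈ Finset.HasAntidiagonal.antidiagonal n,
        L (V p.1 x) (fderiv ℝ (A p.2) x)) ε = 0 := by
      refine Finset.sum_eq_zero fun n _ => ?_
      have := hzero n x hx
      simp only [hL, ContinuousLinearMap.flip_apply, ContinuousLinearMap.coe_id', id]
      rw [this, smul_zero]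
    rw [h3, zero_add] at h2
    exact h2
  · filter_upwards [hinit, hO.mem_nhds hc] with x hx hxO
    have h0 : ∀ a : ℕ → E, truncSum K a 0 = a 0 := by
      intro a
      obtain ⟨k, rfl⟩ : ∃ k, K = k + 1 := ⟨K - 1, by omega⟩
      simp [truncSum, Finset.sum_range_succ']
    simp only [h0]
    rw [hAβ x hxO, hx]
  · have h0 : ∀ a : ℕ → E, truncSum K a 0 = a 0 := by
      intro a
      obtain ⟨k, rfl⟩ : ∃ k, K = k + 1 := ⟨K - 1, by omega⟩
      simp [truncSum, Finset.sum_range_succ']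
    simp only [h0, hV0]

end NearZero

/-! ### Approximate zeros of the roto-rate on the manifold -/

section NearZeroChart

variable {E : Type*} [NormedAddCommGroup E] [NormedSpace ℝ E] [FiniteDimensional ℝ E]
  {M : Type*} [TopologicalSpace M] [ChartedSpace E M] [IsManifold 𝓘(ℝ, E) ∞ M]

theorem vectorInChart_self (V : (m : M) → TangentSpace 𝓘(ℝ, E) m) (c : M) :
    vectorInChart V c (extChartAt 𝓘(ℝ, E) c c) = V c := by
  have h : ∀ m, m = c → chartD (E := E) c m (V m) = V c := by
    rintro _ rfl
    rw [chartD_self]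
    rfl
  exact h _ (extChartAt_to_inv c)

theorem GeneratesCircleAction.exists_isSmoothFlow {R₀ : (m : M) → TangentSpace 𝓘(ℝ, E) m}
    (h : GeneratesCircleAction R₀) : ∃ Φ : ℝ → M → M, IsSmoothFlow R₀ Φ := by
  obtain ⟨Φ, h1, h2, h3, -, h4⟩ := h
  exact ⟨Φ, h1, h2, h3, h4⟩

/-- Near a zero of the limiting roto-rate, a point at which the truncated roto-rate is small is
close to a point at which it vanishes up to the order of the truncation. -/
theorem exists_near_zero_chart [T2Space M] {R₀ : (m : M) → TangentSpace 𝓘(ℝ, E) m}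
    (hcirc : GeneratesCircleAction R₀) {R : ℕ → (m : M) → TangentSpace 𝓘(ℝ, E) m}
    (hR : ∀ n, SmoothVectorField (R n)) (hR0 : R 0 = R₀) (hper : FormalExpTwoPiIsOne R)
    {c : M} (hc : R₀ c = 0) {K : ℕ} (hK : 1 ≤ K) :
    ∃ ρ > 0, ∃ C > 0, ∀ ε : ℝ, |ε| ≤ ρ → ∀ m ∈ Metric.closedBall (extChartAt 𝓘(ℝ, E) c c) ρ,
      ∃ m' ∈ (extChartAt 𝓘(ℝ, E) c).target,
        ‖m' - m‖ ≤ C * ‖truncSum K (fun n => vectorInChart (R n) c m) ε‖ ∧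
        ‖truncSum K (fun n => vectorInChart (R n) c m') ε‖ ≤ C * |ε| ^ K := by
  obtain ⟨Φ, hΦ⟩ := hcirc.exists_isSmoothFlow
  set b := Module.finBasis ℝ E
  obtain ⟨χ⟩ : Nonempty (SmoothBumpFunction 𝓘(ℝ, E) c) := inferInstance
  set ℓ : Fin (Module.finrank ℝ E) → E →L[ℝ] ℝ := fun i => (b.coord i).toContinuousLinearMap
  -- Periodicity of the formal action concerns functions on all of M, so the coordinates are cut off
  -- by a bump function. They are unchanged near c, which is all that the averaging argument needs.
  have hf : ∀ i, ContMDiff 𝓘(ℝ, E) 𝓘(ℝ, ℝ) ∞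
      (fun m => χ m • ℓ i (extChartAt 𝓘(ℝ, E) c m)) := fun i =>
    χ.contMDiff_smul (((ℓ i).contDiff.contMDiff (n := ∞)).comp_contMDiffOn
      (contMDiffOn_extChartAt (I := 𝓘(ℝ, E)) (x := c)))
  choose F hFs hFd hF0 hFn using fun i => exists_formal_transport hΦ hR hR0 (hf i)
  have hFper := fun i => hper (F i) (hFs i) (hFd i)
  have hFc : ∀ i n, ContDiffOn ℝ ∞ (fun p : ℝ × E => F i p.1 n ((extChartAt 𝓘(ℝ, E) c).symm p.2))
      (univ ×ˢ (extChartAt 𝓘(ℝ, E) c).target) := fun i n => contDiffOn_chart_of_contMDiff (hFs i n) c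
  have hopen : IsOpen (univ ×ˢ (extChartAt 𝓘(ℝ, E) c).target : Set (ℝ × E)) :=
    isOpen_univ.prod (isOpen_chart_target c)
  refine exists_near_zero_of_transport (isOpen_chart_target c) (mem_extChartAt_target c)
    (V := fun n => vectorInChart (R n) c) (fun n => contDiffOn_vectorField_chart (hR n) c) ?_
    (F := fun n p => ∑ i, F i p.1 n ((extChartAt 𝓘(ℝ, E) c).symm p.2) • b i) ?_ ?_ ?_ ?_ hK
  · rw [vectorInChart_self, hR0, hc]
    rfl
  · exact fun n => ContDiffOn.sum fun i _ => (hFc i n).smul contDiffOn_const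
  · intro n θ x hx
    have h1 := HasDerivAt.fun_sum (u := Finset.univ) fun i _ =>
      (hFd i θ n ((extChartAt 𝓘(ℝ, E) c).symm x)).smul_const (b i)
    refine h1.congr_deriv ?_
    simp only [Finset.sum_smul]
    rw [Finset.sum_comm]
    refine Finset.sum_congr rfl fun p _ => ?_
    have hd : ∀ i, HasFDerivAt (fun y => F i θ p.2 ((extChartAt 𝓘(ℝ, E) c).symm y))
        (fderiv ℝ (F i θ p.2 ∘ (extChartAt 𝓘(ℝ, E) c).symm) x) x := by
      intro i
      refine DifferentiableAt.hasFDerivAt (f := F i θ p.2 ∘ (extChartAt 𝓘(ℝ, E) c).symm) ?_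
      exact (hasFDerivAt_slice (((hFc i p.2).contDiffAt (hopen.mem_nhds
        (x := (θ, x)) ⟨mem_univ _, hx⟩)).differentiableAt (by simp))).differentiableAt
    have h2 := HasFDerivAt.fun_sum (u := Finset.univ) fun i _ => (hd i).smul_const (b i)
    rw [h2.fderiv]
    simp only [sum_apply, ContinuousLinearMap.smulRight_apply]
    refine Finset.sum_congr rfl fun i _ => ?_
    rw [dFun_eq_fderiv_chart (contMDiff_slice (hFs i p.2) θ) (R p.1) hx]
  · intro n x _
    simp only [hFper]
  · have h1 : ∀ᶠ x in 𝓝 (extChartAt 𝓘(ℝ, E) c c), χ ((extChartAt 𝓘(ℝ, E) c).symm x) = 1 := by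
      have h2 := continuousAt_extChartAt_symm (I := 𝓘(ℝ, E)) c
      have h3 := χ.eventuallyEq_one
      rw [ContinuousAt, extChartAt_to_inv] at h2
      exact h2.eventually h3
    filter_upwards [h1, (isOpen_chart_target c).mem_nhds (mem_extChartAt_target c)] with x hx hxt
    simp only [hF0, hx, one_smul, (extChartAt 𝓘(ℝ, E) c).right_inv hxt]
    exact b.sum_repr x

end NearZeroChart

/-! ### Expansions with a smooth remainder -/

section Expansion

variable {E F F₁ F₂ : Type*} [NormedAddCommGroup E] [NormedSpace ℝ E] [FiniteDimensional ℝ E]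
  [NormedAddCommGroup F] [NormedSpace ℝ F] [CompleteSpace F]
  [NormedAddCommGroup F₁] [NormedSpace ℝ F₁] [NormedAddCommGroup F₂] [NormedSpace ℝ F₂]

/-- `f (ε, x) = ∑_{n < K} εⁿ aₙ(x) + ε^K b(ε, x)` on `(-1, 1) × O` with all data smooth. -/
def HasExpansion (K : ℕ) (O : Set E) (f : ℝ × E → F) (a : ℕ → E → F) : Prop :=
  (∀ n, ContDiffOn ℝ ∞ (a n) O) ∧ ∃ b : ℝ × E → F, ContDiffOn ℝ ∞ b (Ioo (-1) 1 ×ˢ O) ∧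
    ∀ ε ∈ Ioo (-1 : ℝ) 1, ∀ x ∈ O, f (ε, x) = truncSum K (fun n => a n x) ε + ε ^ K • b (ε, x)

variable {K : ℕ} {O : Set E}

theorem contDiffOn_truncSum {a : ℕ → E → F} (ha : ∀ n, ContDiffOn ℝ ∞ (a n) O) {s : Set ℝ} :
    ContDiffOn ℝ ∞ (fun p : ℝ × E => truncSum K (fun n => a n p.2) p.1) (s ×ˢ O) :=
  ContDiffOn.sum fun n _ => ContDiffOn.smul (f := fun p : ℝ × E => p.1 ^ n) (by fun_prop)
    ((ha n).comp contDiffOn_snd fun _ hp => hp.2)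

theorem contDiffOn_cauchyRemainder {L : F₁ →L[ℝ] F₂ →L[ℝ] F} {a : ℕ → E → F₁} {b : ℕ → E → F₂}
    (ha : ∀ n, ContDiffOn ℝ ∞ (a n) O) (hb : ∀ n, ContDiffOn ℝ ∞ (b n) O) {s : Set ℝ} :
    ContDiffOn ℝ ∞ (fun p : ℝ × E =>
      cauchyRemainder L K (fun n => a n p.2) (fun n => b n p.2) p.1) (s ×ˢ O) := by
  refine ContDiffOn.sum fun q _ => ContDiffOn.smul
    (f := fun p : ℝ × E => p.1 ^ (q.1 + q.2 - K)) (by fun_prop) ?_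
  exact (L.contDiff.comp_contDiffOn ((ha q.1).comp contDiffOn_snd fun _ hp => hp.2)).clm_apply
    ((hb q.2).comp contDiffOn_snd fun _ hp => hp.2)

theorem hasFDerivAt_truncSum {a : ℕ → E → F} {x : E} (ha : ∀ n, DifferentiableAt ℝ (a n) x)
    (ε : ℝ) : HasFDerivAt (fun y => truncSum K (fun n => a n y) ε)
      (truncSum K (fun n => fderiv ℝ (a n) x) ε) x :=
  HasFDerivAt.fun_sum fun n _ => (ha n).hasFDerivAt.const_smul _

theorem truncSum_zero_right (hK : 1 ≤ K) (a : ℕ → F) : truncSum K a 0 = a 0 := by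
  obtain ⟨k, rfl⟩ : ∃ k, K = k + 1 := ⟨K - 1, by omega⟩
  simp [truncSum, Finset.sum_range_succ']

theorem contDiffOn_slice {F : Type*} [NormedAddCommGroup F] [NormedSpace ℝ F] {f : ℝ × E → F}
    {s : Set ℝ} (hf : ContDiffOn ℝ ∞ f (s ×ˢ O)) {ε : ℝ} (hε : ε ∈ s) :
    ContDiffOn ℝ ∞ (fun y => f (ε, y)) O :=
  hf.comp (f := fun y : E => (ε, y)) (by fun_prop) fun _ hy => ⟨hε, hy⟩

theorem contDiffAt_slice {F : Type*} [NormedAddCommGroup F] [NormedSpace ℝ F] {f : ℝ × E → F}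
    {s : Set ℝ} (hO : IsOpen O) (hf : ContDiffOn ℝ ∞ f (s ×ˢ O)) {ε : ℝ} (hε : ε ∈ s) {x : E}
    (hx : x ∈ O) : ContDiffAt ℝ ∞ (fun y => f (ε, y)) x :=
  (contDiffOn_slice hf hε).contDiffAt (hO.mem_nhds hx)

theorem continuousAt_slice_left {F : Type*} [NormedAddCommGroup F] [NormedSpace ℝ F]
    {f : ℝ × E → F} (hO : IsOpen O) (hf : ContDiffOn ℝ ∞ f (Ioo (-1) 1 ×ˢ O)) {x : E}
    (hx : x ∈ O) : ContinuousAt (fun ε => f (ε, x)) 0 :=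
  (hf.contDiffAt ((isOpen_Ioo.prod hO).mem_nhds (x := ((0 : ℝ), x))
    ⟨by simp, hx⟩)).continuousAt.comp (f := fun ε : ℝ => (ε, x)) (by fun_prop)

namespace HasExpansion

variable {f g : ℝ × E → F} {a b : ℕ → E → F}

theorem of_contDiffOn (hO : IsOpen O) (hf : ContDiffOn ℝ ∞ f (Ioo (-1) 1 ×ˢ O)) :
    HasExpansion K O f (fun n x => taylorCoeff (fun ε => f (ε, x)) n) := by
  obtain ⟨r, hr, -, hfr⟩ := exists_taylor_expansion one_pos hO hf K
  exact ⟨fun n => contDiffOn_taylorCoeff one_pos hO hf n, r, hr, hfr⟩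

theorem of_truncSum (ha : ∀ n, ContDiffOn ℝ ∞ (a n) O) :
    HasExpansion K O (fun p => truncSum K (fun n => a n p.2) p.1) a :=
  ⟨ha, fun _ => 0, contDiffOn_const, by simp⟩

theorem contDiffOn (hf : HasExpansion K O f a) : ContDiffOn ℝ ∞ f (Ioo (-1) 1 ×ˢ O) := by
  obtain ⟨ha, r, hr, hfr⟩ := hf
  refine ((contDiffOn_truncSum (K := K) ha).add
    (ContDiffOn.smul (f := fun p : ℝ × E => p.1 ^ K) (by fun_prop) hr)).congr fun p hp => ?_
  exact hfr p.1 hp.1 p.2 hp.2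

theorem sub (hf : HasExpansion K O f a) (hg : HasExpansion K O g b) :
    HasExpansion K O (fun p => f p - g p) (fun n x => a n x - b n x) := by
  obtain ⟨ha, r, hr, hfr⟩ := hf
  obtain ⟨hb, s, hs, hgs⟩ := hg
  refine ⟨fun n => (ha n).sub (hb n), fun p => r p - s p, hr.sub hs, fun ε hε x hx => ?_⟩
  simp only
  rw [hfr ε hε x hx, hgs ε hε x hx]
  simp only [truncSum, smul_sub, Finset.sum_sub_distrib]
  abel

theorem bilin {f : ℝ × E → F₁} {g : ℝ × E → F₂} {a : ℕ → E → F₁} {b : ℕ → E → F₂}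
    (L : F₁ →L[ℝ] F₂ →L[ℝ] F) [CompleteSpace F₁] [CompleteSpace F₂]
    (hf : HasExpansion K O f a) (hg : HasExpansion K O g b) :
    HasExpansion K O (fun p => L (f p) (g p))
      (fun n x => ∑ p ∈ Finset.HasAntidiagonal.antidiagonal n, L (a p.1 x) (b p.2 x)) := by
  have hgs := hg.contDiffOn
  obtain ⟨ha, r, hr, hfr⟩ := hf
  obtain ⟨hb, s, hs, hgs'⟩ := hg
  refine ⟨fun n => ContDiffOn.sum fun p _ =>
    (L.contDiff.comp_contDiffOn (ha p.1)).clm_apply (hb p.2),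
    fun p => cauchyRemainder L K (fun n => a n p.2) (fun n => b n p.2) p.1
      + L (truncSum K (fun n => a n p.2) p.1) (s p) + L (r p) (g p), ?_, ?_⟩
  · exact ((contDiffOn_cauchyRemainder ha hb).add
      ((L.contDiff.comp_contDiffOn (contDiffOn_truncSum ha)).clm_apply hs)).add
      ((L.contDiff.comp_contDiffOn hr).clm_apply hgs)
  · intro ε hε x hx
    have h := truncSum_mul L K (fun n => a n x) (fun n => b n x) ε
    simp only
    rw [hfr ε hε x hx, map_add, add_apply, map_smul, smul_apply, smul_add, smul_add]
    nth_rewrite 1 [hgs' ε hε x hx]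
    rw [map_add, map_smul, h]
    abel

theorem clm_apply {f : ℝ × E → F₁ →L[ℝ] F} {g : ℝ × E → F₁} {a : ℕ → E → F₁ →L[ℝ] F}
    {b : ℕ → E → F₁} [CompleteSpace F₁]
    (hf : HasExpansion K O f a) (hg : HasExpansion K O g b) :
    HasExpansion K O (fun p => f p (g p))
      (fun n x => ∑ p ∈ Finset.HasAntidiagonal.antidiagonal n, a p.1 x (b p.2 x)) :=
  hf.bilin (ContinuousLinearMap.id ℝ (F₁ →L[ℝ] F)) hg

/-- The Cauchy product with its two indices exchanged, so that the two halves of the Lie bracket are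
summed over the same pairs and can be subtracted term by term. -/
theorem clm_apply_swap {f : ℝ × E → F₁ →L[ℝ] F} {g : ℝ × E → F₁} {a : ℕ → E → F₁ →L[ℝ] F}
    {b : ℕ → E → F₁} [CompleteSpace F₁]
    (hf : HasExpansion K O f a) (hg : HasExpansion K O g b) :
    HasExpansion K O (fun p => f p (g p))
      (fun n x => ∑ p ∈ Finset.HasAntidiagonal.antidiagonal n, a p.2 x (b p.1 x)) :=
  hg.bilin (ContinuousLinearMap.id ℝ (F₁ →L[ℝ] F)).flip hf

/-- Term-by-term differentiation is legitimate because the remainder is smooth jointly in (ε, x), so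
that its derivative in x is again a smooth factor of ε^K. -/
theorem fderiv (hO : IsOpen O) (hf : HasExpansion K O f a) :
    HasExpansion K O (fun p => fderiv ℝ (fun y => f (p.1, y)) p.2)
      (fun n x => fderiv ℝ (a n) x) := by
  obtain ⟨ha, r, hr, hfr⟩ := hf
  have hopen : IsOpen (Ioo (-1) 1 ×ˢ O : Set (ℝ × E)) := isOpen_Ioo.prod hO
  refine ⟨fun n => (ha n).fderiv_of_isOpen hO (by simp),
    fun p => (_root_.fderiv ℝ r p).comp (ContinuousLinearMap.inr ℝ ℝ E),
    (hr.fderiv_of_isOpen (m := ∞) hopen (by simp)).clm_comp contDiffOn_const,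
    fun ε hε x hx => ?_⟩
  refine HasFDerivAt.fderiv ?_
  have h1 := hasFDerivAt_slice (σ := ε) (p := x)
    ((hr.contDiffAt (hopen.mem_nhds ⟨hε, hx⟩)).differentiableAt (by simp))
  have h2 := hasFDerivAt_truncSum (K := K) (a := a) (x := x)
    (fun n => ((ha n).contDiffAt (hO.mem_nhds hx)).differentiableAt (by simp)) ε
  refine (h2.add (h1.const_smul (ε ^ K))).congr_of_eventuallyEq ?_
  filter_upwards [hO.mem_nhds hx] with y hy using hfr ε hε y hy

theorem coeff_eq_zero (hf : HasExpansion K O f a) {x : E} (hx : x ∈ O) {b : ℝ → F}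
    (hb : ContinuousAt b 0) (h : ∀ ε ∈ Ioo (-1 : ℝ) 1, f (ε, x) = ε ^ K • b ε) {n : ℕ}
    (hn : n < K) : a n x = 0 := by
  obtain ⟨ha, r, hr, hfr⟩ := hf
  refine coeff_eq_zero_of_pow_bound (K := K) (a := fun n => a n x) (b := fun ε => b ε - r (ε, x))
    ?_ ?_ n hn
  · refine hb.sub (ContinuousOn.continuousAt (s := Ioo (-1) 1) ?_ (Ioo_mem_nhds (by simp) (by simp)))
    exact hr.continuousOn.comp (f := fun ε : ℝ => (ε, x)) (by fun_prop) fun ε hε => ⟨hε, hx⟩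
  · have : Ioo (-1 : ℝ) 1 ∈ 𝓝[≠] 0 := mem_nhdsWithin_of_mem_nhds (Ioo_mem_nhds (by simp) (by simp))
    filter_upwards [this] with ε hε
    have h1 := hfr ε hε x hx
    rw [h ε hε] at h1
    rw [smul_sub, h1]
    simp [truncSum]

theorem remainder (hf : HasExpansion K O f a) (h : ∀ n < K, ∀ x ∈ O, a n x = 0) :
    ∃ b : ℝ × E → F, ContDiffOn ℝ ∞ b (Ioo (-1) 1 ×ˢ O) ∧
      ∀ ε ∈ Ioo (-1 : ℝ) 1, ∀ x ∈ O, f (ε, x) = ε ^ K • b (ε, x) := by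
  obtain ⟨ha, r, hr, hfr⟩ := hf
  refine ⟨r, hr, fun ε hε x hx => ?_⟩
  rw [hfr ε hε x hx]
  have : truncSum K (fun n => a n x) ε = 0 :=
    Finset.sum_eq_zero fun n hn => by simp only; rw [h n (Finset.mem_range.1 hn) x hx, smul_zero]
  rw [this, zero_add]

end HasExpansion

theorem taylorCoeff_clm_apply {E F : Type*} [NormedAddCommGroup E] [NormedSpace ℝ E]
    [NormedAddCommGroup F] [NormedSpace ℝ F] (L : E →L[ℝ] F) {f : ℝ → E}
    (hf : ContDiffAt ℝ ∞ f 0) (n : ℕ) :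
    taylorCoeff (fun ε => L (f ε)) n = L (taylorCoeff f n) := by
  have h := L.iteratedFDeriv_comp_left hf (i := n) (by exact_mod_cast le_top)
  simp only [taylorCoeff, map_smul, iteratedDeriv]
  congr 1
  exact congrArg (fun T => T fun _ => (1 : ℝ)) h

end Expansion

/-! ### The Hamiltonian is formally invariant -/

section Invariance

variable {E : Type*} [NormedAddCommGroup E] [NormedSpace ℝ E] [FiniteDimensional ℝ E]

/-- The coordinate expression of a nearly periodic Hamiltonian system with a formal symmetry
`∑ εⁿ Vₙ` whose formal momentum is `∑ εⁿ μₙ`. -/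
structure LocalSystem (O : Set E) (Ω : ℝ × E → E →L[ℝ] E →L[ℝ] ℝ) (X : ℝ × E → E)
    (H : ℝ × E → ℝ) (V : ℕ → E → E) (μ : ℕ → E → ℝ) : Prop where
  isOpen : IsOpen O
  form : ContDiffOn ℝ ∞ Ω (Ioo (-1) 1 ×ˢ O)
  exact : ∃ ϑ : ℝ × E → E →L[ℝ] ℝ, ContDiffOn ℝ ∞ ϑ (Ioo (-1) 1 ×ˢ O) ∧
    ∀ ε ∈ Ioo (-1 : ℝ) 1, ∀ x ∈ O, ∀ u w, Ω (ε, x) u w =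
      -(fderiv ℝ (fun y => ϑ (ε, y)) x u w - fderiv ℝ (fun y => ϑ (ε, y)) x w u)
  field : ContDiffOn ℝ ∞ X (Ioo (-1) 1 ×ˢ O)
  energy : ContDiffOn ℝ ∞ H (Ioo (-1) 1 ×ˢ O)
  hamiltonian : ∀ ε ∈ Ioo (-1 : ℝ) 1, ∀ x ∈ O, Ω (ε, x) (X (ε, x)) = fderiv ℝ (fun y => H (ε, y)) x
  symm : ∀ n, ContDiffOn ℝ ∞ (V n) O
  momentum : ∀ n, ContDiffOn ℝ ∞ (μ n) O
  fderiv_momentum : ∀ n, ∀ x ∈ O, fderiv ℝ (μ n) x =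
    ∑ p ∈ Finset.HasAntidiagonal.antidiagonal n, taylorCoeff (fun ε => Ω (ε, x)) p.1 (V p.2 x)

variable {O : Set E} {Ω : ℝ × E → E →L[ℝ] E →L[ℝ] ℝ} {X : ℝ × E → E}
  {H : ℝ × E → ℝ} {V : ℕ → E → E} {μ : ℕ → E → ℝ}

namespace LocalSystem

/-- The formal relation ι_V Ω = dμ holds for the truncations up to a smooth multiple of ε^K. -/
theorem exists_momentum_remainder (h : LocalSystem O Ω X H V μ) (K : ℕ) :
    ∃ r : ℝ × E → E →L[ℝ] ℝ, ContDiffOn ℝ ∞ r (Ioo (-1) 1 ×ˢ O) ∧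
      ∀ ε ∈ Ioo (-1 : ℝ) 1, ∀ x ∈ O, Ω (ε, x) (truncSum K (fun n => V n x) ε) =
        fderiv ℝ (fun y => truncSum K (fun n => μ n y) ε) x + ε ^ K • r (ε, x) := by
  have h1 : HasExpansion K O (fun p => Ω p (truncSum K (fun n => V n p.2) p.1)) _ :=
    (HasExpansion.of_contDiffOn h.isOpen h.form).clm_apply (HasExpansion.of_truncSum h.symm)
  have h2 := (HasExpansion.of_truncSum (K := K) h.momentum).fderiv h.isOpen
  obtain ⟨r, hr, hr'⟩ := (h1.sub h2).remainder fun n _ x hx => by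
    rw [h.fderiv_momentum n x hx, sub_self]
  exact ⟨r, hr, fun ε hε x hx => by rw [← hr' ε hε x hx]; simp⟩

theorem antisymm (h : LocalSystem O Ω X H V μ) {ε : ℝ} (hε : ε ∈ Ioo (-1 : ℝ) 1) {x : E}
    (hx : x ∈ O) (u w : E) : Ω (ε, x) u w = -Ω (ε, x) w u := by
  obtain ⟨ϑ, -, hϑ⟩ := h.exact
  rw [hϑ ε hε x hx, hϑ ε hε x hx]
  ring

theorem closed (h : LocalSystem O Ω X H V μ) {ε : ℝ} (hε : ε ∈ Ioo (-1 : ℝ) 1) {x : E}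
    (hx : x ∈ O) (a b c : E) :
    fderiv ℝ (fun y => Ω (ε, y)) x a b c + fderiv ℝ (fun y => Ω (ε, y)) x b c a
      + fderiv ℝ (fun y => Ω (ε, y)) x c a b = 0 := by
  obtain ⟨ϑ, hϑs, hϑ⟩ := h.exact
  have hs := (contDiffOn_slice hϑs hε).contDiffAt (h.isOpen.mem_nhds hx)
  have hd : DifferentiableAt ℝ (fderiv ℝ (fun y => ϑ (ε, y))) x :=
    (hs.fderiv_right (m := ∞) (by simp)).differentiableAt (by simp)
  have hΩd : DifferentiableAt ℝ (fun y => Ω (ε, y)) x :=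
    ((contDiffOn_slice h.form hε).contDiffAt (h.isOpen.mem_nhds hx)).differentiableAt (by simp)
  have hsymm := hs.isSymmSndFDerivAt (by simpa using ENat.LEInfty.out)
  have key : ∀ a b c, fderiv ℝ (fun y => Ω (ε, y)) x a b c =
      -(fderiv ℝ (fderiv ℝ (fun y => ϑ (ε, y))) x a b c
        - fderiv ℝ (fderiv ℝ (fun y => ϑ (ε, y))) x a c b) := by
    intro a b c
    have h1 : HasFDerivAt (fun y => Ω (ε, y) b c)
        (((fderiv ℝ (fun y => Ω (ε, y)) x).flip b).flip c) x := by
      refine ((hΩd.hasFDerivAt.clm_apply (hasFDerivAt_const b x)).clm_apply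
        (hasFDerivAt_const c x)).congr_fderiv ?_
      ext v; simp
    have h2 : HasFDerivAt (fun y => -(fderiv ℝ (fun y => ϑ (ε, y)) y b c
        - fderiv ℝ (fun y => ϑ (ε, y)) y c b))
        (-((((fderiv ℝ (fderiv ℝ (fun y => ϑ (ε, y))) x).flip b).flip c)
        - (((fderiv ℝ (fderiv ℝ (fun y => ϑ (ε, y))) x).flip c).flip b))) x := by
      refine (((hd.hasFDerivAt.clm_apply (hasFDerivAt_const b x)).clm_apply
        (hasFDerivAt_const c x)).sub ((hd.hasFDerivAt.clm_apply (hasFDerivAt_const c x)).clm_apply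
        (hasFDerivAt_const b x))).neg.congr_fderiv ?_
      ext v; simp
    have h3 := h1.unique (h2.congr_of_eventuallyEq (by
      filter_upwards [h.isOpen.mem_nhds hx] with y hy using hϑ ε hε y hy b c))
    exact congrArg (fun T : E →L[ℝ] ℝ => T a) h3
  have e1 := hsymm.eq a b
  have e2 := hsymm.eq b c
  have e3 := hsymm.eq c a
  rw [key, key, key, e1, e2, e3]
  ring

/-- The differential of `Ω(X, V)` for a closed form `Ω` and vector fields `X`, `V`. -/
theorem _root_.NearlyPeriodic.fderiv_form_apply_apply {Ω : E → E →L[ℝ] E →L[ℝ] ℝ} {X V : E → E}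
    {x : E} (hΩ : DifferentiableAt ℝ Ω x) (hX : DifferentiableAt ℝ X x)
    (hV : DifferentiableAt ℝ V x) (hanti : ∀ u w, Ω x u w = -Ω x w u)
    (hantid : ∀ a u w, fderiv ℝ Ω x a u w = -fderiv ℝ Ω x a w u)
    (hclosed : ∀ a b c, fderiv ℝ Ω x a b c + fderiv ℝ Ω x b c a + fderiv ℝ Ω x c a b = 0) (w : E) :
    fderiv ℝ (fun y => Ω y (X y) (V y)) x w =
      Ω x (fderiv ℝ X x (V x) - fderiv ℝ V x (X x)) w
      - (fderiv ℝ (fun y => Ω y (X y)) x (V x) w - fderiv ℝ (fun y => Ω y (X y)) x w (V x))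
      + (fderiv ℝ (fun y => Ω y (V y)) x (X x) w - fderiv ℝ (fun y => Ω y (V y)) x w (X x)) := by
  have h1 := ((hΩ.hasFDerivAt.clm_apply hX.hasFDerivAt).clm_apply hV.hasFDerivAt).fderiv
  have h2 := (hΩ.hasFDerivAt.clm_apply hX.hasFDerivAt).fderiv
  have h3 := (hΩ.hasFDerivAt.clm_apply hV.hasFDerivAt).fderiv
  rw [h1, h2, h3]
  have e1 := hclosed (V x) (X x) w
  have e2 := hanti (X x) (fderiv ℝ V x w)
  have e3 := hantid (X x) w (V x)
  have e4 := hantid w (X x) (V x)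
  simp only [add_apply, ContinuousLinearMap.comp_apply, ContinuousLinearMap.flip_apply, map_sub,
    sub_apply]
  linarith

/-- The function in question is dH(V) = Ω(X, V). For a closed form, the differential of Ω(X, V)
consists of Ω paired with the bracket of X and V and of the exterior derivatives of ι_X Ω and ι_V Ω.
The bracket vanishes formally, ι_X Ω = dH is exact, and ι_V Ω = dμ is formally exact, so every
coefficient of the differential is zero. -/
theorem coeff_fderiv_energy (h : LocalSystem O Ω X H V μ) {x : E} (hx : x ∈ O)
    (hbr : ∀ n, ∑ p ∈ Finset.HasAntidiagonal.antidiagonal n,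
      (fderiv ℝ (fun y => taylorCoeff (fun ε => X (ε, y)) p.1) x (V p.2 x)
        - fderiv ℝ (V p.2) x (taylorCoeff (fun ε => X (ε, x)) p.1)) = 0) (n : ℕ) :
    fderiv ℝ (fun y => ∑ p ∈ Finset.HasAntidiagonal.antidiagonal n,
      fderiv ℝ (fun y => taylorCoeff (fun ε => H (ε, y)) p.1) y (V p.2 y)) x = 0 := by
  set K := n + 1 with hK
  set W : ℝ × E → E := fun p => truncSum K (fun n => V n p.2) p.1 with hW
  have eX : HasExpansion K O X _ := HasExpansion.of_contDiffOn h.isOpen h.field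
  have eW : HasExpansion K O W V := HasExpansion.of_truncSum h.symm
  have eH : HasExpansion K O H _ := HasExpansion.of_contDiffOn h.isOpen h.energy
  have eg : HasExpansion K O (fun p => fderiv ℝ (fun y => H (p.1, y)) p.2 (W p)) _ :=
    (eH.fderiv h.isOpen).clm_apply eW
  have eDg := eg.fderiv h.isOpen
  have e1 : HasExpansion K O (fun p => fderiv ℝ (fun y => X (p.1, y)) p.2 (W p)) _ :=
    (eX.fderiv h.isOpen).clm_apply eW
  have e2 : HasExpansion K O (fun p => fderiv ℝ (fun y => W (p.1, y)) p.2 (X p)) _ :=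
    (eW.fderiv h.isOpen).clm_apply_swap eX
  have eBr := e1.sub e2
  obtain ⟨-, b, hb, hbr'⟩ := eBr
  have hbx : ∀ ε ∈ Ioo (-1 : ℝ) 1, fderiv ℝ (fun y => X (ε, y)) x (W (ε, x))
      - fderiv ℝ (fun y => W (ε, y)) x (X (ε, x)) = ε ^ K • b (ε, x) := by
    intro ε hε
    have h0 := hbr' ε hε x hx
    simp only at h0
    rw [h0]
    convert zero_add _ using 2
    refine Finset.sum_eq_zero fun n _ => ?_
    simp only
    rw [← Finset.sum_sub_distrib, hbr n, smul_zero]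
  obtain ⟨r, hr, hr'⟩ := h.exists_momentum_remainder K
  have hopen : IsOpen (Ioo (-1) 1 ×ˢ O : Set (ℝ × E)) := isOpen_Ioo.prod h.isOpen
  have hDr : ContDiffOn ℝ ∞ (fun p => (fderiv ℝ r p).comp (ContinuousLinearMap.inr ℝ ℝ E))
      (Ioo (-1) 1 ×ˢ O) :=
    (hr.fderiv_of_isOpen (m := ∞) hopen (by simp)).clm_comp contDiffOn_const
  -- The computation takes place at finite ε with truncated series: the Hessians of H and of the
  -- truncated momentum cancel by symmetry, and what remains is ε^K times the bracket remainder b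
  -- and the exterior derivative of the momentum remainder r. With K = n + 1 the coefficient of
  -- order n must vanish.
  have hpt : ∀ ε ∈ Ioo (-1 : ℝ) 1, ∀ w, fderiv ℝ (fun y => fderiv ℝ (fun y => H (ε, y)) y (W (ε, y))) x w
      = ε ^ K • (Ω (ε, x) (b (ε, x)) w
        + ((fderiv ℝ r (ε, x)).comp (ContinuousLinearMap.inr ℝ ℝ E) (X (ε, x)) w
          - (fderiv ℝ r (ε, x)).comp (ContinuousLinearMap.inr ℝ ℝ E) w (X (ε, x)))) := by
    intro ε hε w
    have hEq : (fun y => fderiv ℝ (fun y => H (ε, y)) y (W (ε, y))) =ᶠ[𝓝 x]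
        fun y => Ω (ε, y) (X (ε, y)) (W (ε, y)) := by
      filter_upwards [h.isOpen.mem_nhds hx] with y hy
      rw [h.hamiltonian ε hε y hy]
    have hΩd := (contDiffAt_slice h.isOpen h.form hε hx).differentiableAt (by simp)
    have hantid : ∀ a u w, fderiv ℝ (fun y => Ω (ε, y)) x a u w =
        -fderiv ℝ (fun y => Ω (ε, y)) x a w u := by
      intro a u w
      have h1 : ∀ u w, HasFDerivAt (fun y => Ω (ε, y) u w)
          (((fderiv ℝ (fun y => Ω (ε, y)) x).flip u).flip w) x := by
        intro u w
        refine ((hΩd.hasFDerivAt.clm_apply (hasFDerivAt_const u x)).clm_apply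
          (hasFDerivAt_const w x)).congr_fderiv ?_
        ext v; simp
      have h2 := (h1 u w).unique ((h1 w u).neg.congr_of_eventuallyEq (by
        filter_upwards [h.isOpen.mem_nhds hx] with y hy using h.antisymm hε hy u w))
      exact congrArg (fun T : E →L[ℝ] ℝ => T a) h2
    rw [hEq.fderiv_eq, fderiv_form_apply_apply hΩd ((contDiffAt_slice h.isOpen h.field hε hx).differentiableAt (by simp))
      ((contDiffAt_slice h.isOpen eW.contDiffOn hε hx).differentiableAt (by simp)) (h.antisymm hε hx) hantid
      (h.closed hε hx), hbx ε hε]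
    have hHs := contDiffAt_slice h.isOpen h.energy hε hx
    have hHX : fderiv ℝ (fun y => Ω (ε, y) (X (ε, y))) x =
        fderiv ℝ (fderiv ℝ (fun y => H (ε, y))) x := by
      refine Filter.EventuallyEq.fderiv_eq ?_
      filter_upwards [h.isOpen.mem_nhds hx] with y hy using h.hamiltonian ε hε y hy
    have hμs : ContDiffAt ℝ ∞ (fun y => truncSum K (fun n => μ n y) ε) x :=
      contDiffAt_slice h.isOpen (contDiffOn_truncSum (K := K) h.momentum) hε hx
    have hμV : fderiv ℝ (fun y => Ω (ε, y) (W (ε, y))) x =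
        fderiv ℝ (fderiv ℝ (fun y => truncSum K (fun n => μ n y) ε)) x +
          ε ^ K • (fderiv ℝ r (ε, x)).comp (ContinuousLinearMap.inr ℝ ℝ E) := by
      have h1 : HasFDerivAt (fun y => fderiv ℝ (fun y => truncSum K (fun n => μ n y) ε) y
          + ε ^ K • r (ε, y)) _ x :=
        (((hμs.fderiv_right (m := ∞) (by simp)).differentiableAt (by simp)).hasFDerivAt).add
          ((hasFDerivAt_slice ((hr.contDiffAt (hopen.mem_nhds
            (x := (ε, x)) ⟨hε, hx⟩)).differentiableAt (by simp))).const_smul (ε ^ K))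
      refine (h1.congr_of_eventuallyEq ?_).fderiv
      filter_upwards [h.isOpen.mem_nhds hx] with y hy using hr' ε hε y hy
    have s1 := (hHs.isSymmSndFDerivAt (by simpa using ENat.LEInfty.out)).eq (W (ε, x)) w
    have s2 := (hμs.isSymmSndFDerivAt (by simpa using ENat.LEInfty.out)).eq (X (ε, x)) w
    rw [hHX, hμV, s1]
    simp only [add_apply, smul_apply, map_smul, smul_eq_mul, s2]
    ring
  ext w
  have eDgw : HasExpansion K O (fun p => fderiv ℝ (fun y => fderiv ℝ (fun y => H (p.1, y)) y
      (W (p.1, y))) p.2 w) _ :=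
    eDg.clm_apply (g := fun _ => w)
      (HasExpansion.of_contDiffOn h.isOpen contDiffOn_const)
  have := eDgw.coeff_eq_zero hx (b := fun ε => (Ω (ε, x) (b (ε, x)) w
        + ((fderiv ℝ r (ε, x)).comp (ContinuousLinearMap.inr ℝ ℝ E) (X (ε, x)) w
          - (fderiv ℝ r (ε, x)).comp (ContinuousLinearMap.inr ℝ ℝ E) w (X (ε, x))))) ?_
    (fun ε hε => hpt ε hε w) (n := n) (by omega)
  -- The vector w does not depend on ε, so only its zeroth Taylor coefficient contributes to the
  -- Cauchy product.
  · rw [Finset.sum_eq_single (n, 0)] at this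
    · simpa [taylorCoeff] using this
    · intro p hp hne
      have hp2 : p.2 ≠ 0 := by
        intro h0
        have := Finset.HasAntidiagonal.mem_antidiagonal.1 hp
        exact hne (Prod.ext (by omega) h0)
      have : taylorCoeff (fun _ : ℝ => w) p.2 = 0 := by
        simp [taylorCoeff, iteratedDeriv_const, hp2]
      rw [this, map_zero]
    · intro hn
      simp at hn
  · have c1 := continuousAt_slice_left h.isOpen h.form hx
    have c2 := continuousAt_slice_left h.isOpen hb hx
    have c3 := continuousAt_slice_left h.isOpen h.field hx
    have c4 := continuousAt_slice_left h.isOpen hDr hx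
    exact ((c1.clm_apply c2).clm_apply continuousAt_const).add
      (((c4.clm_apply c3).clm_apply continuousAt_const).sub
        ((c4.clm_apply continuousAt_const).clm_apply c3))

/-- By antisymmetry dμ(X) = Ω(V, X) = -Ω(X, V) = -dH(V) up to remainders, so formal invariance of H
under V is formal conservation of μ under X, as in Noether's theorem. -/
theorem exists_drift (h : LocalSystem O Ω X H V μ)
    (hc : ∀ n, ∀ x ∈ O, ∑ p ∈ Finset.HasAntidiagonal.antidiagonal n,
      fderiv ℝ (fun y => taylorCoeff (fun ε => H (ε, y)) p.1) x (V p.2 x) = 0) (K : ℕ) :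
    ∃ B : ℝ × E → ℝ, ContDiffOn ℝ ∞ B (Ioo (-1) 1 ×ˢ O) ∧ ∀ ε ∈ Ioo (-1 : ℝ) 1, ∀ x ∈ O,
      fderiv ℝ (fun y => truncSum K (fun n => μ n y) ε) x (X (ε, x)) = ε ^ K • B (ε, x) := by
  have eH : HasExpansion K O H _ := HasExpansion.of_contDiffOn h.isOpen h.energy
  have eg : HasExpansion K O (fun p => fderiv ℝ (fun y => H (p.1, y)) p.2
      (truncSum K (fun n => V n p.2) p.1)) _ :=
    (eH.fderiv h.isOpen).clm_apply (HasExpansion.of_truncSum h.symm)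
  obtain ⟨b, hb, hb'⟩ := eg.remainder fun n _ x hx => hc n x hx
  obtain ⟨r, hr, hr'⟩ := h.exists_momentum_remainder K
  refine ⟨fun p => -b p - r p (X p), hb.neg.sub (hr.clm_apply h.field), fun ε hε x hx => ?_⟩
  have h1 := hb' ε hε x hx
  have h2 := congrArg (fun L : E →L[ℝ] ℝ => L (X (ε, x))) (hr' ε hε x hx)
  simp only [add_apply, smul_apply] at h1 h2
  rw [← h.hamiltonian ε hε x hx, h.antisymm hε hx] at h1
  simp only [smul_eq_mul] at h1 h2 ⊢
  linarith

/-- The relation between the formal symmetry and the differential of its momentum. -/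
theorem exists_sharp_remainder (h : LocalSystem O Ω X H V μ) {j : ℝ × E → (E →L[ℝ] ℝ) →L[ℝ] E}
    (hj : ContDiffOn ℝ ∞ j (Ioo (-1) 1 ×ˢ O)) {d : ℕ}
    (hjΩ : ∀ ε ≠ 0, ∀ x ∈ O, ∀ v, j (ε, x) (Ω (ε, x) v) = -(ε ^ d • v)) (K : ℕ) :
    ∃ B : ℝ × E → E, ContDiffOn ℝ ∞ B (Ioo (-1) 1 ×ˢ O) ∧
      ∀ ε ∈ Ioo (-1 : ℝ) 1, ε ≠ 0 → ∀ x ∈ O, ε ^ d • truncSum K (fun n => V n x) ε =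
        -j (ε, x) (fderiv ℝ (fun y => truncSum K (fun n => μ n y) ε) x) + ε ^ K • B (ε, x) := by
  obtain ⟨r, hr, hr'⟩ := h.exists_momentum_remainder K
  refine ⟨fun p => -j p (r p), (hj.clm_apply hr).neg, fun ε hε h0 x hx => ?_⟩
  have h1 := hjΩ ε h0 x hx (truncSum K (fun n => V n x) ε)
  rw [hr' ε hε x hx, map_add, map_smul] at h1
  rw [← neg_eq_iff_eq_neg.2 h1, smul_neg]
  abel

end LocalSystem

end Invariance

/-! ### The system in a chart -/

section SystemInChart

variable {E : Type*} [NormedAddCommGroup E] [NormedSpace ℝ E] [FiniteDimensional ℝ E]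
  {M : Type*} [TopologicalSpace M] [ChartedSpace E M] [IsManifold 𝓘(ℝ, E) ∞ M]

theorem chartSymmD_vectorInChart (V : (m : M) → TangentSpace 𝓘(ℝ, E) m) {c : M} {x : E}
    (hx : x ∈ (extChartAt 𝓘(ℝ, E) c).target) :
    chartSymmD c x (vectorInChart V c x) = V ((extChartAt 𝓘(ℝ, E) c).symm x) :=
  chartSymmD_chartD hx _

/-- The Lie bracket in the preferred chart. -/
theorem mlieBracket_eq_chart (V W : (m : M) → TangentSpace 𝓘(ℝ, E) m) (m : M) :
    (show E from VectorField.mlieBracket 𝓘(ℝ, E) V W m) =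
      fderiv ℝ (vectorInChart W m) (extChartAt 𝓘(ℝ, E) m m)
        (vectorInChart V m (extChartAt 𝓘(ℝ, E) m m))
      - fderiv ℝ (vectorInChart V m) (extChartAt 𝓘(ℝ, E) m m)
        (vectorInChart W m (extChartAt 𝓘(ℝ, E) m m)) := by
  have hpull : ∀ V : (m : M) → TangentSpace 𝓘(ℝ, E) m, ∀ y ∈ (extChartAt 𝓘(ℝ, E) m).target,
      (show E from VectorField.mpullbackWithin 𝓘(ℝ, E) 𝓘(ℝ, E) (extChartAt 𝓘(ℝ, E) m).symm V
        (range 𝓘(ℝ, E)) y) = vectorInChart V m y := by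
    intro V y hy
    have h1 : ContinuousLinearMap.inverse (chartSymmD m y) =
        chartD (E := E) m ((extChartAt 𝓘(ℝ, E) m).symm y) :=
      ContinuousLinearMap.inverse_eq (by ext v; exact chartSymmD_chartD hy v)
        (by ext v; exact chartD_chartSymmD hy v)
    have h2 : mfderivWithin 𝓘(ℝ, E) 𝓘(ℝ, E) (extChartAt 𝓘(ℝ, E) m).symm (range 𝓘(ℝ, E)) y =
        mfderiv 𝓘(ℝ, E) 𝓘(ℝ, E) (extChartAt 𝓘(ℝ, E) m).symm y := by
      simp only [modelWithCornersSelf_coe, range_id, mfderivWithin_univ]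
    have h3 : VectorField.mpullbackWithin 𝓘(ℝ, E) 𝓘(ℝ, E) (extChartAt 𝓘(ℝ, E) m).symm V
        (range 𝓘(ℝ, E)) y = (mfderivWithin 𝓘(ℝ, E) 𝓘(ℝ, E) (extChartAt 𝓘(ℝ, E) m).symm
          (range 𝓘(ℝ, E)) y).inverse (V ((extChartAt 𝓘(ℝ, E) m).symm y)) := rfl
    rw [h3, h2]
    exact congrArg (fun L : E →L[ℝ] E => L (V ((extChartAt 𝓘(ℝ, E) m).symm y))) h1
  have hnhds := (isOpen_chart_target (E := E) m).mem_nhds (mem_extChartAt_target m)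
  have hself := mem_extChartAt_target (I := 𝓘(ℝ, E)) m
  have hev : ∀ V : (m : M) → TangentSpace 𝓘(ℝ, E) m,
      (fun y => (show E from VectorField.mpullbackWithin 𝓘(ℝ, E) 𝓘(ℝ, E)
        (extChartAt 𝓘(ℝ, E) m).symm V (range 𝓘(ℝ, E)) y)) =ᶠ[𝓝 (extChartAt 𝓘(ℝ, E) m m)]
        vectorInChart V m := fun V => by
    filter_upwards [hnhds] with y hy using hpull V y hy
  have hid : ContinuousLinearMap.inverse (chartD (E := E) m m) = .id ℝ E := by
    rw [chartD_self]; exact ContinuousLinearMap.inverse_id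
  have hset : (extChartAt 𝓘(ℝ, E) m).symm ⁻¹' univ ∩ range 𝓘(ℝ, E) = univ := by simp
  have h1 : (show E from VectorField.mlieBracket 𝓘(ℝ, E) V W m) =
      ContinuousLinearMap.inverse (chartD (E := E) m m) (VectorField.lieBracketWithin ℝ
        (fun y => (show E from VectorField.mpullbackWithin 𝓘(ℝ, E) 𝓘(ℝ, E)
          (extChartAt 𝓘(ℝ, E) m).symm V (range 𝓘(ℝ, E)) y))
        (fun y => (show E from VectorField.mpullbackWithin 𝓘(ℝ, E) 𝓘(ℝ, E)
          (extChartAt 𝓘(ℝ, E) m).symm W (range 𝓘(ℝ, E)) y))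
        ((extChartAt 𝓘(ℝ, E) m).symm ⁻¹' univ ∩ range 𝓘(ℝ, E)) (extChartAt 𝓘(ℝ, E) m m)) := rfl
  rw [h1, hid, hset, VectorField.lieBracketWithin, fderivWithin_univ, fderivWithin_univ,
    (hev V).fderiv_eq, (hev W).fderiv_eq]
  rw [ContinuousLinearMap.id_apply, hpull V _ hself, hpull W _ hself]

theorem contMDiff_of_chart_self {f : M → ℝ}
    (hf : ∀ c : M, ContDiffOn ℝ ∞ (fun x : E => f ((extChartAt 𝓘(ℝ, E) c).symm x))
      (extChartAt 𝓘(ℝ, E) c).target) : ContMDiff 𝓘(ℝ, E) 𝓘(ℝ, ℝ) ∞ f :=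
  contMDiff_slice (contMDiff_of_chart (f := fun p : ℝ × M => f p.2) fun c =>
    (hf c).comp contDiffOn_snd fun _ hp => hp.2) 0

theorem contDiffOn_chart_self {f : M → ℝ} (hf : ContMDiff 𝓘(ℝ, E) 𝓘(ℝ, ℝ) ∞ f) (c : M) :
    ContDiffOn ℝ ∞ (f ∘ (extChartAt 𝓘(ℝ, E) c).symm) (extChartAt 𝓘(ℝ, E) c).target :=
  (hf.comp_contMDiffOn (contMDiffOn_extChartAt_symm (I := 𝓘(ℝ, E)) (n := ∞) c)).contDiffOn

theorem oneForm_apply_eq_chart (α : (m : M) → TangentSpace 𝓘(ℝ, E) m →L[ℝ] ℝ)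
    (V : (m : M) → TangentSpace 𝓘(ℝ, E) m) {c : M} {x : E}
    (hx : x ∈ (extChartAt 𝓘(ℝ, E) c).target) :
    α ((extChartAt 𝓘(ℝ, E) c).symm x) (V ((extChartAt 𝓘(ℝ, E) c).symm x)) =
      oneFormInChart α c x (vectorInChart V c x) :=
  (congrArg (fun v : E => (show E →L[ℝ] ℝ from α ((extChartAt 𝓘(ℝ, E) c).symm x)) v)
    (chartSymmD_vectorInChart V hx)).symm

theorem contMDiff_oneForm_apply {α : (m : M) → TangentSpace 𝓘(ℝ, E) m →L[ℝ] ℝ}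
    (hα : SmoothOneForm α) {V : (m : M) → TangentSpace 𝓘(ℝ, E) m} (hV : SmoothVectorField V) :
    ContMDiff 𝓘(ℝ, E) 𝓘(ℝ, ℝ) ∞ (fun m => α m (V m)) :=
  contMDiff_of_chart_self fun c => ((contDiffOn_oneForm_chart hα c).clm_apply
    (contDiffOn_vectorField_chart hV c)).congr fun _ hx => oneForm_apply_eq_chart α V hx

theorem contDiffAt_taylor_slice {F : Type*} [NormedAddCommGroup F] [NormedSpace ℝ F] {O : Set E}
    (hO : IsOpen O) {f : ℝ × E → F} (hf : ContDiffOn ℝ ∞ f (univ ×ˢ O)) {x : E} (hx : x ∈ O) :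
    ContDiffAt ℝ ∞ (fun ε => f (ε, x)) 0 :=
  (hf.contDiffAt ((isOpen_univ.prod hO).mem_nhds (x := ((0 : ℝ), x)) ⟨mem_univ _, hx⟩)).comp
    (f := fun ε : ℝ => (ε, x)) 0 (by fun_prop)

theorem contDiffAt_vectorFamily {X : ℝ → (m : M) → TangentSpace 𝓘(ℝ, E) m}
    (hX : SmoothVectorFamily X) (m : M) : ContDiffAt ℝ ∞ (fun ε => (show E from X ε m)) 0 := by
  have h := contDiffAt_taylor_slice (isOpen_chart_target m) (contDiffOn_vectorFamily_chart hX m)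
    (mem_extChartAt_target m)
  simp only [vectorInChart_self] at h
  exact h

theorem vectorInChart_vectorCoeff {X : ℝ → (m : M) → TangentSpace 𝓘(ℝ, E) m}
    (hX : SmoothVectorFamily X) (n : ℕ) (c : M) (x : E) :
    vectorInChart (vectorCoeff X n) c x = taylorCoeff (fun ε => vectorInChart (X ε) c x) n :=
  (taylorCoeff_clm_apply (chartD (E := E) c ((extChartAt 𝓘(ℝ, E) c).symm x))
    (contDiffAt_vectorFamily hX _) n).symm

theorem sharpInChart_twoTensorInChart
    {Ω : (m : M) → TangentSpace 𝓘(ℝ, E) m →L[ℝ] TangentSpace 𝓘(ℝ, E) m →L[ℝ] ℝ}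
    {j : (m : M) → (TangentSpace 𝓘(ℝ, E) m →L[ℝ] ℝ) →L[ℝ] TangentSpace 𝓘(ℝ, E) m} {a : ℝ}
    (h : ∀ m v, j m (Ω m v) = -(a • v)) {c : M} {x : E}
    (hx : x ∈ (extChartAt 𝓘(ℝ, E) c).target) (v : E) :
    sharpInChart j c x (twoTensorInChart Ω c x v) = -(a • v) := by
  set m := (extChartAt 𝓘(ℝ, E) c).symm x with hm
  have h1 : (twoTensorInChart Ω c x v).comp (chartD (E := E) c m) =
      (show E →L[ℝ] E →L[ℝ] ℝ from Ω m) (chartSymmD c x v) := by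
    ext w
    change (show E →L[ℝ] E →L[ℝ] ℝ from Ω m) (chartSymmD c x v)
      (chartSymmD c x (chartD c m w)) = _
    rw [chartSymmD_chartD hx]
  have h2 : sharpInChart j c x (twoTensorInChart Ω c x v) = chartD (E := E) c m
      ((show (E →L[ℝ] ℝ) →L[ℝ] E from j m)
        ((twoTensorInChart Ω c x v).comp (chartD (E := E) c m))) := rfl
  have h3 : (show (E →L[ℝ] ℝ) →L[ℝ] E from j m)
      ((show E →L[ℝ] E →L[ℝ] ℝ from Ω m) (chartSymmD c x v)) = -(a • chartSymmD c x v) :=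
    h m (chartSymmD c x v)
  rw [h2, h1, h3, map_neg, map_smul, chartD_chartSymmD hx]

variable {Ω : ℝ → (m : M) → TangentSpace 𝓘(ℝ, E) m →L[ℝ] TangentSpace 𝓘(ℝ, E) m →L[ℝ] ℝ}
  {X : ℝ → (m : M) → TangentSpace 𝓘(ℝ, E) m} {H : ℝ → M → ℝ}
  {R : ℕ → (m : M) → TangentSpace 𝓘(ℝ, E) m}
  {θ : ℕ → (m : M) → TangentSpace 𝓘(ℝ, E) m →L[ℝ] ℝ} {μ : ℕ → M → ℝ}

theorem taylorCoeff_apply {A B : Type*} [NormedAddCommGroup A] [NormedSpace ℝ A]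
    [NormedAddCommGroup B] [NormedSpace ℝ B] {f : ℝ → A →L[ℝ] B} (hf : ContDiffAt ℝ ∞ f 0) (u : A)
    (n : ℕ) : taylorCoeff (fun ε => f ε u) n = taylorCoeff f n u := by
  let L : (A →L[ℝ] B) →L[ℝ] B := ContinuousLinearMap.apply ℝ B u
  exact taylorCoeff_clm_apply L hf n

theorem taylorCoeff_apply_apply {A B C : Type*} [NormedAddCommGroup A]
    [NormedSpace ℝ A] [NormedAddCommGroup B] [NormedSpace ℝ B] [NormedAddCommGroup C]
    [NormedSpace ℝ C] {f : ℝ → A →L[ℝ] B →L[ℝ] C} (hf : ContDiffAt ℝ ∞ f 0) (u : A) (w : B)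
    (n : ℕ) : taylorCoeff (fun ε => f ε u w) n = taylorCoeff f n u w := by
  have h1 := taylorCoeff_apply hf u n
  have h2 := taylorCoeff_apply (hf.clm_apply (contDiffAt_const (c := u))) w n
  exact h2.trans (congrArg (fun L : B →L[ℝ] C => L w) h1)

theorem taylorCoeff_twoTensor_apply (hΩ : SmoothTwoTensorFamily Ω) {c : M} {x : E}
    (hx : x ∈ (extChartAt 𝓘(ℝ, E) c).target) {V : (m : M) → TangentSpace 𝓘(ℝ, E) m} (w : E)
    (n : ℕ) :
    taylorCoeff (fun ε => Ω ε ((extChartAt 𝓘(ℝ, E) c).symm x)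
      (V ((extChartAt 𝓘(ℝ, E) c).symm x)) (chartSymmD c x w)) n =
      taylorCoeff (fun ε => twoTensorInChart (Ω ε) c x) n (vectorInChart V c x) w := by
  refine Eq.trans ?_ (taylorCoeff_apply_apply (contDiffAt_taylor_slice (isOpen_chart_target c)
    (contDiffOn_twoTensorFamily_chart hΩ c) hx) (vectorInChart V c x) w n)
  congr 1
  funext ε
  change _ = (show E →L[ℝ] E →L[ℝ] ℝ from Ω ε ((extChartAt 𝓘(ℝ, E) c).symm x))
    (chartSymmD c x (vectorInChart V c x)) (chartSymmD c x w)
  rw [chartSymmD_vectorInChart V hx]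
  rfl

theorem contMDiff_momentum (hR : ∀ n, SmoothVectorField (R n)) (hθ : ∀ n, SmoothOneForm (θ n))
    (hμ : ∀ n m, μ n m = ∑ p ∈ Finset.HasAntidiagonal.antidiagonal n, θ p.2 m (R p.1 m)) (n : ℕ) :
    ContMDiff 𝓘(ℝ, E) 𝓘(ℝ, ℝ) ∞ (μ n) := by
  rw [funext (hμ n)]
  exact contMDiff_finsetSum fun p _ => contMDiff_oneForm_apply (hθ p.2) (hR p.1)

/-- Cartan's formula: L_R θ = 0 reads d(ι_R θ) = -ι_R dθ, and Ω = -dθ turns the right-hand side into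
ι_R Ω, order by order. -/
theorem fderiv_momentum_chart (hΩ : SmoothTwoTensorFamily Ω)
    (hR : ∀ n, SmoothVectorField (R n)) (hθ : ∀ n, SmoothOneForm (θ n))
    (hθΩ : ∀ n m u w, taylorCoeff (fun ε => Ω ε m u w) n = -dOne (θ n) m u w)
    (hlie : ∀ n m w, ∑ p ∈ Finset.HasAntidiagonal.antidiagonal n,
      lieOne (R p.1) (θ p.2) m w = 0)
    (hμ : ∀ n m, μ n m = ∑ p ∈ Finset.HasAntidiagonal.antidiagonal n, θ p.2 m (R p.1 m)) (c : M) :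
    ∀ n, ∀ x ∈ (extChartAt 𝓘(ℝ, E) c).target, fderiv ℝ (μ n ∘ (extChartAt 𝓘(ℝ, E) c).symm) x =
      ∑ p ∈ Finset.HasAntidiagonal.antidiagonal n,
        taylorCoeff (fun ε => twoTensorInChart (Ω ε) c x) p.1 (vectorInChart (R p.2) c x) := by
  intro n x hx
  set m := (extChartAt 𝓘(ℝ, E) c).symm x with hm
  ext w
  have hsm := fun p q => contMDiff_oneForm_apply (hθ q) (hR p)
  have h1 : HasFDerivAt (μ n ∘ (extChartAt 𝓘(ℝ, E) c).symm)
      (∑ p ∈ Finset.HasAntidiagonal.antidiagonal n,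
        fderiv ℝ ((fun m => θ p.2 m (R p.1 m)) ∘ (extChartAt 𝓘(ℝ, E) c).symm) x) x := by
    have h2 : μ n ∘ (extChartAt 𝓘(ℝ, E) c).symm = fun y =>
        ∑ p ∈ Finset.HasAntidiagonal.antidiagonal n,
          ((fun m => θ p.2 m (R p.1 m)) ∘ (extChartAt 𝓘(ℝ, E) c).symm) y := by
      funext y; exact hμ n _
    rw [h2]
    refine HasFDerivAt.fun_sum fun p _ => ?_
    exact (((contDiffOn_chart_self (hsm p.1 p.2) c).contDiffAt
      ((isOpen_chart_target c).mem_nhds hx)).differentiableAt (by simp)).hasFDerivAt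
  rw [h1.fderiv]
  have h3 := hlie n m (chartSymmD c x w)
  have hswap : ∑ p ∈ Finset.HasAntidiagonal.antidiagonal n,
      taylorCoeff (fun ε => twoTensorInChart (Ω ε) c x) p.1 (vectorInChart (R p.2) c x) w =
      ∑ p ∈ Finset.HasAntidiagonal.antidiagonal n,
      taylorCoeff (fun ε => twoTensorInChart (Ω ε) c x) p.2 (vectorInChart (R p.1) c x) w :=
    (Finset.Nat.sum_antidiagonal_swap (n := n)
      (f := fun p : ℕ × ℕ => taylorCoeff (fun ε => twoTensorInChart (Ω ε) c x) p.1
        (vectorInChart (R p.2) c x) w)).symm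
  simp only [sum_apply]
  rw [hswap, ← sub_eq_zero, ← Finset.sum_sub_distrib]
  refine Eq.trans (Finset.sum_congr rfl fun p _ => ?_) h3
  rw [← dFun_chartSymmD hx ((hsm p.1 p.2).mdifferentiableAt (by simp)), sub_eq_neg_add]
  refine congrArg₂ (· + ·) ?_ rfl
  exact neg_eq_iff_eq_neg.2 ((taylorCoeff_twoTensor_apply hΩ hx w p.2).symm.trans (hθΩ p.2 m _ _))

theorem localSystem_chart (hΩ : IsExactBarelySymplectic Ω) (hX : SmoothVectorFamily X)
    (hH : SmoothFunctionFamily (E := E) H) (hHX : ∀ ε m v, Ω ε m (X ε m) v = dFun (H ε) m v)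
    (hR : ∀ n, SmoothVectorField (R n)) (hθ : ∀ n, SmoothOneForm (θ n))
    (hθΩ : ∀ n m u w, taylorCoeff (fun ε => Ω ε m u w) n = -dOne (θ n) m u w)
    (hlie : ∀ n m w, ∑ p ∈ Finset.HasAntidiagonal.antidiagonal n,
      lieOne (R p.1) (θ p.2) m w = 0)
    (hμ : ∀ n m, μ n m = ∑ p ∈ Finset.HasAntidiagonal.antidiagonal n, θ p.2 m (R p.1 m)) (c : M) :
    LocalSystem (extChartAt 𝓘(ℝ, E) c).target (fun p => twoTensorInChart (Ω p.1) c p.2)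
      (fun p => vectorInChart (X p.1) c p.2)
      (fun p => H p.1 ((extChartAt 𝓘(ℝ, E) c).symm p.2))
      (fun n => vectorInChart (R n) c) (fun n => μ n ∘ (extChartAt 𝓘(ℝ, E) c).symm) where
  isOpen := isOpen_chart_target c
  form := (contDiffOn_twoTensorFamily_chart hΩ.smooth c).mono (prod_mono_left (subset_univ _))
  exact := by
    obtain ⟨ϑ, hϑ, hϑΩ⟩ := hΩ.exact
    refine ⟨fun p => oneFormInChart (ϑ p.1) c p.2,
      (contDiffOn_oneFormFamily_chart hϑ c).mono (prod_mono_left (subset_univ _)),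
      fun ε _ x hx u w => ?_⟩
    have hs : SmoothOneForm (ϑ ε) := hϑ.comp (contMDiff_const.prodMk contMDiff_id)
    exact (hϑΩ ε _ _ _).trans (congrArg Neg.neg (dOne_chartSymmD hs hx u w))
  field := (contDiffOn_vectorFamily_chart hX c).mono (prod_mono_left (subset_univ _))
  energy := (contDiffOn_chart_of_contMDiff hH c).mono (prod_mono_left (subset_univ _))
  hamiltonian := by
    intro ε _ x hx
    ext w
    have h1 : ContMDiff 𝓘(ℝ, E) 𝓘(ℝ, ℝ) ∞ (H ε) := contMDiff_slice hH ε
    have h2 := dFun_chartSymmD hx (h1.mdifferentiableAt (by simp)) w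
    refine Eq.trans ?_ h2
    refine Eq.trans ?_ (hHX ε _ _)
    change (show E →L[ℝ] E →L[ℝ] ℝ from Ω ε ((extChartAt 𝓘(ℝ, E) c).symm x))
      (chartSymmD c x (vectorInChart (X ε) c x)) (chartSymmD c x w) = _
    rw [chartSymmD_vectorInChart (X ε) hx]
    rfl
  symm := fun n => contDiffOn_vectorField_chart (hR n) c
  momentum := fun n => contDiffOn_chart_self (contMDiff_momentum hR hθ hμ n) c
  fderiv_momentum := fderiv_momentum_chart hΩ.smooth hR hθ hθΩ hlie hμ c

end SystemInChart

/-! ### Invariance of the adiabatic invariant -/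

section RotoSystems

variable {E : Type*} [NormedAddCommGroup E] [NormedSpace ℝ E] [FiniteDimensional ℝ E]
  {M : Type*} [TopologicalSpace M] [ChartedSpace E M] [IsManifold 𝓘(ℝ, E) ∞ M]

/-- A nearly periodic Hamiltonian system with its roto-rate `R`, an invariant primitive `θ` of the
symplectic form and its adiabatic invariant `μ`. -/
structure RotoSystem
    (Ω : ℝ → (m : M) → TangentSpace 𝓘(ℝ, E) m →L[ℝ] TangentSpace 𝓘(ℝ, E) m →L[ℝ] ℝ)
    (X : ℝ → (m : M) → TangentSpace 𝓘(ℝ, E) m) (R₀ : (m : M) → TangentSpace 𝓘(ℝ, E) m)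
    (H : ℝ → M → ℝ) (R : ℕ → (m : M) → TangentSpace 𝓘(ℝ, E) m)
    (θ : ℕ → (m : M) → TangentSpace 𝓘(ℝ, E) m →L[ℝ] ℝ) (μ : ℕ → M → ℝ) : Prop where
  symplectic : IsExactBarelySymplectic Ω
  field : SmoothVectorFamily X
  circle : GeneratesCircleAction R₀
  energy : SmoothFunctionFamily (E := E) H
  hamiltonian : ∀ ε m v, Ω ε m (X ε m) v = dFun (H ε) m v
  roto : IsRotoRate X R₀ R
  form : ∀ n, SmoothOneForm (θ n)
  exact : ∀ n m u w, taylorCoeff (fun ε => Ω ε m u w) n = -dOne (θ n) m u w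
  invariant : ∀ n m w, ∑ p ∈ Finset.HasAntidiagonal.antidiagonal n, lieOne (R p.1) (θ p.2) m w = 0
  momentum : ∀ n m, μ n m = ∑ p ∈ Finset.HasAntidiagonal.antidiagonal n, θ p.2 m (R p.1 m)

variable {Ω : ℝ → (m : M) → TangentSpace 𝓘(ℝ, E) m →L[ℝ] TangentSpace 𝓘(ℝ, E) m →L[ℝ] ℝ}
  {X : ℝ → (m : M) → TangentSpace 𝓘(ℝ, E) m} {R₀ : (m : M) → TangentSpace 𝓘(ℝ, E) m}
  {H : ℝ → M → ℝ} {R : ℕ → (m : M) → TangentSpace 𝓘(ℝ, E) m}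
  {θ : ℕ → (m : M) → TangentSpace 𝓘(ℝ, E) m →L[ℝ] ℝ} {μ : ℕ → M → ℝ}

namespace RotoSystem

theorem localSystem (h : RotoSystem Ω X R₀ H R θ μ) (c : M) :
    LocalSystem (extChartAt 𝓘(ℝ, E) c).target (fun p => twoTensorInChart (Ω p.1) c p.2)
      (fun p => vectorInChart (X p.1) c p.2)
      (fun p => H p.1 ((extChartAt 𝓘(ℝ, E) c).symm p.2))
      (fun n => vectorInChart (R n) c) (fun n => μ n ∘ (extChartAt 𝓘(ℝ, E) c).symm) :=
  localSystem_chart h.symplectic h.field h.energy h.hamiltonian h.roto.smooth h.form h.exact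
    h.invariant h.momentum c

theorem contMDiff_momentum (h : RotoSystem Ω X R₀ H R θ μ) (n : ℕ) :
    ContMDiff 𝓘(ℝ, E) 𝓘(ℝ, ℝ) ∞ (μ n) :=
  NearlyPeriodic.contMDiff_momentum h.roto.smooth h.form h.momentum n

theorem contMDiff_energyCoeff (h : RotoSystem Ω X R₀ H R θ μ) (n : ℕ) :
    ContMDiff 𝓘(ℝ, E) 𝓘(ℝ, ℝ) ∞ (fun m => taylorCoeff (fun ε => H ε m) n) :=
  contMDiff_of_chart_self fun c => contDiffOn_taylorCoeff one_pos (isOpen_chart_target c)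
    (h.localSystem c).energy n

/-- The coefficients of the formal derivative of the Hamiltonian along the roto-rate. -/
def energyRate (H : ℝ → M → ℝ) (R : ℕ → (m : M) → TangentSpace 𝓘(ℝ, E) m) (n : ℕ) (m : M) : ℝ :=
  ∑ p ∈ Finset.HasAntidiagonal.antidiagonal n,
    dFun (fun m => taylorCoeff (fun ε => H ε m) p.1) m (R p.2 m)

theorem energyRate_chart (h : RotoSystem Ω X R₀ H R θ μ) (n : ℕ) {c : M} {x : E}
    (hx : x ∈ (extChartAt 𝓘(ℝ, E) c).target) :
    energyRate H R n ((extChartAt 𝓘(ℝ, E) c).symm x) =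
      ∑ p ∈ Finset.HasAntidiagonal.antidiagonal n, fderiv ℝ (fun y =>
        taylorCoeff (fun ε => H ε ((extChartAt 𝓘(ℝ, E) c).symm y)) p.1) x
          (vectorInChart (R p.2) c x) :=
  Finset.sum_congr rfl fun p _ => dFun_eq_fderiv_chart (h.contMDiff_energyCoeff p.1) (R p.2) hx

theorem contMDiff_energyRate (h : RotoSystem Ω X R₀ H R θ μ) (n : ℕ) :
    ContMDiff 𝓘(ℝ, E) 𝓘(ℝ, ℝ) ∞ (energyRate H R n) := by
  refine contMDiff_finsetSum fun p _ => ?_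
  have h1 : ContMDiff (𝓘(ℝ, ℝ).prod 𝓘(ℝ, E)) 𝓘(ℝ, ℝ) ∞
      (fun q : ℝ × M => taylorCoeff (fun ε => H ε q.2) p.1) :=
    (h.contMDiff_energyCoeff p.1).comp contMDiff_snd
  exact contMDiff_slice (contMDiff_dFun_vectorField h1 (h.roto.smooth p.2)) 0

theorem dFun_eq_fderiv_self {f : M → ℝ} (hf : ContMDiff 𝓘(ℝ, E) 𝓘(ℝ, ℝ) ∞ f) (m : M)
    (v : TangentSpace 𝓘(ℝ, E) m) :
    dFun f m v = fderiv ℝ (f ∘ (extChartAt 𝓘(ℝ, E) m).symm) (extChartAt 𝓘(ℝ, E) m m) v := by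
  have h1 := dFun_chartSymmD (mem_extChartAt_target (I := 𝓘(ℝ, E)) m)
    (hf.mdifferentiableAt (by simp)) v
  rw [← h1]
  have key : ∀ m', m' = m → (mfderiv 𝓘(ℝ, E) 𝓘(ℝ, ℝ) f m : E →L[ℝ] ℝ) v =
      (mfderiv 𝓘(ℝ, E) 𝓘(ℝ, ℝ) f m' : E →L[ℝ] ℝ) (chartSymmD m (extChartAt 𝓘(ℝ, E) m m) v) := by
    rintro _ rfl
    rw [chartSymmD_self]
    rfl
  exact key _ (extChartAt_to_inv m)

theorem dFun_energyRate (h : RotoSystem Ω X R₀ H R θ μ) (n : ℕ) (m : M)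
    (v : TangentSpace 𝓘(ℝ, E) m) : dFun (energyRate H R n) m v = 0 := by
  rw [dFun_eq_fderiv_self (h.contMDiff_energyRate n)]
  have hm := mem_extChartAt_target (I := 𝓘(ℝ, E)) m
  have h1 := (h.localSystem m).coeff_fderiv_energy hm (fun n => ?_) n
  · have h2 : (energyRate H R n ∘ (extChartAt 𝓘(ℝ, E) m).symm) =ᶠ[𝓝 (extChartAt 𝓘(ℝ, E) m m)]
        fun x => ∑ p ∈ Finset.HasAntidiagonal.antidiagonal n, fderiv ℝ (fun y =>
          taylorCoeff (fun ε => H ε ((extChartAt 𝓘(ℝ, E) m).symm y)) p.1) x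
            (vectorInChart (R p.2) m x) := by
      filter_upwards [(isOpen_chart_target m).mem_nhds hm] with x hx using h.energyRate_chart n hx
    rw [h2.fderiv_eq]
    exact congrArg (fun L : E →L[ℝ] ℝ => L v) h1
  · have h3 := h.roto.commute n m
    have h4 : ∑ p ∈ Finset.HasAntidiagonal.antidiagonal n,
        (show E from VectorField.mlieBracket 𝓘(ℝ, E) (vectorCoeff X p.1) (R p.2) m) = 0 := h3
    -- The coordinate lemma uses DX(V) - DV(X), the opposite sign to the Lie bracket.
    rw [← neg_eq_zero, ← Finset.sum_neg_distrib]
    refine Eq.trans (Finset.sum_congr rfl fun p _ => ?_) h4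
    rw [mlieBracket_eq_chart, neg_sub]
    have h5 : ∀ k, vectorInChart (vectorCoeff X k) m =
        fun y => taylorCoeff (fun ε => vectorInChart (X ε) m y) k := fun k =>
      funext fun y => vectorInChart_vectorCoeff h.field k m y
    rw [h5]

/-- Each coefficient of L_R H has zero differential, so H + τ L_R H is an exact solution of the
transport equation, affine in τ. Periodicity under τ = 2π is only possible if the slope vanishes. -/
theorem energyRate_eq_zero (h : RotoSystem Ω X R₀ H R θ μ) (n : ℕ) (m : M) :
    energyRate H R n m = 0 := by
  have h1 := h.roto.periodic (fun τ n m => taylorCoeff (fun ε => H ε m) n + τ * energyRate H R n m)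
    ?_ ?_ n m
  · simp only [zero_mul, add_zero] at h1
    have h2 : 2 * Real.pi * energyRate H R n m = 0 := by linarith
    exact (mul_eq_zero.1 h2).resolve_left (by positivity)
  · intro n
    exact ((h.contMDiff_energyCoeff n).comp contMDiff_snd).add
      (contMDiff_fst.mul ((h.contMDiff_energyRate n).comp contMDiff_snd))
  · intro τ n m
    have h2 : HasDerivAt (fun τ => taylorCoeff (fun ε => H ε m) n + τ * energyRate H R n m)
        (energyRate H R n m) τ := by
      simpa using ((hasDerivAt_id τ).mul_const (energyRate H R n m)).const_add
        (taylorCoeff (fun ε => H ε m) n)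
    refine h2.congr_deriv ?_
    rw [energyRate, ← Finset.Nat.sum_antidiagonal_swap]
    refine Finset.sum_congr rfl fun p _ => ?_
    have h3 := ((h.contMDiff_energyCoeff p.2).mdifferentiableAt (x := m) (by simp)).hasMFDerivAt
    have h4 := ((h.contMDiff_energyRate p.2).mdifferentiableAt (x := m) (by simp)).hasMFDerivAt
    have h5 := (h3.add (h4.const_smul τ)).mfderiv
    have h6 : dFun (fun m => taylorCoeff (fun ε => H ε m) p.2 + τ * energyRate H R p.2 m) m
        (R p.1 m) = dFun (fun m => taylorCoeff (fun ε => H ε m) p.2) m (R p.1 m) +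
          τ * dFun (energyRate H R p.2) m (R p.1 m) :=
      congrArg (fun L : E →L[ℝ] ℝ => L (R p.1 m)) h5
    rw [h6, h.dFun_energyRate, mul_zero, add_zero]
    rfl

theorem exists_drift (h : RotoSystem Ω X R₀ H R θ μ) (K : ℕ) (c : M) :
    ∃ B : ℝ × E → ℝ, ContDiffOn ℝ ∞ B (Ioo (-1) 1 ×ˢ (extChartAt 𝓘(ℝ, E) c).target) ∧
      ∀ ε ∈ Ioo (-1 : ℝ) 1, ∀ x ∈ (extChartAt 𝓘(ℝ, E) c).target,
      fderiv ℝ (fun y => truncSum K (fun n => μ n ((extChartAt 𝓘(ℝ, E) c).symm y)) ε) x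
        (vectorInChart (X ε) c x) = ε ^ K • B (ε, x) :=
  (h.localSystem c).exists_drift (fun n x hx => by
    rw [← h.energyRate_chart n hx, h.energyRate_eq_zero]) K

theorem contMDiff_truncSum_momentum (h : RotoSystem Ω X R₀ H R θ μ) (K : ℕ) (ε : ℝ) :
    ContMDiff 𝓘(ℝ, E) 𝓘(ℝ, ℝ) ∞ (fun m => truncSum K (fun n => μ n m) ε) :=
  contMDiff_finsetSum fun n _ => contMDiff_const.mul (h.contMDiff_momentum n)

/-- The truncated adiabatic invariant is conserved up to the order of the truncation, uniformly on
compact sets. -/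
theorem exists_drift_bound (h : RotoSystem Ω X R₀ H R θ μ) (K : ℕ) {C : Set M} (hC : IsCompact C) :
    ∃ B : ℝ, 0 ≤ B ∧ ∀ ε : ℝ, |ε| ≤ 1 / 2 → ∀ m ∈ C,
      |dFun (fun y => truncSum K (fun n => μ n y) ε) m (X ε m)| ≤ B * |ε| ^ K := by
  refine hC.induction_on (p := fun C => ∃ B : ℝ, 0 ≤ B ∧ ∀ ε : ℝ, |ε| ≤ 1 / 2 → ∀ m ∈ C,
      |dFun (fun y => truncSum K (fun n => μ n y) ε) m (X ε m)| ≤ B * |ε| ^ K) ?_ ?_ ?_ ?_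
  · exact ⟨0, le_rfl, by simp⟩
  · rintro s t hst ⟨B, hB, h1⟩
    exact ⟨B, hB, fun ε hε m hm => h1 ε hε m (hst hm)⟩
  · rintro s t ⟨B, hB, h1⟩ ⟨B', hB', h2⟩
    refine ⟨B + B', by positivity, fun ε hε m hm => ?_⟩
    have hp : 0 ≤ |ε| ^ K := by positivity
    rcases hm with hm | hm
    · nlinarith [h1 ε hε m hm, mul_nonneg hB' hp]
    · nlinarith [h2 ε hε m hm, mul_nonneg hB hp]
  · intro c _
    obtain ⟨B, hB, hB'⟩ := h.exists_drift K c
    obtain ⟨r, hr, hball⟩ := Metric.nhds_basis_closedBall.mem_iff.1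
      ((isOpen_chart_target (E := E) c).mem_nhds (mem_extChartAt_target c))
    -- Restricting to |ε| ≤ 1/2 keeps a compact parameter set inside the interval (-1, 1) on which
    -- the remainder is defined.
    have hcomp : IsCompact (Icc (-(1 / 2) : ℝ) (1 / 2) ×ˢ
      Metric.closedBall (extChartAt 𝓘(ℝ, E) c c) r) := isCompact_Icc.prod (isCompact_closedBall _ _)
    obtain ⟨D, hD⟩ := hcomp.exists_bound_of_continuousOn (f := B) (hB.continuousOn.mono
      (prod_mono (Icc_subset_Ioo (by norm_num) (by norm_num)) hball))
    refine ⟨_, mem_nhdsWithin_of_mem_nhds (Filter.inter_mem (extChartAt_source_mem_nhds (I := 𝓘(ℝ, E)) c)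
      ((continuousAt_extChartAt (I := 𝓘(ℝ, E)) c).preimage_mem_nhds
        (Metric.closedBall_mem_nhds _ hr))), max D 0, le_max_right _ _, fun ε hε m hm => ?_⟩
    have hεm := abs_le.1 hε
    have hx := (extChartAt 𝓘(ℝ, E) c).map_source hm.1
    have h1 := hB' ε ⟨by linarith, by linarith⟩ _ hx
    have h2 := dFun_eq_fderiv_chart (h.contMDiff_truncSum_momentum K ε) (X ε) hx
    have h3 : dFun (fun y => truncSum K (fun n => μ n y) ε) m (X ε m) =
        ε ^ K • B (ε, extChartAt 𝓘(ℝ, E) c m) := by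
      rw [← h1]
      refine Eq.trans ?_ h2
      rw [(extChartAt 𝓘(ℝ, E) c).left_inv hm.1]
    rw [h3, smul_eq_mul, abs_mul, abs_pow, mul_comm]
    gcongr
    have h4 := hD (ε, extChartAt 𝓘(ℝ, E) c m) ⟨⟨by linarith, by linarith⟩, hm.2⟩
    exact h4.trans (le_max_left _ _)

/-- If the limiting roto-rate vanishes identically, then so does the roto-rate. -/
theorem roto_eq_zero [T2Space M] (h : RotoSystem Ω X R₀ H R θ μ) (h0 : ∀ m, R₀ m = 0) (n : ℕ) :
    ∀ m, R n m = 0 := by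
  induction n using Nat.strong_induction_on with
  | _ n ih =>
    rcases Nat.eq_zero_or_pos n with rfl | hn
    · rw [h.roto.leading]; exact h0
    intro c
    obtain ⟨ρ, hρ, C, hC, hz⟩ := exists_near_zero_chart h.circle h.roto.smooth h.roto.leading
      h.roto.periodic (h0 c) (K := n + 1) (by omega)
    have hV : ∀ ε x, truncSum (n + 1) (fun k => vectorInChart (R k) c x) ε =
        ε ^ n • vectorInChart (R n) c x := by
      intro ε x
      rw [truncSum, Finset.sum_range_succ, Finset.sum_eq_zero, zero_add]
      intro k hk
      have : vectorInChart (R k) c x = 0 := by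
        have h1 := ih k (Finset.mem_range.1 hk) ((extChartAt 𝓘(ℝ, E) c).symm x)
        rw [vectorInChart, h1]
        exact map_zero (chartD c _)
      rw [this, smul_zero]
    set x₀ := extChartAt 𝓘(ℝ, E) c c with hx₀
    set W := vectorInChart (R n) c with hW
    -- When the lower orders vanish, the truncation at order n + 1 is εⁿ R_n. The approximate zero
    -- m'(ε) thus satisfies R_n(m') = O(ε) after cancelling |ε|ⁿ, and it tends to x₀, so R_n(x₀) = 0
    -- by continuity. The point x₀ serves as a default where the estimate is not available.
    have hseq : ∀ ε : ℝ, ∃ m', |ε| ≤ ρ → |ε| ≤ 1 → ε ≠ 0 →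
        ‖m' - x₀‖ ≤ C * (|ε| * ‖W x₀‖) ∧ ‖W m'‖ ≤ C * |ε| := by
      intro ε
      by_cases hε : |ε| ≤ ρ ∧ |ε| ≤ 1 ∧ ε ≠ 0
      · obtain ⟨m', -, h1, h2⟩ := hz ε hε.1 x₀ (Metric.mem_closedBall_self hρ.le)
        rw [hV, norm_smul, norm_pow, Real.norm_eq_abs] at h1 h2
        refine ⟨m', fun _ _ _ => ⟨h1.trans ?_, ?_⟩⟩
        · gcongr
          exact pow_le_of_le_one (abs_nonneg _) hε.2.1 (by omega)
        · have hp : 0 < |ε| ^ n := pow_pos (abs_pos.2 hε.2.2) n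
          refine le_of_mul_le_mul_left (h2.trans (le_of_eq ?_)) hp
          rw [pow_succ]; ring
      · exact ⟨x₀, fun h1 h2 h3 => absurd ⟨h1, h2, h3⟩ hε⟩
    choose m' hm' using hseq
    have habs : Tendsto (fun ε : ℝ => |ε|) (𝓝[≠] 0) (𝓝 0) := by
      have := (continuous_abs (G := ℝ)).tendsto 0
      rw [abs_zero] at this
      exact this.mono_left nhdsWithin_le_nhds
    have hev : ∀ᶠ ε : ℝ in 𝓝[≠] 0, |ε| ≤ ρ ∧ |ε| ≤ 1 ∧ ε ≠ 0 := by
      filter_upwards [habs.eventually_le_const hρ, habs.eventually_le_const one_pos,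
        self_mem_nhdsWithin] with ε h1 h2 h3 using ⟨h1, h2, h3⟩
    have hlim : Tendsto m' (𝓝[≠] 0) (𝓝 x₀) := by
      rw [tendsto_iff_norm_sub_tendsto_zero]
      have h1 : Tendsto (fun ε : ℝ => C * (|ε| * ‖W x₀‖)) (𝓝[≠] 0) (𝓝 0) := by
        simpa using (habs.mul_const ‖W x₀‖).const_mul C
      refine squeeze_zero' (Eventually.of_forall fun _ => norm_nonneg _) ?_ h1
      filter_upwards [hev] with ε hε using (hm' ε hε.1 hε.2.1 hε.2.2).1
    have hWc : ContinuousAt W x₀ :=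
      (contDiffOn_vectorField_chart (h.roto.smooth n) c).continuousOn.continuousAt
        ((isOpen_chart_target c).mem_nhds (mem_extChartAt_target c))
    have hW0 : Tendsto (fun ε => W (m' ε)) (𝓝[≠] 0) (𝓝 0) := by
      have h1 : Tendsto (fun ε : ℝ => C * |ε|) (𝓝[≠] 0) (𝓝 0) := by
        simpa using habs.const_mul C
      refine squeeze_zero_norm' ?_ h1
      filter_upwards [hev] with ε hε using (hm' ε hε.1 hε.2.1 hε.2.2).2
    have h3 := tendsto_nhds_unique (hWc.tendsto.comp hlim) hW0
    rw [hW, hx₀, vectorInChart_self] at h3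
    exact h3

/-- The relation between the truncated roto-rate and adiabatic invariant in a chart. -/
theorem exists_sharp_remainder (h : RotoSystem Ω X R₀ H R θ μ) {d : ℕ}
    (hd : HasRegularPoisson Ω d) (c : M) :
    ∃ j : ℝ × E → (E →L[ℝ] ℝ) →L[ℝ] E,
      ContDiffOn ℝ ∞ j (Ioo (-1) 1 ×ˢ (extChartAt 𝓘(ℝ, E) c).target) ∧ ∀ K : ℕ,
    ∃ B : ℝ × E → E, ContDiffOn ℝ ∞ B (Ioo (-1) 1 ×ˢ (extChartAt 𝓘(ℝ, E) c).target) ∧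
      ∀ ε ∈ Ioo (-1 : ℝ) 1, ε ≠ 0 → ∀ x ∈ (extChartAt 𝓘(ℝ, E) c).target,
        ε ^ d • truncSum K (fun n => vectorInChart (R n) c x) ε =
        -j (ε, x) (fderiv ℝ (fun y =>
          truncSum K (fun n => μ n ((extChartAt 𝓘(ℝ, E) c).symm y)) ε) x) + ε ^ K • B (ε, x) := by
  obtain ⟨j, hj, hjΩ⟩ := hd
  have hjs : ContDiffOn ℝ ∞ (fun p : ℝ × E => sharpInChart (j p.1) c p.2)
      (Ioo (-1) 1 ×ˢ (extChartAt 𝓘(ℝ, E) c).target) :=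
    (contDiffOn_sharpFamily_chart hj c).mono (prod_mono_left (subset_univ _))
  exact ⟨_, hjs, (h.localSystem c).exists_sharp_remainder hjs fun ε hε x hx v =>
    sharpInChart_twoTensorInChart (hjΩ ε hε) hx v⟩

theorem truncSum_vanishing {a : ℕ → ℝ} {ν : ℕ} (ha : ∀ n < ν, a n = 0) (L : ℕ) (ε : ℝ) :
    truncSum (ν + L) a ε = ε ^ ν * truncSum L (fun n => a (ν + n)) ε := by
  rw [truncSum, Finset.sum_range_add, Finset.sum_eq_zero, zero_add, truncSum, Finset.mul_sum]
  · exact Finset.sum_congr rfl fun n _ => by simp only [smul_eq_mul]; ring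
  · intro n hn
    rw [ha n (Finset.mem_range.1 hn), smul_zero]

/-- If ν > d, the relation ε^d R = -j dμ + remainder forces the truncated roto-rate to be O(ε),
hence R₀ = 0 everywhere. Then R and therefore μ vanish to all orders, which contradicts the
existence of a largest vanishing order. This makes the natural-number difference d - ν the true one.
-/
theorem vanishingIndex_le [T2Space M] (h : RotoSystem Ω X R₀ H R θ μ) {d ν : ℕ}
    (hd : HasRegularPoisson Ω d) (hν : HasVanishingIndex μ ν) : ν ≤ d := by
  by_contra hlt
  push Not at hlt
  have h0 : ∀ m, R₀ m = 0 := by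
    intro c
    obtain ⟨j, hj, hjB⟩ := h.exists_sharp_remainder hd c
    obtain ⟨B, hB, hB'⟩ := hjB (ν + 1)
    set x₀ := extChartAt 𝓘(ℝ, E) c c with hx₀
    have hx := mem_extChartAt_target (I := 𝓘(ℝ, E)) c
    have hO := isOpen_chart_target (E := E) c
    have hμν : ∀ ε : ℝ, fderiv ℝ (fun y =>
        truncSum (ν + 1) (fun n => μ n ((extChartAt 𝓘(ℝ, E) c).symm y)) ε) x₀ =
        ε ^ ν • fderiv ℝ (μ ν ∘ (extChartAt 𝓘(ℝ, E) c).symm) x₀ := by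
      intro ε
      have h1 : (fun y => truncSum (ν + 1) (fun n => μ n ((extChartAt 𝓘(ℝ, E) c).symm y)) ε) =
          fun y => ε ^ ν • (μ ν ∘ (extChartAt 𝓘(ℝ, E) c).symm) y := by
        funext y
        rw [truncSum_vanishing (fun n hn => hν.1 n hn _)]
        simp [truncSum]
      rw [h1]
      refine HasFDerivAt.fderiv (HasFDerivAt.const_smul ?_ (ε ^ ν))
      exact DifferentiableAt.hasFDerivAt (((contDiffOn_chart_self (h.contMDiff_momentum ν) c).contDiffAt
        (hO.mem_nhds hx)).differentiableAt (by simp))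
    have hlim1 : Tendsto (fun ε : ℝ => truncSum (ν + 1) (fun n => vectorInChart (R n) c x₀) ε)
        (𝓝[≠] 0) (𝓝 (vectorInChart (R 0) c x₀)) := by
      have h1 : Continuous fun ε : ℝ =>
          truncSum (ν + 1) (fun n => vectorInChart (R n) c x₀) ε := by
        unfold truncSum; fun_prop
      have h2 := h1.tendsto 0
      rw [truncSum_zero_right (by omega)] at h2
      exact h2.mono_left nhdsWithin_le_nhds
    -- The truncation order is ν + 1, so after division by ε^d the right-hand side still has a
    -- factor ε; the exponents here are what remains after that factor is taken out, and ν > d makes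
    -- both subtractions exact.
    set g : ℝ → E := fun ε => -(ε ^ (ν - d - 1) • j (ε, x₀)
      (fderiv ℝ (μ ν ∘ (extChartAt 𝓘(ℝ, E) c).symm) x₀)) + ε ^ (ν - d) • B (ε, x₀) with hg
    have hgc : ContinuousAt g 0 :=
      ((((continuousAt_id).pow _).smul ((continuousAt_slice_left hO hj hx).clm_apply
        continuousAt_const)).neg).add
        (((continuousAt_id).pow _).smul (continuousAt_slice_left hO hB hx))
    have hlim2 : Tendsto (fun ε : ℝ => ε • g ε) (𝓝[≠] 0) (𝓝 0) := by
      have h1 : Tendsto (fun ε : ℝ => ε • g ε) (𝓝 0) (𝓝 ((0 : ℝ) • g 0)) :=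
        (continuousAt_id.smul hgc).tendsto
      rw [zero_smul] at h1
      exact h1.mono_left nhdsWithin_le_nhds
    have heq : (fun ε : ℝ => truncSum (ν + 1) (fun n => vectorInChart (R n) c x₀) ε) =ᶠ[𝓝[≠] 0]
        fun ε => ε • g ε := by
      have hI : Ioo (-1 : ℝ) 1 ∈ 𝓝[≠] 0 :=
        mem_nhdsWithin_of_mem_nhds (Ioo_mem_nhds (by simp) (by simp))
      filter_upwards [hI, self_mem_nhdsWithin] with ε hε h0
      have h1 := hB' ε hε h0 x₀ hx
      rw [hμν, map_smul] at h1
      have hp : ε ^ d ≠ 0 := pow_ne_zero _ h0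
      refine smul_right_injective E hp ?_
      change ε ^ d • _ = ε ^ d • (ε • g ε)
      rw [h1, hg]
      simp only [smul_add, smul_neg, smul_smul]
      congr 3
      · rw [mul_comm, ← pow_succ', ← pow_add]; congr 1; omega
      · rw [← pow_succ', ← pow_add]; congr 1; omega
    have h4 := tendsto_nhds_unique (hlim1.congr' heq) hlim2
    rw [hx₀, vectorInChart_self, h.roto.leading] at h4
    exact h4
  have h1 : ν + 1 ∈ {ν' : ℕ | ∀ n < ν', ∀ m, μ n m = 0} := by
    intro n _ m
    rw [h.momentum]
    refine Finset.sum_eq_zero fun p _ => ?_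
    rw [h.roto_eq_zero h0]
    exact map_zero (θ p.2 m)
  have := hν.2 h1
  omega

end RotoSystem

end RotoSystems

/-! ### The Riemannian distance in a chart -/

theorem dist_apply_le {F G : Type*} [NormedAddCommGroup F] [NormedSpace ℝ F]
    [NormedAddCommGroup G] [NormedSpace ℝ G] {A B : F →L[ℝ] G} {δ : ℝ} (h : dist A B ≤ δ) (v : F) :
    dist (A v) (B v) ≤ δ * ‖v‖ := by
  rw [dist_eq_norm] at h ⊢
  exact (A - B).le_of_opNorm_le h v

theorem bilin_apply_sub_le {E : Type*} [NormedAddCommGroup E] [NormedSpace ℝ E]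
    {A B : E →L[ℝ] E →L[ℝ] ℝ} {δ : ℝ} (h : dist A B ≤ δ) (v : E) :
    A v v - B v v ≤ δ * ‖v‖ ^ 2 := by
  have h1 := dist_apply_le (dist_apply_le h v) v
  rw [Real.dist_eq] at h1
  linarith [le_abs_self (A v v - B v v)]

section Distance

variable {E : Type*} [NormedAddCommGroup E] [NormedSpace ℝ E] [FiniteDimensional ℝ E]
  {M : Type*} [EMetricSpace M] [ChartedSpace E M] [IsManifold 𝓘(ℝ, E) ∞ M]
  [RiemannianBundle (fun m : M => TangentSpace 𝓘(ℝ, E) m)]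
  [IsContMDiffRiemannianBundle 𝓘(ℝ, E) ∞ E (fun m : M => TangentSpace 𝓘(ℝ, E) m)]

/-- The Riemannian norm in the preferred chart at `c`. -/
def chartNorm (c : M) (x v : E) : ℝ :=
  ‖(show TangentSpace 𝓘(ℝ, E) ((extChartAt 𝓘(ℝ, E) c).symm x) from chartSymmD c x v)‖

theorem chartNorm_nonneg (c : M) (x v : E) : 0 ≤ chartNorm c x v := norm_nonneg _

theorem chartNorm_smul (c : M) (x v : E) (t : ℝ) :
    chartNorm c x (t • v) = |t| * chartNorm c x v := by
  unfold chartNorm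
  rw [map_smul]
  exact norm_smul t (show TangentSpace 𝓘(ℝ, E) ((extChartAt 𝓘(ℝ, E) c).symm x) from
    chartSymmD c x v)

theorem chartNorm_pos {c : M} {x v : E} (hx : x ∈ (extChartAt 𝓘(ℝ, E) c).target) (hv : v ≠ 0) :
    0 < chartNorm c x v := by
  refine norm_pos_iff.2 fun h => hv ?_
  rw [← chartD_chartSymmD hx v]
  have h' : chartSymmD c x v = 0 := h
  rw [h', map_zero]

/-- In a chart, the Riemannian norm is comparable to the norm of the model space and depends on the
point in a Lipschitz way. -/
theorem exists_chartNorm_bounds (c : M) :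
    ∃ ρ > 0, ∃ C > 0, Metric.closedBall (extChartAt 𝓘(ℝ, E) c c) ρ ⊆
        (extChartAt 𝓘(ℝ, E) c).target ∧
      ∀ x ∈ Metric.closedBall (extChartAt 𝓘(ℝ, E) c c) ρ, ∀ v,
        ‖v‖ ≤ C * chartNorm c x v ∧ chartNorm c x v ≤ C * ‖v‖ ∧
        ∀ y ∈ Metric.closedBall (extChartAt 𝓘(ℝ, E) c c) ρ,
          chartNorm c x v ≤ (1 + C * ‖x - y‖) * chartNorm c y v := by
  obtain ⟨g, hg, hgn⟩ := exists_metric_chart (E := E) c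
  have hgN : ∀ x ∈ (extChartAt 𝓘(ℝ, E) c).target, ∀ v, g x v v = chartNorm c x v ^ 2 := hgn
  have hO := isOpen_chart_target (E := E) c
  have hc := mem_extChartAt_target (I := 𝓘(ℝ, E)) c
  obtain ⟨L, t, ht, hL⟩ := ((hg.contDiffAt (hO.mem_nhds hc)).of_le
    (m := 1) (by simp)).exists_lipschitzOnWith
  obtain ⟨ρ, hρ, hball⟩ := Metric.nhds_basis_closedBall.mem_iff.1
    (Filter.inter_mem (hO.mem_nhds hc) ht)
  set D := Metric.closedBall (extChartAt 𝓘(ℝ, E) c c) ρ with hD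
  have hDc : IsCompact D := isCompact_closedBall _ _
  have hcomp : IsCompact (D ×ˢ Metric.sphere (0 : E) 1) := hDc.prod (isCompact_sphere _ _)
  have hgc : ContinuousOn (fun p : E × E => g p.1 p.2 p.2) (D ×ˢ Metric.sphere (0 : E) 1) := by
    have h1 : ContinuousOn (fun p : E × E => g p.1) (D ×ˢ Metric.sphere (0 : E) 1) :=
      hg.continuousOn.comp continuousOn_fst fun p hp => (hball hp.1).1
    exact (h1.clm_apply continuousOn_snd).clm_apply continuousOn_snd
  obtain ⟨A, hA⟩ := hcomp.exists_bound_of_continuousOn hgc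
  obtain ⟨a, ha, hamin⟩ : ∃ a > 0, ∀ p ∈ D ×ˢ Metric.sphere (0 : E) 1, a ≤ g p.1 p.2 p.2 := by
    by_cases hne : (D ×ˢ Metric.sphere (0 : E) 1).Nonempty
    · obtain ⟨p, hp, hmin⟩ := hcomp.exists_isMinOn hne hgc
      refine ⟨g p.1 p.2 p.2, ?_, fun q hq => hmin hq⟩
      rw [hgN _ (hball hp.1).1]
      refine pow_pos (chartNorm_pos (hball hp.1).1 ?_) 2
      rintro h0
      have := hp.2
      simp [h0] at this
    · exact ⟨1, one_pos, fun p hp => absurd ⟨p, hp⟩ hne⟩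
  have hscale : ∀ x v, g x v v = ‖v‖ ^ 2 * g x (‖v‖⁻¹ • v) (‖v‖⁻¹ • v) ∨ v = 0 := by
    intro x v
    by_cases hv : v = 0
    · exact Or.inr hv
    · left
      have : ‖v‖ ≠ 0 := norm_ne_zero_iff.2 hv
      simp only [map_smul, smul_apply, smul_eq_mul]
      field_simp
  have hunit : ∀ v : E, v ≠ 0 → ‖v‖⁻¹ • v ∈ Metric.sphere (0 : E) 1 := by
    intro v hv
    simp [norm_smul, norm_ne_zero_iff.2 hv]
  have hlow : ∀ x ∈ D, ∀ v, a * ‖v‖ ^ 2 ≤ g x v v := by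
    intro x hx v
    rcases hscale x v with h | h
    · by_cases hv : v = 0
      · simp [hv]
      · rw [h, mul_comm]
        gcongr
        exact hamin (x, _) ⟨hx, hunit v hv⟩
    · simp [h]
  have hup : ∀ x ∈ D, ∀ v, g x v v ≤ |A| * ‖v‖ ^ 2 := by
    intro x hx v
    rcases hscale x v with h | h
    · by_cases hv : v = 0
      · simp [hv]
      · rw [h, mul_comm]
        gcongr
        exact (le_abs_self _).trans ((hA (x, _) ⟨hx, hunit v hv⟩).trans (le_abs_self A))
    · simp [h]
  -- Comparisons are made between squared norms. Since C ≥ 1, the bounds a⁻¹ ≤ C² and |A| ≤ C²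
  -- follow, and no square roots are needed.
  set C := 1 + a⁻¹ + |A| + L * a⁻¹ with hC
  have hai : 0 < a⁻¹ := inv_pos.2 ha
  have hLa : 0 ≤ (L : ℝ) * a⁻¹ := by positivity
  have hAn : 0 ≤ |A| := abs_nonneg A
  have hC1 : 1 ≤ C := by rw [hC]; linarith
  refine ⟨ρ, hρ, C, by linarith, fun x hx => (hball hx).1, fun x hx v => ⟨?_, ?_, fun y hy => ?_⟩⟩
  · refine abs_le_of_sq_le_sq' ?_ (mul_nonneg (by linarith) (chartNorm_nonneg _ _ _)) |>.2
    have h1 := hlow x hx v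
    rw [hgN x (hball hx).1] at h1
    have h2 : ‖v‖ ^ 2 ≤ a⁻¹ * chartNorm c x v ^ 2 := by
      rw [inv_mul_eq_div, le_div_iff₀ ha]; linarith
    have h3 : a⁻¹ ≤ C ^ 2 := by nlinarith
    rw [mul_pow]
    exact h2.trans (by gcongr)
  · refine abs_le_of_sq_le_sq' ?_ (mul_nonneg (by linarith) (norm_nonneg _)) |>.2
    have h1 := hup x hx v
    rw [hgN x (hball hx).1] at h1
    have h3 : |A| ≤ C ^ 2 := by nlinarith
    rw [mul_pow]
    exact h1.trans (by gcongr)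
  · refine abs_le_of_sq_le_sq' ?_ (mul_nonneg (by positivity) (chartNorm_nonneg _ _ _)) |>.2
    have h1 : g x v v - g y v v ≤ L * ‖x - y‖ * ‖v‖ ^ 2 := by
      have h2 := hL.dist_le_mul x (hball hx).2 y (hball hy).2
      rw [← dist_eq_norm x y]
      exact bilin_apply_sub_le h2 v
    have h4 := hlow y hy v
    have h5 : ‖v‖ ^ 2 ≤ a⁻¹ * g y v v := by
      rw [inv_mul_eq_div, le_div_iff₀ ha]; linarith
    rw [← hgN x (hball hx).1, mul_pow, ← hgN y (hball hy).1]
    have h6 : 0 ≤ g y v v := le_trans (by positivity) h4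
    have h7 : L * ‖x - y‖ * ‖v‖ ^ 2 ≤ L * ‖x - y‖ * (a⁻¹ * g y v v) := by gcongr
    have h8 : g x v v ≤ (1 + L * a⁻¹ * ‖x - y‖) * g y v v := by nlinarith
    refine h8.trans ?_
    gcongr
    have h9 : 0 ≤ ‖x - y‖ := norm_nonneg _
    have h10 : L * a⁻¹ * ‖x - y‖ ≤ C * ‖x - y‖ := by
      gcongr; rw [hC]; linarith
    nlinarith [mul_nonneg (by linarith : (0 : ℝ) ≤ C) h9]

variable [IsRiemannianManifold 𝓘(ℝ, E) M]

theorem mfderiv_chart_symm_comp {c : M} {σ : ℝ → E} {τ : ℝ} (hσ : DifferentiableAt ℝ σ τ)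
    (hx : σ τ ∈ (extChartAt 𝓘(ℝ, E) c).target) :
    (mfderiv 𝓘(ℝ, ℝ) 𝓘(ℝ, E) ((extChartAt 𝓘(ℝ, E) c).symm ∘ σ) τ : ℝ →L[ℝ] E) 1 =
      chartSymmD c (σ τ) (deriv σ τ) := by
  have h := mfderiv_comp τ (mdifferentiableAt_chart_symm hx) hσ.mdifferentiableAt
  rw [mfderiv_eq_fderiv] at h
  exact congrArg (fun L : ℝ →L[ℝ] E => L 1) h

theorem edist_chart_symm_le_lintegral {c : M} {σ : ℝ → E}
    (hσ : ∀ τ ∈ Icc (0 : ℝ) 1, ContDiffAt ℝ 1 σ τ ∧ σ τ ∈ (extChartAt 𝓘(ℝ, E) c).target) :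
    edist ((extChartAt 𝓘(ℝ, E) c).symm (σ 0)) ((extChartAt 𝓘(ℝ, E) c).symm (σ 1)) ≤
      ∫⁻ τ in Icc (0 : ℝ) 1, ENNReal.ofReal (chartNorm c (σ τ) (deriv σ τ)) := by
  rw [IsRiemannianManifold.out (I := 𝓘(ℝ, E))]
  refine (Manifold.riemannianEDist_le_pathELength (γ := (extChartAt 𝓘(ℝ, E) c).symm ∘ σ)
    (a := 0) (b := 1) ?_ rfl rfl zero_le_one).trans (le_of_eq ?_)
  · intro τ hτ
    have h1 : ContMDiffAt 𝓘(ℝ, E) 𝓘(ℝ, E) 1 (extChartAt 𝓘(ℝ, E) c).symm (σ τ) :=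
      ((contMDiffOn_extChartAt_symm (I := 𝓘(ℝ, E)) (n := ∞) c).contMDiffAt
        ((isOpen_chart_target c).mem_nhds (hσ τ hτ).2)).of_le (by simp)
    exact (h1.comp τ (hσ τ hτ).1.contMDiffAt).contMDiffWithinAt
  · rw [Manifold.pathELength_eq_lintegral_mfderiv_Icc]
    refine MeasureTheory.setLIntegral_congr_fun measurableSet_Icc fun τ hτ => ?_
    have h1 := mfderiv_chart_symm_comp ((hσ τ hτ).1.differentiableAt (by simp)) (hσ τ hτ).2
    have h2 : ‖(show TangentSpace 𝓘(ℝ, E) ((extChartAt 𝓘(ℝ, E) c).symm (σ τ)) from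
        (mfderiv 𝓘(ℝ, ℝ) 𝓘(ℝ, E) ((extChartAt 𝓘(ℝ, E) c).symm ∘ σ) τ : ℝ →L[ℝ] E) 1)‖ₑ =
        ENNReal.ofReal (chartNorm c (σ τ) (deriv σ τ)) := by
      rw [h1]
      exact (ofReal_norm _).symm
    exact h2

/-- Almost length minimizing curves, in a chart. -/
theorem exists_curve_of_edist_lt {c p q : M} {r : ENNReal} (hpq : edist p q < r)
    (hsrc : ∀ m, edist p m < r → m ∈ (extChartAt 𝓘(ℝ, E) c).source) :
    ∃ σ : ℝ → E, σ 0 = extChartAt 𝓘(ℝ, E) c p ∧ σ 1 = extChartAt 𝓘(ℝ, E) c q ∧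
      (∀ τ ∈ Icc (0 : ℝ) 1, ContDiffAt ℝ 1 σ τ ∧ σ τ ∈ (extChartAt 𝓘(ℝ, E) c).target ∧
        edist p ((extChartAt 𝓘(ℝ, E) c).symm (σ τ)) < r) ∧
      ∫⁻ τ in Icc (0 : ℝ) 1, ENNReal.ofReal (chartNorm c (σ τ) (deriv σ τ)) < r := by
  rw [IsRiemannianManifold.out (I := 𝓘(ℝ, E))] at hpq
  obtain ⟨γ, h0, h1, hγ, hlen, -⟩ :=
    Manifold.exists_lt_locally_constant_of_riemannianEDist_lt hpq zero_lt_one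
  have hd : ∀ τ ∈ Icc (0 : ℝ) 1, edist p (γ τ) < r := by
    intro τ hτ
    rw [IsRiemannianManifold.out (I := 𝓘(ℝ, E))]
    refine ((Manifold.riemannianEDist_le_pathELength hγ.contMDiffOn h0 rfl hτ.1).trans ?_).trans_lt
      hlen
    exact Manifold.pathELength_mono le_rfl hτ.2
  have hs : ∀ τ ∈ Icc (0 : ℝ) 1, γ τ ∈ (extChartAt 𝓘(ℝ, E) c).source := fun τ hτ =>
    hsrc _ (hd τ hτ)
  have hC : ∀ τ ∈ Icc (0 : ℝ) 1, ContDiffAt ℝ 1 (extChartAt 𝓘(ℝ, E) c ∘ γ) τ := by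
    intro τ hτ
    have h2 : ContMDiffAt 𝓘(ℝ, E) 𝓘(ℝ, E) 1 (extChartAt 𝓘(ℝ, E) c) (γ τ) :=
      (contMDiffAt_extChartAt' (I := 𝓘(ℝ, E)) (n := ∞)
        (by rw [← extChartAt_source 𝓘(ℝ, E)]; exact hs τ hτ)).of_le (by simp)
    exact (h2.comp τ hγ.contMDiffAt).contDiffAt
  have hτm : ∀ τ ∈ Icc (0 : ℝ) 1,
      (extChartAt 𝓘(ℝ, E) c).symm ((extChartAt 𝓘(ℝ, E) c ∘ γ) τ) = γ τ := fun τ hτ =>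
    (extChartAt 𝓘(ℝ, E) c).left_inv (hs τ hτ)
  refine ⟨extChartAt 𝓘(ℝ, E) c ∘ γ, by simp [h0], by simp [h1], fun τ hτ =>
    ⟨hC τ hτ, (extChartAt 𝓘(ℝ, E) c).map_source (hs τ hτ), ?_⟩, ?_⟩
  · rw [hτm τ hτ]; exact hd τ hτ
  · refine lt_of_eq_of_lt ?_ hlen
    rw [Manifold.pathELength_eq_lintegral_mfderiv_Icc]
    refine MeasureTheory.setLIntegral_congr_fun measurableSet_Icc fun τ hτ => ?_
    have h2 := mfderiv_chart_symm_comp (c := c) ((hC τ hτ).differentiableAt (by simp))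
      ((extChartAt 𝓘(ℝ, E) c).map_source (hs τ hτ))
    have hev : (extChartAt 𝓘(ℝ, E) c).symm ∘ (extChartAt 𝓘(ℝ, E) c ∘ γ) =ᶠ[𝓝 τ] γ := by
      filter_upwards [hγ.continuous.continuousAt.preimage_mem_nhds
        ((isOpen_extChartAt_source (I := 𝓘(ℝ, E)) c).mem_nhds (hs τ hτ))] with t ht
      exact (extChartAt 𝓘(ℝ, E) c).left_inv ht
    have h3 : ∀ (f : ℝ → M), f =ᶠ[𝓝 τ] γ →
        ‖(show TangentSpace 𝓘(ℝ, E) (f τ) from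
          (mfderiv 𝓘(ℝ, ℝ) 𝓘(ℝ, E) f τ : ℝ →L[ℝ] E) 1)‖ₑ =
        ‖(show TangentSpace 𝓘(ℝ, E) (γ τ) from
          (mfderiv 𝓘(ℝ, ℝ) 𝓘(ℝ, E) γ τ : ℝ →L[ℝ] E) 1)‖ₑ := by
      intro f hf
      have e1 : (mfderiv 𝓘(ℝ, ℝ) 𝓘(ℝ, E) f τ : ℝ →L[ℝ] E) = mfderiv 𝓘(ℝ, ℝ) 𝓘(ℝ, E) γ τ :=
        hf.mfderiv_eq
      rw [e1]
      have e2 := hf.eq_of_nhds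
      have : ∀ (a b : M), a = b → ∀ v : E, ‖(show TangentSpace 𝓘(ℝ, E) a from v)‖ₑ =
          ‖(show TangentSpace 𝓘(ℝ, E) b from v)‖ₑ := by
        rintro a _ rfl v; rfl
      exact this _ _ e2 _
    have h4 := h3 _ hev
    refine Eq.trans ?_ h4
    have h5 : ENNReal.ofReal (chartNorm c ((extChartAt 𝓘(ℝ, E) c ∘ γ) τ)
        (deriv (extChartAt 𝓘(ℝ, E) c ∘ γ) τ)) =
        ‖(show TangentSpace 𝓘(ℝ, E) ((extChartAt 𝓘(ℝ, E) c).symm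
          ((extChartAt 𝓘(ℝ, E) c ∘ γ) τ)) from
          (mfderiv 𝓘(ℝ, ℝ) 𝓘(ℝ, E) ((extChartAt 𝓘(ℝ, E) c).symm ∘
            (extChartAt 𝓘(ℝ, E) c ∘ γ)) τ : ℝ →L[ℝ] E) 1)‖ₑ := by
      rw [h2]
      exact ofReal_norm _
    exact h5

end Distance

/-! ### Comparison of the Riemannian distance with a chart -/

section Comparison

variable {E : Type*} [NormedAddCommGroup E] [NormedSpace ℝ E] [FiniteDimensional ℝ E]
  {M : Type*} [EMetricSpace M] [ChartedSpace E M] [IsManifold 𝓘(ℝ, E) ∞ M]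
  [RiemannianBundle (fun m : M => TangentSpace 𝓘(ℝ, E) m)]
  [IsContMDiffRiemannianBundle 𝓘(ℝ, E) ∞ E (fun m : M => TangentSpace 𝓘(ℝ, E) m)]
  [IsRiemannianManifold 𝓘(ℝ, E) M]

theorem lintegral_ofReal_mul_le {s : Set ℝ} {f : ℝ → ℝ} {a r : ℝ} (ha : 0 ≤ a)
    (h : ∫⁻ τ in s, ENNReal.ofReal (f τ) ≤ ENNReal.ofReal r) :
    ∫⁻ τ in s, ENNReal.ofReal (a * f τ) ≤ ENNReal.ofReal (a * r) := by
  simp_rw [ENNReal.ofReal_mul ha]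
  rw [MeasureTheory.lintegral_const_mul' _ _ ENNReal.ofReal_ne_top]
  gcongr

/-- Comparison of the Riemannian distance near `c` with the norm in the chart at `c`. The last
property says that homotheties of the chart contract the distance to the centre almost as they
contract the norm. -/
theorem exists_chart_comparison (c : M) :
    ∃ r₀ > 0, ∃ C > 0,
      Metric.closedBall (extChartAt 𝓘(ℝ, E) c c) r₀ ⊆ (extChartAt 𝓘(ℝ, E) c).target ∧
      (∀ x ∈ Metric.closedBall (extChartAt 𝓘(ℝ, E) c c) r₀,
        ∀ y ∈ Metric.closedBall (extChartAt 𝓘(ℝ, E) c c) r₀,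
        edist ((extChartAt 𝓘(ℝ, E) c).symm x) ((extChartAt 𝓘(ℝ, E) c).symm y) ≤
          ENNReal.ofReal (C * ‖x - y‖)) ∧
      ∀ p q : M, edist c p < ENNReal.ofReal r₀ → ∀ r < r₀, edist p q ≤ ENNReal.ofReal r →
        p ∈ (extChartAt 𝓘(ℝ, E) c).source ∧ q ∈ (extChartAt 𝓘(ℝ, E) c).source ∧
        (0 ≤ r → ‖extChartAt 𝓘(ℝ, E) c p - extChartAt 𝓘(ℝ, E) c q‖ ≤ C * r ∧
        ∀ t ∈ Icc (0 : ℝ) 1, edist p ((extChartAt 𝓘(ℝ, E) c).symm (extChartAt 𝓘(ℝ, E) c q +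
            t • (extChartAt 𝓘(ℝ, E) c p - extChartAt 𝓘(ℝ, E) c q))) ≤
          ENNReal.ofReal ((1 - t) * ((1 + C * (t * r)) * r))) := by
  obtain ⟨ρ, hρ, C, hC, hsub, hN⟩ := exists_chartNorm_bounds (E := E) c
  set φ := extChartAt 𝓘(ℝ, E) c with hφ
  set D := Metric.closedBall (φ c) ρ with hD
  have hDconv : Convex ℝ D := convex_closedBall _ _
  have hnhds : {m | m ∈ φ.source ∧ φ m ∈ D} ∈ 𝓝 c :=
    Filter.inter_mem ((isOpen_extChartAt_source (I := 𝓘(ℝ, E)) c).mem_nhds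
      (mem_extChartAt_source (I := 𝓘(ℝ, E)) c))
      ((continuousAt_extChartAt (I := 𝓘(ℝ, E)) c).preimage_mem_nhds
        (Metric.closedBall_mem_nhds _ hρ))
  obtain ⟨R, hR, hball⟩ : ∃ R > 0, ∀ m, edist c m < ENNReal.ofReal R → m ∈ φ.source ∧ φ m ∈ D := by
    obtain ⟨R, hR, h⟩ := EMetric.mem_nhds_iff.1 hnhds
    have hR' : min R 1 ≠ ⊤ := (lt_of_le_of_lt (min_le_right _ _) ENNReal.one_lt_top).ne
    refine ⟨(min R 1).toReal, ENNReal.toReal_pos (by simpa using hR.ne') hR', fun m hm => h ?_⟩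
    rw [ENNReal.ofReal_toReal hR'] at hm
    rw [Metric.mem_eball, edist_comm]
    exact hm.trans_le (min_le_left _ _)
  -- With r₀ ≤ R/2, a point within r₀ of a point within r₀ of c is still in the region where the
  -- chart bounds hold.
  set r₀ := min (R / 2) ρ with hr₀
  have hr₀R : r₀ + r₀ ≤ R := by
    have := min_le_left (R / 2) ρ
    linarith
  have hr₀p : 0 < r₀ := lt_min (by linarith) hρ
  have hloc : ∀ p, edist c p < ENNReal.ofReal r₀ → ∀ r ≤ r₀, ∀ m, edist p m < ENNReal.ofReal r →
      m ∈ φ.source ∧ φ m ∈ D := by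
    intro p hp r hr m hm
    refine hball m ((edist_triangle c p m).trans_lt ?_)
    calc edist c p + edist p m < ENNReal.ofReal r₀ + ENNReal.ofReal r := ENNReal.add_lt_add hp hm
      _ ≤ ENNReal.ofReal r₀ + ENNReal.ofReal r₀ := by gcongr
      _ = ENNReal.ofReal (r₀ + r₀) := (ENNReal.ofReal_add hr₀p.le hr₀p.le).symm
      _ ≤ ENNReal.ofReal R := ENNReal.ofReal_le_ofReal hr₀R
  have hlip : ∀ p, edist c p < ENNReal.ofReal r₀ → ∀ r ≤ r₀, ∀ q, edist p q < ENNReal.ofReal r →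
      ‖φ p - φ q‖ ≤ C * r := by
    intro p hp r hr q hq
    have hrpos : 0 < r := by
      by_contra h
      rw [ENNReal.ofReal_of_nonpos (not_lt.1 h)] at hq
      exact not_lt_zero hq
    obtain ⟨σ, h0, h1, hσ, hint⟩ := exists_curve_of_edist_lt (E := E) (c := c) hq
      fun m hm => (hloc p hp r hr m hm).1
    have hσD : ∀ τ ∈ Icc (0 : ℝ) 1, σ τ ∈ D := by
      intro τ hτ
      have := (hloc p hp r hr _ (hσ τ hτ).2.2).2
      rwa [φ.right_inv (hσ τ hτ).2.1] at this
    have h2 := enorm_sub_le_lintegral_deriv_of_contDiffOn_Icc (f := σ) (a := 0) (b := 1)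
      (fun τ hτ => (hσ τ hτ).1.contDiffWithinAt) zero_le_one
    have h3 : ∫⁻ τ in Icc (0 : ℝ) 1, ‖deriv σ τ‖ₑ ≤ ENNReal.ofReal (C * r) := by
      refine le_trans ?_ (lintegral_ofReal_mul_le hC.le hint.le)
      refine MeasureTheory.setLIntegral_mono' measurableSet_Icc fun τ hτ => ?_
      rw [← ofReal_norm]
      exact ENNReal.ofReal_le_ofReal (hN (σ τ) (hσD τ hτ) _).1
    rw [h0, h1, ← ofReal_norm, norm_sub_rev] at h2
    exact (ENNReal.ofReal_le_ofReal_iff (by positivity)).1 (h2.trans h3)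
  have hhom : ∀ p, edist c p < ENNReal.ofReal r₀ → ∀ r ≤ r₀, ∀ q, edist p q < ENNReal.ofReal r →
      ∀ t ∈ Icc (0 : ℝ) 1, edist p (φ.symm (φ q + t • (φ p - φ q))) ≤
        ENNReal.ofReal ((1 - t) * ((1 + C * (t * (C * r))) * r)) := by
    intro p hp r hr q hq t ht
    have hrpos : 0 < r := by
      by_contra h
      rw [ENNReal.ofReal_of_nonpos (not_lt.1 h)] at hq
      exact not_lt_zero hq
    obtain ⟨σ, h0, h1, hσ, hint⟩ := exists_curve_of_edist_lt (E := E) (c := c) hq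
      fun m hm => (hloc p hp r hr m hm).1
    have hσD : ∀ τ ∈ Icc (0 : ℝ) 1, σ τ ∈ D := by
      intro τ hτ
      have := (hloc p hp r hr _ (hσ τ hτ).2.2).2
      rwa [φ.right_inv (hσ τ hτ).2.1] at this
    have hps := hloc p hp r hr p (by simpa using hrpos)
    -- A nearly minimizing curve σ from p to q is contracted towards p by the factor 1 - t in the
    -- chart. Each point moves by t(φ p - σ), of norm at most t C r, so the Lipschitz dependence of
    -- the metric costs only a factor 1 + O(t r). Plain equivalence of distance and chart norm would
    -- lose a fixed factor and could not show that the distance decreases.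
    set η : ℝ → E := fun τ => (1 - t) • σ τ + t • φ p with hη
    have hηD : ∀ τ ∈ Icc (0 : ℝ) 1, η τ ∈ D := fun τ hτ =>
      hDconv (hσD τ hτ) hps.2 (by linarith [ht.2]) ht.1 (by ring)
    have hηd : ∀ τ ∈ Icc (0 : ℝ) 1, ContDiffAt ℝ 1 η τ := fun τ hτ =>
      (contDiffAt_const.smul (hσ τ hτ).1).add contDiffAt_const
    have h2 := edist_chart_symm_le_lintegral (E := E) (c := c) (σ := η)
      fun τ hτ => ⟨hηd τ hτ, hsub (hηD τ hτ)⟩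
    have e0 : φ.symm (η 0) = p := by
      have : η 0 = φ p := by simp only [hη, h0]; module
      rw [this, φ.left_inv hps.1]
    have e1 : η 1 = φ q + t • (φ p - φ q) := by simp only [hη, h1]; module
    rw [← hφ, e0, e1] at h2
    refine h2.trans ?_
    have hfac : (1 - t) * ((1 + C * (t * (C * r))) * r) =
        ((1 - t) * (1 + C * (t * (C * r)))) * r := by ring
    have h1t : 0 ≤ 1 - t := by linarith [ht.2]
    have ht0 := ht.1
    rw [hfac]
    refine le_trans ?_ (lintegral_ofReal_mul_le (by positivity) hint.le)
    refine MeasureTheory.setLIntegral_mono' measurableSet_Icc fun τ hτ => ?_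
    refine ENNReal.ofReal_le_ofReal ?_
    have hder : deriv η τ = (1 - t) • deriv σ τ := by
      have := (((hσ τ hτ).1.differentiableAt (by simp)).hasDerivAt.const_smul (1 - t)).add_const
        (t • φ p)
      exact this.deriv
    rw [hder, chartNorm_smul, abs_of_nonneg h1t, mul_assoc]
    refine mul_le_mul_of_nonneg_left ?_ h1t
    refine ((hN _ (hηD τ hτ) _).2.2 _ (hσD τ hτ)).trans ?_
    refine mul_le_mul_of_nonneg_right ?_ (chartNorm_nonneg _ _ _)
    have h5 : η τ - σ τ = t • (φ p - σ τ) := by simp only [hη]; module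
    have h6 := hlip p hp r hr _ (hσ τ hτ).2.2
    rw [φ.right_inv (hσ τ hτ).2.1] at h6
    rw [h5, norm_smul, Real.norm_of_nonneg ht0]
    gcongr
  -- The constant C · C arises from the Lipschitz constant of the metric times the chart
  -- displacement bound C r.
  refine ⟨r₀, hr₀p, max C (C * C), lt_max_of_lt_left hC,
    (Metric.closedBall_subset_closedBall (min_le_right _ _)).trans hsub, ?_, ?_⟩
  · intro x hx y hy
    replace hx := Metric.closedBall_subset_closedBall (min_le_right _ _) hx
    replace hy := Metric.closedBall_subset_closedBall (min_le_right _ _) hy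
    set η : ℝ → E := fun τ => (1 - τ) • x + τ • y with hη
    have hηD : ∀ τ ∈ Icc (0 : ℝ) 1, η τ ∈ D := fun τ hτ =>
      hDconv hx hy (by linarith [hτ.2]) hτ.1 (by ring)
    have hder : ∀ τ, HasDerivAt η (y - x) τ := by
      intro τ
      have h1 := (((hasDerivAt_id τ).const_sub 1).smul_const x).add
        ((hasDerivAt_id τ).smul_const y)
      refine h1.congr_deriv ?_
      module
    have h2 := edist_chart_symm_le_lintegral (E := E) (c := c) (σ := η)
      fun τ hτ => ⟨by simp only [hη]; fun_prop, hsub (hηD τ hτ)⟩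
    have e0 : η 0 = x := by simp [hη]
    have e1 : η 1 = y := by simp [hη]
    rw [e0, e1] at h2
    refine h2.trans ?_
    have : ∫⁻ τ in Icc (0 : ℝ) 1, ENNReal.ofReal (chartNorm c (η τ) (deriv η τ)) ≤
        ∫⁻ τ in Icc (0 : ℝ) 1, ENNReal.ofReal (max C (C * C) * ‖x - y‖) := by
      refine MeasureTheory.setLIntegral_mono' measurableSet_Icc fun τ hτ => ?_
      refine ENNReal.ofReal_le_ofReal (((hN _ (hηD τ hτ) _).2.1).trans ?_)
      rw [(hder τ).deriv, norm_sub_rev]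
      gcongr
      exact le_max_left _ _
    refine this.trans (le_of_eq ?_)
    simp
  · intro p q hp r hr hq
    -- Almost minimizing curves exist only for radii strictly above the distance. The estimates are
    -- proved for r' > r and passed to the limit r' ↓ r, which covers points at distance exactly r.
    have hev : ∀ᶠ r' in 𝓝[>] r, r' ≤ r₀ ∧ edist p q < ENNReal.ofReal r' ∨ r < 0 := by
      rcases lt_or_ge r 0 with h | h
      · exact Eventually.of_forall fun _ => Or.inr h
      · filter_upwards [Ioo_mem_nhdsGT hr] with r' hr'
        exact Or.inl ⟨hr'.2.le, hq.trans_lt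
          ((ENNReal.ofReal_lt_ofReal_iff (h.trans_lt hr'.1)).2 hr'.1)⟩
    refine ⟨(hloc p hp r₀ le_rfl p (by simpa using hr₀p)).1, (hloc p hp r₀ le_rfl q
      (hq.trans_lt ((ENNReal.ofReal_lt_ofReal_iff hr₀p).2 hr))).1, fun hr0 => ⟨?_, ?_⟩⟩
    · have hlim : Tendsto (fun r' : ℝ => C * r') (𝓝[>] r) (𝓝 (C * r)) :=
        ((continuous_const.mul continuous_id).tendsto r).mono_left nhdsWithin_le_nhds
      refine (ge_of_tendsto hlim ?_).trans (by gcongr; exact le_max_left _ _)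
      filter_upwards [hev] with r' hr'
      rcases hr' with hr' | hr'
      · exact hlip p hp r' hr'.1 q hr'.2
      · linarith
    · intro t ht
      have hlim : Tendsto (fun r' : ℝ => ENNReal.ofReal
          ((1 - t) * ((1 + C * (t * (C * r'))) * r'))) (𝓝[>] r)
          (𝓝 (ENNReal.ofReal ((1 - t) * ((1 + C * (t * (C * r))) * r)))) := by
        refine ((ENNReal.continuous_ofReal.comp ?_).tendsto r).mono_left nhdsWithin_le_nhds
        fun_prop
      refine (ge_of_tendsto hlim ?_).trans ?_
      · filter_upwards [hev] with r' hr'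
        rcases hr' with hr' | hr'
        · exact hhom p hp r' hr'.1 q hr'.2 t ht
        · linarith
      · have h1t : 0 ≤ 1 - t := by linarith [ht.2]
        have ht0 := ht.1
        refine ENNReal.ofReal_le_ofReal (mul_le_mul_of_nonneg_left (mul_le_mul_of_nonneg_right ?_
          hr0) h1t)
        have : C * (t * (C * r)) = (C * C) * (t * r) := by ring
        rw [this]
        gcongr
        exact le_max_right _ _

end Comparison

/-! ### Uniform bounds for families of maps of a normed space -/

section Bounds

variable {E : Type*} [NormedAddCommGroup E] [NormedSpace ℝ E]
  {G : Type*} [NormedAddCommGroup G] [NormedSpace ℝ G]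

/-- The derivative of a family of maps in the space variable. -/
def spaceDeriv (g : ℝ × E → G) (p : ℝ × E) : E →L[ℝ] G := fderiv ℝ (fun x => g (p.1, x)) p.2

theorem contDiffOn_spaceDeriv {g : ℝ × E → G} {W : Set (ℝ × E)} (hW : IsOpen W)
    (hg : ContDiffOn ℝ ∞ g W) : ContDiffOn ℝ ∞ (spaceDeriv g) W := by
  have h1 : ContDiffOn ℝ ∞ (fun p => (fderiv ℝ g p).comp (ContinuousLinearMap.inr ℝ ℝ E)) W :=
    (hg.fderiv_of_isOpen hW (by simp)).clm_comp contDiffOn_const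
  refine h1.congr fun p hp => ?_
  exact (hasFDerivAt_slice ((hg.contDiffAt (hW.mem_nhds hp)).differentiableAt (by simp))).fderiv

theorem hasFDerivAt_spaceDeriv {g : ℝ × E → G} {W : Set (ℝ × E)} (hW : IsOpen W)
    (hg : ContDiffOn ℝ ∞ g W) {ε : ℝ} {x : E} (hp : (ε, x) ∈ W) :
    HasFDerivAt (fun x => g (ε, x)) (spaceDeriv g (ε, x)) x :=
  (hasFDerivAt_slice ((hg.contDiffAt (hW.mem_nhds hp)).differentiableAt
    (by simp))).differentiableAt.hasFDerivAt

/-- `C` bounds the values and the variation of `g` on the ball of radius `r` about `p₀`. -/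
def BoundedNear (p₀ : ℝ × E) (C r : ℝ) (g : ℝ × E → G) : Prop :=
  ∀ p ∈ Metric.closedBall p₀ r, ‖g p‖ ≤ C ∧
    ∀ q ∈ Metric.closedBall p₀ r, ‖g p - g q‖ ≤ C * ‖p - q‖

/-- The bound holds for all large C and, given C, for all small r. In this form finitely many bounds
can be intersected into one pair (C, r). -/
theorem eventually_boundedNear {p₀ : ℝ × E} {g : ℝ × E → G} {W : Set (ℝ × E)} (hW : IsOpen W)
    (hg : ContDiffOn ℝ ∞ g W) (hp : p₀ ∈ W) :
    ∀ᶠ C in atTop, ∀ᶠ r in 𝓝[>] (0 : ℝ), BoundedNear p₀ C r g := by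
  have hg' := (hg.contDiffAt (hW.mem_nhds hp)).of_le (m := 1) (by simp)
  obtain ⟨L, t, ht, hL⟩ := hg'.exists_lipschitzOnWith
  have hb : ∀ᶠ p in 𝓝 p₀, ‖g p‖ < ‖g p₀‖ + 1 :=
    hg'.continuousAt.norm.eventually (gt_mem_nhds (by linarith))
  obtain ⟨r₀, hr₀, h⟩ := Metric.nhds_basis_closedBall.mem_iff.1 (Filter.inter_mem ht hb)
  filter_upwards [eventually_ge_atTop (max (L : ℝ) (‖g p₀‖ + 1))] with C hC
  filter_upwards [Ioo_mem_nhdsGT hr₀] with r hr p hp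
  have hsub := Metric.closedBall_subset_closedBall (x := p₀) hr.2.le
  have hp' := h (hsub hp)
  refine ⟨(le_of_lt hp'.2).trans ((le_max_right _ _).trans hC), fun q hq => ?_⟩
  have h1 := hL.dist_le_mul p hp'.1 q (h (hsub hq)).1
  rw [dist_eq_norm, dist_eq_norm] at h1
  exact h1.trans (by gcongr; exact (le_max_left _ _).trans hC)

theorem norm_taylor_one_le {φ : E → G} {φ' : E → E →L[ℝ] G} {C : ℝ} {s : Set E}
    (hs : Convex ℝ s) (hφ : ∀ x ∈ s, HasFDerivAt φ (φ' x) x)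
    (hC : ∀ x ∈ s, ∀ y ∈ s, ‖φ' x - φ' y‖ ≤ C * ‖x - y‖) (hC0 : 0 ≤ C) {x y : E} (hx : x ∈ s)
    (hy : y ∈ s) : ‖φ y - φ x - φ' x (y - x)‖ ≤ C * ‖y - x‖ ^ 2 := by
  have h1 : ∀ z ∈ segment ℝ x y, ‖φ' z - φ' x‖ ≤ C * ‖y - x‖ := by
    intro z hz
    refine (hC z (hs.segment_subset hx hy hz) x hx).trans ?_
    gcongr
    rw [← dist_eq_norm, ← dist_eq_norm, dist_comm z, dist_comm y]
    have := dist_add_dist_of_mem_segment hz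
    linarith [dist_nonneg (x := z) (y := y)]
  have h2 := (convex_segment x y).norm_image_sub_le_of_norm_hasFDerivWithin_le' (𝕜 := ℝ)
    (f := φ) (f' := φ') (φ := φ' x) (C := C * ‖y - x‖)
    (fun z hz => (hφ z (hs.segment_subset hx hy hz)).hasFDerivWithinAt) h1
    (left_mem_segment ℝ x y) (right_mem_segment ℝ x y)
  calc _ ≤ _ := h2
    _ = _ := by ring

theorem norm_taylor_two_le {φ : E → ℝ} {φ' : E → E →L[ℝ] ℝ} {φ'' : E → E →L[ℝ] E →L[ℝ] ℝ} {C : ℝ}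
    {s : Set E} (hs : Convex ℝ s) (hφ : ∀ x ∈ s, HasFDerivAt φ (φ' x) x)
    (hφ' : ∀ x ∈ s, HasFDerivAt φ' (φ'' x) x)
    (hC : ∀ x ∈ s, ∀ y ∈ s, ‖φ'' x - φ'' y‖ ≤ C * ‖x - y‖) (hC0 : 0 ≤ C) {x v : E} (hx : x ∈ s)
    (hy : x + v ∈ s) :
    |φ (x + v) - φ x - φ' x v - φ'' x v v / 2| ≤ C * ‖v‖ ^ 3 := by
  have hseg : ∀ t ∈ Icc (0 : ℝ) 1, x + t • v ∈ s := by
    intro t ht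
    have := hs hx hy (by linarith [ht.2] : 0 ≤ 1 - t) ht.1 (by ring)
    convert this using 1
    module
  set u : ℝ → ℝ := fun t => φ (x + t • v) - t * φ' x v - t ^ 2 * (φ'' x v v / 2) with hu
  have hd : ∀ t ∈ Icc (0 : ℝ) 1, HasDerivWithinAt u
      (φ' (x + t • v) v - φ' x v - t * φ'' x v v) (Icc 0 1) t := by
    intro t ht
    have h1 : HasDerivAt (fun t : ℝ => x + t • v) v t := by
      simpa using ((hasDerivAt_id t).smul_const v).const_add x
    have h2 := (hφ _ (hseg t ht)).comp_hasDerivAt t h1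
    have h3 := (h2.sub ((hasDerivAt_id t).mul_const (φ' x v))).sub
      (((hasDerivAt_id t).pow 2).mul_const (φ'' x v v / 2))
    refine (h3.congr_deriv ?_).hasDerivWithinAt
    simp
    ring
  have hb : ∀ t ∈ Ico (0 : ℝ) 1,
      ‖φ' (x + t • v) v - φ' x v - t * φ'' x v v‖ ≤ C * ‖v‖ ^ 3 := by
    intro t ht
    have ht' : t ∈ Icc (0 : ℝ) 1 := ⟨ht.1, ht.2.le⟩
    have h1 := norm_taylor_one_le hs hφ' hC hC0 hx (hseg t ht')
    have h2 : φ' (x + t • v) v - φ' x v - t * φ'' x v v =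
        (φ' (x + t • v) - φ' x - φ'' x (x + t • v - x)) v := by simp
    rw [h2]
    refine (ContinuousLinearMap.le_of_opNorm_le _ h1 v).trans ?_
    have h3 : ‖x + t • v - x‖ ≤ ‖v‖ := by
      rw [add_sub_cancel_left, norm_smul, Real.norm_of_nonneg ht.1]
      exact mul_le_of_le_one_left (norm_nonneg _) ht.2.le
    calc C * ‖x + t • v - x‖ ^ 2 * ‖v‖ ≤ C * ‖v‖ ^ 2 * ‖v‖ := by gcongr
      _ = _ := by ring
  have h := norm_image_sub_le_of_norm_deriv_le_segment' hd hb 1 (by simp)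
  have e : u 1 - u 0 = φ (x + v) - φ x - φ' x v - φ'' x v v / 2 := by
    simp only [hu]; simp; ring
  rw [e, Real.norm_eq_abs] at h
  simpa using h

end Bounds

/-- Splitting off, from a vector on which a semi-definite form is small, a vector which the form
almost annihilates. -/
theorem exists_resolvent_bound (E : Type*) [NormedAddCommGroup E] [NormedSpace ℝ E]
    [FiniteDimensional ℝ E] :
    ∃ C > 0, ∀ H : E →L[ℝ] E →L[ℝ] ℝ, (∀ u w, H u w = H w u) →
      ((∀ u, 0 ≤ H u u) ∨ (∀ u, H u u ≤ 0)) → ∀ l > 0, ∀ v, ∃ w,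
        l * ‖v - w‖ ^ 2 ≤ C * |H v v| ∧ ‖H w‖ ≤ C * (l * ‖v - w‖) := by
  -- The norm of E need not come from an inner product, so an auxiliary Euclidean form q is used;
  -- equivalence of norms accounts for the constants a and b.
  let T := toEuclidean (E := E)
  let q : E →ₗ[ℝ] E →ₗ[ℝ] ℝ := LinearMap.mk₂ ℝ (fun u w => inner ℝ (T u) (T w))
    (fun u u' w => by simp [inner_add_left]) (fun a u w => by simp [inner_smul_left])
    (fun u w w' => by simp [inner_add_right]) (fun a u w => by simp [inner_smul_right])
  have hq : ∀ u w, q u w = inner ℝ (T u) (T w) := fun u w => rfl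
  obtain ⟨a, ha, hTa⟩ : ∃ a > 0, ∀ u, ‖u‖ ≤ a * ‖T u‖ := by
    refine ⟨‖T.symm.toContinuousLinearMap‖ + 1, by positivity, fun u => ?_⟩
    have := T.symm.toContinuousLinearMap.le_opNorm (T u)
    simp only [ContinuousLinearEquiv.coe_coe, ContinuousLinearEquiv.symm_apply_apply] at this
    linarith [norm_nonneg (T u)]
  obtain ⟨b, hb, hTb⟩ : ∃ b > 0, ∀ u, ‖T u‖ ≤ b * ‖u‖ := by
    refine ⟨‖T.toContinuousLinearMap‖ + 1, by positivity, fun u => ?_⟩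
    have := T.toContinuousLinearMap.le_opNorm u
    simp only [ContinuousLinearEquiv.coe_coe] at this
    linarith [norm_nonneg u]
  have hpsd : ∀ H : E →L[ℝ] E →L[ℝ] ℝ, (∀ u w, H u w = H w u) → (∀ u, 0 ≤ H u u) →
      ∀ l > 0, ∀ v, ∃ w, l * ‖v - w‖ ^ 2 ≤ (a ^ 2 + b ^ 2) * |H v v| ∧
        ‖H w‖ ≤ (a ^ 2 + b ^ 2) * (l * ‖v - w‖) := by
    intro H hsymm hpos l hl v
    let A : E →ₗ[ℝ] E →ₗ[ℝ] ℝ := LinearMap.mk₂ ℝ (fun u w => H u w + l * q u w)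
      (fun u u' w => by simp; ring) (fun a u w => by simp; ring)
      (fun u w w' => by simp; ring) (fun a u w => by simp; ring)
    have hA : ∀ u w, A u w = H u w + l * q u w := fun u w => rfl
    have hinj : Function.Injective A := by
      refine (injective_iff_map_eq_zero A).2 fun u hu => ?_
      have h1 : A u u = 0 := by rw [hu]; rfl
      rw [hA, hq, real_inner_self_eq_norm_sq] at h1
      have h2 : ‖T u‖ ^ 2 = 0 := by nlinarith [hpos u, sq_nonneg ‖T u‖]
      have h3 : T u = 0 := by simpa using h2
      simpa using h3
    have hsurj : Function.Surjective A := by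
      refine (LinearMap.injective_iff_surjective_of_finrank_eq_finrank ?_).1 hinj
      exact (Subspace.dual_finrank_eq (K := ℝ) (V := E)).symm
    -- The vector w solves (H + l q) w = l q v, that is, it minimizes H(w, w) + l q(v - w, v - w).
    -- The scale l trades the size of v - w against the size of H w.
    obtain ⟨w, hw⟩ := hsurj (l • q v)
    have hHw : ∀ u, H w u = l * q (v - w) u := by
      intro u
      have h1 : A w u = l * q v u := by rw [hw]; rfl
      rw [hA] at h1
      have h2 : q (v - w) u = q v u - q w u := by rw [map_sub]; rfl
      rw [h2]
      linarith
    refine ⟨w, ?_, ?_⟩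
    · have h1 : H v v = H w w + 2 * H w (v - w) + H (v - w) (v - w) := by
        have h2 : v = w + (v - w) := by abel
        generalize v - w = y at h2
        subst h2
        simp only [map_add, add_apply, hsymm y w]
        ring
      -- Since H w = l q(v - w), the cross term in H(v, v) equals 2l‖T(v - w)‖², and the two
      -- remaining terms are nonnegative.
      have h3 : l * ‖T (v - w)‖ ^ 2 ≤ |H v v| := by
        have h4 := hHw (v - w)
        rw [hq, real_inner_self_eq_norm_sq] at h4
        nlinarith [hpos w, hpos (v - w), le_abs_self (H v v), sq_nonneg ‖T (v - w)‖,
          mul_nonneg hl.le (sq_nonneg ‖T (v - w)‖)]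
      have h5 : ‖v - w‖ ^ 2 ≤ a ^ 2 * ‖T (v - w)‖ ^ 2 := by
        rw [← mul_pow]
        gcongr
        exact hTa _
      calc l * ‖v - w‖ ^ 2 ≤ l * (a ^ 2 * ‖T (v - w)‖ ^ 2) := by gcongr
        _ = a ^ 2 * (l * ‖T (v - w)‖ ^ 2) := by ring
        _ ≤ a ^ 2 * |H v v| := by gcongr
        _ ≤ _ := by gcongr; nlinarith [sq_nonneg b]
    · refine ContinuousLinearMap.opNorm_le_bound _ (by positivity) fun u => ?_
      rw [hHw, hq, norm_mul, Real.norm_of_nonneg hl.le]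
      have h6 : ‖inner ℝ (T (v - w)) (T u)‖ ≤ (b * ‖v - w‖) * (b * ‖u‖) :=
        (norm_inner_le_norm _ _).trans (by gcongr <;> exact hTb _)
      calc _ ≤ l * ((b * ‖v - w‖) * (b * ‖u‖)) := by gcongr
        _ = b ^ 2 * (l * ‖v - w‖) * ‖u‖ := by ring
        _ ≤ _ := by gcongr; nlinarith [sq_nonneg a]
  refine ⟨a ^ 2 + b ^ 2, by positivity, fun H hsymm hdef l hl v => ?_⟩
  rcases hdef with h | h
  · exact hpsd H hsymm h l hl v
  · obtain ⟨w, h1, h2⟩ := hpsd (-H) (fun u w => by simp [hsymm u w]) (fun u => by simpa using h u)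
      l hl v
    exact ⟨w, by simpa using h1, by simpa using h2⟩

/-! ### Critical points of approximate invariants in a chart -/

section SlowModel

variable {E : Type*} [NormedAddCommGroup E] [NormedSpace ℝ E] [FiniteDimensional ℝ E]

/-- The coordinate data, near the point `x₀` of the limiting slow manifold, of a truncation `V` of
the roto-rate, a truncation `ρ` of the reduced adiabatic invariant, an approximation `f` of it, and
the parametrization `F` of the critical points of `f` by the zeros of `V` at `ε = 0`. -/
structure SlowModel (x₀ : E) (e : ℝ) (O : Set E) (N δ ν L : ℕ) (V : ℝ × E → E)
    (ρ f b : ℝ × E → ℝ) (j : ℝ × E → (E →L[ℝ] ℝ) →L[ℝ] E) (B F : ℝ × E → E) : Prop where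
  e_pos : 0 < e
  isOpen : IsOpen O
  mem : x₀ ∈ O
  smooth_V : ContDiffOn ℝ ∞ V (Ioo (-e) e ×ˢ O)
  smooth_ρ : ContDiffOn ℝ ∞ ρ (Ioo (-e) e ×ˢ O)
  smooth_f : ContDiffOn ℝ ∞ f (Ioo (-e) e ×ˢ O)
  smooth_b : ContDiffOn ℝ ∞ b (Ioo (-e) e ×ˢ O)
  smooth_j : ContDiffOn ℝ ∞ j (Ioo (-e) e ×ˢ O)
  smooth_B : ContDiffOn ℝ ∞ B (Ioo (-e) e ×ˢ O)
  smooth_F : ContDiffOn ℝ ∞ F (Ioo (-e) e ×ˢ O)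
  approx : ∀ ε ∈ Ioo (-e) e, ∀ x ∈ O, ρ (ε, x) = f (ε, x) + ε ^ (N + 1) * b (ε, x)
  sharp : ∀ ε ∈ Ioo (-e) e, ε ≠ 0 → ∀ x ∈ O,
    ε ^ δ • V (ε, x) = -j (ε, x) (spaceDeriv ρ (ε, x)) + ε ^ L • B (ε, x)
  near_zero : ∀ᶠ C in atTop, ∀ᶠ r in 𝓝[>] (0 : ℝ), ∀ ε, |ε| ≤ r → ∀ m ∈ Metric.closedBall x₀ r,
    ∃ m', ‖m' - m‖ ≤ C * ‖V (ε, m)‖ ∧ ‖V (ε, m')‖ ≤ C * |ε| ^ (ν + L)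
  value : ∀ᶠ C in atTop, ∀ᶠ r in 𝓝[>] (0 : ℝ), ∀ ε, |ε| ≤ r → ∀ m ∈ Metric.closedBall x₀ r,
    |ε ^ ν * ρ (ε, m)| ≤ C * ‖V (ε, m)‖ + C * |ε| ^ (ν + L)
  inclusion : ∀ x ∈ O, V (0, x) = 0 → F (0, x) = x
  index_le : 3 * δ ≤ N
  order_le : N + 2 ≤ L

namespace SlowModel

variable {x₀ : E} {e : ℝ} {O : Set E} {N δ ν L : ℕ} {V : ℝ × E → E}
  {ρ f b : ℝ × E → ℝ} {j : ℝ × E → (E →L[ℝ] ℝ) →L[ℝ] E} {B F : ℝ × E → E}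

theorem isOpen_domain (h : SlowModel x₀ e O N δ ν L V ρ f b j B F) :
    IsOpen (Ioo (-e) e ×ˢ O) := isOpen_Ioo.prod h.isOpen

theorem spaceDeriv_approx (h : SlowModel x₀ e O N δ ν L V ρ f b j B F) {p : ℝ × E}
    (hp : p ∈ Ioo (-e) e ×ˢ O) :
    spaceDeriv ρ p = spaceDeriv f p + p.1 ^ (N + 1) • spaceDeriv b p := by
  have h1 := (hasFDerivAt_spaceDeriv h.isOpen_domain h.smooth_f hp).add
    ((hasFDerivAt_spaceDeriv h.isOpen_domain h.smooth_b hp).const_smul (p.1 ^ (N + 1)))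
  refine (h1.congr_of_eventuallyEq ?_).fderiv
  filter_upwards [h.isOpen.mem_nhds hp.2] with x hx
  exact h.approx _ hp.1 x hx

theorem spaceDeriv_spaceDeriv_approx (h : SlowModel x₀ e O N δ ν L V ρ f b j B F) {p : ℝ × E}
    (hp : p ∈ Ioo (-e) e ×ˢ O) :
    spaceDeriv (spaceDeriv ρ) p = spaceDeriv (spaceDeriv f) p +
      p.1 ^ (N + 1) • spaceDeriv (spaceDeriv b) p := by
  have hW := h.isOpen_domain
  have h1 := (hasFDerivAt_spaceDeriv hW (contDiffOn_spaceDeriv hW h.smooth_f) hp).add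
    ((hasFDerivAt_spaceDeriv hW (contDiffOn_spaceDeriv hW h.smooth_b) hp).const_smul
      (p.1 ^ (N + 1)))
  refine (h1.congr_of_eventuallyEq ?_).fderiv
  filter_upwards [h.isOpen.mem_nhds hp.2] with x hx
  exact h.spaceDeriv_approx (p := (p.1, x)) ⟨hp.1, hx⟩

theorem spaceDeriv_sharp (h : SlowModel x₀ e O N δ ν L V ρ f b j B F) {ε : ℝ} {x : E}
    (hp : (ε, x) ∈ Ioo (-e) e ×ˢ O) (hε : ε ≠ 0) (w : E) :
    ε ^ δ • spaceDeriv V (ε, x) w = -(spaceDeriv j (ε, x) w (spaceDeriv ρ (ε, x)) +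
      j (ε, x) (spaceDeriv (spaceDeriv ρ) (ε, x) w)) + ε ^ L • spaceDeriv B (ε, x) w := by
  have hW := h.isOpen_domain
  have h1 := (hasFDerivAt_spaceDeriv hW h.smooth_V hp).const_smul (ε ^ δ)
  have h2 := (((hasFDerivAt_spaceDeriv hW h.smooth_j hp).clm_apply
    (hasFDerivAt_spaceDeriv hW (contDiffOn_spaceDeriv hW h.smooth_ρ) hp)).neg).add
    ((hasFDerivAt_spaceDeriv hW h.smooth_B hp).const_smul (ε ^ L))
  have h3 := h2.congr_of_eventuallyEq (f₁ := ε ^ δ • fun y => V (ε, y)) (by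
    filter_upwards [h.isOpen.mem_nhds hp.2] with y hy
    exact h.sharp _ hp.1 hε y hy)
  have h4 := congrArg (fun A : E →L[ℝ] E => A w) (h1.unique h3)
  simp only [add_apply, neg_apply, smul_apply, ContinuousLinearMap.comp_apply,
    ContinuousLinearMap.flip_apply] at h4
  rw [h4, add_comm (j (ε, x) _)]

/-- Uniform bounds for all the data. -/
structure Bounds (x₀ : E) (e : ℝ) (O : Set E) (ν L : ℕ) (V : ℝ × E → E)
    (ρ f b : ℝ × E → ℝ) (j : ℝ × E → (E →L[ℝ] ℝ) →L[ℝ] E) (B F : ℝ × E → E) (C r : ℝ) : Prop where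
  one_le : 1 ≤ C
  pos : 0 < r
  le_one : r ≤ 1
  sub : ∀ ε, |ε| ≤ r → ∀ x ∈ Metric.closedBall x₀ r, (ε, x) ∈ Ioo (-e) e ×ˢ O
  V1 : BoundedNear (0, x₀) C r (spaceDeriv V)
  ρ1 : BoundedNear (0, x₀) C r (spaceDeriv ρ)
  f2 : BoundedNear (0, x₀) C r (spaceDeriv (spaceDeriv f))
  b0 : BoundedNear (0, x₀) C r b
  b1 : BoundedNear (0, x₀) C r (spaceDeriv b)
  b2 : BoundedNear (0, x₀) C r (spaceDeriv (spaceDeriv b))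
  j0 : BoundedNear (0, x₀) C r j
  j1 : BoundedNear (0, x₀) C r (spaceDeriv j)
  B0 : BoundedNear (0, x₀) C r B
  B1 : BoundedNear (0, x₀) C r (spaceDeriv B)
  F0 : BoundedNear (0, x₀) C r F
  F1 : BoundedNear (0, x₀) C r (spaceDeriv F)
  near_zero : ∀ ε, |ε| ≤ r → ∀ m ∈ Metric.closedBall x₀ r,
    ∃ m', ‖m' - m‖ ≤ C * ‖V (ε, m)‖ ∧ ‖V (ε, m')‖ ≤ C * |ε| ^ (ν + L)
  value : ∀ ε, |ε| ≤ r → ∀ m ∈ Metric.closedBall x₀ r,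
    |ε ^ ν * ρ (ε, m)| ≤ C * ‖V (ε, m)‖ + C * |ε| ^ (ν + L)

theorem exists_bounds (h : SlowModel x₀ e O N δ ν L V ρ f b j B F) :
    ∃ C r, Bounds x₀ e O ν L V ρ f b j B F C r := by
  have hW := h.isOpen_domain
  have hp : ((0 : ℝ), x₀) ∈ Ioo (-e) e ×ˢ O := ⟨by simp [h.e_pos], h.mem⟩
  have hsub : ∀ᶠ r in 𝓝[>] (0 : ℝ), ∀ ε, |ε| ≤ r → ∀ x ∈ Metric.closedBall x₀ r,
      (ε, x) ∈ Ioo (-e) e ×ˢ O := by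
    obtain ⟨r₀, hr₀, hs⟩ := Metric.nhds_basis_closedBall.mem_iff.1 (hW.mem_nhds hp)
    filter_upwards [Ioo_mem_nhdsGT hr₀] with r hr ε hε x hx
    refine hs ?_
    rw [← closedBall_prod_same]
    exact ⟨by simpa using hε.trans hr.2.le, Metric.closedBall_subset_closedBall hr.2.le hx⟩
  obtain ⟨C, hC1, c1, c2, c3, c4, c5, c6, c7, c8, c9, c10, c11, c12, c13, c14⟩ :=
    ((eventually_ge_atTop (1 : ℝ)).and <|
    (eventually_boundedNear hW (contDiffOn_spaceDeriv hW h.smooth_V) hp).and <|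
    (eventually_boundedNear hW (contDiffOn_spaceDeriv hW h.smooth_ρ) hp).and <|
    (eventually_boundedNear hW (contDiffOn_spaceDeriv hW
      (contDiffOn_spaceDeriv hW h.smooth_f)) hp).and <|
    (eventually_boundedNear hW h.smooth_b hp).and <|
    (eventually_boundedNear hW (contDiffOn_spaceDeriv hW h.smooth_b) hp).and <|
    (eventually_boundedNear hW (contDiffOn_spaceDeriv hW
      (contDiffOn_spaceDeriv hW h.smooth_b)) hp).and <|
    (eventually_boundedNear hW h.smooth_j hp).and <|
    (eventually_boundedNear hW (contDiffOn_spaceDeriv hW h.smooth_j) hp).and <|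
    (eventually_boundedNear hW h.smooth_B hp).and <|
    (eventually_boundedNear hW (contDiffOn_spaceDeriv hW h.smooth_B) hp).and <|
    (eventually_boundedNear hW h.smooth_F hp).and <|
    (eventually_boundedNear hW (contDiffOn_spaceDeriv hW h.smooth_F) hp).and <|
    h.near_zero.and h.value).exists
  obtain ⟨r, hr, d0, d1, d2, d3, d4, d5, d6, d7, d8, d9, d10, d11, d12, d13, d14⟩ :=
    (Filter.Eventually.and (Ioo_mem_nhdsGT (one_pos (α := ℝ))) <|
    hsub.and <| c1.and <| c2.and <| c3.and <| c4.and <| c5.and <| c6.and <| c7.and <| c8.and <|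
    c9.and <| c10.and <| c11.and <| c12.and <| c13.and c14).exists
  exact ⟨C, r, hC1, hr.1, hr.2.le, d0, d1, d2, d3, d4, d5, d6, d7, d8, d9, d10, d11, d12, d13, d14⟩

theorem mem_closedBall_zero_prod {ε : ℝ} {x : E} {r : ℝ} (hε : |ε| ≤ r)
    (hx : x ∈ Metric.closedBall x₀ r) : (ε, x) ∈ Metric.closedBall ((0 : ℝ), x₀) r := by
  rw [← closedBall_prod_same]
  exact ⟨by simpa using hε, hx⟩

theorem Bounds.norm_spaceDeriv_critical_le (h : SlowModel x₀ e O N δ ν L V ρ f b j B F) {C r : ℝ}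
    (hb : Bounds x₀ e O ν L V ρ f b j B F C r) {ε : ℝ} (hε : |ε| ≤ r) {s : E}
    (hs : s ∈ Metric.closedBall x₀ r) (hcrit : spaceDeriv f (ε, s) = 0) :
    ‖spaceDeriv ρ (ε, s)‖ ≤ C * |ε| ^ (N + 1) := by
  rw [h.spaceDeriv_approx (hb.sub ε hε s hs), hcrit, zero_add, norm_smul, norm_pow,
    Real.norm_eq_abs, mul_comm]
  gcongr
  exact (hb.b1 _ (mem_closedBall_zero_prod hε hs)).1

theorem Bounds.abs_sub_le (h : SlowModel x₀ e O N δ ν L V ρ f b j B F) {C r : ℝ}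
    (hb : Bounds x₀ e O ν L V ρ f b j B F C r) {ε : ℝ} (hε : |ε| ≤ r) {x y : E}
    (hx : x ∈ Metric.closedBall x₀ r) (hy : y ∈ Metric.closedBall x₀ r) :
    |ρ (ε, y) - ρ (ε, x) - spaceDeriv ρ (ε, x) (y - x)| ≤ C * ‖y - x‖ ^ 2 := by
  refine norm_taylor_one_le (φ := fun z => ρ (ε, z)) (φ' := fun z => spaceDeriv ρ (ε, z))
    (convex_closedBall x₀ r) (fun z hz => hasFDerivAt_spaceDeriv h.isOpen_domain h.smooth_ρ
      (hb.sub ε hε z hz)) (fun z hz z' hz' => ?_) (by linarith [hb.one_le]) hx hy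
  have := (hb.ρ1 _ (mem_closedBall_zero_prod hε hz)).2 _ (mem_closedBall_zero_prod hε hz')
  refine this.trans (le_of_eq ?_)
  simp [Prod.norm_def]

/-- The approximate invariant is small at the critical points. -/
theorem exists_critical_value_bound (h : SlowModel x₀ e O N δ ν L V ρ f b j B F) :
    ∃ C > 0, ∃ r > 0, ∀ ε, ε ≠ 0 → |ε| ≤ r → ∀ s ∈ Metric.closedBall x₀ r,
      spaceDeriv f (ε, s) = 0 → |ρ (ε, s)| ≤ C * |ε| ^ (N + 2) ∧
      ∀ A, 1 ≤ A → ∀ v, ‖v‖ ≤ A * |ε| ^ (N + 1) → A * |ε| ≤ r →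
        |ρ (ε, s + v)| ≤ C * A ^ 2 * |ε| ^ (N + 2) := by
  obtain ⟨C, r, hb⟩ := h.exists_bounds
  have hC := hb.one_le
  have hr := hb.pos
  -- With N = δ + n, the condition 3δ ≤ N becomes 2δ ≤ n, and the critical points turn out to be
  -- within O(ε^(n+1)) of approximate zeros of V.
  obtain ⟨n, hn⟩ : ∃ n, N = δ + n := ⟨N - δ, by have := h.index_le; omega⟩
  have hnδ : 2 * δ ≤ n := by have := h.index_le; omega
  set K := 2 * C ^ 2 + C * (2 * C ^ 3) + C * (2 * C ^ 3) ^ 2 with hK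
  have hKp : 0 < K := by positivity
  refine ⟨K + 2 * C, by positivity, min (r / 2) (r / (4 * C ^ 3)), by positivity,
    fun ε hε0 hε s hs hcrit => ?_⟩
  have hεr : |ε| ≤ r := (hε.trans (min_le_left _ _)).trans (by linarith)
  have hε1 : |ε| ≤ 1 := hεr.trans hb.le_one
  have hp0 : 0 < |ε| := abs_pos.2 hε0
  have hsr : s ∈ Metric.closedBall x₀ r :=
    Metric.closedBall_subset_closedBall ((min_le_left _ _).trans (by linarith)) hs
  have hs2 : dist s x₀ ≤ r / 2 := (Metric.mem_closedBall.1 hs).trans (min_le_left _ _)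
  have hmem := mem_closedBall_zero_prod hεr hsr
  have hD := Bounds.norm_spaceDeriv_critical_le h hb hεr hsr hcrit
  -- At a critical point of f the differential of ρ is O(ε^(N+1)); the sharp relation yields V only
  -- after division by ε^δ, hence the loss of δ orders.
  have hV : ‖V (ε, s)‖ ≤ 2 * C ^ 2 * |ε| ^ (n + 1) := by
    have h1 := h.sharp ε (hb.sub ε hεr s hsr).1 hε0 s (hb.sub ε hεr s hsr).2
    have h2 : |ε| ^ δ * ‖V (ε, s)‖ ≤ |ε| ^ δ * (2 * C ^ 2 * |ε| ^ (n + 1)) := by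
      calc |ε| ^ δ * ‖V (ε, s)‖ = ‖ε ^ δ • V (ε, s)‖ := by
            rw [norm_smul, norm_pow, Real.norm_eq_abs]
        _ ≤ ‖j (ε, s) (spaceDeriv ρ (ε, s))‖ + ‖ε ^ L • B (ε, s)‖ := by
            rw [h1]; exact (norm_add_le _ _).trans (by rw [norm_neg])
        _ ≤ C * (C * |ε| ^ (N + 1)) + |ε| ^ L * C := by
            rw [norm_smul, norm_pow, Real.norm_eq_abs]
            gcongr
            · exact (ContinuousLinearMap.le_opNorm _ _).trans
                (mul_le_mul (hb.j0 _ hmem).1 hD (norm_nonneg _) (by linarith))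
            · exact (hb.B0 _ hmem).1
        _ ≤ C * (C * |ε| ^ (N + 1)) + |ε| ^ (N + 1) * C ^ 2 := by
            have h3 : |ε| ^ L ≤ |ε| ^ (N + 1) :=
              pow_le_pow_of_le_one hp0.le hε1 (by have := h.order_le; omega)
            have h4 : C ≤ C ^ 2 := by nlinarith
            gcongr
        _ = |ε| ^ δ * (2 * C ^ 2 * |ε| ^ (n + 1)) := by rw [hn]; ring
    exact le_of_mul_le_mul_left h2 (by positivity)
  obtain ⟨s', hs', hVs'⟩ := hb.near_zero ε hεr s hsr
  have hds : ‖s' - s‖ ≤ 2 * C ^ 3 * |ε| ^ (n + 1) := by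
    refine hs'.trans ?_
    calc C * ‖V (ε, s)‖ ≤ C * (2 * C ^ 2 * |ε| ^ (n + 1)) := by gcongr
      _ = _ := by ring
  have hs'r : s' ∈ Metric.closedBall x₀ r := by
    rw [Metric.mem_closedBall]
    have h5 : ‖s' - s‖ ≤ r / 2 := by
      refine hds.trans ?_
      have h6 : |ε| ^ (n + 1) ≤ |ε| := pow_le_of_le_one hp0.le hε1 (by omega)
      have h7 := hε.trans (min_le_right _ _)
      rw [le_div_iff₀ (by positivity)] at h7
      calc 2 * C ^ 3 * |ε| ^ (n + 1) ≤ 2 * C ^ 3 * |ε| := by gcongr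
        _ ≤ r / 2 := by linarith
    calc dist s' x₀ ≤ dist s' s + dist s x₀ := dist_triangle _ _ _
      _ ≤ r / 2 + r / 2 := by rw [dist_eq_norm s']; gcongr
      _ = r := by ring
  -- At s' the roto-rate is O(ε^(ν+L)), so ε^ν ρ is of the same order, and cancelling ε^ν leaves
  -- O(ε^L) with L ≥ N + 2.
  have hρs' : |ρ (ε, s')| ≤ 2 * C ^ 2 * |ε| ^ (N + 2) := by
    have h8 := hb.value ε hεr s' hs'r
    have h9 : |ε| ^ ν * |ρ (ε, s')| ≤ |ε| ^ ν * (2 * C ^ 2 * |ε| ^ L) := by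
      rw [abs_mul, abs_pow] at h8
      calc _ ≤ _ := h8
        _ ≤ C * (C * |ε| ^ (ν + L)) + C * |ε| ^ (ν + L) := by gcongr
        _ ≤ C * (C * |ε| ^ (ν + L)) + C ^ 2 * |ε| ^ (ν + L) := by gcongr; nlinarith
        _ = _ := by ring
    refine (le_of_mul_le_mul_left h9 (by positivity)).trans ?_
    gcongr 2 * C ^ 2 * ?_
    exact pow_le_pow_of_le_one hp0.le hε1 h.order_le
  -- Taylor's formula from s to s': the linear term is O(ε^(N+1) ε^(n+1)) and the quadratic one
  -- O(ε^(2n+2)). Both are O(ε^(N+2)) because n ≥ δ.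
  have hρs : |ρ (ε, s)| ≤ K * |ε| ^ (N + 2) := by
    have h10 := Bounds.abs_sub_le h hb hεr hsr hs'r
    have h11 : |spaceDeriv ρ (ε, s) (s' - s)| ≤ C * (2 * C ^ 3) * |ε| ^ (N + 2) := by
      calc _ ≤ ‖spaceDeriv ρ (ε, s)‖ * ‖s' - s‖ := ContinuousLinearMap.le_opNorm _ _
        _ ≤ (C * |ε| ^ (N + 1)) * (2 * C ^ 3 * |ε| ^ (n + 1)) := by gcongr
        _ = C * (2 * C ^ 3) * |ε| ^ (N + 1 + (n + 1)) := by rw [pow_add]; ring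
        _ ≤ _ := by
            gcongr C * (2 * C ^ 3) * ?_
            exact pow_le_pow_of_le_one hp0.le hε1 (by omega)
    have h12 : C * ‖s' - s‖ ^ 2 ≤ C * (2 * C ^ 3) ^ 2 * |ε| ^ (N + 2) := by
      calc C * ‖s' - s‖ ^ 2 ≤ C * (2 * C ^ 3 * |ε| ^ (n + 1)) ^ 2 := by gcongr
        _ = C * (2 * C ^ 3) ^ 2 * |ε| ^ (2 * (n + 1)) := by ring
        _ ≤ _ := by
            gcongr C * (2 * C ^ 3) ^ 2 * ?_
            exact pow_le_pow_of_le_one hp0.le hε1 (by omega)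
    have e1 : K * |ε| ^ (N + 2) = 2 * C ^ 2 * |ε| ^ (N + 2) + C * (2 * C ^ 3) * |ε| ^ (N + 2) +
      C * (2 * C ^ 3) ^ 2 * |ε| ^ (N + 2) := by rw [hK]; ring
    rw [e1]
    rw [abs_le] at *
    constructor <;> linarith [h10.1, h10.2, h11.1, h11.2, hρs'.1, hρs'.2]
  have hE : 0 ≤ |ε| ^ (N + 2) := by positivity
  refine ⟨hρs.trans (by gcongr; linarith), fun A hA v hv hAr => ?_⟩
  have hvr : ‖v‖ ≤ r / 2 := by
    have h6 : |ε| ^ (N + 1) ≤ |ε| := pow_le_of_le_one hp0.le hε1 (by omega)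
    have h7 := hAr.trans (min_le_left _ _)
    exact hv.trans ((by gcongr : A * |ε| ^ (N + 1) ≤ A * |ε|).trans h7)
  have hsv : s + v ∈ Metric.closedBall x₀ r := by
    rw [Metric.mem_closedBall]
    calc dist (s + v) x₀ ≤ dist (s + v) s + dist s x₀ := dist_triangle _ _ _
      _ ≤ r / 2 + r / 2 := by rw [dist_eq_norm, add_sub_cancel_left]; gcongr
      _ = r := by ring
  have h13 := Bounds.abs_sub_le h hb hεr hsr hsv
  rw [add_sub_cancel_left] at h13
  have hA2 : A ≤ A ^ 2 := by nlinarith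
  have hA1 : 1 ≤ A ^ 2 := by nlinarith
  have hEE : |ε| ^ (N + 1) * |ε| ^ (N + 1) ≤ |ε| ^ (N + 2) := by
    rw [← pow_add]
    exact pow_le_pow_of_le_one hp0.le hε1 (by omega)
  have h14 : |spaceDeriv ρ (ε, s) v| ≤ C * A ^ 2 * |ε| ^ (N + 2) := by
    calc _ ≤ ‖spaceDeriv ρ (ε, s)‖ * ‖v‖ := ContinuousLinearMap.le_opNorm _ _
      _ ≤ (C * |ε| ^ (N + 1)) * (A * |ε| ^ (N + 1)) := by gcongr
      _ = C * A * (|ε| ^ (N + 1) * |ε| ^ (N + 1)) := by ring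
      _ ≤ _ := by gcongr
  have h15 : C * ‖v‖ ^ 2 ≤ C * A ^ 2 * |ε| ^ (N + 2) := by
    calc C * ‖v‖ ^ 2 ≤ C * (A * |ε| ^ (N + 1)) ^ 2 := by gcongr
      _ = C * A ^ 2 * (|ε| ^ (N + 1) * |ε| ^ (N + 1)) := by ring
      _ ≤ _ := by gcongr
  have h16 : K * |ε| ^ (N + 2) ≤ K * A ^ 2 * |ε| ^ (N + 2) := by
    gcongr; nlinarith
  have e2 : (K + 2 * C) * A ^ 2 * |ε| ^ (N + 2) = K * A ^ 2 * |ε| ^ (N + 2) +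
    C * A ^ 2 * |ε| ^ (N + 2) + C * A ^ 2 * |ε| ^ (N + 2) := by ring
  rw [e2]
  rw [abs_le] at *
  constructor <;> linarith [h13.1, h13.2, h14.1, h14.2, hρs.1, hρs.2]

end SlowModel

end SlowModel

/-! ### Descent along the slow manifold in a chart -/

namespace SlowModel

variable {E : Type*} [NormedAddCommGroup E] [NormedSpace ℝ E] [FiniteDimensional ℝ E]
  {x₀ : E} {e : ℝ} {O : Set E} {N δ ν L : ℕ} {V : ℝ × E → E}
  {ρ f b : ℝ × E → ℝ} {j : ℝ × E → (E →L[ℝ] ℝ) →L[ℝ] E} {B F : ℝ × E → E}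

theorem norm_apply_le_of_le {F G : Type*} [NormedAddCommGroup F] [NormedSpace ℝ F]
    [NormedAddCommGroup G] [NormedSpace ℝ G] {A : F →L[ℝ] G} {a c : ℝ} (hA : ‖A‖ ≤ a) {v : F}
    (hv : ‖v‖ ≤ c) : ‖A v‖ ≤ a * c :=
  (A.le_of_opNorm_le hA v).trans (mul_le_mul_of_nonneg_left hv ((norm_nonneg A).trans hA))

theorem BoundedNear.norm_sub_slice_le {G : Type*} [NormedAddCommGroup G] {g : ℝ × E → G}
    {C r ε : ℝ} (hg : BoundedNear (0, x₀) C r g) (hε : |ε| ≤ r) {x y : E}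
    (hx : x ∈ Metric.closedBall x₀ r) (hy : y ∈ Metric.closedBall x₀ r) :
    ‖g (ε, x) - g (ε, y)‖ ≤ C * ‖x - y‖ := by
  refine ((hg _ (mem_closedBall_zero_prod hε hx)).2 _
    (mem_closedBall_zero_prod hε hy)).trans (le_of_eq ?_)
  simp [Prod.norm_def]

theorem Bounds.hessian_symm (h : SlowModel x₀ e O N δ ν L V ρ f b j B F) {p : ℝ × E}
    (hp : p ∈ Ioo (-e) e ×ˢ O) (u w : E) :
    spaceDeriv (spaceDeriv f) p u w = spaceDeriv (spaceDeriv f) p w u := by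
  have h1 : ContDiffAt ℝ ∞ (fun x => f (p.1, x)) p.2 :=
    contDiffAt_slice h.isOpen h.smooth_f hp.1 hp.2
  exact (h1.isSymmSndFDerivAt (by simpa using ENat.LEInfty.out)) u w

theorem Bounds.abs_hessian_le (h : SlowModel x₀ e O N δ ν L V ρ f b j B F) {C r : ℝ}
    (hb : Bounds x₀ e O ν L V ρ f b j B F C r) {ε : ℝ} (hε : |ε| ≤ r) {s v : E}
    (hs : s ∈ Metric.closedBall x₀ r) (hsv : s + v ∈ Metric.closedBall x₀ r)
    (hcrit : spaceDeriv f (ε, s) = 0) :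
    |spaceDeriv (spaceDeriv f) (ε, s) v v| ≤ 2 * (|ρ (ε, s + v)| + |ρ (ε, s)| +
      |ε| ^ (N + 1) * (C * ‖v‖) + C * ‖v‖ ^ 3) := by
  have hW := h.isOpen_domain
  have h1 := norm_taylor_two_le (φ := fun z => f (ε, z)) (φ' := fun z => spaceDeriv f (ε, z))
    (φ'' := fun z => spaceDeriv (spaceDeriv f) (ε, z)) (C := C) (s := Metric.closedBall x₀ r)
    (convex_closedBall x₀ r) (fun z hz => hasFDerivAt_spaceDeriv hW h.smooth_f
      (hb.sub ε hε z hz)) (fun z hz => hasFDerivAt_spaceDeriv hW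
      (contDiffOn_spaceDeriv hW h.smooth_f) (hb.sub ε hε z hz))
    (fun z hz z' hz' => BoundedNear.norm_sub_slice_le hb.f2 hε hz hz')
    (by linarith [hb.one_le]) hs hsv
  have h2 := h.approx ε (hb.sub ε hε s hs).1 s (hb.sub ε hε s hs).2
  have h3 := h.approx ε (hb.sub ε hε s hs).1 _ (hb.sub ε hε _ hsv).2
  have h4 : |ε ^ (N + 1) * (b (ε, s + v) - b (ε, s))| ≤ |ε| ^ (N + 1) * (C * ‖v‖) := by
    rw [abs_mul, abs_pow]
    gcongr
    have := BoundedNear.norm_sub_slice_le hb.b0 hε hsv hs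
    rwa [add_sub_cancel_left] at this
  simp only [hcrit, zero_apply, sub_zero] at h1
  have h5 := neg_abs_le (ρ (ε, s + v))
  have h6 := le_abs_self (ρ (ε, s + v))
  have h7 := neg_abs_le (ρ (ε, s))
  have h8 := le_abs_self (ρ (ε, s))
  rw [abs_le] at h1 h4 ⊢
  constructor <;> nlinarith [h1.1, h1.2, h4.1, h4.2]

set_option maxHeartbeats 1000000 in
set_option synthInstance.maxHeartbeats 200000 in
/-- The semi-definite Hessian nearly vanishes in directions in which the approximate invariant is
nearly constant, so that these directions are nearly tangent to the slow manifold. -/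
theorem exists_descent (h : SlowModel x₀ e O N δ ν L V ρ f b j B F) {A : ℝ} (hA : 1 ≤ A) :
    ∃ C > 0, ∃ q₀ > 0, ∀ q, 0 < q → q ≤ q₀ → ∀ ε, |ε| = q ^ 4 →
      ∀ a ∈ Metric.closedBall x₀ q₀, V (0, a) = 0 → spaceDeriv f (ε, F (ε, a)) = 0 →
      ((∀ u, 0 ≤ spaceDeriv (spaceDeriv f) (ε, F (ε, a)) u u) ∨
        (∀ u, spaceDeriv (spaceDeriv f) (ε, F (ε, a)) u u ≤ 0)) →
      ∀ v, ‖v‖ ≤ A * q ^ (2 * (N + 1 - δ)) → |ρ (ε, F (ε, a) + v)| ≤ A * |ε| ^ (N + 2) →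
      ∀ t, 0 < t → t ≤ q → ∃ a', V (0, a') = 0 ∧ ‖a' - a‖ ≤ C * t ∧
        ‖F (ε, a') - F (ε, a) - t • v‖ ≤ C * (t * (q * q ^ (2 * (N + 1 - δ)))) := by
  obtain ⟨C, r, hb⟩ := h.exists_bounds
  obtain ⟨C₁, hC₁, r₁, hr₁, hcv⟩ := h.exists_critical_value_bound
  obtain ⟨Cₑ, hCₑ, hres⟩ := exists_resolvent_bound E
  have hW := h.isOpen_domain
  have hC := hb.one_le
  have hr := hb.pos
  obtain ⟨n, hn⟩ : ∃ n, N = δ + n := ⟨N - δ, by have := h.index_le; omega⟩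
  have hnδ : 2 * δ ≤ n := by have := h.index_le; omega
  have hexp : N + 1 - δ = n + 1 := by omega
  have hL := h.order_le
  -- None of these constants depends on q. C₂ bounds the Hessian on (v, v), C₃ the difference v - w,
  -- C₄ the vector w, C₅ and C₆ the derivative of V along w at (ε, s) and at (0, a), C₇ the value
  -- V(0, a + t w), C₈ the step a' - a, and C₉ the final error.
  obtain ⟨C₂, hC₂⟩ : ∃ c, c = 2 * (A + C₁ + C * A + C * A ^ 3) := ⟨_, rfl⟩
  have hC₂p : 0 < C₂ := by rw [hC₂]; positivity
  obtain ⟨C₃, hC₃⟩ : ∃ c, c = Cₑ * C₂ + 1 := ⟨_, rfl⟩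
  have hC₃p : 1 ≤ C₃ := by rw [hC₃]; linarith [mul_pos hCₑ hC₂p]
  obtain ⟨C₄, hC₄⟩ : ∃ c, c = A + C₃ := ⟨_, rfl⟩
  have hC₄p : 1 ≤ C₄ := by linarith
  obtain ⟨C₅, hC₅⟩ : ∃ c, c = C * C₄ * C + C * (Cₑ * C₃ + C * C₄) + C * C₄ := ⟨_, rfl⟩
  have hC₅p : 0 < C₅ := by rw [hC₅]; positivity
  obtain ⟨C₆, hC₆⟩ : ∃ c, c = C₅ + C * C * C₄ := ⟨_, rfl⟩
  have hC₆p : 0 < C₆ := by rw [hC₆]; positivity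
  obtain ⟨C₇, hC₇⟩ : ∃ c, c = C₆ + C * C₄ ^ 2 := ⟨_, rfl⟩
  have hC₇p : 0 < C₇ := by rw [hC₇]; positivity
  obtain ⟨C₈, hC₈⟩ : ∃ c, c = C₄ + C * C₇ := ⟨_, rfl⟩
  have hC₈p : 0 < C₈ := by rw [hC₈]; positivity
  obtain ⟨C₉, hC₉⟩ : ∃ c, c = C * C₇ + C₃ + C * C₈ := ⟨_, rfl⟩
  have hC₉p : 0 < C₉ := by rw [hC₉]; positivity
  obtain ⟨r', hr'⟩ : ∃ c, c = min r r₁ := ⟨_, rfl⟩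
  have hr'p : 0 < r' := hr' ▸ lt_min hr hr₁
  -- Q dominates each constant whose product with q measures a displacement, so q ≤ r'/(4Q) keeps
  -- every such displacement within r'/4.
  obtain ⟨Q, hQ⟩ : ∃ c, c = 1 + C + A + C₄ + C₈ := ⟨_, rfl⟩
  have hQp : 1 ≤ Q := by rw [hQ]; linarith
  refine ⟨C₈ + C₉, by positivity, r' / (4 * Q), by positivity, ?_⟩
  intro q hq hqq ε hε a ha hVa hcrit hdef v hv hρv t ht htq
  rw [hexp] at hv ⊢
  have hr'r₁ : r' ≤ r₁ := hr' ▸ min_le_right _ _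
  have hQq : Q * q ≤ r' / 4 := by
    rw [le_div_iff₀ (by positivity)] at hqq; linarith
  have hr'r : r' ≤ r := hr' ▸ min_le_left _ _
  have hr'1 : r' ≤ 1 := hr'r.trans hb.le_one
  have hle : ∀ c ≤ Q, c * q ≤ r' / 4 := fun c hc =>
    (mul_le_mul_of_nonneg_right hc hq.le).trans hQq
  have hqr : q ≤ r' / 4 := by simpa using hle 1 hQp
  have hq1 : q ≤ 1 := by linarith
  have hCq : C * q ≤ r' / 4 := hle _ (by linarith)
  have hAq : A * q ≤ r' / 4 := hle _ (by linarith)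
  have h4q : C₄ * q ≤ r' / 4 := hle _ (by linarith)
  have h8q : C₈ * q ≤ r' / 4 := hle _ (by linarith)
  -- R is the critical distance |ε|^((N+1-δ)/2). The parameter q = |ε|^(1/4) makes it, its gain
  -- factor q, and l = |ε|^δ below all natural powers of one small number, with |ε|^(N+1) = l R².
  obtain ⟨R, hR⟩ : ∃ c, c = q ^ (2 * (n + 1)) := ⟨_, rfl⟩
  have hRp : 0 < R := hR ▸ pow_pos hq _
  rw [← hR] at hv ⊢
  have hpow : ∀ m k : ℕ, k ≤ m → q ^ m ≤ q ^ k := fun m k hmk =>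
    pow_le_pow_of_le_one hq.le hq1 hmk
  have hRq : R ≤ q := by rw [hR]; simpa using hpow (2 * (n + 1)) 1 (by omega)
  have hR1 : R ≤ 1 := hRq.trans hq1
  have hεq : |ε| ≤ q := by rw [hε]; simpa using hpow 4 1 (by norm_num)
  have hεr' : |ε| ≤ r' / 4 := hεq.trans hqr
  have hεr : |ε| ≤ r := by linarith
  have hε0 : ε ≠ 0 := by
    rintro rfl
    simp only [abs_zero] at hε
    exact (pow_pos hq 4).ne hε
  have har' : dist a x₀ ≤ r' / 4 := by
    refine (Metric.mem_closedBall.1 ha).trans ?_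
    gcongr
    linarith
  have hball : ∀ y, dist y a ≤ r' / 4 → y ∈ Metric.closedBall x₀ r' := by
    intro y hy
    rw [Metric.mem_closedBall]
    linarith [dist_triangle y a x₀]
  have hballr : ∀ {y}, y ∈ Metric.closedBall x₀ r' → y ∈ Metric.closedBall x₀ r := fun hy =>
    Metric.closedBall_subset_closedBall hr'r hy
  have har : a ∈ Metric.closedBall x₀ r := hballr (hball a (by rw [dist_self]; positivity))
  have h0r : |(0 : ℝ)| ≤ r := by simpa using hr.le
  have haO := (hb.sub 0 h0r a har).2
  have hF0 : F (0, a) = a := h.inclusion a haO hVa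
  set s := F (ε, a) with hs
  have hsa : ‖s - a‖ ≤ C * |ε| := by
    have h1 := (hb.F0 _ (mem_closedBall_zero_prod hεr har)).2 _ (mem_closedBall_zero_prod h0r har)
    rw [hF0] at h1
    simpa [Prod.norm_def] using h1
  have hsr' : s ∈ Metric.closedBall x₀ r' := by
    refine hball s ?_
    rw [dist_eq_norm]
    refine hsa.trans ((?_ : C * |ε| ≤ C * q).trans hCq)
    gcongr
  have hsr := hballr hsr'
  have hsvr : s + v ∈ Metric.closedBall x₀ r := by
    refine hballr ?_
    rw [Metric.mem_closedBall]
    have h1 : ‖v‖ ≤ r' / 4 := hv.trans ((by gcongr : A * R ≤ A * q).trans hAq)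
    have h2 : dist s a ≤ r' / 4 := by
      rw [dist_eq_norm]
      exact hsa.trans ((by gcongr : C * |ε| ≤ C * q).trans hCq)
    have h3 : dist (s + v) s = ‖v‖ := by rw [dist_eq_norm, add_sub_cancel_left]
    linarith [dist_triangle (s + v) s x₀, dist_triangle s a x₀]
  obtain ⟨l, hl⟩ : ∃ c, c = |ε| ^ δ := ⟨_, rfl⟩
  have hεl : l = q ^ (4 * δ) := by rw [hl, hε, ← pow_mul]
  have hlp : 0 < l := by rw [hεl]; positivity
  have hlN : |ε| ^ (N + 1) = l * R ^ 2 := by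
    rw [hεl, hε, hR, hn]; ring
  have hρs := (hcv ε hε0 (by linarith) s
    (Metric.closedBall_subset_closedBall hr'r₁ hsr') hcrit).1
  -- The target l q² R² is chosen so that the resolvent bound at scale l makes v - w of size q R,
  -- smaller than v by a factor q.
  have hHv : |spaceDeriv (spaceDeriv f) (ε, s) v v| ≤ C₂ * (l * (q ^ 2 * R ^ 2)) := by
    refine (Bounds.abs_hessian_le h hb hεr hsr hsvr hcrit).trans ?_
    have e1 : |ε| ^ (N + 2) ≤ l * (q ^ 2 * R ^ 2) := by
      rw [pow_succ, hlN, hε]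
      have : q ^ 4 ≤ q ^ 2 := hpow 4 2 (by norm_num)
      calc l * R ^ 2 * q ^ 4 ≤ l * R ^ 2 * q ^ 2 := by gcongr
        _ = _ := by ring
    have e2 : R ≤ q ^ 2 := hR ▸ hpow _ 2 (by omega)
    -- This controls the cubic Taylor term R³. The exponents compare as 2(n+1) ≥ 4δ + 2, that is n ≥
    -- 2δ, which is exactly the condition N ≥ 3δ.
    have e3 : R ≤ l * q ^ 2 := by
      rw [hεl, ← pow_add, hR]
      exact hpow _ _ (by omega)
    have e4 : |ε| ^ (N + 1) * (C * ‖v‖) ≤ C * A * (l * (q ^ 2 * R ^ 2)) := by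
      rw [hlN]
      calc l * R ^ 2 * (C * ‖v‖) ≤ l * R ^ 2 * (C * (A * R)) := by gcongr
        _ ≤ l * R ^ 2 * (C * (A * q ^ 2)) := by gcongr
        _ = _ := by ring
    have e5 : C * ‖v‖ ^ 3 ≤ C * A ^ 3 * (l * (q ^ 2 * R ^ 2)) := by
      calc C * ‖v‖ ^ 3 ≤ C * (A * R) ^ 3 := by gcongr
        _ = C * A ^ 3 * (R * R ^ 2) := by ring
        _ ≤ C * A ^ 3 * ((l * q ^ 2) * R ^ 2) := by gcongr
        _ = _ := by ring
    have e6 : A * |ε| ^ (N + 2) ≤ A * (l * (q ^ 2 * R ^ 2)) := by gcongr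
    have e7 : C₁ * |ε| ^ (N + 2) ≤ C₁ * (l * (q ^ 2 * R ^ 2)) := by gcongr
    rw [hC₂]
    linarith
  obtain ⟨w, hw1, hw2⟩ := hres (spaceDeriv (spaceDeriv f) (ε, s))
    (Bounds.hessian_symm h (hb.sub ε hεr s hsr)) hdef l hlp v
  have hvw : ‖v - w‖ ≤ C₃ * (q * R) := by
    have e1 : l * ‖v - w‖ ^ 2 ≤ l * (C₃ * (q * R)) ^ 2 := by
      calc l * ‖v - w‖ ^ 2 ≤ Cₑ * |spaceDeriv (spaceDeriv f) (ε, s) v v| := hw1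
        _ ≤ Cₑ * (C₂ * (l * (q ^ 2 * R ^ 2))) := by gcongr
        _ = l * ((Cₑ * C₂) * (q * R) ^ 2) := by ring
        _ ≤ l * (C₃ ^ 2 * (q * R) ^ 2) := by
            gcongr
            have : Cₑ * C₂ ≤ C₃ := by rw [hC₃]; linarith
            exact this.trans (le_self_pow₀ hC₃p two_ne_zero)
        _ = _ := by ring
    exact abs_le_of_sq_le_sq' (le_of_mul_le_mul_left e1 hlp) (by positivity) |>.2
  have hHw : ‖spaceDeriv (spaceDeriv f) (ε, s) w‖ ≤ Cₑ * C₃ * (l * (q * R)) := by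
    refine hw2.trans ?_
    calc Cₑ * (l * ‖v - w‖) ≤ Cₑ * (l * (C₃ * (q * R))) := by gcongr
      _ = _ := by ring
  have hwR : ‖w‖ ≤ C₄ * R := by
    have e1 : w = v - (v - w) := by abel
    have e2 : q * R ≤ R := mul_le_of_le_one_left hRp.le hq1
    calc ‖w‖ ≤ ‖v‖ + ‖v - w‖ := by conv_lhs => rw [e1]
                                   exact norm_sub_le _ _
      _ ≤ A * R + C₃ * R := by gcongr; exact hvw.trans (by gcongr)
      _ = _ := by rw [hC₄]; ring
  have hmem := mem_closedBall_zero_prod hεr hsr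
  have hNq : |ε| ^ (N + 1) ≤ l * q := by
    rw [hlN]
    gcongr
    calc R ^ 2 = R * R := sq R
      _ ≤ 1 * q := by gcongr
      _ = q := one_mul q
  have hε1 : |ε| ≤ 1 := hεq.trans hq1
  have hLq : |ε| ^ L ≤ l * q :=
    (pow_le_pow_of_le_one (abs_nonneg _) hε1 (by omega)).trans hNq
  -- In the differentiated sharp relation the left side carries the factor l = |ε|^δ. The bound on
  -- the Hessian along w has the same factor l, and the other terms are small enough to contain it,
  -- so it cancels without loss.
  have hDV : ‖spaceDeriv V (ε, s) w‖ ≤ C₅ * (q * R) := by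
    have e0 := h.spaceDeriv_sharp (hb.sub ε hεr s hsr) hε0 w
    have e1 : ‖spaceDeriv j (ε, s) w (spaceDeriv ρ (ε, s))‖ ≤ C * C₄ * C * (l * (q * R)) := by
      calc _ ≤ (C * (C₄ * R)) * (C * |ε| ^ (N + 1)) :=
            norm_apply_le_of_le (norm_apply_le_of_le (hb.j1 _ hmem).1 hwR)
              (Bounds.norm_spaceDeriv_critical_le h hb hεr hsr hcrit)
        _ ≤ (C * (C₄ * R)) * (C * (l * q)) := by gcongr
        _ = _ := by ring
    have e2 : ‖j (ε, s) (spaceDeriv (spaceDeriv ρ) (ε, s) w)‖ ≤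
        C * (Cₑ * C₃ + C * C₄) * (l * (q * R)) := by
      rw [h.spaceDeriv_spaceDeriv_approx (hb.sub ε hεr s hsr)]
      refine (ContinuousLinearMap.le_of_opNorm_le _ (hb.j0 _ hmem).1 _).trans ?_
      have e3 : ‖ε ^ (N + 1) • spaceDeriv (spaceDeriv b) (ε, s) w‖ ≤ C * C₄ * (l * (q * R)) := by
        rw [norm_smul, norm_pow, Real.norm_eq_abs]
        calc |ε| ^ (N + 1) * ‖spaceDeriv (spaceDeriv b) (ε, s) w‖ ≤ (l * q) * (C * (C₄ * R)) := by
              gcongr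
              exact norm_apply_le_of_le (hb.b2 _ hmem).1 hwR
          _ = _ := by ring
      rw [mul_assoc C]
      gcongr
      refine (norm_add_le _ _).trans ?_
      have e4 : (Cₑ * C₃ + C * C₄) * (l * (q * R)) =
        Cₑ * C₃ * (l * (q * R)) + C * C₄ * (l * (q * R)) := by ring
      rw [e4]
      exact add_le_add hHw e3
    have e5 : ‖ε ^ L • spaceDeriv B (ε, s) w‖ ≤ C * C₄ * (l * (q * R)) := by
      rw [norm_smul, norm_pow, Real.norm_eq_abs]
      calc |ε| ^ L * ‖spaceDeriv B (ε, s) w‖ ≤ (l * q) * (C * (C₄ * R)) := by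
            gcongr
            exact norm_apply_le_of_le (hb.B1 _ hmem).1 hwR
        _ = _ := by ring
    have e6 : l * ‖spaceDeriv V (ε, s) w‖ ≤ l * (C₅ * (q * R)) := by
      calc l * ‖spaceDeriv V (ε, s) w‖ = ‖ε ^ δ • spaceDeriv V (ε, s) w‖ := by
            rw [norm_smul, norm_pow, Real.norm_eq_abs, hl]
        _ ≤ (‖spaceDeriv j (ε, s) w (spaceDeriv ρ (ε, s))‖ +
            ‖j (ε, s) (spaceDeriv (spaceDeriv ρ) (ε, s) w)‖) +
            ‖ε ^ L • spaceDeriv B (ε, s) w‖ := by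
            rw [e0]
            refine (norm_add_le _ _).trans ?_
            rw [norm_neg]
            gcongr
            exact norm_add_le _ _
        _ ≤ _ := by rw [hC₅]; linarith
    exact le_of_mul_le_mul_left e6 hlp
  have hDV0 : ‖spaceDeriv V (0, a) w‖ ≤ C₆ * (q * R) := by
    have e1 := (hb.V1 _ (mem_closedBall_zero_prod h0r har)).2 _ hmem
    have e2 : ‖((0 : ℝ), a) - (ε, s)‖ ≤ C * q := by
      rw [Prod.norm_def]
      refine max_le ?_ ?_
      · simp only [Prod.fst_sub, zero_sub, norm_neg, Real.norm_eq_abs]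
        exact hεq.trans (le_mul_of_one_le_left hq.le hC)
      · simp only [Prod.snd_sub]
        rw [norm_sub_rev]
        exact hsa.trans (by gcongr)
    have e3 : ‖(spaceDeriv V (0, a) - spaceDeriv V (ε, s)) w‖ ≤ C * C * C₄ * (q * R) := by
      refine (ContinuousLinearMap.le_of_opNorm_le _ e1 w).trans ?_
      calc C * ‖((0 : ℝ), a) - (ε, s)‖ * ‖w‖ ≤ C * (C * q) * (C₄ * R) := by gcongr
        _ = _ := by ring
    have e4 : spaceDeriv V (0, a) w =
        spaceDeriv V (ε, s) w + (spaceDeriv V (0, a) - spaceDeriv V (ε, s)) w := by simp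
    rw [e4]
    refine (norm_add_le _ _).trans ?_
    rw [hC₆]
    linarith
  have htR : t * R ≤ q := (mul_le_of_le_one_right ht.le hR1).trans htq
  have hmr : a + t • w ∈ Metric.closedBall x₀ r := by
    refine hballr (hball _ ?_)
    rw [dist_eq_norm, add_sub_cancel_left, norm_smul, Real.norm_of_nonneg ht.le]
    calc t * ‖w‖ ≤ t * (C₄ * R) := by gcongr
      _ = C₄ * (t * R) := by ring
      _ ≤ C₄ * q := by gcongr
      _ ≤ _ := h4q
  -- The linear term is t · O(qR) because w is almost in the kernel. The quadratic term t²‖w‖² is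
  -- absorbed because t ≤ q and R ≤ 1.
  have hVm : ‖V (0, a + t • w)‖ ≤ C₇ * (t * (q * R)) := by
    have e1 := norm_taylor_one_le (φ := fun z => V (0, z)) (φ' := fun z => spaceDeriv V (0, z))
      (C := C) (convex_closedBall x₀ r) (fun z hz => hasFDerivAt_spaceDeriv hW h.smooth_V
      (hb.sub 0 h0r z hz)) (fun z hz z' hz' => BoundedNear.norm_sub_slice_le hb.V1 h0r hz hz')
      (by linarith) har hmr
    simp only [hVa, sub_zero, add_sub_cancel_left, map_smul] at e1
    have e2 : ‖t • w‖ ≤ t * (C₄ * R) := by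
      rw [norm_smul, Real.norm_of_nonneg ht.le]; gcongr
    have e3 : C * ‖t • w‖ ^ 2 ≤ C * C₄ ^ 2 * (t * (q * R)) := by
      have : t * R ^ 2 ≤ q * R := by
        gcongr
        exact pow_le_of_le_one hRp.le hR1 two_ne_zero
      calc C * ‖t • w‖ ^ 2 ≤ C * (t * (C₄ * R)) ^ 2 := by gcongr
        _ = C * C₄ ^ 2 * (t * (t * R ^ 2)) := by ring
        _ ≤ _ := by gcongr
    have e4 : ‖t • spaceDeriv V (0, a) w‖ ≤ C₆ * (t * (q * R)) := by
      rw [norm_smul, Real.norm_of_nonneg ht.le]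
      calc t * ‖spaceDeriv V (0, a) w‖ ≤ t * (C₆ * (q * R)) := by gcongr
        _ = _ := by ring
    have e5 : V (0, a + t • w) = (V (0, a + t • w) - t • spaceDeriv V (0, a) w) +
      t • spaceDeriv V (0, a) w := by abel
    rw [e5]
    refine (norm_add_le _ _).trans ?_
    rw [hC₇]
    linarith
  -- At ε = 0 the error |ε|^(ν+L) is zero, so the nearby point is an exact zero of the limiting
  -- roto-rate, a genuine point of the limiting slow manifold.
  obtain ⟨a', ha'1, ha'2⟩ := hb.near_zero 0 h0r _ hmr
  have hVa' : V (0, a') = 0 := by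
    rw [abs_zero, zero_pow (by omega), mul_zero] at ha'2
    exact norm_le_zero_iff.1 ha'2
  have ha'm : ‖a' - (a + t • w)‖ ≤ C * C₇ * (t * (q * R)) := by
    refine ha'1.trans ?_
    rw [mul_assoc]
    gcongr
  have htqR : t * (q * R) ≤ t * R := by
    gcongr
    exact mul_le_of_le_one_left hRp.le hq1
  have ha'a : ‖a' - a‖ ≤ C₈ * (t * R) := by
    have e1 : a' - a = (a' - (a + t • w)) + t • w := by abel
    rw [e1]
    refine (norm_add_le _ _).trans ?_
    rw [norm_smul, Real.norm_of_nonneg ht.le]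
    have e2 : t * ‖w‖ ≤ C₄ * (t * R) := by
      calc t * ‖w‖ ≤ t * (C₄ * R) := by gcongr
        _ = _ := by ring
    have e3 : C * C₇ * (t * (q * R)) ≤ C * C₇ * (t * R) := by gcongr
    rw [hC₈]
    linarith
  have ha'r : a' ∈ Metric.closedBall x₀ r := by
    refine hballr (hball _ ?_)
    rw [dist_eq_norm]
    exact ha'a.trans ((by gcongr : C₈ * (t * R) ≤ C₈ * q).trans h8q)
  have hFa' : F (0, a') = a' := h.inclusion a' (hb.sub 0 h0r a' ha'r).2 hVa'
  refine ⟨a', hVa', ?_, ?_⟩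
  · refine ha'a.trans ?_
    have : t * R ≤ t := mul_le_of_le_one_right ht.le hR1
    calc C₈ * (t * R) ≤ C₈ * t := by gcongr
      _ ≤ _ := by gcongr; linarith
  -- F(ε, ·) - F(0, ·) has Lipschitz constant O(ε), hence at most C q, so the displacement on the
  -- slow manifold equals a' - a up to a factor of relative size q. Since a' - a is close to t w and
  -- w is close to v, it is close to t v.
  · have e1 : ‖(F (ε, a') - F (0, a')) - (F (ε, a) - F (0, a))‖ ≤ C * q * ‖a' - a‖ := by
      refine (convex_closedBall x₀ r).norm_image_sub_le_of_norm_hasFDerivWithin_le (𝕜 := ℝ)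
        (f := fun x => F (ε, x) - F (0, x))
        (f' := fun x => spaceDeriv F (ε, x) - spaceDeriv F (0, x)) (fun x hx => ?_)
        (fun x hx => ?_) har ha'r
      · exact ((hasFDerivAt_spaceDeriv hW h.smooth_F (hb.sub ε hεr x hx)).sub
          (hasFDerivAt_spaceDeriv hW h.smooth_F (hb.sub 0 h0r x hx))).hasFDerivWithinAt
      · refine ((hb.F1 _ (mem_closedBall_zero_prod hεr hx)).2 _
          (mem_closedBall_zero_prod h0r hx)).trans ?_
        gcongr
        simpa [Prod.norm_def] using hεq
    rw [hFa', hF0] at e1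
    have e2 : F (ε, a') - s - t • v = ((F (ε, a') - a') - (s - a)) + (a' - (a + t • w)) -
        t • (v - w) := by module
    rw [e2]
    refine (norm_sub_le _ _).trans ?_
    rw [norm_smul, Real.norm_of_nonneg ht.le]
    have e3 : C * q * ‖a' - a‖ ≤ C * C₈ * (t * (q * R)) := by
      calc C * q * ‖a' - a‖ ≤ C * q * (C₈ * (t * R)) := by gcongr
        _ = _ := by ring
    have e4 : t * ‖v - w‖ ≤ C₃ * (t * (q * R)) := by
      calc t * ‖v - w‖ ≤ t * (C₃ * (q * R)) := by gcongr
        _ = _ := by ring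
    have e5 := norm_add_le ((F (ε, a') - a') - (s - a)) (a' - (a + t • w))
    have e6 : C₉ * (t * (q * R)) ≤ (C₈ + C₉) * (t * (q * R)) := by
      gcongr; linarith
    refine le_trans ?_ e6
    rw [hC₉]
    linarith

end SlowModel

/-! ### The coordinate data at a point of the limiting slow manifold -/

section ChartModel

variable {E : Type*} [NormedAddCommGroup E] [NormedSpace ℝ E] [FiniteDimensional ℝ E]
  {M : Type*} [TopologicalSpace M] [ChartedSpace E M] [IsManifold 𝓘(ℝ, E) ∞ M]

/-- The coordinate expression of a family of maps into `M` near a point that is fixed at `ε = 0`. -/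
theorem exists_map_chart {c : M} {U : Set (ℝ × M)} (hU : U ∈ 𝓝 ((0 : ℝ), c)) {F : ℝ × M → M}
    (hF : ContMDiffOn (𝓘(ℝ, ℝ).prod 𝓘(ℝ, E)) 𝓘(ℝ, E) ∞ F U) (hc : F (0, c) = c) :
    ∃ e > 0, ∃ O : Set E, IsOpen O ∧ extChartAt 𝓘(ℝ, E) c c ∈ O ∧
      O ⊆ (extChartAt 𝓘(ℝ, E) c).target ∧
      (∀ ε ∈ Ioo (-e) e, ∀ x ∈ O, (ε, (extChartAt 𝓘(ℝ, E) c).symm x) ∈ U ∧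
        F (ε, (extChartAt 𝓘(ℝ, E) c).symm x) ∈ (extChartAt 𝓘(ℝ, E) c).source) ∧
      ContDiffOn ℝ ∞ (fun p : ℝ × E =>
        extChartAt 𝓘(ℝ, E) c (F (p.1, (extChartAt 𝓘(ℝ, E) c).symm p.2))) (Ioo (-e) e ×ˢ O) := by
  set φ := extChartAt 𝓘(ℝ, E) c with hφ
  have hF' := hF.mono interior_subset
  have h1 : IsOpen (interior U ∩ F ⁻¹' φ.source) :=
    hF'.continuousOn.isOpen_inter_preimage isOpen_interior (isOpen_extChartAt_source c)
  have h2 : ContinuousOn (fun p : ℝ × E => (p.1, φ.symm p.2)) (univ ×ˢ φ.target) :=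
    (contMDiffOn_prod_chart_symm (E := E) c).continuousOn
  have h3 := h2.isOpen_inter_preimage (isOpen_univ.prod (isOpen_chart_target c)) h1
  have h4 : ((0 : ℝ), φ c) ∈ (univ ×ˢ φ.target) ∩ (fun p : ℝ × E => (p.1, φ.symm p.2)) ⁻¹'
      (interior U ∩ F ⁻¹' φ.source) := by
    refine ⟨⟨mem_univ _, mem_extChartAt_target (I := 𝓘(ℝ, E)) c⟩, ?_⟩
    change ((0 : ℝ), φ.symm (φ c)) ∈ interior U ∩ F ⁻¹' φ.source
    rw [hφ, extChartAt_to_inv]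
    refine ⟨mem_interior_iff_mem_nhds.2 hU, ?_⟩
    change F (0, c) ∈ φ.source
    rw [hc]
    exact mem_extChartAt_source (I := 𝓘(ℝ, E)) c
  obtain ⟨u, O, hu, hO, h0, hx, hsub⟩ := isOpen_prod_iff.1 h3 _ _ h4
  obtain ⟨e, he, hball⟩ := Metric.isOpen_iff.1 hu 0 h0
  rw [Real.ball_eq_Ioo, zero_sub, zero_add] at hball
  have hmem : ∀ ε ∈ Ioo (-e) e, ∀ x ∈ O, (ε, x) ∈ (univ ×ˢ φ.target) ∩
      (fun p : ℝ × E => (p.1, φ.symm p.2)) ⁻¹' (interior U ∩ F ⁻¹' φ.source) :=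
    fun ε hε x hx => hsub ⟨hball hε, hx⟩
  refine ⟨e, he, O, hO, hx, fun x hx => (hmem 0 (by simp [he]) x hx).1.2,
    fun ε hε x hx => ⟨interior_subset (hmem ε hε x hx).2.1, (hmem ε hε x hx).2.2⟩, ?_⟩
  have h5 : ContMDiffOn 𝓘(ℝ, ℝ × E) 𝓘(ℝ, E) ∞ (fun p : ℝ × E => F (p.1, φ.symm p.2))
      (Ioo (-e) e ×ˢ O) :=
    hF'.comp ((contMDiffOn_prod_chart_symm (E := E) c).mono fun p hp =>
      (hmem p.1 hp.1 p.2 hp.2).1) fun p hp => (hmem p.1 hp.1 p.2 hp.2).2.1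
  refine ((contMDiffOn_extChartAt (I := 𝓘(ℝ, E)) (n := ∞) (x := c)).comp h5
    fun p hp => ?_).contDiffOn
  have := (hmem p.1 hp.1 p.2 hp.2).2.2
  rw [← extChartAt_source 𝓘(ℝ, E)]
  exact this

variable {Ω : ℝ → (m : M) → TangentSpace 𝓘(ℝ, E) m →L[ℝ] TangentSpace 𝓘(ℝ, E) m →L[ℝ] ℝ}
  {X : ℝ → (m : M) → TangentSpace 𝓘(ℝ, E) m} {R₀ : (m : M) → TangentSpace 𝓘(ℝ, E) m}
  {H : ℝ → M → ℝ} {R : ℕ → (m : M) → TangentSpace 𝓘(ℝ, E) m}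
  {θ : ℕ → (m : M) → TangentSpace 𝓘(ℝ, E) m →L[ℝ] ℝ} {μ : ℕ → M → ℝ}

/-- The truncated momentum is controlled by the truncated roto-rate. -/
theorem RotoSystem.eventually_momentum_le (h : RotoSystem Ω X R₀ H R θ μ) (K : ℕ) (c : M) :
    ∀ᶠ C in atTop, ∀ᶠ r in 𝓝[>] (0 : ℝ), ∀ ε, |ε| ≤ r →
      ∀ x ∈ Metric.closedBall (extChartAt 𝓘(ℝ, E) c c) r,
        |truncSum K (fun n => μ n ((extChartAt 𝓘(ℝ, E) c).symm x)) ε| ≤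
          C * ‖truncSum K (fun n => vectorInChart (R n) c x) ε‖ + C * |ε| ^ K := by
  have hO := isOpen_chart_target (E := E) c
  have hW : IsOpen (Ioo (-1 : ℝ) 1 ×ˢ (extChartAt 𝓘(ℝ, E) c).target) := isOpen_Ioo.prod hO
  have hp : ((0 : ℝ), extChartAt 𝓘(ℝ, E) c c) ∈
      Ioo (-1 : ℝ) 1 ×ˢ (extChartAt 𝓘(ℝ, E) c).target :=
    ⟨by simp, mem_extChartAt_target (I := 𝓘(ℝ, E)) c⟩
  have hθ := fun n => contDiffOn_oneForm_chart (h.form n) c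
  have hR := fun n => contDiffOn_vectorField_chart (h.roto.smooth n) c
  set T : E →L[ℝ] (E →L[ℝ] ℝ) →L[ℝ] ℝ := ContinuousLinearMap.apply ℝ ℝ with hT
  have h1 := eventually_boundedNear hW (contDiffOn_truncSum (K := K) hθ) hp
  have h2 := eventually_boundedNear hW
    (contDiffOn_cauchyRemainder (K := K) (L := T) hR hθ) hp
  filter_upwards [h1, h2] with C hC1 hC2
  have hsub : ∀ᶠ r in 𝓝[>] (0 : ℝ), ∀ x ∈ Metric.closedBall (extChartAt 𝓘(ℝ, E) c c) r,
      x ∈ (extChartAt 𝓘(ℝ, E) c).target := by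
    obtain ⟨r₀, hr₀, hs⟩ := Metric.nhds_basis_closedBall.mem_iff.1
      (hO.mem_nhds (mem_extChartAt_target (I := 𝓘(ℝ, E)) c))
    filter_upwards [Ioo_mem_nhdsGT hr₀] with r hr x hx
    exact hs (Metric.closedBall_subset_closedBall hr.2.le hx)
  filter_upwards [hC1, hC2, hsub] with r hr1 hr2 hr3 ε hε x hx
  have hm := SlowModel.mem_closedBall_zero_prod hε hx
  have h3 := truncSum_mul T K (fun n => vectorInChart (R n) c x) (fun n => oneFormInChart (θ n) c x) ε
  have h4 : (fun n => ∑ p ∈ Finset.HasAntidiagonal.antidiagonal n,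
      T (vectorInChart (R p.1) c x) (oneFormInChart (θ p.2) c x)) =
      fun n => μ n ((extChartAt 𝓘(ℝ, E) c).symm x) := by
    funext n
    rw [h.momentum]
    exact Finset.sum_congr rfl fun p _ => (oneForm_apply_eq_chart (θ p.2) (R p.1) (hr3 x hx)).symm
  rw [h4] at h3
  have h5 : truncSum K (fun n => μ n ((extChartAt 𝓘(ℝ, E) c).symm x)) ε =
      (truncSum K (fun n => oneFormInChart (θ n) c x) ε)
        (truncSum K (fun n => vectorInChart (R n) c x) ε) -
      ε ^ K • cauchyRemainder T K (fun n => vectorInChart (R n) c x)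
        (fun n => oneFormInChart (θ n) c x) ε := eq_sub_of_add_eq h3.symm
  rw [h5, ← Real.norm_eq_abs]
  refine (norm_sub_le _ _).trans (add_le_add ?_ ?_)
  · exact ContinuousLinearMap.le_of_opNorm_le _ (hr1 _ hm).1 _
  · rw [norm_smul, norm_pow, Real.norm_eq_abs, mul_comm]
    gcongr
    exact (hr2 _ hm).1

/-- Truncating the roto-rate at order ν + L makes the truncated invariant exactly ε^ν times the
reduced one. Cancelling ε^ν replaces the degeneracy d by d - ν, the loss that governs all later
exponents. -/
theorem RotoSystem.sharp_reduced (h : RotoSystem Ω X R₀ H R θ μ) {d ν : ℕ}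
    (hd : HasRegularPoisson Ω d) (hν : HasVanishingIndex μ ν) (hdν : ν ≤ d) (c : M) (L : ℕ) :
    ∃ (j : ℝ × E → (E →L[ℝ] ℝ) →L[ℝ] E) (B : ℝ × E → E),
      ContDiffOn ℝ ∞ j (Ioo (-1) 1 ×ˢ (extChartAt 𝓘(ℝ, E) c).target) ∧
      ContDiffOn ℝ ∞ B (Ioo (-1) 1 ×ˢ (extChartAt 𝓘(ℝ, E) c).target) ∧
      ∀ ε ∈ Ioo (-1 : ℝ) 1, ε ≠ 0 → ∀ x ∈ (extChartAt 𝓘(ℝ, E) c).target,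
        ε ^ (d - ν) • truncSum (ν + L) (fun n => vectorInChart (R n) c x) ε =
        -j (ε, x) (spaceDeriv (fun p : ℝ × E =>
          truncSum L (fun n => μ (ν + n) ((extChartAt 𝓘(ℝ, E) c).symm p.2)) p.1) (ε, x)) +
          ε ^ L • B (ε, x) := by
  obtain ⟨j, hj, hjB⟩ := h.exists_sharp_remainder hd c
  obtain ⟨B, hB, hB'⟩ := hjB (ν + L)
  have hO := isOpen_chart_target (E := E) c
  refine ⟨j, B, hj, hB, fun ε hε h0 x hx => ?_⟩
  have h1 := hB' ε hε h0 x hx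
  have h2 : (fun y => truncSum (ν + L) (fun n => μ n ((extChartAt 𝓘(ℝ, E) c).symm y)) ε) =
      fun y => ε ^ ν • truncSum L (fun n => μ (ν + n) ((extChartAt 𝓘(ℝ, E) c).symm y)) ε := by
    funext y
    rw [RotoSystem.truncSum_vanishing (fun n hn => hν.1 n hn _), smul_eq_mul]
  have h3 : ContDiffOn ℝ ∞ (fun p : ℝ × E =>
      truncSum L (fun n => μ (ν + n) ((extChartAt 𝓘(ℝ, E) c).symm p.2)) p.1)
      (univ ×ˢ (extChartAt 𝓘(ℝ, E) c).target) :=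
    contDiffOn_truncSum fun n => contDiffOn_chart_self (h.contMDiff_momentum (ν + n)) c
  have h4 := (hasFDerivAt_spaceDeriv (isOpen_univ.prod hO) h3 (ε := ε) (x := x)
    ⟨mem_univ _, hx⟩).const_smul (ε ^ ν)
  have h5 : fderiv ℝ (fun y =>
      ε ^ ν • truncSum L (fun n => μ (ν + n) ((extChartAt 𝓘(ℝ, E) c).symm y)) ε) x = _ := h4.fderiv
  rw [h2, h5, map_smul] at h1
  have hp : ε ^ ν ≠ 0 := pow_ne_zero _ h0
  refine smul_right_injective E hp ?_
  change ε ^ ν • _ = ε ^ ν • _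
  rw [smul_smul, ← pow_add, Nat.add_sub_cancel' hdν, h1, smul_add, smul_neg, smul_smul, ← pow_add]

/-- The Taylor polynomial of f below order K agrees with the truncated series, and all further terms
of the series join the smooth remainder. This compares a truncation at the high order L with an
approximation valid only to order K. -/
theorem exists_approx_remainder {e : ℝ} (he : 0 < e) {O : Set E} (hO : IsOpen O)
    {f : ℝ × E → ℝ} (hf : ContDiffOn ℝ ∞ f (Ioo (-e) e ×ˢ O)) {a : ℕ → E → ℝ}
    (ha : ∀ n, ContDiffOn ℝ ∞ (a n) O) {K L : ℕ} (hKL : K ≤ L)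
    (hfa : ∀ x ∈ O, ∀ n < K, taylorCoeff (fun ε => f (ε, x)) n = a n x) :
    ∃ b : ℝ × E → ℝ, ContDiffOn ℝ ∞ b (Ioo (-e) e ×ˢ O) ∧ ∀ ε ∈ Ioo (-e) e, ∀ x ∈ O,
      truncSum L (fun n => a n x) ε = f (ε, x) + ε ^ K * b (ε, x) := by
  obtain ⟨b, hb, -, hfb⟩ := exists_taylor_expansion he hO hf K
  obtain ⟨m, rfl⟩ := Nat.exists_eq_add_of_le hKL
  refine ⟨fun p => truncSum m (fun n => a (K + n) p.2) p.1 - b p,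
    (contDiffOn_truncSum fun n => ha (K + n)).sub hb, fun ε hε x hx => ?_⟩
  have h0 : ∑ n ∈ Finset.range K, ε ^ n • taylorCoeff (fun ε => f (ε, x)) n =
      ∑ n ∈ Finset.range K, ε ^ n • a n x :=
    Finset.sum_congr rfl fun n hn => by rw [hfa x hx n (Finset.mem_range.1 hn)]
  rw [hfb ε hε x hx, h0, truncSum, Finset.sum_range_add]
  have h1 : ∑ n ∈ Finset.range m, ε ^ (K + n) • a (K + n) x =
      ε ^ K * truncSum m (fun n => a (K + n) x) ε := by
    rw [truncSum, Finset.mul_sum]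
    exact Finset.sum_congr rfl fun n _ => by simp only [smul_eq_mul]; ring
  rw [h1, smul_eq_mul]
  ring

variable [T2Space M] [RiemannianBundle (fun m : M => TangentSpace 𝓘(ℝ, E) m)]

/-- Collects in one chart everything needed near a point of the limiting slow manifold. The
roto-rate is truncated at ν + L and the reduced invariant at L, so both stem from the same
truncation of μ. -/
theorem RotoSystem.exists_slowModel (h : RotoSystem Ω X R₀ H R θ μ) {d ν N L : ℕ}
    {C₀ C₁ C₂ : Set M} {e : ℝ} {μN : ℝ → M → ℝ} {S : ℝ → M → M}
    (hd : HasRegularPoisson Ω d) (hν : HasVanishingIndex μ ν)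
    (hS : IsCriticalSlowManifold X (limitingSlowManifold R₀) μ ν N C₀ C₁ C₂ e μN S)
    (hN : 3 * (d - ν) ≤ N) (hL : N + 2 ≤ L) {c : M} (hc : R₀ c = 0) (hc1 : c ∈ interior C₁) :
    ∃ (e' : ℝ) (O : Set E) (b : ℝ × E → ℝ) (j : ℝ × E → (E →L[ℝ] ℝ) →L[ℝ] E) (B F : ℝ × E → E),
      e' ≤ e ∧ O ⊆ (extChartAt 𝓘(ℝ, E) c).target ∧
      (∀ ε ∈ Ioo (-e') e', ∀ x ∈ O, R₀ ((extChartAt 𝓘(ℝ, E) c).symm x) = 0 →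
        S ε ((extChartAt 𝓘(ℝ, E) c).symm x) = (extChartAt 𝓘(ℝ, E) c).symm (F (ε, x)) ∧
        F (ε, x) ∈ (extChartAt 𝓘(ℝ, E) c).target) ∧
      SlowModel (extChartAt 𝓘(ℝ, E) c c) e' O N (d - ν) ν L
        (fun p => truncSum (ν + L) (fun n => vectorInChart (R n) c p.2) p.1)
        (fun p => truncSum L (fun n => μ (ν + n) ((extChartAt 𝓘(ℝ, E) c).symm p.2)) p.1)
        (fun p => μN p.1 ((extChartAt 𝓘(ℝ, E) c).symm p.2)) b j B F := by
  have hdν := h.vanishingIndex_le hd hν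
  have hc2 : c ∈ interior C₂ := hS.subset₂ (interior_subset hc1)
  obtain ⟨U, hU, F, hF, hFS⟩ := hS.embedding.smooth 0 (by simpa using hS.e_pos) c ⟨hc, hc2⟩
  have hFc : F (0, c) = c := by
    rw [← hFS (0, c) (mem_of_mem_nhds hU) ⟨hc, hc2⟩]
    exact hS.at_zero c ⟨hc, hc2⟩
  obtain ⟨e₁, he₁, O₁, hO₁, hxO₁, hO₁t, hO₁F, hFsm⟩ := exists_map_chart hU hF hFc
  obtain ⟨j, B, hj, hB, hjB⟩ := h.sharp_reduced hd hν hdν c L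
  set φ := extChartAt 𝓘(ℝ, E) c with hφ
  have hO : IsOpen (O₁ ∩ (φ.target ∩ φ.symm ⁻¹' interior C₁)) :=
    hO₁.inter ((continuousOn_extChartAt_symm (I := 𝓘(ℝ, E)) c).isOpen_inter_preimage
      (isOpen_chart_target c) isOpen_interior)
  set O := O₁ ∩ (φ.target ∩ φ.symm ⁻¹' interior C₁) with hOdef
  have hxO : φ c ∈ O := ⟨hxO₁, mem_extChartAt_target (I := 𝓘(ℝ, E)) c, by
    change φ.symm (φ c) ∈ interior C₁
    rwa [hφ, extChartAt_to_inv]⟩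
  have hOt : O ⊆ φ.target := fun x hx => hx.2.1
  have hOC2 : ∀ x ∈ O, φ.symm x ∈ interior C₂ := fun x hx => hS.subset₂ (interior_subset hx.2.2)
  set e' := min e₁ (min e 1) with he'
  have he'p : 0 < e' := lt_min he₁ (lt_min hS.e_pos one_pos)
  have hIoo : ∀ {a}, e' ≤ a → Ioo (-e') e' ⊆ Ioo (-a) a := fun ha =>
    Ioo_subset_Ioo (neg_le_neg ha) ha
  have h₁ : e' ≤ e₁ := min_le_left _ _
  have h₂ : e' ≤ e := (min_le_right _ _).trans (min_le_left _ _)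
  have h₃ : e' ≤ 1 := (min_le_right _ _).trans (min_le_right _ _)
  have hμ : ∀ n, ContDiffOn ℝ ∞ (fun x => μ (ν + n) (φ.symm x)) O := fun n =>
    (contDiffOn_chart_self (h.contMDiff_momentum (ν + n)) c).mono hOt
  have hR : ∀ n, ContDiffOn ℝ ∞ (vectorInChart (R n) c) O := fun n =>
    (contDiffOn_vectorField_chart (h.roto.smooth n) c).mono hOt
  have hf : ContDiffOn ℝ ∞ (fun p : ℝ × E => μN p.1 (φ.symm p.2)) (Ioo (-e') e' ×ˢ O) :=
    (contDiffOn_function_chart c hS.smooth_μN).mono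
      (prod_mono (hIoo h₂) fun x hx => ⟨hOt hx, hOC2 x hx⟩)
  obtain ⟨b, hb, hb'⟩ := exists_approx_remainder he'p hO hf hμ (K := N + 1) (L := L) (by omega)
    fun x hx n hn => hS.approx _ hx.2.2 n (by omega)
  obtain ⟨r₀, hr₀, C₃, -, hnz⟩ := exists_near_zero_chart h.circle h.roto.smooth h.roto.leading
    h.roto.periodic hc (K := ν + L) (by omega)
  have hzero : ∀ x, truncSum (ν + L) (fun n => vectorInChart (R n) c x) 0 = vectorInChart R₀ c x := by
    intro x
    rw [truncSum_zero_right (by omega), h.roto.leading]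
  refine ⟨e', O, b, j, B, fun p => φ (F (p.1, φ.symm p.2)), h₂, hOt, fun ε hε x hx h0 => ?_, ?_⟩
  · have h4 := hO₁F ε (hIoo h₁ hε) x hx.1
    have h5 := hFS _ h4.1 ⟨h0, hOC2 x hx⟩
    refine ⟨?_, φ.map_source h4.2⟩
    rw [φ.left_inv h4.2]
    exact h5
  · refine
    { e_pos := he'p
      isOpen := hO
      mem := hxO
      smooth_V := contDiffOn_truncSum hR
      smooth_ρ := contDiffOn_truncSum hμ
      smooth_f := hf
      smooth_b := hb
      smooth_j := hj.mono (prod_mono (hIoo h₃) hOt)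
      smooth_B := hB.mono (prod_mono (hIoo h₃) hOt)
      smooth_F := hFsm.mono (prod_mono (hIoo h₁) fun x hx => hx.1)
      approx := hb'
      sharp := fun ε hε h0 x hx => hjB ε (hIoo h₃ hε) h0 x (hOt hx)
      near_zero := ?_
      value := ?_
      inclusion := fun x hx h0 => ?_
      index_le := hN
      order_le := hL }
    · filter_upwards [eventually_ge_atTop C₃] with C hC
      filter_upwards [Ioo_mem_nhdsGT hr₀] with r hr ε hε m hm
      obtain ⟨m', -, h1, h2⟩ := hnz ε (hε.trans hr.2.le) m
        (Metric.closedBall_subset_closedBall hr.2.le hm)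
      exact ⟨m', h1.trans (by gcongr), h2.trans (by gcongr)⟩
    · filter_upwards [h.eventually_momentum_le (ν + L) c] with C hC
      filter_upwards [hC] with r hr ε hε x hx
      have h1 := hr ε hε x hx
      rwa [RotoSystem.truncSum_vanishing (fun n hn => hν.1 n hn _)] at h1
    · have h4 := hO₁F 0 (by simp [he₁]) x hx.1
      have h6 : vectorInChart R₀ c x = 0 := by rw [← hzero]; exact h0
      have h7 : R₀ (φ.symm x) = 0 := by
        rw [← chartSymmD_vectorInChart R₀ (hOt hx), h6]
        exact map_zero (chartSymmD c x)
      have h5 := hFS _ h4.1 ⟨h7, hOC2 x hx⟩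
      change φ (F (0, φ.symm x)) = x
      rw [← h5]
      change φ (S 0 (φ.symm x)) = x
      rw [hS.at_zero _ ⟨h7, hOC2 x hx⟩, φ.right_inv (hOt hx)]

end ChartModel

/-! ### Local estimates near the slow manifold -/

section LocalEstimates

variable {E : Type*} [NormedAddCommGroup E] [NormedSpace ℝ E] [FiniteDimensional ℝ E]

theorem SlowModel.eventually_mem {M : Type*} [TopologicalSpace M] [ChartedSpace E M]
    {c : M} {e : ℝ} {O : Set E} {N δ ν L : ℕ} {V : ℝ × E → E}
    {ρ f b : ℝ × E → ℝ} {j : ℝ × E → (E →L[ℝ] ℝ) →L[ℝ] E} {B F : ℝ × E → E}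
    (h : SlowModel (extChartAt 𝓘(ℝ, E) c c) e O N δ ν L V ρ f b j B F)
    (hV : V (0, extChartAt 𝓘(ℝ, E) c c) = 0) {r : ℝ} (hr : 0 < r) :
    ∀ᶠ p in 𝓝 ((0 : ℝ), c), p.2 ∈ (extChartAt 𝓘(ℝ, E) c).source ∧ p.1 ∈ Ioo (-e) e ∧
      |p.1| ≤ r ∧ extChartAt 𝓘(ℝ, E) c p.2 ∈ O ∧
      extChartAt 𝓘(ℝ, E) c p.2 ∈ Metric.closedBall (extChartAt 𝓘(ℝ, E) c c) r ∧
      F (p.1, extChartAt 𝓘(ℝ, E) c p.2) ∈ Metric.closedBall (extChartAt 𝓘(ℝ, E) c c) r := by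
  have h1 : ContinuousAt (fun p : ℝ × M => (p.1, extChartAt 𝓘(ℝ, E) c p.2)) ((0 : ℝ), c) :=
    continuousAt_fst.prodMk (ContinuousAt.comp (f := Prod.snd)
      (continuousAt_extChartAt (I := 𝓘(ℝ, E)) c) continuousAt_snd)
  have hp : ((0 : ℝ), extChartAt 𝓘(ℝ, E) c c) ∈ Ioo (-e) e ×ˢ O := ⟨by simp [h.e_pos], h.mem⟩
  have h2 : ContinuousAt F ((0 : ℝ), extChartAt 𝓘(ℝ, E) c c) :=
    (h.smooth_F.contDiffAt (h.isOpen_domain.mem_nhds hp)).continuousAt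
  have h3 := h.inclusion _ h.mem hV
  have e1 := h1.eventually (h.isOpen_domain.mem_nhds hp)
  have e2 := h1.eventually (Metric.closedBall_mem_nhds ((0 : ℝ), extChartAt 𝓘(ℝ, E) c c) hr)
  have e3 := (ContinuousAt.comp (f := fun p : ℝ × M => (p.1, extChartAt 𝓘(ℝ, E) c p.2)) h2
    h1).eventually (Metric.closedBall_mem_nhds (F ((0 : ℝ), extChartAt 𝓘(ℝ, E) c c)) hr)
  have e4 : ∀ᶠ p in 𝓝 ((0 : ℝ), c), p.2 ∈ (extChartAt 𝓘(ℝ, E) c).source :=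
    continuousAt_snd.eventually (extChartAt_source_mem_nhds (I := 𝓘(ℝ, E)) c)
  filter_upwards [e1, e2, e3, e4] with p h1 h2 h3' h4
  rw [h3] at h3'
  have h2' := max_le_iff.1 h2
  exact ⟨h4, h1.1, by simpa using h2'.1, h1.2, h2'.2, h3'⟩

variable {M : Type*} [EMetricSpace M] [ChartedSpace E M] [IsManifold 𝓘(ℝ, E) ∞ M]
  [RiemannianBundle (fun m : M => TangentSpace 𝓘(ℝ, E) m)]
  {Ω : ℝ → (m : M) → TangentSpace 𝓘(ℝ, E) m →L[ℝ] TangentSpace 𝓘(ℝ, E) m →L[ℝ] ℝ}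
  {X : ℝ → (m : M) → TangentSpace 𝓘(ℝ, E) m} {R₀ : (m : M) → TangentSpace 𝓘(ℝ, E) m}
  {H : ℝ → M → ℝ} {R : ℕ → (m : M) → TangentSpace 𝓘(ℝ, E) m}
  {θ : ℕ → (m : M) → TangentSpace 𝓘(ℝ, E) m →L[ℝ] ℝ} {μ : ℕ → M → ℝ} {d ν N L : ℕ}
  {C₀ C₁ C₂ : Set M} {e : ℝ} {μN : ℝ → M → ℝ} {S : ℝ → M → M}

theorem eq_zero_of_vectorInChart {V : (m : M) → TangentSpace 𝓘(ℝ, E) m} {c : M} {x : E}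
    (hx : x ∈ (extChartAt 𝓘(ℝ, E) c).target) (h : vectorInChart V c x = 0) :
    V ((extChartAt 𝓘(ℝ, E) c).symm x) = 0 := by
  rw [← chartSymmD_vectorInChart V hx, h]
  exact map_zero (chartSymmD c x)

theorem vectorInChart_eq_zero {V : (m : M) → TangentSpace 𝓘(ℝ, E) m} {c m : M}
    (hm : m ∈ (extChartAt 𝓘(ℝ, E) c).source) (h : V m = 0) :
    vectorInChart V c (extChartAt 𝓘(ℝ, E) c m) = 0 := by
  unfold vectorInChart
  rw [(extChartAt 𝓘(ℝ, E) c).left_inv hm, h]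
  exact map_zero (chartD (E := E) c m)

/-- In the compactness arguments, points off the zero set of R₀ have neighbourhoods free of zeros,
where the estimates hold vacuously. -/
theorem eventually_ne_zero_of_ne_zero {V : (m : M) → TangentSpace 𝓘(ℝ, E) m}
    (hV : SmoothVectorField V) {c : M} (hc : V c ≠ 0) : ∀ᶠ m in 𝓝 c, V m ≠ 0 := by
  have h1 : ContinuousAt (vectorInChart V c) (extChartAt 𝓘(ℝ, E) c c) :=
    ((contDiffOn_vectorField_chart hV c).contDiffAt ((isOpen_chart_target c).mem_nhds
      (mem_extChartAt_target (I := 𝓘(ℝ, E)) c))).continuousAt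
  have h2 : vectorInChart V c (extChartAt 𝓘(ℝ, E) c c) ≠ 0 := by
    rw [vectorInChart_self]; exact hc
  filter_upwards [(ContinuousAt.comp (f := extChartAt 𝓘(ℝ, E) c) h1
    (continuousAt_extChartAt (I := 𝓘(ℝ, E)) c)).eventually_ne h2,
    extChartAt_source_mem_nhds (I := 𝓘(ℝ, E)) c] with m hm hms h0
  exact hm (vectorInChart_eq_zero hms h0)

theorem IsCriticalSlowManifold.mem_interior
    (hS : IsCriticalSlowManifold X (limitingSlowManifold R₀) μ ν N C₀ C₁ C₂ e μN S) {ε : ℝ}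
    (hε : ε ≠ 0) (hεe : |ε| < e) {a : M} (ha : R₀ a = 0) (ha2 : a ∈ interior C₂) :
    S ε a ∈ interior C₂ ∧ ∀ v, dFun (E := E) (μN ε) (S ε a) v = 0 := by
  have : S ε a ∈ {m ∈ interior C₂ | ∀ v, dFun (E := E) (μN ε) m v = 0} := by
    rw [← hS.critical ε hε hεe]
    exact ⟨a, ⟨ha, ha2⟩, rfl⟩
  exact this

theorem IsCriticalSlowManifold.contMDiffOn_slice
    (hS : IsCriticalSlowManifold X (limitingSlowManifold R₀) μ ν N C₀ C₁ C₂ e μN S) {ε : ℝ}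
    (hεe : |ε| < e) : ContMDiffOn 𝓘(ℝ, E) 𝓘(ℝ, ℝ) ∞ (μN ε) (interior C₂) :=
  hS.smooth_μN.comp (f := fun m : M => ((ε, m) : ℝ × M))
    (contMDiffOn_const.prodMk contMDiffOn_id) fun _ hm => ⟨abs_lt.1 hεe, hm⟩

/-- Along the slow manifold, the derivative in a chart vanishes. -/
theorem IsCriticalSlowManifold.fderiv_eq_zero
    (hS : IsCriticalSlowManifold X (limitingSlowManifold R₀) μ ν N C₀ C₁ C₂ e μN S) {ε : ℝ}
    (hε : ε ≠ 0) (hεe : |ε| < e) {a c : M} (ha : R₀ a = 0) (ha2 : a ∈ interior C₂) {s : E}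
    (hs : s ∈ (extChartAt 𝓘(ℝ, E) c).target) (hSa : S ε a = (extChartAt 𝓘(ℝ, E) c).symm s) :
    fderiv ℝ (μN ε ∘ (extChartAt 𝓘(ℝ, E) c).symm) s = 0 := by
  have h1 := hS.mem_interior hε hεe ha ha2
  rw [hSa] at h1
  ext v
  rw [← dFun_chartSymmD hs (((hS.contMDiffOn_slice hεe).contMDiffAt
    (isOpen_interior.mem_nhds h1.1)).mdifferentiableAt (by simp))]
  exact h1.2 _

/-- Semi-definiteness of the Hessian on the slow manifold, in a chart. -/
theorem IsCriticalSlowManifold.semidefinite_chart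
    (hS : IsCriticalSlowManifold X (limitingSlowManifold R₀) μ ν N C₀ C₁ C₂ e μN S) {ε : ℝ}
    (hε : ε ≠ 0) (hεe : |ε| < e) {a c : M} (ha : R₀ a = 0) (ha2 : a ∈ interior C₂) {s : E}
    (hs : s ∈ (extChartAt 𝓘(ℝ, E) c).target) (hSa : S ε a = (extChartAt 𝓘(ℝ, E) c).symm s)
    (hdef : (∀ v : TangentSpace 𝓘(ℝ, E) (S ε a), 0 ≤ hessian (μN ε) (S ε a) v v) ∨
      (∀ v : TangentSpace 𝓘(ℝ, E) (S ε a), hessian (μN ε) (S ε a) v v ≤ 0)) :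
    (∀ u, 0 ≤ fderiv ℝ (fderiv ℝ (μN ε ∘ (extChartAt 𝓘(ℝ, E) c).symm)) s u u) ∨
      (∀ u, fderiv ℝ (fderiv ℝ (μN ε ∘ (extChartAt 𝓘(ℝ, E) c).symm)) s u u ≤ 0) := by
  have h1 := hS.mem_interior hε hεe ha ha2
  have h2 := hS.fderiv_eq_zero hε hεe ha ha2 hs hSa
  have hsrc : S ε a ∈ (extChartAt 𝓘(ℝ, E) c).source := by
    rw [hSa]; exact (extChartAt 𝓘(ℝ, E) c).map_target hs
  have hφ : extChartAt 𝓘(ℝ, E) c (S ε a) = s := by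
    rw [hSa]; exact (extChartAt 𝓘(ℝ, E) c).right_inv hs
  have h3 := fderiv_fderiv_chart_of_critical (E := E) (c := c) (m := S ε a)
    (by rwa [← extChartAt_source 𝓘(ℝ, E)]) (isOpen_interior.mem_nhds h1.1)
    (hS.contMDiffOn_slice hεe) (by rw [hφ]; exact h2)
  rw [hφ] at h3
  rcases hdef with h | h
  · exact Or.inl fun u => by rw [h3]; exact h _
  · exact Or.inr fun u => by rw [h3]; exact h _

variable [IsContMDiffRiemannianBundle 𝓘(ℝ, E) ∞ E (fun m : M => TangentSpace 𝓘(ℝ, E) m)]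
  [IsRiemannianManifold 𝓘(ℝ, E) M]

/-- The approximate invariant is small near the slow manifold. -/
theorem RotoSystem.exists_value_bound (h : RotoSystem Ω X R₀ H R θ μ)
    (hd : HasRegularPoisson Ω d) (hν : HasVanishingIndex μ ν)
    (hS : IsCriticalSlowManifold X (limitingSlowManifold R₀) μ ν N C₀ C₁ C₂ e μN S)
    (hN : 3 * (d - ν) ≤ N) (hL : N + 2 ≤ L) {c : M} (hc : R₀ c = 0) (hc1 : c ∈ interior C₁) :
    ∃ C > 0, ∀ᶠ p in 𝓝 ((0 : ℝ), c), p.1 ≠ 0 → R₀ p.2 = 0 → p.2 ∈ interior C₂ →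
      ∀ z, edist z (S p.1 p.2) ≤ ENNReal.ofReal (2 * |p.1| ^ (N + 1)) →
        |truncSum L (fun n => μ (ν + n) z) p.1| ≤ C * |p.1| ^ (N + 2) := by
  obtain ⟨e', O, b, j, B, F, he', hO, hSF, hm⟩ := h.exists_slowModel hd hν hS hN hL hc hc1
  obtain ⟨r₀, hr₀, C, hC, hball, hlip, hcmp⟩ := exists_chart_comparison (E := E) c
  obtain ⟨C₃, hC₃, r, hr, hcv⟩ := hm.exists_critical_value_bound
  set φ := extChartAt 𝓘(ℝ, E) c with hφ
  have hV : truncSum (ν + L) (fun n => vectorInChart (R n) c (φ c)) 0 = 0 := by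
    rw [truncSum_zero_right (by omega), h.roto.leading]
    exact vectorInChart_eq_zero (mem_extChartAt_source (I := 𝓘(ℝ, E)) c) hc
  -- The chart comparison turns distance 2|ε|^(N+1) into a displacement of norm at most 2C|ε|^(N+1).
  set A := max 1 (2 * C) with hA
  have hA1 : 1 ≤ A := le_max_left _ _
  have hη : 0 < min (min r (r / A)) (min (r₀ / 4) (r₀ / (2 * C))) := by positivity
  refine ⟨C₃ * A ^ 2, by positivity, ?_⟩
  filter_upwards [hm.eventually_mem hV hη, hm.eventually_mem hV one_pos] with p hp hp1
  obtain ⟨hps, hpe, hpη, hpO, hpb, hFb⟩ := hp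
  obtain ⟨ε, a⟩ := p
  intro hε ha ha2 z hz
  dsimp only at *
  have k1 : min (min r (r / A)) (min (r₀ / 4) (r₀ / (2 * C))) ≤ r :=
    (min_le_left _ _).trans (min_le_left _ _)
  have k2 : min (min r (r / A)) (min (r₀ / 4) (r₀ / (2 * C))) ≤ r / A :=
    (min_le_left _ _).trans (min_le_right _ _)
  have k3 : min (min r (r / A)) (min (r₀ / 4) (r₀ / (2 * C))) ≤ r₀ / 4 :=
    (min_le_right _ _).trans (min_le_left _ _)
  have k4 : min (min r (r / A)) (min (r₀ / 4) (r₀ / (2 * C))) ≤ r₀ / (2 * C) :=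
    (min_le_right _ _).trans (min_le_right _ _)
  have hεe : |ε| < e := (abs_lt.2 hpe).trans_le he'
  obtain ⟨hSa, hFt⟩ := hSF ε hpe _ hpO (by rw [φ.left_inv hps]; exact ha)
  rw [φ.left_inv hps] at hSa
  set s := F (ε, φ a) with hs
  have hcrit : spaceDeriv (fun p : ℝ × E => μN p.1 (φ.symm p.2)) (ε, s) = 0 :=
    hS.fderiv_eq_zero hε hεe ha ha2 hFt hSa
  have hcS : edist c (S ε a) < ENNReal.ofReal r₀ := by
    have h1 := hlip (φ c) (Metric.mem_closedBall_self hr₀.le) s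
      (Metric.closedBall_subset_closedBall (k3.trans (by linarith)) hFb)
    rw [hφ, extChartAt_to_inv, ← hφ, ← hSa] at h1
    refine h1.trans_lt ((ENNReal.ofReal_lt_ofReal_iff hr₀).2 ?_)
    have h2 : ‖φ c - s‖ ≤ r₀ / (2 * C) := by
      rw [← dist_eq_norm, dist_comm]
      exact (Metric.mem_closedBall.1 hFb).trans k4
    calc C * ‖φ c - s‖ ≤ C * (r₀ / (2 * C)) := by gcongr
      _ = r₀ / 2 := by field_simp
      _ < r₀ := by linarith
  have hε1 : |ε| ≤ 1 := hp1.2.2.1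
  have hrad : 2 * |ε| ^ (N + 1) < r₀ := by
    have : |ε| ^ (N + 1) ≤ |ε| := pow_le_of_le_one (abs_nonneg _) hε1 (by omega)
    linarith [hpη.trans k3]
  rw [edist_comm] at hz
  obtain ⟨-, hzs, hzz⟩ := hcmp (S ε a) z hcS _ hrad hz
  have h3 := (hzz (by positivity)).1
  have hφS : φ (S ε a) = s := by rw [hSa, φ.right_inv hFt]
  rw [hφS, norm_sub_rev] at h3
  have h4 := (hcv ε hε (hpη.trans k1) s (Metric.closedBall_subset_closedBall k1 hFb) hcrit).2 A hA1
    (φ z - s) (h3.trans ?_) ?_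
  · rw [add_sub_cancel, φ.left_inv hzs] at h4
    exact h4
  · calc C * (2 * |ε| ^ (N + 1)) = 2 * C * |ε| ^ (N + 1) := by ring
      _ ≤ A * |ε| ^ (N + 1) := by gcongr; exact le_max_right _ _
  · have := hpη.trans k2
    rw [le_div_iff₀ (by positivity)] at this
    linarith

/-- A point at the critical distance of a point of the slow manifold, where the invariant is small,
is closer to another point of the slow manifold. -/
theorem RotoSystem.eventually_exists_closer (h : RotoSystem Ω X R₀ H R θ μ)
    (hd : HasRegularPoisson Ω d) (hν : HasVanishingIndex μ ν)
    (hS : IsCriticalSlowManifold X (limitingSlowManifold R₀) μ ν N C₀ C₁ C₂ e μN S)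
    (hN : 3 * (d - ν) ≤ N) (hL : N + 2 ≤ L) (A₀ : ℝ) {c : M} (hc : R₀ c = 0)
    (hc1 : c ∈ interior C₁) :
    ∀ᶠ p in 𝓝 ((0 : ℝ), c), ∀ q > 0, |p.1| = q ^ 4 → R₀ p.2 = 0 → p.2 ∈ interior C₀ →
      ((∀ v : TangentSpace 𝓘(ℝ, E) (S p.1 p.2), 0 ≤ hessian (μN p.1) (S p.1 p.2) v v) ∨
        (∀ v : TangentSpace 𝓘(ℝ, E) (S p.1 p.2), hessian (μN p.1) (S p.1 p.2) v v ≤ 0)) →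
      ∀ z, edist z (S p.1 p.2) = ENNReal.ofReal (q ^ (2 * (N + 1 - (d - ν)))) →
        |truncSum L (fun n => μ (ν + n) z) p.1| ≤ A₀ * |p.1| ^ (N + 2) →
        ∃ a', R₀ a' = 0 ∧ a' ∈ interior C₀ ∧ edist z (S p.1 a') < edist z (S p.1 p.2) := by
  obtain ⟨e', O, b, j, B, F, he', hO, hSF, hm⟩ := h.exists_slowModel hd hν hS hN hL hc hc1
  obtain ⟨r₀, hr₀, C, hC, hball, hlip, hcmp⟩ := exists_chart_comparison (E := E) c
  set A := max 1 (max A₀ C) with hA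
  have hA1 : 1 ≤ A := le_max_left _ _
  have hAA₀ : A₀ ≤ A := (le_max_left _ _).trans (le_max_right _ _)
  have hAC : C ≤ A := (le_max_right _ _).trans (le_max_right _ _)
  obtain ⟨Cd, hCd, q₀, hq₀, hdesc⟩ := hm.exists_descent hA1
  set φ := extChartAt 𝓘(ℝ, E) c with hφ
  have hV : truncSum (ν + L) (fun n => vectorInChart (R n) c (φ c)) 0 = 0 := by
    rw [truncSum_zero_right (by omega), h.roto.leading]
    exact vectorInChart_eq_zero (mem_extChartAt_source (I := 𝓘(ℝ, E)) c) hc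
  -- The last requirement makes the two relative errors of the final estimate, C r from the
  -- variation of the metric and C · Cd · q from the imperfect tangency, at most 1/2 together.
  obtain ⟨η, hη, hη1⟩ : ∃ η > 0, η ≤ 1 ∧ η ≤ q₀ ∧ η ≤ r₀ / 4 ∧ C * η ≤ r₀ / 4 ∧
      (C + C * Cd) * η ≤ 1 / 2 := by
    refine ⟨min (min 1 q₀) (min (r₀ / 4) (min (r₀ / (4 * C)) (1 / (2 * (C + C * Cd))))),
      by positivity, (min_le_left _ _).trans (min_le_left _ _),
      (min_le_left _ _).trans (min_le_right _ _), (min_le_right _ _).trans (min_le_left _ _), ?_, ?_⟩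
    · have : min (min 1 q₀) (min (r₀ / 4) (min (r₀ / (4 * C)) (1 / (2 * (C + C * Cd))))) ≤
          r₀ / (4 * C) :=
        (min_le_right _ _).trans ((min_le_right _ _).trans (min_le_left _ _))
      rw [le_div_iff₀ (by positivity)] at this
      linarith
    · have : min (min 1 q₀) (min (r₀ / 4) (min (r₀ / (4 * C)) (1 / (2 * (C + C * Cd))))) ≤
          1 / (2 * (C + C * Cd)) :=
        (min_le_right _ _).trans ((min_le_right _ _).trans (min_le_right _ _))
      rw [le_div_iff₀ (by positivity)] at this
      linarith
  obtain ⟨hη1, hηq, hηr, hηC, hηd⟩ := hη1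
  filter_upwards [hm.eventually_mem hV hη, hm.eventually_mem hV (pow_pos hη 4)] with p hp hp'
  obtain ⟨hps, hpe, -, hpO, hpb, hFb⟩ := hp
  have hεη := hp'.2.2.1
  obtain ⟨ε, a⟩ := p
  intro q hq hεq ha ha0 hdef z hz hρz
  dsimp only at *
  have hqη : q ≤ η := by
    rw [hεq] at hεη
    exact (pow_le_pow_iff_left₀ hq.le hη.le (by norm_num)).1 hεη
  have hε : ε ≠ 0 := by
    rintro rfl
    rw [abs_zero] at hεq
    exact (pow_pos hq 4).ne hεq
  have ha2 : a ∈ interior C₂ :=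
    hS.subset₂ (interior_subset (hS.subset₁ (interior_subset ha0)))
  have hεe : |ε| < e := (abs_lt.2 hpe).trans_le he'
  obtain ⟨hSa, hFt⟩ := hSF ε hpe _ hpO (by rw [φ.left_inv hps]; exact ha)
  rw [φ.left_inv hps] at hSa
  have hcrit : spaceDeriv (fun p : ℝ × E => μN p.1 (φ.symm p.2)) (ε, F (ε, φ a)) = 0 :=
    hS.fderiv_eq_zero hε hεe ha ha2 hFt hSa
  have hsemi := hS.semidefinite_chart hε hεe ha ha2 hFt hSa hdef
  have hVa : truncSum (ν + L) (fun n => vectorInChart (R n) c (φ a)) 0 = 0 := by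
    rw [truncSum_zero_right (by omega), h.roto.leading]
    exact vectorInChart_eq_zero hps ha
  set s := F (ε, φ a) with hs
  set r := q ^ (2 * (N + 1 - (d - ν))) with hr
  have hrp : 0 < r := by positivity
  have hrq : r ≤ q := pow_le_of_le_one hq.le (hqη.trans hη1) (by omega)
  have hφS : φ (S ε a) = s := by rw [hSa, φ.right_inv hFt]
  have hcS : edist c (S ε a) ≤ ENNReal.ofReal (r₀ / 4) := by
    have h1 := hlip (φ c) (Metric.mem_closedBall_self hr₀.le) s
      (Metric.closedBall_subset_closedBall (hηr.trans (by linarith)) hFb)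
    rw [hφ, extChartAt_to_inv, ← hφ, ← hSa] at h1
    refine h1.trans (ENNReal.ofReal_le_ofReal ?_)
    have h2 : ‖φ c - s‖ ≤ η := by
      rw [← dist_eq_norm, dist_comm]
      exact Metric.mem_closedBall.1 hFb
    exact (mul_le_mul_of_nonneg_left h2 hC.le).trans hηC
  have hcz : edist c z < ENNReal.ofReal r₀ := by
    calc edist c z ≤ edist c (S ε a) + edist (S ε a) z := edist_triangle _ _ _
      _ ≤ ENNReal.ofReal (r₀ / 4) + ENNReal.ofReal (r₀ / 4) := by
          gcongr
          rw [edist_comm, hz]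
          exact ENNReal.ofReal_le_ofReal (by linarith)
      _ = ENNReal.ofReal (r₀ / 4 + r₀ / 4) := (ENNReal.ofReal_add (by positivity)
          (by positivity)).symm
      _ < _ := (ENNReal.ofReal_lt_ofReal_iff hr₀).2 (by linarith)
  obtain ⟨hzs, -, hzz⟩ := hcmp z (S ε a) hcz r (by linarith) hz.le
  obtain ⟨hv, hhom⟩ := hzz hrp.le
  rw [hφS] at hv hhom
  set v := φ z - s with hvdef
  have hρv : |truncSum L (fun n => μ (ν + n) (φ.symm (s + v))) ε| ≤ A * |ε| ^ (N + 2) := by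
    rw [hvdef, add_sub_cancel, φ.left_inv hzs]
    exact hρz.trans (by gcongr)
  have key := hdesc q hq (hqη.trans hηq) ε hεq (φ a)
    (Metric.closedBall_subset_closedBall hηq hpb) hVa hcrit hsemi v
    (hv.trans (by gcongr)) hρv
  have hnh : {y | y ∈ O ∧ φ.symm y ∈ interior C₀ ∧
      F (ε, y) ∈ Metric.ball (φ c) r₀} ∈ 𝓝 (φ a) := by
    have hc1 : ContinuousAt φ.symm (φ a) :=
      (continuousOn_extChartAt_symm (I := 𝓘(ℝ, E)) c).continuousAt
        ((isOpen_chart_target c).mem_nhds (hO hpO))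
    have hc2 : ContinuousAt (fun y => F (ε, y)) (φ a) :=
      (contDiffAt_slice hm.isOpen hm.smooth_F hpe hpO).continuousAt
    filter_upwards [hm.isOpen.mem_nhds hpO, hc1.eventually (isOpen_interior.mem_nhds
      (show φ.symm (φ a) ∈ interior C₀ by rwa [φ.left_inv hps])), hc2.eventually (Metric.isOpen_ball.mem_nhds
      (show s ∈ Metric.ball (φ c) r₀ from
        lt_of_le_of_lt (Metric.mem_closedBall.1 hFb) (by linarith)))] with y h1 h2 h3
    exact ⟨h1, h2, h3⟩
  obtain ⟨κ, hκ, hκs⟩ := Metric.nhds_basis_closedBall.mem_iff.1 hnh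
  -- Any positive step suffices, since only a strict decrease is needed. The step may depend on ε
  -- and a and is taken so small that a' stays over the interior of C₀, hence off the edge.
  obtain ⟨t, ht, htq, htκ⟩ : ∃ t > 0, t ≤ q ∧ Cd * t ≤ κ :=
    ⟨min q (κ / Cd), by positivity, min_le_left _ _, by
      have := min_le_right q (κ / Cd)
      rw [le_div_iff₀ hCd] at this
      linarith⟩
  obtain ⟨a', hVa', ha'1, ha'2⟩ := key t ht htq
  obtain ⟨ha'O, ha'C, ha'F⟩ := hκs (show a' ∈ Metric.closedBall (φ a) κ by
    rw [Metric.mem_closedBall, dist_eq_norm]; exact ha'1.trans htκ)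
  have hR : R₀ (φ.symm a') = 0 := by
    refine eq_zero_of_vectorInChart (hO ha'O) ?_
    rw [← h.roto.leading, ← truncSum_zero_right (K := ν + L) (by omega)
      (fun n => vectorInChart (R n) c a')]
    exact hVa'
  obtain ⟨hSa', -⟩ := hSF ε hpe a' ha'O hR
  refine ⟨φ.symm a', hR, ha'C, ?_⟩
  have ht1 : t ≤ 1 := htq.trans (hqη.trans hη1)
  have hstv : s + t • v ∈ Metric.closedBall (φ c) r₀ := by
    rw [Metric.mem_closedBall]
    have h1 : dist (s + t • v) s ≤ r₀ / 4 := by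
      rw [dist_eq_norm, add_sub_cancel_left, norm_smul, Real.norm_of_nonneg ht.le]
      calc t * ‖v‖ ≤ 1 * (C * r) := by gcongr
        _ ≤ C * η := by rw [one_mul]; gcongr; exact hrq.trans hqη
        _ ≤ _ := hηC
    have h2 := (Metric.mem_closedBall.1 hFb).trans hηr
    linarith [dist_triangle (s + t • v) s (φ c)]
  have h5 := hlip _ hstv _ (Metric.ball_subset_closedBall ha'F)
  have h6 : C * ‖s + t • v - F (ε, a')‖ ≤ C * (Cd * (t * (q * r))) := by
    gcongr
    rw [norm_sub_rev]
    rwa [← sub_sub]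
  have h1t : 0 ≤ 1 - t := by linarith
  rw [hz, hSa']
  -- Moving by t v gains t r to first order. The metric distortion costs at most C t r² and
  -- replacing s + t v by a point of the slow manifold costs C · Cd · t q r; both losses together
  -- are at most t r / 2.
  calc edist z (φ.symm (F (ε, a'))) ≤ edist z (φ.symm (s + t • v)) +
        edist (φ.symm (s + t • v)) (φ.symm (F (ε, a'))) := edist_triangle _ _ _
    _ ≤ ENNReal.ofReal ((1 - t) * ((1 + C * (t * r)) * r)) +
        ENNReal.ofReal (C * (Cd * (t * (q * r)))) :=
        add_le_add (hhom t ⟨ht.le, ht1⟩) (h5.trans (ENNReal.ofReal_le_ofReal h6))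
    _ = ENNReal.ofReal ((1 - t) * ((1 + C * (t * r)) * r) + C * (Cd * (t * (q * r)))) :=
        (ENNReal.ofReal_add (by positivity) (by positivity)).symm
    _ < ENNReal.ofReal r := (ENNReal.ofReal_lt_ofReal_iff hrp).2 ?_
  have h7 : (1 - t) * (1 + C * (t * r)) ≤ 1 - t + C * (t * r) := by
    nlinarith [mul_nonneg ht.le (mul_nonneg hC.le (mul_nonneg ht.le hrp.le))]
  have h8 : C * (t * r) ≤ C * (t * η) := by gcongr; exact hrq.trans hqη
  have h9 : C * Cd * (t * q) ≤ C * Cd * (t * η) := by gcongr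
  have h10 : t * ((C + C * Cd) * η) ≤ t * (1 / 2) := by gcongr
  have h11 : (1 - t) * (1 + C * (t * r)) + C * Cd * (t * q) < 1 := by linarith
  calc (1 - t) * ((1 + C * (t * r)) * r) + C * (Cd * (t * (q * r))) =
      ((1 - t) * (1 + C * (t * r)) + C * Cd * (t * q)) * r := by ring
    _ < 1 * r := by gcongr
    _ = r := one_mul r

end LocalEstimates

/-! ### Long time estimates -/

section LongTime

/-- The first time at which a continuous function takes a value. -/
theorem exists_exit_time {g : ℝ → ENNReal} (hg : Continuous g) {r : ENNReal} (h0 : g 0 ≤ r) {t₁ : ℝ}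
    (h1 : r < g t₁) : ∃ t ∈ uIcc 0 t₁, g t = r ∧ ∀ τ ∈ uIcc 0 t, g τ ≤ r := by
  have key : ∀ g : ℝ → ENNReal, Continuous g → g 0 ≤ r → ∀ t₁ ≥ 0, r < g t₁ →
      ∃ t ∈ Icc 0 t₁, g t = r ∧ ∀ τ ∈ Icc 0 t, g τ ≤ r := by
    intro g hg h0 t₁ ht₁ h1
    have hne : (Icc 0 t₁ ∩ g ⁻¹' {r}).Nonempty := by
      obtain ⟨t, ht, h⟩ := intermediate_value_Icc ht₁ hg.continuousOn ⟨h0, h1.le⟩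
      exact ⟨t, ht, h⟩
    obtain ⟨t, ht, hmin⟩ := (isCompact_Icc.inter_right
      (isClosed_singleton.preimage hg)).exists_isLeast hne
    refine ⟨t, ht.1, ht.2, fun τ hτ => ?_⟩
    by_contra hlt
    push Not at hlt
    obtain ⟨σ, hσ, hσr⟩ := intermediate_value_Icc hτ.1 hg.continuousOn ⟨h0, hlt.le⟩
    have h2 : t ≤ σ := hmin ⟨⟨hσ.1, hσ.2.trans (hτ.2.trans ht.1.2)⟩, hσr⟩
    have h3 : τ = σ := le_antisymm (hτ.2.trans h2) hσ.2
    rw [h3, hσr] at hlt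
    exact lt_irrefl _ hlt
  rcases le_total 0 t₁ with ht | ht
  · obtain ⟨t, ht', h2, h3⟩ := key g hg h0 t₁ ht h1
    exact ⟨t, by rwa [uIcc_of_le ht], h2, by rwa [uIcc_of_le ht'.1]⟩
  · obtain ⟨t, ht', h2, h3⟩ := key (fun τ => g (-τ)) (hg.comp continuous_neg) (by simpa using h0)
      (-t₁) (by simpa using ht) (by simpa using h1)
    refine ⟨-t, ?_, h2, fun τ hτ => ?_⟩
    · rw [uIcc_of_ge ht]
      exact ⟨by linarith [ht'.2], by linarith [ht'.1]⟩
    · rw [uIcc_of_ge (by linarith [ht'.1])] at hτ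
      simpa using h3 (-τ) ⟨by linarith [hτ.2], by linarith [hτ.1]⟩

variable {E : Type*} [NormedAddCommGroup E] [NormedSpace ℝ E] [FiniteDimensional ℝ E]
  {M : Type*} [EMetricSpace M] [ChartedSpace E M] [IsManifold 𝓘(ℝ, E) ∞ M]
  {Ω : ℝ → (m : M) → TangentSpace 𝓘(ℝ, E) m →L[ℝ] TangentSpace 𝓘(ℝ, E) m →L[ℝ] ℝ}
  {X : ℝ → (m : M) → TangentSpace 𝓘(ℝ, E) m} {R₀ : (m : M) → TangentSpace 𝓘(ℝ, E) m}
  {H : ℝ → M → ℝ} {R : ℕ → (m : M) → TangentSpace 𝓘(ℝ, E) m}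
  {θ : ℕ → (m : M) → TangentSpace 𝓘(ℝ, E) m →L[ℝ] ℝ} {μ : ℕ → M → ℝ} {d ν N L : ℕ}
  {C₀ C₁ C₂ : Set M} {e : ℝ} {μN : ℝ → M → ℝ} {S : ℝ → M → M}

/-- The reduced truncated invariant is almost conserved along integral curves. -/
theorem RotoSystem.exists_reduced_drift (h : RotoSystem Ω X R₀ H R θ μ)
    (hν : HasVanishingIndex μ ν) (L : ℕ) (hC₀ : IsCompact C₀) :
    ∃ B : ℝ, 0 ≤ B ∧ ∀ ε : ℝ, ε ≠ 0 → |ε| ≤ 1 / 2 → ∀ z : ℝ → M,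
      IsMIntegralCurve (I := 𝓘(ℝ, E)) z (X ε) → (∀ t, z t ∈ C₀) → ∀ t,
        |truncSum L (fun n => μ (ν + n) (z t)) ε - truncSum L (fun n => μ (ν + n) (z 0)) ε| ≤
          B * |ε| ^ L * |t| := by
  obtain ⟨B, hB, hdrift⟩ := h.exists_drift_bound (ν + L) hC₀
  refine ⟨B, hB, fun ε hε hε2 z hz hzC t => ?_⟩
  have h1 : ∀ τ, HasDerivAt (fun τ => truncSum (ν + L) (fun n => μ n (z τ)) ε)
      (dFun (fun y => truncSum (ν + L) (fun n => μ n y) ε) (z τ) (X ε (z τ))) τ := fun τ =>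
    hasDerivAt_comp_integralCurve hz
      ((h.contMDiff_truncSum_momentum (ν + L) ε).mdifferentiableAt (by simp))
  have h2 := convex_univ.norm_image_sub_le_of_norm_hasDerivWithin_le (𝕜 := ℝ)
    (fun τ _ => (h1 τ).hasDerivWithinAt) (fun τ _ => hdrift ε hε2 (z τ) (hzC τ))
    (mem_univ 0) (mem_univ t)
  simp only [RotoSystem.truncSum_vanishing (fun n hn => hν.1 n hn _)] at h2
  rw [← mul_sub, norm_mul, norm_pow, Real.norm_eq_abs, Real.norm_eq_abs, Real.norm_eq_abs,
    sub_zero, pow_add] at h2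
  have hp : 0 < |ε| ^ ν := pow_pos (abs_pos.2 hε) ν
  refine le_of_mul_le_mul_left (h2.trans (le_of_eq ?_)) hp
  ring

variable [RiemannianBundle (fun m : M => TangentSpace 𝓘(ℝ, E) m)]
  [IsContMDiffRiemannianBundle 𝓘(ℝ, E) ∞ E (fun m : M => TangentSpace 𝓘(ℝ, E) m)]
  [IsRiemannianManifold 𝓘(ℝ, E) M]

/-- The local bounds near (0, c) hold for a in a neighbourhood of c and all small ε. A finite cover
of C₀ then yields a single constant and a single range of ε. -/
theorem RotoSystem.exists_uniform_value_bound (h : RotoSystem Ω X R₀ H R θ μ)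
    (hd : HasRegularPoisson Ω d) (hν : HasVanishingIndex μ ν)
    (hS : IsCriticalSlowManifold X (limitingSlowManifold R₀) μ ν N C₀ C₁ C₂ e μN S)
    (hN : 3 * (d - ν) ≤ N) (hL : N + 2 ≤ L) (hC₀ : IsCompact C₀) :
    ∃ C > 0, ∀ᶠ ε in 𝓝 (0 : ℝ), ∀ a ∈ C₀, ε ≠ 0 → R₀ a = 0 →
      ∀ z, edist z (S ε a) ≤ ENNReal.ofReal (2 * |ε| ^ (N + 1)) →
        |truncSum L (fun n => μ (ν + n) z) ε| ≤ C * |ε| ^ (N + 2) := by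
  have hR : SmoothVectorField R₀ := h.roto.leading ▸ h.roto.smooth 0
  suffices hK : ∀ K, IsCompact K → K ⊆ interior C₁ → ∃ C > 0, ∀ᶠ ε in 𝓝 (0 : ℝ), ∀ a ∈ K, ε ≠ 0 →
      R₀ a = 0 → a ∈ interior C₂ → ∀ z, edist z (S ε a) ≤ ENNReal.ofReal (2 * |ε| ^ (N + 1)) →
        |truncSum L (fun n => μ (ν + n) z) ε| ≤ C * |ε| ^ (N + 2) by
    obtain ⟨C, hC, hev⟩ := hK C₀ hC₀ hS.subset₁
    refine ⟨C, hC, hev.mono fun ε hε a ha h0 hRa => hε a ha h0 hRa ?_⟩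
    exact hS.subset₂ (interior_subset (hS.subset₁ ha))
  intro K hK hKC
  have := hK.induction_on (p := fun T => ∃ C > 0, ∀ᶠ ε in 𝓝 (0 : ℝ), ∀ a ∈ T, ε ≠ 0 →
      R₀ a = 0 → a ∈ interior C₂ → ∀ z, edist z (S ε a) ≤ ENNReal.ofReal (2 * |ε| ^ (N + 1)) →
        |truncSum L (fun n => μ (ν + n) z) ε| ≤ C * |ε| ^ (N + 2)) ?_ ?_ ?_ ?_
  · exact this
  · exact ⟨1, one_pos, by simp⟩
  · rintro s t hst ⟨C, hC, h1⟩
    exact ⟨C, hC, h1.mono fun ε hε a ha => hε a (hst ha)⟩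
  · rintro s t ⟨C, hC, h1⟩ ⟨C', hC', h2⟩
    refine ⟨max C C', lt_max_of_lt_left hC, ?_⟩
    filter_upwards [h1, h2] with ε hε1 hε2 a ha h0 hRa ha2 z hz
    rcases ha with ha | ha
    · exact (hε1 a ha h0 hRa ha2 z hz).trans (by gcongr; exact le_max_left _ _)
    · exact (hε2 a ha h0 hRa ha2 z hz).trans (by gcongr; exact le_max_right _ _)
  · intro c hc
    by_cases hc0 : R₀ c = 0
    · obtain ⟨C, hC, hev⟩ := h.exists_value_bound hd hν hS hN hL hc0 (hKC hc)
      rw [nhds_prod_eq] at hev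
      obtain ⟨pa, hpa, pb, hpb, hab⟩ := eventually_prod_iff.1 hev
      exact ⟨_, mem_nhdsWithin_of_mem_nhds hpb, C, hC, hpa.mono fun ε hε a ha => hab hε ha⟩
    · exact ⟨_, mem_nhdsWithin_of_mem_nhds (eventually_ne_zero_of_ne_zero hR hc0), 1, one_pos,
        Eventually.of_forall fun ε a ha _ hRa => absurd hRa ha⟩

theorem RotoSystem.eventually_forall_exists_closer (h : RotoSystem Ω X R₀ H R θ μ)
    (hd : HasRegularPoisson Ω d) (hν : HasVanishingIndex μ ν)
    (hS : IsCriticalSlowManifold X (limitingSlowManifold R₀) μ ν N C₀ C₁ C₂ e μN S)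
    (hN : 3 * (d - ν) ≤ N) (hL : N + 2 ≤ L) (A₀ : ℝ) (hC₀ : IsCompact C₀) :
    ∀ᶠ ε in 𝓝 (0 : ℝ), ∀ a ∈ C₀, ∀ q > 0, |ε| = q ^ 4 → R₀ a = 0 → a ∈ interior C₀ →
      ((∀ v : TangentSpace 𝓘(ℝ, E) (S ε a), 0 ≤ hessian (μN ε) (S ε a) v v) ∨
        (∀ v : TangentSpace 𝓘(ℝ, E) (S ε a), hessian (μN ε) (S ε a) v v ≤ 0)) →
      ∀ z, edist z (S ε a) = ENNReal.ofReal (q ^ (2 * (N + 1 - (d - ν)))) →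
        |truncSum L (fun n => μ (ν + n) z) ε| ≤ A₀ * |ε| ^ (N + 2) →
        ∃ a', R₀ a' = 0 ∧ a' ∈ interior C₀ ∧ edist z (S ε a') < edist z (S ε a) := by
  have hR : SmoothVectorField R₀ := h.roto.leading ▸ h.roto.smooth 0
  refine hC₀.eventually_forall_of_forall_eventually fun c hc => ?_
  by_cases hc0 : R₀ c = 0
  · exact h.eventually_exists_closer hd hν hS hN hL A₀ hc0 (hS.subset₁ hc)
  · filter_upwards [continuousAt_snd.eventually (eventually_ne_zero_of_ne_zero hR hc0)] with p hp
    intro q _ _ hRa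
    exact absurd hRa hp

/-- With q = |ε|^(1/4), the possibly fractional critical exponent becomes a natural power of q. -/
theorem abs_rpow_eq_pow {ε : ℝ} (hdν : ν ≤ d) (hdN : d - ν ≤ N) :
    |ε| ^ (((N : ℝ) + 1 - d + ν) / 2) = (|ε| ^ (1 / 4 : ℝ)) ^ (2 * (N + 1 - (d - ν))) := by
  rw [← Real.rpow_natCast, ← Real.rpow_mul (abs_nonneg ε)]
  congr 1
  push_cast [Nat.cast_sub (by omega : d - ν ≤ N + 1), Nat.cast_sub hdν]
  ring

/-- The dichotomy for a single value of `ε`: a curve along which the points of the slow manifold at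
distance `r` are never nearest either stays close to the slow manifold or runs off its edge. -/
theorem runsOffEdge_of_exists_closer {z : ℝ → M} (hz : Continuous z) {A K : Set M}
    (hK : IsCompact K) (hAK : A ⊆ K) {r T : ℝ} (h0 : Metric.infEDist (z 0) A ≤ ENNReal.ofReal r)
    (hclose : ∀ t, |t| ≤ T → ∀ s ∈ A, edist (z t) s = ENNReal.ofReal r →
      ∃ s' ∈ A, edist (z t) s' < edist (z t) s) :
    (∀ t : ℝ, |t| ≤ T → Metric.infEDist (z t) A ≤ ENNReal.ofReal r) ∨ RunsOffEdge z A r T := by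
  by_cases hstay : ∀ t : ℝ, |t| ≤ T → Metric.infEDist (z t) A ≤ ENNReal.ofReal r
  · exact Or.inl hstay
  push Not at hstay
  obtain ⟨t₁, ht₁, hr⟩ := hstay
  obtain ⟨t, ht, hgt, hle⟩ := exists_exit_time (Metric.continuous_infEDist.comp hz) h0 hr
  have hgt' : Metric.infEDist (z t) A = ENNReal.ofReal r := hgt
  have htT : |t| ≤ T := by
    refine le_trans ?_ ht₁
    simpa using abs_sub_left_of_mem_uIcc ht
  -- A nearest point in A would be at distance exactly r at the exit time, and the hypothesis
  -- supplies a point of A closer still.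
  have hnot : ∀ s ∈ A, Metric.infEDist (z t) A < edist (z t) s := by
    intro s hs
    refine lt_of_le_of_ne (Metric.infEDist_le_edist_of_mem hs) fun heq => ?_
    obtain ⟨s', hs', hlt⟩ := hclose t htT s hs (heq.symm.trans hgt')
    exact (hlt.trans_le (heq.symm.le.trans (Metric.infEDist_le_edist_of_mem hs'))).false
  have hne : A.Nonempty := by
    rw [nonempty_iff_ne_empty]
    rintro rfl
    rw [Metric.infEDist_empty] at hgt'
    exact ENNReal.ofReal_ne_top hgt'.symm
  -- Compactness of the closure provides a nearest point; since no point of A is nearest, it lies on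
  -- the edge.
  have hcl : IsCompact (closure A) := hK.closure_of_subset hAK
  obtain ⟨s, hs, hsd⟩ := hcl.exists_infEDist_eq_edist hne.closure (z t)
  rw [Metric.infEDist_closure] at hsd
  exact Or.inr ⟨t, htT, hle, ⟨s, ⟨hs, fun hsA => (hnot s hsA).ne hsd⟩, hsd.symm⟩, hnot⟩

end LongTime

end NearlyPeriodic

end

/-! ### Conclusion: the free-action principle -/

open NearlyPeriodic in
theorem mainTheorem1
    {E : Type*} [NormedAddCommGroup E] [NormedSpace ℝ E] [FiniteDimensional ℝ E]
    {M : Type*} [EMetricSpace M] [ChartedSpace E M] [IsManifold 𝓘(ℝ, E) ∞ M]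
    [RiemannianBundle (fun m : M => TangentSpace 𝓘(ℝ, E) m)]
    [IsContMDiffRiemannianBundle 𝓘(ℝ, E) ∞ E (fun m : M => TangentSpace 𝓘(ℝ, E) m)]
    [IsRiemannianManifold 𝓘(ℝ, E) M]
    (Ω : ℝ → (m : M) → TangentSpace 𝓘(ℝ, E) m →L[ℝ] TangentSpace 𝓘(ℝ, E) m →L[ℝ] ℝ)
    (X : ℝ → (m : M) → TangentSpace 𝓘(ℝ, E) m)
    (R₀ : (m : M) → TangentSpace 𝓘(ℝ, E) m)
    (μ : ℕ → M → ℝ) (d ν N : ℕ)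
    (hΩ : IsExactBarelySymplectic Ω) (hd : HasDegeneracyIndex Ω d)
    (hX : IsNearlyPeriodic X R₀) (hH : IsHamiltonian Ω X)
    (hμ : IsAdiabaticInvariant Ω X R₀ μ) (hν : HasVanishingIndex μ ν)
    (hN : 3 * ((d : ℤ) - ν) < N + 1)
    (C₀ C₁ C₂ : Set M) (hC₀ : IsCompact C₀)
    (e : ℝ) (μN : ℝ → M → ℝ) (S : ℝ → M → M)
    (hS : IsCriticalSlowManifold X (limitingSlowManifold R₀) μ ν N C₀ C₁ C₂ e μN S)
    (hdef : ∀ᶠ ε in 𝓝[≠] (0 : ℝ),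
      ∀ s ∈ closure (S ε '' (limitingSlowManifold R₀ ∩ interior C₀)),
        (∀ v : TangentSpace 𝓘(ℝ, E) s, 0 ≤ hessian (μN ε) s v v) ∨
        (∀ v : TangentSpace 𝓘(ℝ, E) s, hessian (μN ε) s v v ≤ 0))
    (k : ℕ) :
    ∃ ε₀ : ℝ, 0 < ε₀ ∧ ∀ ε : ℝ, ε ≠ 0 → |ε| ≤ ε₀ →
      ∀ z : ℝ → M, IsMIntegralCurve (I := 𝓘(ℝ, E)) z (X ε) → (∀ t, z t ∈ C₀) →
        Metric.infEDist (z 0) (S ε '' (limitingSlowManifold R₀ ∩ interior C₀))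
          ≤ ENNReal.ofReal (|ε| ^ (N + 1)) →
        (∀ t : ℝ, |t| ≤ (|ε| ^ k)⁻¹ →
          Metric.infEDist (z t) (S ε '' (limitingSlowManifold R₀ ∩ interior C₀))
            ≤ ENNReal.ofReal (|ε| ^ (((N : ℝ) + 1 - d + ν) / 2))) ∨
        RunsOffEdge z (S ε '' (limitingSlowManifold R₀ ∩ interior C₀))
          (|ε| ^ (((N : ℝ) + 1 - d + ν) / 2)) ((|ε| ^ k)⁻¹) := by
  obtain ⟨H, hHs, hHam⟩ := hH
  obtain ⟨R, θ, hR, hθ, hexact, hinv, hmom⟩ := hμ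
  have sys : RotoSystem Ω X R₀ H R θ μ :=
    ⟨hΩ, hX.smooth, hX.circle, hHs, hHam, hR, hθ, hexact, hinv, hmom⟩
  have hdν : ν ≤ d := sys.vanishingIndex_le hd.1 hν
  have hN' : 3 * (d - ν) ≤ N := by omega
  -- Truncation at order N + 2 + k leaves a drift of order ε^(N+2) after a time |ε|^(-k).
  have hL : N + 2 ≤ N + 2 + k := by omega
  obtain ⟨B, hB, hdrift⟩ := sys.exists_reduced_drift hν (N + 2 + k) hC₀
  obtain ⟨C, hC, hvalue⟩ := sys.exists_uniform_value_bound hd.1 hν hS hN' hL hC₀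
  -- The constant C bounds ρ at the starting point and B its drift, so C + B bounds ρ along the
  -- whole curve.
  have hcloser := sys.eventually_forall_exists_closer hd.1 hν hS hN' hL (C + B) hC₀
  obtain ⟨η, hη, hall⟩ := Metric.eventually_nhds_iff.1
    (((hvalue.and hcloser).and hS.inside).and (eventually_nhdsWithin_iff.1 hdef))
  refine ⟨min (1 / 2) (η / 2), by positivity, fun ε hε hε₀ z hz hzC hz0 => ?_⟩
  have hε2 : |ε| ≤ 1 / 2 := hε₀.trans (min_le_left _ _)
  have hεp : 0 < |ε| := abs_pos.2 hε
  obtain ⟨⟨⟨hval, hclose⟩, hins⟩, hsemi⟩ := hall (y := ε) (by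
    rw [Real.dist_eq, sub_zero]
    exact (hε₀.trans (min_le_right _ _)).trans_lt (by linarith))
  have hbound : ∀ t, |t| ≤ (|ε| ^ k)⁻¹ →
      |truncSum (N + 2 + k) (fun n => μ (ν + n) (z t)) ε| ≤ (C + B) * |ε| ^ (N + 2) := by
    intro t ht
    -- The infimum defining the distance need not be attained, so the radius is doubled to obtain an
    -- actual point of the slow manifold; the value bound is stated with this factor 2.
    have h2 : Metric.infEDist (z 0) (S ε '' (limitingSlowManifold R₀ ∩ interior C₀)) <
        ENNReal.ofReal (2 * |ε| ^ (N + 1)) :=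
      hz0.trans_lt ((ENNReal.ofReal_lt_ofReal_iff (by positivity)).2
        (by linarith [pow_pos hεp (N + 1)]))
    obtain ⟨_, ⟨a, ha, rfl⟩, hza⟩ := Metric.infEDist_lt_iff.1 h2
    have h3 := hval a (interior_subset ha.2) hε ha.1 (z 0) hza.le
    have h4 := hdrift ε hε hε2 z hz hzC t
    have h5 : B * |ε| ^ (N + 2 + k) * |t| ≤ B * |ε| ^ (N + 2) := by
      calc B * |ε| ^ (N + 2 + k) * |t| ≤ B * |ε| ^ (N + 2 + k) * (|ε| ^ k)⁻¹ := by gcongr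
        _ = B * |ε| ^ (N + 2) := by rw [pow_add]; field_simp
    have h6 := abs_sub_abs_le_abs_sub (truncSum (N + 2 + k) (fun n => μ (ν + n) (z t)) ε)
      (truncSum (N + 2 + k) (fun n => μ (ν + n) (z 0)) ε)
    linarith
  have hq : 0 < |ε| ^ (1 / 4 : ℝ) := Real.rpow_pos_of_pos hεp _
  have hq4 : |ε| = (|ε| ^ (1 / 4 : ℝ)) ^ 4 := by
    rw [← Real.rpow_natCast, ← Real.rpow_mul (abs_nonneg ε)]
    norm_num
  rw [abs_rpow_eq_pow hdν (by omega)]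
  refine runsOffEdge_of_exists_closer hz.continuous hS.compact₁ (hins.trans interior_subset)
    (hz0.trans (ENNReal.ofReal_le_ofReal ?_)) ?_
  · have hq1 : |ε| ^ (1 / 4 : ℝ) ≤ 1 := Real.rpow_le_one (abs_nonneg ε) (by linarith) (by norm_num)
    calc |ε| ^ (N + 1) = ((|ε| ^ (1 / 4 : ℝ)) ^ 4) ^ (N + 1) := by rw [← hq4]
      _ = (|ε| ^ (1 / 4 : ℝ)) ^ (4 * (N + 1)) := (pow_mul _ _ _).symm
      _ ≤ _ := pow_le_pow_of_le_one hq.le hq1 (by omega)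
  · rintro t ht _ ⟨a, ha, rfl⟩ hza
    obtain ⟨a', hRa', ha', hlt⟩ := hclose a (interior_subset ha.2) _ hq hq4 ha.1 ha.2
      (hsemi hε _ (subset_closure ⟨a, ha, rfl⟩)) (z t) hza (hbound t ht)
    exact ⟨S ε a', ⟨a', ⟨hRa', ha'⟩, rfl⟩, hlt⟩
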